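/- **Setting.** Let $T>0$, $\alpha,\beta>0$, let $k,r\ge 0$ be integers and $\sigma\ge k+2$. Let $a,b$ be smooth on $[0,1]$ with $a\ge\alpha$ and $b-\tfrac12a_x\ge\beta$. For $0<\varepsilon$ let $u$ solve $$u_t-\varepsilon u_{xx}+a(x)u_x+b(x)u=f(x,t)\ \text{ in }(0,1)\times(0,T],\qquad u(x,0)=u_0(x),\qquad u(0,t)=u(1,t)=0,$$ and assume that $u=S+E$ with smooth $S,E$ on $[0,1]\times[0,T]$ such that for all $j,m\ge0$ $$|\partial_x^j\partial_t^mS(x,t)|\le K_{j,m},\qquad |\partial_x^j\partial_t^mE(x,t)|\le K_{j,m}\,\varepsilon^{-j}e^{-\alpha(1-x)/\varepsilon},$$ where the constants $K_{j,m}$ do not depend on $\varepsilon$. **Mesh.** Let $N\ge2$ be even, $\varepsilon\le N^{-1}$, and let $\varphi\in C^2[0,\tfrac12]$ (it may depend on $N$ and $\varepsilon$) satisfy $\varphi(0)=0$, $\varphi'>0$, $\varphi''\ge0$ and either $\varphi(\tfrac12)=\ln N$ (Shishkin-type) or $\varphi(\tfrac12)=\ln(1/\varepsilon)$ (Bakhvalov-type).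 Put $\tau=\min\{\tfrac12,\tfrac{\sigma\varepsilon}{\alpha}\varphi(\tfrac12)\}$, and assume $\tau=\tfrac{\sigma\varepsilon}{\alpha}\varphi(\tfrac12)$. The mesh points are $x_i=2(1-\tau)\tfrac iN$ for $i\le N/2$ and $x_i=1-\tfrac{\sigma\varepsilon}\alpha\varphi(1-\tfrac iN)$ for $N/2\le i\le N$; $I_j=(x_{j-1},x_j)$, $h_j=x_j-x_{j-1}$. Let $\psi=e^{-\varphi}$ and $\max|\psi'|=\max_{[0,1/2]}|\psi'|$. **Scheme.** Let $\mathcal V_N$ be the space of functions that are polynomials of degree at most $k$ on every $I_j$. Write $(\cdot,\cdot)$, $\|\cdot\|$ for the inner product and norm of $L^2(0,1)$, $v_j^\pm$ for one-sided limits at $x_j$, and $[\![v]\!]_j=v_j^+-v_j^-$ for $1\le j\le N-1$, $[\![v]\!]_0=v_0^+$, $[\![v]\!]_N=-v_N^-$. With $\lambda_N=\varepsilon/h_N$ and elementwise derivatives, let $$\begin{aligned}B((u,q);(v,s))={}&\varepsilon^{-1}(q,s)+((b-a_x)u,v)+(u,s_x)+\sum_{j=1}^{N-1}u_j^-[\![s]\!]_j+(q,v_x)+\sum_{j=0}^{N-1}q_j^+[\![v]\!]_j-q_N^-v_N^-\\&-(au,v_x)-\sum_{j=1}^{N}a(x_j)u_j^-[\![v]\!]_j+\lambda_Nu_N^-v_N^-,\end{aligned}$$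 $$|||(u,q)|||^2=\varepsilon^{-1}\|q\|^2+\|(b-\tfrac12a_x)^{1/2}u\|^2+\sum_{j=0}^N\tfrac12a(x_j)[\![u]\!]_j^2+\lambda_N[\![u]\!]_N^2 .$$ Let $M\ge1$, $\Delta t=T/M$, $t^m=m\Delta t$, $K^m=(t^{m-1},t^m]$, and let $\mathcal V_N^{\Delta t}$ be the space of functions of $t\in(0,T]$ whose restriction to each $K^m$ is a $\mathcal V_N$-valued polynomial in $t$ of degree at most $r$; $V^{m,\pm}$ denotes one-sided limits at $t^m$ and $[\![V]\!]^m=V^{m,+}-V^{m,-}$. Let $\mathbb W=(\mathbb U,\mathbb Q)\in\mathcal V_N^{\Delta t}\times\mathcal V_N^{\Delta t}$ solve the space-time DG scheme $$\int_{K^m}\big((\mathbb U_t,V)+B(\mathbb W;(V,R))\big)\,dt+([\![\mathbb U]\!]^{m-1},V^{m-1,+})=\int_{K^m}(f,V)\,dt\qquad\forall (V,R)\in\mathcal V_N^{\Delta t}\times\mathcal V_N^{\Delta t},\ m=1,\dots,M,$$ where $\mathbb U^{0,-}=\pi u_0$ is the elementwise $L^2$-projection of $u_0$ onto $\mathcal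 V_N$. **Theorem.** Let $w=(u,q)=(u,\varepsilon u_x)$. There is a constant $C>0$, depending only on $k,r,T,\alpha,\beta,\sigma,a,b$ and the constants $K_{j,m}$, and in particular independent of $\varepsilon$, $N$, $M$ and $\varphi$, such that always $$\|u(T)-\mathbb U(T)\|\le C\big((\Delta t)^{r+1}+(N^{-1}\max|\psi'|)^{k+1}\big),$$ $$\Big(\sum_{m=1}^M\int_{K^m}|||w-\mathbb W|||^2\,dt\Big)^{1/2}\le C\big((\Delta t)^{r+1}+(N^{-1}\max|\psi'|)^{k+1/2}\big).$$ -/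

import Mathlib

open Set Filter Topology MeasureTheory

open scoped ContDiff

noncomputable section

namespace LDG

/-! ### The continuous problem on `[0,1] × [0,T]` -/

/-- `∂ₓʲ ∂ₜᵐ g (x,t)` for a function `g` on the closed rectangle `[0,1] × [0,T]`
(one-sided derivatives on the boundary). -/
def mixedDeriv (T : ℝ) (g : ℝ → ℝ → ℝ) (j m : ℕ) (x t : ℝ) : ℝ :=
  iteratedDerivWithin j
    (fun y => iteratedDerivWithin m (fun s => g y s) (Icc 0 T) t) (Icc 0 1) x

/-- `u` is a classical solution of `u_t - ε u_xx + a u_x + b u = f` in `(0,1) × (0,T]` with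
`u(x,0) = u₀(x)` and homogeneous Dirichlet boundary values. -/
structure IsClassicalSolution (T ε : ℝ) (a b : ℝ → ℝ) (f : ℝ → ℝ → ℝ) (u₀ : ℝ → ℝ)
    (u : ℝ → ℝ → ℝ) : Prop where
  smooth : ContDiffOn ℝ 2 (Function.uncurry u) (Icc 0 1 ×ˢ Icc 0 T)
  pde : ∀ x ∈ Ioo (0 : ℝ) 1, ∀ t ∈ Ioc 0 T,
    mixedDeriv T u 0 1 x t - ε * mixedDeriv T u 2 0 x t + a x * mixedDeriv T u 1 0 x t
      + b x * u x t = f x t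
  initial : ∀ x ∈ Icc (0 : ℝ) 1, u x 0 = u₀ x
  left_bdry : ∀ t ∈ Ioc 0 T, u 0 t = 0
  right_bdry : ∀ t ∈ Ioc 0 T, u 1 t = 0

/-- The decomposition `u = S + E` into a smooth part and an exponential layer at `x = 1`, with
`|∂ₓʲ ∂ₜᵐ S| ≤ K j m` and `|∂ₓʲ ∂ₜᵐ E| ≤ K j m · ε⁻ʲ e^{-α(1-x)/ε}` for all `j, m`. -/
def HasLayerDecomposition (T ε α : ℝ) (K : ℕ → ℕ → ℝ) (u : ℝ → ℝ → ℝ) : Prop :=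
  ∃ S E : ℝ → ℝ → ℝ,
    ContDiffOn ℝ ∞ (Function.uncurry S) (Icc 0 1 ×ˢ Icc 0 T) ∧
    ContDiffOn ℝ ∞ (Function.uncurry E) (Icc 0 1 ×ˢ Icc 0 T) ∧
    (∀ x ∈ Icc (0 : ℝ) 1, ∀ t ∈ Icc 0 T, u x t = S x t + E x t) ∧
    (∀ j m : ℕ, ∀ x ∈ Icc (0 : ℝ) 1, ∀ t ∈ Icc 0 T, |mixedDeriv T S j m x t| ≤ K j m) ∧
    (∀ j m : ℕ, ∀ x ∈ Icc (0 : ℝ) 1, ∀ t ∈ Icc 0 T,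
      |mixedDeriv T E j m x t| ≤ K j m * (ε ^ j)⁻¹ * Real.exp (-α * (1 - x) / ε))

/-- The flux `q(·,t) = ε u_x(·,t)` as a function of `x`. -/
def flux (ε : ℝ) (u : ℝ → ℝ → ℝ) (t x : ℝ) : ℝ :=
  ε * derivWithin (fun y => u y t) (Icc 0 1) x

/-! ### Layer-adapted meshes -/

/-- The conditions on the function `φ` on `[0,1/2]`: `φ(0) = 0`, `φ' > 0`, `φ'' ≥ 0`, and
`φ(1/2) = ln N` (Shishkin-type) or `φ(1/2) = ln (1/ε)` (Bakhvalov-type). -/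
structure IsMeshFunction (ε : ℝ) (N : ℕ) (φ : ℝ → ℝ) : Prop where
  contDiffOn : ContDiffOn ℝ 2 φ (Icc 0 (1 / 2))
  zero : φ 0 = 0
  deriv_pos : ∀ t ∈ Icc (0 : ℝ) (1 / 2), 0 < derivWithin φ (Icc 0 (1 / 2)) t
  deriv2_nonneg : ∀ t ∈ Icc (0 : ℝ) (1 / 2), 0 ≤ iteratedDerivWithin 2 φ (Icc 0 (1 / 2)) t
  type : φ (1 / 2) = Real.log N ∨ φ (1 / 2) = Real.log (1 / ε)

/-- The transition parameter `τ = min {1/2, σ ε α⁻¹ φ(1/2)}`. -/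
def tau (σ α ε : ℝ) (φ : ℝ → ℝ) : ℝ := min (1 / 2) (σ * ε / α * φ (1 / 2))

/-- The mesh points `x_i = λ(i/N)`, `i = 0, …, N`. -/
def meshPt (σ α ε : ℝ) (φ : ℝ → ℝ) (N i : ℕ) : ℝ :=
  if (i : ℝ) / N ≤ 1 / 2 then 2 * (1 - tau σ α ε φ) * ((i : ℝ) / N)
  else 1 - σ * ε / α * φ (1 - (i : ℝ) / N)

/-- `max |ψ'|` over `[0,1/2]`, where `ψ = e^{-φ}` is the mesh characterizing function. -/
def maxPsi' (φ : ℝ → ℝ) : ℝ :=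
  sSup ((fun t => |derivWithin (fun s => Real.exp (-φ s)) (Icc 0 (1 / 2)) t|) ''
    Icc (0 : ℝ) (1 / 2))

/-! ### The LDG discretization in space

In this section `X 0 < X 1 < … < X N` are the mesh points. -/

/-- `v ∈ 𝒱_N`: on each element `(X j, X (j+1))`, `v` is a polynomial of degree at most `k`. -/
def IsBrokenPoly (k N : ℕ) (X : ℕ → ℝ) (v : ℝ → ℝ) : Prop :=
  ∀ j < N, ∃ p : Polynomial ℝ, p.natDegree ≤ k ∧ ∀ x ∈ Ioo (X j) (X (j + 1)), v x = p.eval x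

/-- The inner product of `L²(0,1)`. -/
def l2 (w v : ℝ → ℝ) : ℝ := ∫ x in (0 : ℝ)..1, w x * v x

/-- The norm of `L²(0,1)`. -/
def l2norm (v : ℝ → ℝ) : ℝ := Real.sqrt (l2 v v)

/-- The trace `v_j⁻` from the left element. -/
def trL (X : ℕ → ℝ) (v : ℝ → ℝ) (j : ℕ) : ℝ := Function.leftLim v (X j)

/-- The trace `v_j⁺` from the right element. -/
def trR (X : ℕ → ℝ) (v : ℝ → ℝ) (j : ℕ) : ℝ := Function.rightLim v (X j)

/-- The jump `⟦v⟧_j = v_j⁺ - v_j⁻`, with `⟦v⟧_0 = v_0⁺` and `⟦v⟧_N = -v_N⁻`. -/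
def jump (N : ℕ) (X : ℕ → ℝ) (v : ℝ → ℝ) (j : ℕ) : ℝ :=
  if j = 0 then trR X v 0 else if j = N then -trL X v N else trR X v j - trL X v j

/-- The penalty parameter `λ_N = ε / h_N`. -/
def penalty (ε : ℝ) (N : ℕ) (X : ℕ → ℝ) : ℝ := ε / (X N - X (N - 1))

/-- The derivative `a_x` on `[0,1]`. -/
def coefDeriv (a : ℝ → ℝ) (x : ℝ) : ℝ := derivWithin a (Icc 0 1) x

/-- The LDG bilinear form `B((u,q);(v,s)) = 𝒯₁ + 𝒯₂ + 𝒯₃ + 𝒯₄`. The derivatives `deriv s`, `deriv v`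
are elementwise derivatives: the finitely many mesh points do not contribute to the integrals. -/
def bilin (ε : ℝ) (a b : ℝ → ℝ) (N : ℕ) (X : ℕ → ℝ) (u q v s : ℝ → ℝ) : ℝ :=
  (ε⁻¹ * l2 q s + l2 (fun x => (b x - coefDeriv a x) * u x) v)
  + (l2 u (deriv s) + ∑ j ∈ Finset.Ico 1 N, trL X u j * jump N X s j)
  + (l2 q (deriv v) + ∑ j ∈ Finset.range N, trR X q j * jump N X v j - trL X q N * trL X v N)
  + (-l2 (fun x => a x * u x) (deriv v)
      - ∑ j ∈ Finset.Icc 1 N, a (X j) * trL X u j * jump N X v j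
      + penalty ε N X * trL X u N * trL X v N)

/-- The square `|||(u,q)|||²` of the energy norm. -/
def energySq (ε : ℝ) (a b : ℝ → ℝ) (N : ℕ) (X : ℕ → ℝ) (u q : ℝ → ℝ) : ℝ :=
  ε⁻¹ * l2 q q + l2 (fun x => (b x - coefDeriv a x / 2) * u x) u
  + ∑ j ∈ Finset.range (N + 1), 1 / 2 * a (X j) * jump N X u j ^ 2
  + penalty ε N X * jump N X u N ^ 2

/-- `w = π u₀` is the elementwise `L²`-projection of `u₀` onto `𝒱_N`. -/
def IsL2Proj (k N : ℕ) (X : ℕ → ℝ) (u₀ w : ℝ → ℝ) : Prop :=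
  IsBrokenPoly k N X w ∧
  ∀ j < N, ∀ p : Polynomial ℝ, p.natDegree ≤ k →
    ∫ x in (X j)..(X (j + 1)), w x * p.eval x = ∫ x in (X j)..(X (j + 1)), u₀ x * p.eval x

/-! ### The DG discretization in time -/

/-- The time levels `t^m = m Δt` with `Δt = T / M`. -/
def timePt (T : ℝ) (M m : ℕ) : ℝ := m * (T / M)

/-- `V ∈ 𝒱_N^{Δt}`: on each time interval `(t^m, t^{m+1}]`, `0 ≤ m < M`, the function `t ↦ V t` is
a polynomial in `t` of degree at most `r` with coefficients in `𝒱_N`. -/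
def IsSpaceTimePoly (k r N : ℕ) (X : ℕ → ℝ) (T : ℝ) (M : ℕ) (V : ℝ → ℝ → ℝ) : Prop :=
  ∀ m < M, ∃ c : ℕ → ℝ → ℝ, (∀ i, IsBrokenPoly k N X (c i)) ∧
    ∀ t ∈ Ioc (timePt T M m) (timePt T M (m + 1)), ∀ x,
      V t x = ∑ i ∈ Finset.range (r + 1), t ^ i * c i x

/-- The left limit `V^{m,-}` in time as a function of `x`; at `m = 0` it is the prescribed
initial value. -/
def timeL (T : ℝ) (M : ℕ) (V₀ : ℝ → ℝ) (V : ℝ → ℝ → ℝ) (m : ℕ) (x : ℝ) : ℝ :=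
  if m = 0 then V₀ x else Function.leftLim (fun t => V t x) (timePt T M m)

/-- The right limit `V^{m,+}` in time as a function of `x`. -/
def timeR (T : ℝ) (M : ℕ) (V : ℝ → ℝ → ℝ) (m : ℕ) (x : ℝ) : ℝ :=
  Function.rightLim (fun t => V t x) (timePt T M m)

/-- `(U,Q)` solves the space-time DG scheme with initial value `U^{0,-} = π u₀`. Discrete functions
are written `U t x`, and the time interval with index `m`, `0 ≤ m < M`, is `(t^m, t^{m+1}]`. -/
def IsDGSolution (k r : ℕ) (ε : ℝ) (a b : ℝ → ℝ) (N : ℕ) (X : ℕ → ℝ) (T : ℝ) (M : ℕ)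
    (f : ℝ → ℝ → ℝ) (u₀ : ℝ → ℝ) (U Q : ℝ → ℝ → ℝ) : Prop :=
  IsSpaceTimePoly k r N X T M U ∧ IsSpaceTimePoly k r N X T M Q ∧
  ∃ U₀ : ℝ → ℝ, IsL2Proj k N X u₀ U₀ ∧
  ∀ V R : ℝ → ℝ → ℝ, IsSpaceTimePoly k r N X T M V → IsSpaceTimePoly k r N X T M R →
  ∀ m < M,
    (∫ t in (timePt T M m)..(timePt T M (m + 1)),
        (l2 (fun x => deriv (fun s => U s x) t) (V t) + bilin ε a b N X (U t) (Q t) (V t) (R t)))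
      + l2 (fun x => timeR T M U m x - timeL T M U₀ U m x) (timeR T M V m)
    = ∫ t in (timePt T M m)..(timePt T M (m + 1)), l2 (fun x => f x t) (V t)

end LDG

end

/-! ### Polynomials on the unit interval: dual bases, Radau projection, inverse inequalities. -/

noncomputable section

namespace LDG

open scoped Polynomial

/-! ### Cauchy–Schwarz -/

/-! The discrete solution is compared with a discrete function built from the exact solution, and
the difference ξ is estimated by an energy argument whose stability (`ldgFun_self`, `le_ldgEnergy`)
is uniform in ε. The work lies in choosing the comparison function so that its residual, too, is
small uniformly in ε.

In space the comparison uses cellwise Gauss–Radau projections: `projR` for u, interpolating at right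
end points, and `projL` for the flux q = εu_x, interpolating at left end points. These are the
traces the form uses, so all nodal terms of the projection error vanish except the flux at x = 1,
which the outflow trace in the energy absorbs (`exists_projection_functional_bound`). The mesh
enters only through `IsLayerMesh`. With ϖ = min(1, N⁻¹ max|ψ'|) and e(x) = exp(-α(1-x)/(σε)), the
widths h_j and the resolutions min(1, h_j/ε) e(x_{j+1}) are O(ϖ), and the resolutions sum to O(1)
(`isLayerMesh_meshPt`). Since σ ≥ k+2, the layer is bounded by e^{k+2}. Of these factors, k+1
produce the power k+1 of the resolution; the last one has L² norm O(√ε), which balances the weight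
ε⁻¹ of the flux. The squared jumps of the projection error only sum to O(ϖ^{2k+1}), whence the order
k+1/2 in the energy norm.

In time the comparison function z on (l, t₀) is the Taylor polynomial at t₀ of degree r+1 whose top
monomial is replaced by its Radau projection to degree r (`timeComp`). It equals u at t₀ and
inherits the boundary conditions and the layer bounds. Its leading defect, a polynomial χ(t) times
∂_t^{r+1}u(t₀), is invisible to the time stepping (`timeDefect_consistency`). What remains of the
mismatch at l is therefore one order smaller (`exists_jump_bound`), and the local errors add up
independently of M.

The delicate term is the spatial operator applied to the time error u - z, since the layer part of
the result is not bounded in L² uniformly in ε. Up to bounded terms this layer part is a derivative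
g' with g = aE - εE_x, where E is the layer part of u - z, and g is bounded by a multiple of e. The
discrete flux equation holds at every time (`IsCellDG.fluxEq`). Tested with the projection of g, it
expresses (g', ξ) by the flux error and an outflow trace (`cip_deriv_eq`), and ε^{-1/2} times the L²
norm of that projection is bounded uniformly in ε (`exists_operator_bound`).

These estimates meet in `exists_energy_step`. The steps are summed in `exists_discrete_error`
without a Gronwall argument, because the energy controls β times the squared L² norm.
`exists_energy_bound` adds the projection error and the time error. -/

lemma sq_le_mul_of_quadratic_nonneg {A B Y : ℝ} (h : ∀ t : ℝ, 0 ≤ A + 2 * t * Y + t ^ 2 * B) :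
    Y ^ 2 ≤ A * B := by
  have := discrim_le_zero (a := B) (b := 2 * Y) (c := A) (fun t => by linarith [h t])
  rw [discrim] at this
  linarith

lemma sq_integral_mul_le {l r : ℝ} (hlr : l ≤ r) (f g : C(ℝ, ℝ)) :
    (∫ x in l..r, f x * g x) ^ 2 ≤ (∫ x in l..r, f x ^ 2) * ∫ x in l..r, g x ^ 2 := by
  apply sq_le_mul_of_quadratic_nonneg
  intro t
  have : (∫ x in l..r, f x ^ 2) + 2 * t * (∫ x in l..r, f x * g x) + t ^ 2 * (∫ x in l..r, g x ^ 2)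
      = ∫ x in l..r, (f x + t * g x) ^ 2 := by
    rw [← intervalIntegral.integral_const_mul, ← intervalIntegral.integral_const_mul,
      ← intervalIntegral.integral_add, ← intervalIntegral.integral_add]
    · exact intervalIntegral.integral_congr fun x _ => by ring
    all_goals exact Continuous.intervalIntegrable (by fun_prop) _ _
  rw [this]
  exact intervalIntegral.integral_nonneg hlr fun x _ => sq_nonneg _

/-! ### Dual bases of spaces of polynomials -/

/-- By counting dimensions, n functionals that separate a space of dimension n are coordinates on
it. The Radau projection and the inverse inequalities are both written in such coordinates, which
reduces their stability to bounds for finitely many fixed polynomials. -/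
lemma exists_dualBasis (n : ℕ) (L : Fin n → ℝ[X] →ₗ[ℝ] ℝ)
    (h : ∀ p : ℝ[X], p ∈ Polynomial.degreeLT ℝ n → (∀ i, L i p = 0) → p = 0) :
    ∃ B : Fin n → ℝ[X], (∀ i, B i ∈ Polynomial.degreeLT ℝ n) ∧
      ∀ i j, L i (B j) = if i = j then 1 else 0 := by
  let Φ : Polynomial.degreeLT ℝ n →ₗ[ℝ] (Fin n → ℝ) :=
    LinearMap.pi fun i => (L i).comp (Polynomial.degreeLT ℝ n).subtype
  have hfd : FiniteDimensional ℝ (Polynomial.degreeLT ℝ n) :=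
    Module.Finite.equiv (Polynomial.degreeLTEquiv ℝ n).symm
  have hinj : Function.Injective Φ := by
    rw [← LinearMap.ker_eq_bot, LinearMap.ker_eq_bot']
    intro p hp
    apply Subtype.ext
    exact h p p.2 fun i => congrFun hp i
  have hsurj := (LinearMap.injective_iff_surjective_of_finrank_eq_finrank
    (LinearEquiv.finrank_eq (Polynomial.degreeLTEquiv ℝ n)) (f := Φ)).1 hinj
  choose B hB using fun j : Fin n => hsurj (Pi.single j 1)
  refine ⟨fun j => B j, fun j => (B j).2, fun i j => ?_⟩
  have := congrFun (hB j) i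
  simpa [Φ, Pi.single_apply] using this

lemma mem_degreeLT_iff_natDegree {k : ℕ} {p : ℝ[X]} :
    p ∈ Polynomial.degreeLT ℝ (k + 1) ↔ p.natDegree ≤ k := by
  rw [Polynomial.mem_degreeLT]
  by_cases h : p = 0
  · simp [h]
  · rw [← Polynomial.natDegree_lt_iff_degree_lt h, Nat.lt_succ_iff]

lemma eq_sum_dualBasis {n : ℕ} {L : Fin n → ℝ[X] →ₗ[ℝ] ℝ}
    (h : ∀ p : ℝ[X], p ∈ Polynomial.degreeLT ℝ n → (∀ i, L i p = 0) → p = 0)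
    {B : Fin n → ℝ[X]} (hB : ∀ i, B i ∈ Polynomial.degreeLT ℝ n)
    (hLB : ∀ i j, L i (B j) = if i = j then 1 else 0) {p : ℝ[X]}
    (hp : p ∈ Polynomial.degreeLT ℝ n) : p = ∑ i, L i p • B i := by
  rw [← sub_eq_zero]
  apply h
  · exact Submodule.sub_mem _ hp
      (Submodule.sum_mem _ fun i _ => Submodule.smul_mem _ _ (hB i))
  · intro i
    simp [hLB]

lemma exists_bound_eval (p : ℝ[X]) : ∃ C, ∀ y ∈ Icc (0 : ℝ) 1, |p.eval y| ≤ C := by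
  obtain ⟨C, hC⟩ := isCompact_Icc.exists_bound_of_continuousOn (s := Icc (0 : ℝ) 1)
    p.continuous.continuousOn
  exact ⟨C, fun y hy => hC y hy⟩

/-- A bound for a finite family of polynomials and their derivatives on `[0,1]`. -/
lemma exists_bound_eval_family {n : ℕ} (B : Fin n → ℝ[X]) :
    ∃ C, 0 < C ∧ ∀ i, ∀ y ∈ Icc (0 : ℝ) 1,
      |(B i).eval y| ≤ C ∧ |(B i).derivative.eval y| ≤ C := by
  choose c hc using fun i => exists_bound_eval (B i)
  choose d hd using fun i => exists_bound_eval (B i).derivative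
  refine ⟨1 + ∑ i, (|c i| + |d i|), by positivity, fun i y hy => ?_⟩
  have h : |c i| + |d i| ≤ ∑ i, (|c i| + |d i|) :=
    Finset.single_le_sum (f := fun i => |c i| + |d i|) (fun _ _ => by positivity)
      (Finset.mem_univ i)
  constructor
  · linarith [hc i y hy, le_abs_self (c i), abs_nonneg (d i)]
  · linarith [hd i y hy, le_abs_self (d i), abs_nonneg (c i)]

/-! ### Moments on the unit interval -/

/-- The linear functional `g ↦ ∫₀¹ g y yⁱ dy`. -/
def moment (i : ℕ) : C(ℝ, ℝ) →ₗ[ℝ] ℝ where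
  toFun g := ∫ y in (0 : ℝ)..1, g y * y ^ i
  map_add' f g := by
    rw [← intervalIntegral.integral_add]
    · exact intervalIntegral.integral_congr fun x _ => by simp [add_mul]
    all_goals exact Continuous.intervalIntegrable (by fun_prop) _ _
  map_smul' c g := by
    simp only [ContinuousMap.coe_smul, Pi.smul_apply, smul_eq_mul, RingHom.id_apply]
    rw [← intervalIntegral.integral_const_mul]
    exact intervalIntegral.integral_congr fun x _ => by ring

/-- A polynomial as a continuous function. -/
def polyC : ℝ[X] →ₗ[ℝ] C(ℝ, ℝ) := Polynomial.toContinuousMapAlgHom.toLinearMap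

@[simp] lemma polyC_apply (p : ℝ[X]) (x : ℝ) : polyC p x = p.eval x := rfl

lemma moment_apply (i : ℕ) (g : C(ℝ, ℝ)) : moment i g = ∫ y in (0 : ℝ)..1, g y * y ^ i := rfl

/-- If the moments of order less than `k` vanish, `g` is orthogonal to polynomials of degree less
than `k`. -/
lemma integral_mul_eval_eq_zero {k : ℕ} {g : C(ℝ, ℝ)} (hg : ∀ i < k, moment i g = 0) {p : ℝ[X]}
    (hp : p ∈ Polynomial.degreeLT ℝ k) : ∫ y in (0 : ℝ)..1, g y * p.eval y = 0 := by
  have h : ∀ y, g y * p.eval y = ∑ i ∈ Finset.range k, p.coeff i * (g y * y ^ i) := by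
    intro y
    rcases Nat.eq_zero_or_pos k with rfl | hk
    · have : p = 0 := by
        rw [Polynomial.mem_degreeLT] at hp
        simpa using hp
      simp [this]
    · have hn : p.natDegree < k := by
        rw [Polynomial.mem_degreeLT] at hp
        by_cases h0 : p = 0
        · simpa [h0] using hk
        · exact (Polynomial.natDegree_lt_iff_degree_lt h0).2 hp
      rw [Polynomial.eval_eq_sum_range' hn, Finset.mul_sum]
      exact Finset.sum_congr rfl fun i _ => by ring
  simp_rw [h]
  rw [intervalIntegral.integral_finsetSum]
  · apply Finset.sum_eq_zero
    intro i hi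
    rw [intervalIntegral.integral_const_mul, ← moment_apply, hg i (Finset.mem_range.1 hi), mul_zero]
  · intro i _
    exact Continuous.intervalIntegrable (by fun_prop) _ _

/-- The weight is 1 for plain moments and X for the Radau functionals. The latter vanishes at 0, so
positivity is required only in the open interval. -/
lemma eq_zero_of_integral_sq_eq_zero {p q : ℝ[X]} {l r : ℝ} (hlr : l < r)
    (hq : ∀ y ∈ Ioo l r, 0 < q.eval y)
    (h : ∫ y in l..r, q.eval y * p.eval y ^ 2 = 0) : p = 0 := by
  have h0 : ∀ y ∈ Ioo l r, q.eval y * p.eval y ^ 2 = 0 := by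
    by_contra! hne
    obtain ⟨y, hy, hne⟩ := hne
    have hpos : ∀ z ∈ Icc l r, 0 ≤ q.eval z := by
      have : closure (Ioo l r) ⊆ {z | 0 ≤ q.eval z} :=
        closure_minimal (fun z hz => (hq z hz).le)
          (isClosed_le continuous_const q.continuous)
      rwa [closure_Ioo hlr.ne] at this
    have := intervalIntegral.integral_pos hlr
      (f := fun y => q.eval y * p.eval y ^ 2) (by fun_prop)
      (fun z hz => mul_nonneg (hpos z (Ioc_subset_Icc_self hz)) (sq_nonneg _))
      ⟨y, Ioo_subset_Icc_self hy,
        lt_of_le_of_ne (mul_nonneg (hq y hy).le (sq_nonneg _)) hne.symm⟩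
    linarith
  apply Polynomial.eq_zero_of_infinite_isRoot
  apply Set.Infinite.mono _ (Ioo_infinite hlr)
  intro y hy
  have := h0 y hy
  rcases mul_eq_zero.1 this with h1 | h1
  · exact absurd h1 (hq y hy).ne'
  · exact pow_eq_zero_iff (two_ne_zero) |>.1 h1

lemma eq_zero_of_moments (k : ℕ) (p : ℝ[X]) (hp : p ∈ Polynomial.degreeLT ℝ k)
    (h : ∀ i : Fin k, moment i (polyC p) = 0) : p = 0 := by
  have h1 := integral_mul_eval_eq_zero (g := polyC p) (fun i hi => h ⟨i, hi⟩) hp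
  apply eq_zero_of_integral_sq_eq_zero (q := 1) one_pos (by simp)
  refine Eq.trans ?_ h1
  exact intervalIntegral.integral_congr fun x _ => by simp [sq]

/-! ### The Gauss–Radau projection on the unit interval -/

/-- The functionals determining the Gauss–Radau projection: the value at `0` and the moments. -/
def radauFun (i : ℕ) : C(ℝ, ℝ) →ₗ[ℝ] ℝ :=
  if i = 0 then (ContinuousMap.evalCLM ℝ (0 : ℝ)).toLinearMap else moment (i - 1)

lemma radauFun_zero (g : C(ℝ, ℝ)) : radauFun 0 g = g 0 := by simp [radauFun]

lemma radauFun_succ (i : ℕ) (g : C(ℝ, ℝ)) : radauFun (i + 1) g = moment i g := by simp [radauFun]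

/-- Since p vanishes at 0, p = X q with q of degree less than k, so q is an admissible test
polynomial. The vanishing moments then give ∫ X q² = 0. -/
lemma eq_zero_of_radauFun (k : ℕ) (p : ℝ[X]) (hp : p ∈ Polynomial.degreeLT ℝ (k + 1))
    (h : ∀ i : Fin (k + 1), radauFun i (polyC p) = 0) : p = 0 := by
  have h0 : p.eval 0 = 0 := by
    have := h 0
    rwa [Fin.val_zero, radauFun_zero, polyC_apply] at this
  obtain ⟨q, rfl⟩ : Polynomial.X ∣ p := by
    rw [Polynomial.X_dvd_iff, Polynomial.coeff_zero_eq_eval_zero, h0]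
  by_cases hq0 : q = 0
  · simp [hq0]
  have hq : q ∈ Polynomial.degreeLT ℝ k := by
    rw [mem_degreeLT_iff_natDegree, Polynomial.natDegree_X_mul hq0] at hp
    rw [Polynomial.mem_degreeLT]
    exact (Polynomial.natDegree_lt_iff_degree_lt hq0).1 (by omega)
  have h1 := integral_mul_eval_eq_zero (g := polyC (Polynomial.X * q)) (fun i hi => by
    have := h ⟨i + 1, by omega⟩
    rwa [radauFun_succ] at this) hq
  have : q = 0 := by
    apply eq_zero_of_integral_sq_eq_zero (q := Polynomial.X) one_pos
      (by simp +contextual)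
    refine Eq.trans ?_ h1
    exact intervalIntegral.integral_congr fun x _ => by simp; ring
  simp [this]

lemma exists_radauBasis (k : ℕ) : ∃ B : Fin (k + 1) → ℝ[X],
    (∀ i, B i ∈ Polynomial.degreeLT ℝ (k + 1)) ∧
      ∀ i j : Fin (k + 1), ((radauFun i).comp polyC) (B j) = if i = j then 1 else 0 :=
  exists_dualBasis (k + 1) (fun i => (radauFun i).comp polyC) fun p hp h =>
    eq_zero_of_radauFun k p hp h

/-- The Gauss–Radau projection onto polynomials of degree at most `k` on `[0,1]`: it interpolates
at `0` and preserves the moments of order less than `k`. -/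
def radau (k : ℕ) : C(ℝ, ℝ) →ₗ[ℝ] ℝ[X] :=
  ∑ i : Fin (k + 1), (radauFun i).smulRight (Classical.choose (exists_radauBasis k) i)

lemma radau_apply (k : ℕ) (g : C(ℝ, ℝ)) : radau k g =
    ∑ i : Fin (k + 1), radauFun i g • Classical.choose (exists_radauBasis k) i := by
  simp [radau]

lemma radau_mem (k : ℕ) (g : C(ℝ, ℝ)) : radau k g ∈ Polynomial.degreeLT ℝ (k + 1) := by
  rw [radau_apply]
  exact Submodule.sum_mem _ fun i _ => Submodule.smul_mem _ _
    ((Classical.choose_spec (exists_radauBasis k)).1 i)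

lemma radauFun_radau (k : ℕ) (g : C(ℝ, ℝ)) (i : Fin (k + 1)) :
    radauFun i (polyC (radau k g)) = radauFun i g := by
  have h := (Classical.choose_spec (exists_radauBasis k)).2
  simp only [LinearMap.comp_apply] at h
  rw [radau_apply, map_sum, map_sum]
  simp [h]

lemma radau_eval_zero (k : ℕ) (g : C(ℝ, ℝ)) : (radau k g).eval 0 = g 0 := by
  have := radauFun_radau k g 0
  rwa [Fin.val_zero, radauFun_zero, radauFun_zero, polyC_apply] at this

lemma radau_orth {k : ℕ} (g : C(ℝ, ℝ)) {p : ℝ[X]} (hp : p ∈ Polynomial.degreeLT ℝ k) :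
    ∫ y in (0 : ℝ)..1, (radau k g).eval y * p.eval y = ∫ y in (0 : ℝ)..1, g y * p.eval y := by
  have h := integral_mul_eval_eq_zero (g := polyC (radau k g) - g) (fun i hi => by
    have := radauFun_radau k g ⟨i + 1, by omega⟩
    rw [radauFun_succ, radauFun_succ] at this
    rw [map_sub, this, sub_self]) hp
  rw [← sub_eq_zero, ← intervalIntegral.integral_sub]
  · refine Eq.trans ?_ h
    exact intervalIntegral.integral_congr fun x _ => by simp [sub_mul]
  all_goals exact Continuous.intervalIntegrable (by fun_prop) _ _

lemma radau_polyC {k : ℕ} {p : ℝ[X]} (hp : p ∈ Polynomial.degreeLT ℝ (k + 1)) :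
    radau k (polyC p) = p := by
  rw [← sub_eq_zero]
  apply eq_zero_of_radauFun k _ (Submodule.sub_mem _ (radau_mem _ _) hp)
  intro i
  rw [map_sub, map_sub, radauFun_radau, sub_self]

lemma abs_radauFun_le (i : ℕ) (g : C(ℝ, ℝ)) :
    radauFun i g ^ 2 ≤ g 0 ^ 2 + ∫ y in (0 : ℝ)..1, g y ^ 2 := by
  have h0 : 0 ≤ ∫ y in (0 : ℝ)..1, g y ^ 2 :=
    intervalIntegral.integral_nonneg zero_le_one fun _ _ => sq_nonneg _
  cases i with
  | zero => rw [radauFun_zero]; linarith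
  | succ i =>
    rw [radauFun_succ, moment_apply]
    have h1 := sq_integral_mul_le zero_le_one g (polyC (Polynomial.X ^ i))
    have h2 : ∫ y in (0 : ℝ)..1, (polyC (Polynomial.X ^ i) y) ^ 2 ≤ 1 := by
      have : ∫ y in (0 : ℝ)..1, (polyC (Polynomial.X ^ i) y) ^ 2 = 1 / (2 * i + 1) := by
        simp [← pow_mul]
        ring
      rw [this, div_le_one (by positivity)]
      linarith [(Nat.cast_nonneg i : (0 : ℝ) ≤ i)]
    simp only [polyC_apply, Polynomial.eval_pow, Polynomial.eval_X] at h1 h2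
    nlinarith [sq_nonneg (g 0)]

/-- The projection is a fixed linear combination of its functionals, and these see only the value at
0 and the L² norm. Keeping the two apart is what later allows an L² bound for functions whose size
is smallest at the interpolation point. -/
lemma exists_radau_bound (k : ℕ) : ∃ C, 0 < C ∧ ∀ (g : C(ℝ, ℝ)), ∀ y ∈ Icc (0 : ℝ) 1,
    (radau k g).eval y ^ 2 ≤ C * (g 0 ^ 2 + ∫ y in (0 : ℝ)..1, g y ^ 2) ∧
    (radau k g).derivative.eval y ^ 2 ≤ C * (g 0 ^ 2 + ∫ y in (0 : ℝ)..1, g y ^ 2) := by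
  obtain ⟨C, hC, hB⟩ := exists_bound_eval_family (Classical.choose (exists_radauBasis k))
  refine ⟨(k + 1) * ((k + 1) * C ^ 2), by positivity, fun g y hy => ?_⟩
  set R := g 0 ^ 2 + ∫ y in (0 : ℝ)..1, g y ^ 2
  have key : ∀ e : Fin (k + 1) → ℝ, (∀ i, |e i| ≤ C) →
      (∑ i : Fin (k + 1), radauFun i g * e i) ^ 2 ≤ (k + 1) * ((k + 1) * C ^ 2) * R := by
    intro e he
    calc (∑ i : Fin (k + 1), radauFun i g * e i) ^ 2
        ≤ (Finset.univ : Finset (Fin (k + 1))).card * ∑ i : Fin (k + 1), (radauFun i g * e i) ^ 2 :=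
          sq_sum_le_card_mul_sum_sq
      _ ≤ (k + 1) * ∑ i : Fin (k + 1), R * C ^ 2 := by
          simp only [Finset.card_univ, Fintype.card_fin, Nat.cast_add, Nat.cast_one]
          gcongr with i
          rw [mul_pow]
          exact mul_le_mul (abs_radauFun_le i g) (sq_le_sq' (abs_le.1 (he i)).1 (abs_le.1 (he i)).2)
            (sq_nonneg _) (le_trans (sq_nonneg _) (abs_radauFun_le i g))
      _ = (k + 1) * ((k + 1) * C ^ 2) * R := by simp; ring
  rw [radau_apply]
  constructor
  · simpa [Polynomial.eval_finsetSum] using key _ fun i => (hB i y hy).1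
  · simpa [Polynomial.eval_finsetSum, Polynomial.derivative_sum] using
      key _ fun i => (hB i y hy).2

/-! ### Inverse inequalities -/

/-- Expand p in the basis dual to the moments; by Cauchy–Schwarz each coefficient is at most the L²
norm of p. -/
lemma exists_inverse_unit (k : ℕ) : ∃ C, 0 < C ∧ ∀ p : ℝ[X], p.natDegree ≤ k →
    ∀ y ∈ Icc (0 : ℝ) 1, p.eval y ^ 2 ≤ C * (∫ y in (0 : ℝ)..1, p.eval y ^ 2) ∧
    p.derivative.eval y ^ 2 ≤ C * ∫ y in (0 : ℝ)..1, p.eval y ^ 2 := by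
  obtain ⟨B, hB, hLB⟩ := exists_dualBasis (k + 1) (fun i => (moment i).comp polyC)
    fun p hp h => eq_zero_of_moments (k + 1) p hp h
  obtain ⟨C, hC, hbd⟩ := exists_bound_eval_family B
  refine ⟨(k + 1) * ((k + 1) * C ^ 2), by positivity, fun p hp y hy => ?_⟩
  have hp' := eq_sum_dualBasis (fun p hp h => eq_zero_of_moments (k + 1) p hp h) hB hLB
    (mem_degreeLT_iff_natDegree.2 hp)
  set R := ∫ y in (0 : ℝ)..1, p.eval y ^ 2 with hR
  have hR0 : 0 ≤ R := intervalIntegral.integral_nonneg zero_le_one fun _ _ => sq_nonneg _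
  have hmom : ∀ i : ℕ, (moment i (polyC p)) ^ 2 ≤ R := by
    intro i
    rw [moment_apply]
    have h1 := sq_integral_mul_le zero_le_one (polyC p) (polyC (Polynomial.X ^ i))
    have h2 : ∫ y in (0 : ℝ)..1, (polyC (Polynomial.X ^ i) y) ^ 2 ≤ 1 := by
      have : ∫ y in (0 : ℝ)..1, (polyC (Polynomial.X ^ i) y) ^ 2 = 1 / (2 * i + 1) := by
        simp [← pow_mul]
        ring
      rw [this, div_le_one (by positivity)]
      linarith [(Nat.cast_nonneg i : (0 : ℝ) ≤ i)]
    simp only [polyC_apply, Polynomial.eval_pow, Polynomial.eval_X] at h1 h2 ⊢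
    nlinarith
  have key : ∀ e : Fin (k + 1) → ℝ, (∀ i, |e i| ≤ C) →
      (∑ i : Fin (k + 1), moment i (polyC p) * e i) ^ 2 ≤ (k + 1) * ((k + 1) * C ^ 2) * R := by
    intro e he
    calc (∑ i : Fin (k + 1), moment i (polyC p) * e i) ^ 2
        ≤ (Finset.univ : Finset (Fin (k + 1))).card *
            ∑ i : Fin (k + 1), (moment i (polyC p) * e i) ^ 2 :=
          sq_sum_le_card_mul_sum_sq
      _ ≤ (k + 1) * ∑ i : Fin (k + 1), R * C ^ 2 := by
          simp only [Finset.card_univ, Fintype.card_fin, Nat.cast_add, Nat.cast_one]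
          gcongr with i
          rw [mul_pow]
          exact mul_le_mul (hmom i) (sq_le_sq' (abs_le.1 (he i)).1 (abs_le.1 (he i)).2)
            (sq_nonneg _) hR0
      _ = (k + 1) * ((k + 1) * C ^ 2) * R := by simp; ring
  have e1 : p.eval y = ∑ i : Fin (k + 1), moment i (polyC p) * (B i).eval y := by
    conv_lhs => rw [hp']
    simp [Polynomial.eval_finsetSum]
  have e2 : p.derivative.eval y =
      ∑ i : Fin (k + 1), moment i (polyC p) * (B i).derivative.eval y := by
    conv_lhs => rw [hp']
    simp [Polynomial.eval_finsetSum]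
  rw [e1, e2]
  exact ⟨key _ fun i => (hbd i y hy).1, key _ fun i => (hbd i y hy).2⟩

/-- Inverse inequalities on an arbitrary interval. -/
lemma exists_inverse (k : ℕ) : ∃ C, 0 < C ∧ ∀ p : ℝ[X], p.natDegree ≤ k → ∀ l r : ℝ, l < r →
    ∀ x ∈ Icc l r, (r - l) * p.eval x ^ 2 ≤ C * (∫ y in l..r, p.eval y ^ 2) ∧
    (r - l) ^ 3 * p.derivative.eval x ^ 2 ≤ C * ∫ y in l..r, p.eval y ^ 2 := by
  obtain ⟨C, hC, h⟩ := exists_inverse_unit k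
  refine ⟨C, hC, fun p hp l r hlr x hx => ?_⟩
  have hd : 0 < r - l := sub_pos.2 hlr
  set q := p.comp (Polynomial.C l + Polynomial.C (r - l) * Polynomial.X) with hq
  have hqd : q.natDegree ≤ k := by
    rw [hq]
    refine Polynomial.natDegree_comp_le.trans ?_
    have : (Polynomial.C l + Polynomial.C (r - l) * Polynomial.X).natDegree ≤ 1 := by
      rw [add_comm]
      exact Polynomial.natDegree_linear_le
    calc _ ≤ p.natDegree * 1 := Nat.mul_le_mul_left _ this
      _ ≤ k := by omega
  have hy : (x - l) / (r - l) ∈ Icc (0 : ℝ) 1 :=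
    ⟨div_nonneg (by linarith [hx.1]) hd.le, (div_le_one hd).2 (by linarith [hx.2])⟩
  have hxy : l + (r - l) * ((x - l) / (r - l)) = x := by field_simp; ring
  obtain ⟨h1, h2⟩ := h q hqd _ hy
  have hev : ∀ y, q.eval y = p.eval (l + (r - l) * y) := by intro y; simp [hq]
  have hdev : ∀ y, q.derivative.eval y = (r - l) * p.derivative.eval (l + (r - l) * y) := by
    intro y; simp [hq, Polynomial.derivative_comp]
  have hint : ∫ y in (0 : ℝ)..1, q.eval y ^ 2 = (r - l)⁻¹ * ∫ y in l..r, p.eval y ^ 2 := by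
    simp_rw [hev]
    rw [intervalIntegral.integral_comp_add_mul (fun y => p.eval y ^ 2) hd.ne']
    simp
  rw [hint, hev, hxy] at h1
  rw [hint, hdev, hxy] at h2
  constructor
  · calc (r - l) * p.eval x ^ 2 ≤ (r - l) * (C * ((r - l)⁻¹ * ∫ y in l..r, p.eval y ^ 2)) := by
          gcongr
      _ = _ := by field_simp
  · calc (r - l) ^ 3 * p.derivative.eval x ^ 2
        = (r - l) * ((r - l) * p.derivative.eval x) ^ 2 := by ring
      _ ≤ (r - l) * (C * ((r - l)⁻¹ * ∫ y in l..r, p.eval y ^ 2)) := by gcongr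
      _ = _ := by field_simp

end LDG

end

/-! ### Estimates on a single cell: scaled Radau projections and Taylor expansion. -/

noncomputable section

namespace LDG

open scoped Polynomial

/-! ### The Gauss–Radau projection on a cell -/

lemma derivative_mem_degreeLT {k : ℕ} {p : ℝ[X]} (hp : p.natDegree ≤ k) :
    p.derivative ∈ Polynomial.degreeLT ℝ k := by
  rw [Polynomial.mem_degreeLT]
  by_cases h : p = 0
  · simp [h]
  · refine (Polynomial.degree_derivative_lt h).trans_le ?_
    exact Polynomial.natDegree_le_iff_degree_le.1 hp

/-- The affine map `y ↦ x₀ + H y`. -/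
def affineC (x₀ H : ℝ) : C(ℝ, ℝ) := ⟨fun y => x₀ + H * y, by fun_prop⟩

@[simp] lemma affineC_apply (x₀ H y : ℝ) : affineC x₀ H y = x₀ + H * y := rfl

/-- The Gauss–Radau projection onto polynomials of degree at most `k` on the segment from `x₀` to
`x₀ + H`, interpolating at `x₀`. -/
def cellRadau (k : ℕ) (x₀ H : ℝ) : C(ℝ, ℝ) →ₗ[ℝ] ℝ[X] where
  toFun g := (radau k (g.comp (affineC x₀ H))).comp
    (Polynomial.C H⁻¹ * (Polynomial.X - Polynomial.C x₀))
  map_add' f g := by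
    rw [ContinuousMap.add_comp, map_add, Polynomial.add_comp]
  map_smul' c g := by
    rw [ContinuousMap.smul_comp, map_smul, Polynomial.smul_comp, RingHom.id_apply]

lemma cellRadau_apply (k : ℕ) (x₀ H : ℝ) (g : C(ℝ, ℝ)) : cellRadau k x₀ H g =
    (radau k (g.comp (affineC x₀ H))).comp
      (Polynomial.C H⁻¹ * (Polynomial.X - Polynomial.C x₀)) := rfl

lemma natDegree_comp_affine_le {p : ℝ[X]} {k : ℕ} (hp : p.natDegree ≤ k) (a b : ℝ) :
    (p.comp (Polynomial.C a + Polynomial.C b * Polynomial.X)).natDegree ≤ k := by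
  refine Polynomial.natDegree_comp_le.trans ?_
  have : (Polynomial.C a + Polynomial.C b * Polynomial.X).natDegree ≤ 1 := by
    rw [add_comm]
    exact Polynomial.natDegree_linear_le
  calc _ ≤ p.natDegree * 1 := Nat.mul_le_mul_left _ this
    _ ≤ k := by omega

lemma degree_comp_affine_lt {p : ℝ[X]} {k : ℕ} (hp : p ∈ Polynomial.degreeLT ℝ k) (a b : ℝ) :
    p.comp (Polynomial.C a + Polynomial.C b * Polynomial.X) ∈ Polynomial.degreeLT ℝ k := by
  cases k with
  | zero =>
    have : p = 0 := by
      rw [Polynomial.mem_degreeLT] at hp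
      simpa using hp
    simp [this]
  | succ k =>
    rw [mem_degreeLT_iff_natDegree] at hp ⊢
    exact natDegree_comp_affine_le hp a b

lemma cellRadau_natDegree (k : ℕ) (x₀ H : ℝ) (g : C(ℝ, ℝ)) :
    (cellRadau k x₀ H g).natDegree ≤ k := by
  have : Polynomial.C H⁻¹ * (Polynomial.X - Polynomial.C x₀) =
      Polynomial.C (-(H⁻¹ * x₀)) + Polynomial.C H⁻¹ * Polynomial.X := by
    simp only [Polynomial.C_neg, Polynomial.C_mul]
    ring
  rw [cellRadau_apply, this]
  exact natDegree_comp_affine_le (mem_degreeLT_iff_natDegree.1 (radau_mem _ _)) _ _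

lemma cellRadau_eval (k : ℕ) {x₀ H : ℝ} (hH : H ≠ 0) (g : C(ℝ, ℝ)) (y : ℝ) :
    (cellRadau k x₀ H g).eval (x₀ + H * y) = (radau k (g.comp (affineC x₀ H))).eval y := by
  rw [cellRadau_apply, Polynomial.eval_comp]
  congr 1
  simp [hH]

lemma cellRadau_derivative_eval (k : ℕ) {x₀ H : ℝ} (hH : H ≠ 0) (g : C(ℝ, ℝ)) (y : ℝ) :
    H * (cellRadau k x₀ H g).derivative.eval (x₀ + H * y) =
      (radau k (g.comp (affineC x₀ H))).derivative.eval y := by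
  rw [cellRadau_apply, Polynomial.derivative_comp, Polynomial.eval_mul, Polynomial.eval_comp]
  simp [hH]

lemma cellRadau_eval_base (k : ℕ) {x₀ H : ℝ} (hH : H ≠ 0) (g : C(ℝ, ℝ)) :
    (cellRadau k x₀ H g).eval x₀ = g x₀ := by
  have := cellRadau_eval k hH g 0 (x₀ := x₀)
  rw [mul_zero, add_zero] at this
  rw [this, radau_eval_zero]
  simp

lemma cellRadau_orth {k : ℕ} {x₀ H : ℝ} (hH : H ≠ 0) (g : C(ℝ, ℝ)) {p : ℝ[X]}
    (hp : p ∈ Polynomial.degreeLT ℝ k) :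
    ∫ x in x₀..x₀ + H, (cellRadau k x₀ H g).eval x * p.eval x =
      ∫ x in x₀..x₀ + H, g x * p.eval x := by
  have key : ∀ f : ℝ → ℝ, ∫ x in x₀..x₀ + H, f x = H * ∫ y in (0 : ℝ)..1, f (x₀ + H * y) := by
    intro f
    rw [intervalIntegral.integral_comp_add_mul f hH]
    simp [hH]
  rw [key, key]
  congr 1
  have := radau_orth (g.comp (affineC x₀ H)) (degree_comp_affine_lt hp x₀ H)
  simp only [Polynomial.eval_comp, Polynomial.eval_add, Polynomial.eval_mul, Polynomial.eval_C,
    Polynomial.eval_X, ContinuousMap.comp_apply, affineC_apply] at this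
  simp_rw [cellRadau_eval k hH]
  exact this

lemma cellRadau_polyC {k : ℕ} {x₀ H : ℝ} (hH : H ≠ 0) {p : ℝ[X]} (hp : p.natDegree ≤ k) :
    cellRadau k x₀ H (polyC p) = p := by
  have h1 : (polyC p).comp (affineC x₀ H) =
      polyC (p.comp (Polynomial.C x₀ + Polynomial.C H * Polynomial.X)) := by
    ext y
    simp
  rw [cellRadau_apply, h1, radau_polyC (mem_degreeLT_iff_natDegree.2
    (natDegree_comp_affine_le hp _ _)), Polynomial.comp_assoc]
  have : (Polynomial.C x₀ + Polynomial.C H * Polynomial.X).comp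
      (Polynomial.C H⁻¹ * (Polynomial.X - Polynomial.C x₀)) = Polynomial.X := by
    simp only [Polynomial.add_comp, Polynomial.C_comp, Polynomial.mul_comp, Polynomial.X_comp]
    rw [← mul_assoc, ← Polynomial.C_mul, mul_inv_cancel₀ hH]
    simp
  rw [this, Polynomial.comp_X]

/-- Stability of the Gauss–Radau projection with respect to the maximum norm. -/
lemma exists_cellRadau_sup (k : ℕ) : ∃ C, 1 ≤ C ∧ ∀ (x₀ H : ℝ) (g : C(ℝ, ℝ)) (A : ℝ), H ≠ 0 →
    (∀ y ∈ Icc (0 : ℝ) 1, |g (x₀ + H * y)| ≤ A) → ∀ y ∈ Icc (0 : ℝ) 1,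
      |(cellRadau k x₀ H g).eval (x₀ + H * y)| ≤ C * A ∧
      |H| * |(cellRadau k x₀ H g).derivative.eval (x₀ + H * y)| ≤ C * A := by
  obtain ⟨C, hC, h⟩ := exists_radau_bound k
  -- The estimate for squares carries the factor 2C, and 2C ≤ (1 + 2C)² avoids a square root.
  refine ⟨1 + C * 2, by linarith, fun x₀ H g A hH hA y hy => ?_⟩
  have hA0 : 0 ≤ A := (abs_nonneg _).trans (hA 0 (by simp))
  have h2 : (g.comp (affineC x₀ H)) 0 ^ 2 + ∫ y in (0 : ℝ)..1, (g.comp (affineC x₀ H)) y ^ 2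
      ≤ 2 * A ^ 2 := by
    have e1 : (g.comp (affineC x₀ H)) 0 ^ 2 ≤ A ^ 2 :=
      sq_le_sq' (abs_le.1 (hA 0 (by simp))).1 (abs_le.1 (hA 0 (by simp))).2
    have e2 : ∫ y in (0 : ℝ)..1, (g.comp (affineC x₀ H)) y ^ 2 ≤ ∫ y in (0 : ℝ)..1, A ^ 2 := by
      apply intervalIntegral.integral_mono_on zero_le_one
      · exact Continuous.intervalIntegrable (by fun_prop) _ _
      · exact Continuous.intervalIntegrable (by fun_prop) _ _
      · intro y hy
        exact sq_le_sq' (abs_le.1 (hA y hy)).1 (abs_le.1 (hA y hy)).2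
    simp only [intervalIntegral.integral_const, sub_zero, one_smul] at e2
    linarith
  have key : ∀ z : ℝ, z ^ 2 ≤ C * (2 * A ^ 2) → |z| ≤ (1 + C * 2) * A := by
    intro z hz
    apply abs_le_of_sq_le_sq _ (by positivity)
    nlinarith [sq_nonneg A, mul_nonneg hC.le (sq_nonneg A), mul_nonneg hC.le hC.le,
      mul_nonneg (mul_nonneg hC.le hC.le) (sq_nonneg A)]
  obtain ⟨h3, h4⟩ := h (g.comp (affineC x₀ H)) y hy
  rw [← abs_mul, cellRadau_eval k hH, cellRadau_derivative_eval k hH]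
  exact ⟨key _ (h3.trans (mul_le_mul_of_nonneg_left h2 hC.le)),
    key _ (h4.trans (mul_le_mul_of_nonneg_left h2 hC.le))⟩

/-- The error of the Gauss–Radau projection is bounded by the error of any polynomial. -/
lemma exists_cellRadau_error (k : ℕ) : ∃ C, 1 ≤ C ∧ ∀ (x₀ H : ℝ) (g : C(ℝ, ℝ)) (p : ℝ[X]) (A : ℝ),
    H ≠ 0 → p.natDegree ≤ k → (∀ y ∈ Icc (0 : ℝ) 1, |g (x₀ + H * y) - p.eval (x₀ + H * y)| ≤ A) →
    ∀ y ∈ Icc (0 : ℝ) 1, |(cellRadau k x₀ H g).eval (x₀ + H * y) - g (x₀ + H * y)| ≤ C * A := by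
  obtain ⟨C, hC, h⟩ := exists_cellRadau_sup k
  refine ⟨C + 1, by linarith, fun x₀ H g p A hH hp hA y hy => ?_⟩
  -- The projection reproduces p, so its error for g is its error for g - p, and stability suffices.
  have h1 := (h x₀ H (g - polyC p) A hH hA y hy).1
  rw [map_sub, cellRadau_polyC hH hp, Polynomial.eval_sub] at h1
  have h2 := hA y hy
  rw [abs_le] at h1 h2 ⊢
  constructor <;> linarith

/-- `L²`-stability of the left Gauss–Radau projection for functions with an increasing majorant. -/
lemma exists_cellRadau_l2 (k : ℕ) : ∃ C, 1 ≤ C ∧ ∀ (l r : ℝ) (g G : C(ℝ, ℝ)), l < r →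
    MonotoneOn G (Icc l r) → (∀ x ∈ Icc l r, |g x| ≤ G x) →
    ∫ x in l..r, (cellRadau k l (r - l) g).eval x ^ 2 ≤ C * ∫ x in l..r, G x ^ 2 := by
  obtain ⟨C, hC, h⟩ := exists_radau_bound k
  refine ⟨1 + C * 2, by linarith, fun l r g G hlr hmono hg => ?_⟩
  have hd : 0 < r - l := sub_pos.2 hlr
  have key : ∀ f : ℝ → ℝ, ∫ x in l..r, f x = (r - l) * ∫ y in (0 : ℝ)..1, f (l + (r - l) * y) := by
    intro f
    rw [intervalIntegral.integral_comp_add_mul f hd.ne']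
    simp [hd.ne']
  have hmem : ∀ y ∈ Icc (0 : ℝ) 1, l + (r - l) * y ∈ Icc l r := fun y hy =>
    ⟨by nlinarith [hy.1], by nlinarith [hy.2]⟩
  have hG0 : ∀ x ∈ Icc l r, 0 ≤ G x := fun x hx => (abs_nonneg _).trans (hg x hx)
  -- The interpolation point is where the increasing majorant is smallest, so the point value is
  -- bounded by a mean value. This is why a layer at the right is compatible in L² with
  -- interpolation at the left.
  have e0 : G l ^ 2 ≤ ∫ y in (0 : ℝ)..1, G (l + (r - l) * y) ^ 2 := by
    calc G l ^ 2 = ∫ y in (0 : ℝ)..1, G l ^ 2 := by simp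
      _ ≤ _ := by
        apply intervalIntegral.integral_mono_on zero_le_one
        · exact Continuous.intervalIntegrable (by fun_prop) _ _
        · exact Continuous.intervalIntegrable (by fun_prop) _ _
        · intro y hy
          have hl : l ∈ Icc l r := left_mem_Icc.2 hlr.le
          exact pow_le_pow_left₀ (hG0 l hl) (hmono hl (hmem y hy) (hmem y hy).1) 2
  have e1 : ∫ y in (0 : ℝ)..1, (g.comp (affineC l (r - l))) y ^ 2
      ≤ ∫ y in (0 : ℝ)..1, G (l + (r - l) * y) ^ 2 := by
    apply intervalIntegral.integral_mono_on zero_le_one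
    · exact Continuous.intervalIntegrable (by fun_prop) _ _
    · exact Continuous.intervalIntegrable (by fun_prop) _ _
    · intro y hy
      have := hg _ (hmem y hy)
      exact sq_le_sq' (abs_le.1 this).1 (abs_le.1 this).2
  have e2 : (g.comp (affineC l (r - l))) 0 ^ 2 ≤ G l ^ 2 := by
    have := hg l (left_mem_Icc.2 hlr.le)
    simp only [ContinuousMap.comp_apply, affineC_apply, mul_zero, add_zero]
    exact sq_le_sq' (abs_le.1 this).1 (abs_le.1 this).2
  set J := ∫ y in (0 : ℝ)..1, G (l + (r - l) * y) ^ 2 with hJ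
  have hJ0 : 0 ≤ J := (sq_nonneg _).trans e0
  rw [key, key (fun x => G x ^ 2), ← hJ]
  have e3 : ∫ y in (0 : ℝ)..1, (cellRadau k l (r - l) g).eval (l + (r - l) * y) ^ 2
      ≤ ∫ y in (0 : ℝ)..1, C * (2 * J) := by
    apply intervalIntegral.integral_mono_on zero_le_one
    · exact Continuous.intervalIntegrable (by fun_prop) _ _
    · exact Continuous.intervalIntegrable (by fun_prop) _ _
    · intro y hy
      rw [cellRadau_eval k hd.ne']
      refine ((h _ y hy).1).trans (mul_le_mul_of_nonneg_left ?_ hC.le)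
      linarith
  simp only [intervalIntegral.integral_const, sub_zero, one_smul] at e3
  calc _ ≤ (r - l) * (C * (2 * J)) := mul_le_mul_of_nonneg_left e3 hd.le
    _ ≤ (1 + C * 2) * ((r - l) * J) := by nlinarith [mul_nonneg hd.le hJ0]

/-! ### Taylor remainders -/

/-- A Taylor estimate for a sequence of successive derivatives. -/
lemma abs_taylor_remainder_le {c d : ℝ} (n : ℕ) : ∀ (W : ℕ → ℝ → ℝ) (A : ℝ),
    (∀ i, ContinuousOn (W i) (Icc c d)) →
    (∀ i, ∀ x ∈ Ioo c d, HasDerivAt (W i) (W (i + 1) x) x) →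
    ∀ x₀ ∈ Icc c d, ∀ x ∈ Icc c d, (∀ y ∈ uIcc x₀ x, |W n y| ≤ A) →
    |W 0 x - ∑ i ∈ Finset.range n, W i x₀ / (i.factorial : ℝ) * (x - x₀) ^ i|
      ≤ A * |x - x₀| ^ n := by
  induction n with
  | zero =>
    intro W A _ _ x₀ _ x _ hA
    simpa using hA x right_mem_uIcc
  | succ n ih =>
    intro W A hc hd x₀ hx₀ x hx hA
    -- F is the remainder and F' the remainder of one order less for the shifted sequence. Since the
    -- bound omits the factor 1/n!, the mean value theorem suffices for the induction.
    set F : ℝ → ℝ := fun x => W 0 x -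
      ∑ i ∈ Finset.range (n + 1), W i x₀ / (i.factorial : ℝ) * (x - x₀) ^ i with hF
    set F' : ℝ → ℝ := fun x => W 1 x -
      ∑ i ∈ Finset.range n, W (i + 1) x₀ / (i.factorial : ℝ) * (x - x₀) ^ i with hF'
    have hA0 : 0 ≤ A := (abs_nonneg _).trans (hA x right_mem_uIcc)
    have hFx₀ : F x₀ = 0 := by
      simp [hF, Finset.sum_range_succ']
    have hFc : ContinuousOn F (Icc c d) := (hc 0).sub (by fun_prop)
    have hFd : ∀ y ∈ Ioo c d, HasDerivAt F (F' y) y := by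
      intro y hy
      apply (hd 0 y hy).sub
      have h1 : ∀ i ∈ Finset.range n, HasDerivAt
          (fun x => W (i + 1) x₀ / ((i + 1).factorial : ℝ) * (x - x₀) ^ (i + 1))
          (W (i + 1) x₀ / (i.factorial : ℝ) * (y - x₀) ^ i) y := by
        intro i _
        have h2 := (((hasDerivAt_id y).sub_const x₀).pow (i + 1)).const_mul
          (W (i + 1) x₀ / ((i + 1).factorial : ℝ))
        refine h2.congr_deriv ?_
        rw [Nat.factorial_succ]
        push_cast
        have : (i.factorial : ℝ) ≠ 0 := by positivity
        have : (i : ℝ) + 1 ≠ 0 := by positivity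
        simp only [id]
        field_simp
      have h2 := (HasDerivAt.fun_sum h1).add_const (W 0 x₀ / ((0).factorial : ℝ) * 1)
      simpa [Finset.sum_range_succ'] using h2
    have hsub : uIcc x₀ x ⊆ Icc c d := fun y hy => by
      rcases le_total x₀ x with h | h
      · rw [uIcc_of_le h] at hy; exact ⟨hx₀.1.trans hy.1, hy.2.trans hx.2⟩
      · rw [uIcc_of_ge h] at hy; exact ⟨hx.1.trans hy.1, hy.2.trans hx₀.2⟩
    have hbd : ∀ y ∈ uIcc x₀ x, |F' y| ≤ A * |x - x₀| ^ n := by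
      intro y hy
      have h1 : uIcc x₀ y ⊆ uIcc x₀ x := uIcc_subset_uIcc left_mem_uIcc hy
      refine (ih (fun i => W (i + 1)) A (fun i => hc _) (fun i => hd _) x₀ hx₀ y (hsub hy)
        fun z hz => hA z (h1 hz)).trans ?_
      apply mul_le_mul_of_nonneg_left _ hA0
      apply pow_le_pow_left₀ (abs_nonneg _)
      exact abs_sub_left_of_mem_uIcc hy
    have hmain : |F x - F x₀| ≤ A * |x - x₀| ^ n * |x - x₀| := by
      rcases lt_trichotomy x₀ x with h | h | h
      · obtain ⟨z, hz, hz'⟩ := exists_hasDerivAt_eq_slope F F' h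
          (hFc.mono (Icc_subset_Icc hx₀.1 hx.2))
          (fun y hy => hFd y ⟨hx₀.1.trans_lt hy.1, hy.2.trans_le hx.2⟩)
        have h1 : F x - F x₀ = F' z * (x - x₀) := by
          rw [hz']; field_simp [(sub_pos.2 h).ne']
        rw [h1, abs_mul]
        exact mul_le_mul_of_nonneg_right (hbd z (by
          rw [uIcc_of_le h.le]; exact Ioo_subset_Icc_self hz)) (abs_nonneg _)
      · simp [h]
      · obtain ⟨z, hz, hz'⟩ := exists_hasDerivAt_eq_slope F F' h
          (hFc.mono (Icc_subset_Icc hx.1 hx₀.2))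
          (fun y hy => hFd y ⟨hx.1.trans_lt hy.1, hy.2.trans_le hx₀.2⟩)
        have h1 : F x - F x₀ = F' z * (x - x₀) := by
          rw [hz']; field_simp [(sub_pos.2 h).ne']; ring
        rw [h1, abs_mul]
        exact mul_le_mul_of_nonneg_right (hbd z (by
          rw [uIcc_of_ge h.le]; exact Ioo_subset_Icc_self hz)) (abs_nonneg _)
    rw [hFx₀, sub_zero] at hmain
    rw [pow_succ, ← mul_assoc]
    exact hmain

end LDG

end

noncomputable section

namespace LDG

/-! ### Layer-adapted meshes -/

/-- The layer function `e^{-α(1-x)/(σε)}`. -/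
def layerFn (α σ ε : ℝ) : C(ℝ, ℝ) := ⟨fun x => Real.exp (-(α / (σ * ε)) * (1 - x)), by fun_prop⟩

lemma layerFn_apply (α σ ε x : ℝ) :
    layerFn α σ ε x = Real.exp (-(α / (σ * ε)) * (1 - x)) := rfl

/-- The relative resolution of the layer on the cell with index `j`. -/
def cellRes (α σ ε : ℝ) (X : ℕ → ℝ) (j : ℕ) : ℝ :=
  min 1 ((X (j + 1) - X j) / ε) * layerFn α σ ε (X (j + 1))

/-- The properties of the mesh `0 = X 0 < … < X (n+1) = 1` used in the error analysis. -/
structure IsLayerMesh (α σ ε ϖ Cm : ℝ) (n : ℕ) (X : ℕ → ℝ) : Prop where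
  zero : X 0 = 0
  one : X (n + 1) = 1
  lt : ∀ j ≤ n, X j < X (j + 1)
  width : ∀ j ≤ n, X (j + 1) - X j ≤ Cm * ϖ
  res : ∀ j ≤ n, cellRes α σ ε X j ≤ Cm * ϖ
  sum_res : ∑ j ∈ Finset.range (n + 1), cellRes α σ ε X j ≤ Cm

/-- From 1 + y ≤ e^y one gets 1 - e^{-y} ≥ y/(1+y) ≥ min(1, y)/2. This turns a relative cell width
into a difference of consecutive values of the layer function, so that the resolutions telescope. -/
lemma min_one_le_two_mul_one_sub_exp {y : ℝ} (hy : 0 ≤ y) :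
    min 1 y ≤ 2 * (1 - Real.exp (-y)) := by
  have h1 : Real.exp (-y) * (1 + y) ≤ 1 := by
    have := Real.add_one_le_exp y
    calc Real.exp (-y) * (1 + y) ≤ Real.exp (-y) * Real.exp y := by gcongr; linarith
      _ = 1 := by rw [← Real.exp_add]; simp
  have h2 := Real.exp_pos (-y)
  rcases le_total 1 y with h | h
  · rw [min_eq_left h]; nlinarith
  · rw [min_eq_right h]; nlinarith

/-! ### Properties of φ and of ψ = e^{-φ}. -/

section MeshFunction

variable {ε : ℝ} {N : ℕ} {φ : ℝ → ℝ}

lemma IsMeshFunction.hasDerivWithinAt (h : IsMeshFunction ε N φ) {t : ℝ}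
    (ht : t ∈ Icc (0 : ℝ) (1 / 2)) :
    HasDerivWithinAt φ (derivWithin φ (Icc 0 (1 / 2)) t) (Icc 0 (1 / 2)) t :=
  ((h.contDiffOn.differentiableOn (by norm_num)) t ht).hasDerivWithinAt

lemma IsMeshFunction.strictMonoOn (h : IsMeshFunction ε N φ) :
    StrictMonoOn φ (Icc 0 (1 / 2)) := by
  apply strictMonoOn_of_deriv_pos (convex_Icc _ _) h.contDiffOn.continuousOn
  intro x hx
  rw [interior_Icc] at hx
  rw [← derivWithin_of_mem_nhds (Icc_mem_nhds hx.1 hx.2)]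
  exact h.deriv_pos x (Ioo_subset_Icc_self hx)

lemma IsMeshFunction.nonneg (h : IsMeshFunction ε N φ) {t : ℝ} (ht : t ∈ Icc (0 : ℝ) (1 / 2)) :
    0 ≤ φ t := by
  rw [← h.zero]
  exact h.strictMonoOn.monotoneOn (by norm_num) ht ht.1

/-- The mean value inequality for ψ. Continuity of ψ' on the compact interval is needed to make the
supremum in `maxPsi'` a genuine bound. -/
lemma IsMeshFunction.abs_exp_sub_le (h : IsMeshFunction ε N φ) {s t : ℝ}
    (hs : s ∈ Icc (0 : ℝ) (1 / 2)) (ht : t ∈ Icc (0 : ℝ) (1 / 2)) :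
    |Real.exp (-φ t) - Real.exp (-φ s)| ≤ maxPsi' φ * |t - s| := by
  have hd : ∀ x ∈ Icc (0 : ℝ) (1 / 2), HasDerivWithinAt (fun s => Real.exp (-φ s))
      (derivWithin (fun s => Real.exp (-φ s)) (Icc 0 (1 / 2)) x) (Icc 0 (1 / 2)) x := fun x hx =>
    ((h.hasDerivWithinAt hx).neg.exp).differentiableWithinAt.hasDerivWithinAt
  have hcd : ContDiffOn ℝ 2 (fun s => Real.exp (-φ s)) (Icc 0 (1 / 2)) := h.contDiffOn.neg.exp
  have hcont : ContinuousOn (fun t => |derivWithin (fun s => Real.exp (-φ s)) (Icc 0 (1 / 2)) t|)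
      (Icc 0 (1 / 2)) :=
    (hcd.continuousOn_derivWithin (uniqueDiffOn_Icc (by norm_num)) (by norm_num)).abs
  have hbdd : BddAbove ((fun t => |derivWithin (fun s => Real.exp (-φ s)) (Icc 0 (1 / 2)) t|) ''
      Icc (0 : ℝ) (1 / 2)) := (isCompact_Icc.image_of_continuousOn hcont).bddAbove
  have := (convex_Icc (0 : ℝ) (1 / 2)).norm_image_sub_le_of_norm_hasDerivWithin_le hd
    (C := maxPsi' φ) (fun x hx => le_csSup hbdd ⟨x, hx, rfl⟩) hs ht
  simpa using this

/-- The two mesh types are treated alike through these inequalities: ψ(1/2) equals one of ε and 1/N,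
and ε ≤ 1/N. The upper bound makes the layer negligible on the coarse cells; the lower bound
controls the widths of the fine cells. -/
lemma IsMeshFunction.exp_half (h : IsMeshFunction ε N φ) (hε : 0 < ε) (hN : 2 ≤ N)
    (hεN : ε ≤ 1 / (N : ℝ)) :
    Real.exp (-φ (1 / 2)) ≤ 1 / N ∧ ε ≤ Real.exp (-φ (1 / 2)) := by
  have hN0 : (0 : ℝ) < N := by positivity
  rcases h.type with h1 | h1
  · rw [h1, Real.exp_neg, Real.exp_log hN0, ← one_div]
    exact ⟨le_rfl, hεN⟩
  · rw [h1, Real.exp_neg, Real.exp_log (by positivity), ← one_div, one_div_one_div]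
    exact ⟨hεN, le_rfl⟩

/-- ψ falls from 1 to at most 1/2 over an interval of length 1/2. Consequently N⁻¹ is dominated by
N⁻¹ max|ψ'|. -/
lemma IsMeshFunction.one_le_maxPsi' (h : IsMeshFunction ε N φ) (hε : 0 < ε) (hN : 2 ≤ N)
    (hεN : ε ≤ 1 / (N : ℝ)) : 1 ≤ maxPsi' φ := by
  have h1 := h.abs_exp_sub_le (s := 1 / 2) (t := 0) (by norm_num) (by norm_num)
  have h2 := (h.exp_half hε hN hεN).1
  have h3 : 1 / (N : ℝ) ≤ 1 / 2 := one_div_le_one_div_of_le two_pos (by exact_mod_cast hN)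
  rw [h.zero, neg_zero, Real.exp_zero] at h1
  have h4 := (le_abs_self _).trans h1
  norm_num at h4
  linarith

end MeshFunction

/-! ### The layer function on the generated mesh. -/

section

variable {α σ ε : ℝ} {N : ℕ} {φ : ℝ → ℝ}

lemma layerFn_le_one (hα : 0 < α) (hσ : 0 < σ) (hε : 0 < ε) {x : ℝ} (hx : x ≤ 1) :
    layerFn α σ ε x ≤ 1 := by
  rw [layerFn_apply, Real.exp_le_one_iff]
  have : 0 < α / (σ * ε) := by positivity
  nlinarith

lemma layerFn_mono (hα : 0 < α) (hσ : 0 < σ) (hε : 0 < ε) : Monotone (layerFn α σ ε) := by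
  intro x y hxy
  rw [layerFn_apply, layerFn_apply]
  have : 0 < α / (σ * ε) := by positivity
  apply Real.exp_le_exp.2
  nlinarith

lemma layerFn_pos (α σ ε x : ℝ) : 0 < layerFn α σ ε x := Real.exp_pos _

lemma cellRes_nonneg (hε : 0 < ε) {X : ℕ → ℝ} {j : ℕ} (h : X j ≤ X (j + 1)) :
    0 ≤ cellRes α σ ε X j :=
  mul_nonneg (le_min zero_le_one (div_nonneg (sub_nonneg.2 h) hε.le)) (layerFn_pos _ _ _ _).le

lemma cellRes_le_one (hα : 0 < α) (hσ : 0 < σ) (hε : 0 < ε) {X : ℕ → ℝ} {j : ℕ}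
    (h : X (j + 1) ≤ 1) : cellRes α σ ε X j ≤ 1 := by
  have := layerFn_le_one hα hσ hε h
  have := (layerFn_pos α σ ε (X (j + 1))).le
  calc cellRes α σ ε X j ≤ 1 * layerFn α σ ε (X (j + 1)) := by
        unfold cellRes; gcongr; exact min_le_left _ _
    _ ≤ 1 := by linarith

lemma meshPt_coarse (hN : 2 ≤ N) (hτ : σ * ε / α * φ (1 / 2) ≤ 1 / 2) {i : ℕ} (hi : 2 * i ≤ N) :
    meshPt σ α ε φ N i = 2 * (1 - σ * ε / α * φ (1 / 2)) * ((i : ℝ) / N) := by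
  have hN0 : (0 : ℝ) < N := by positivity
  have : (i : ℝ) / N ≤ 1 / 2 := by
    rw [div_le_div_iff₀ hN0 two_pos]
    have : (2 * i : ℝ) ≤ N := by exact_mod_cast hi
    linarith
  rw [meshPt, if_pos this, tau, min_eq_right hτ]

lemma meshPt_fine (hN : 2 ≤ N) (hτ : σ * ε / α * φ (1 / 2) ≤ 1 / 2) {i : ℕ} (hi : N ≤ 2 * i) :
    meshPt σ α ε φ N i = 1 - σ * ε / α * φ (1 - (i : ℝ) / N) := by
  have hN0 : (0 : ℝ) < N := by positivity
  have hi' : (N : ℝ) ≤ 2 * i := by exact_mod_cast hi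
  rcases hi.eq_or_lt with h | h
  -- At the transition point `meshPt` takes the coarse branch, whose value agrees with the fine
  -- formula.
  · have : (i : ℝ) / N = 1 / 2 := by
      rw [div_eq_div_iff hN0.ne' two_ne_zero]
      have : (N : ℝ) = 2 * i := by exact_mod_cast h
      linarith
    rw [meshPt_coarse hN hτ (by omega), this, show (1 : ℝ) - 1 / 2 = 1 / 2 by norm_num]
    ring
  · have : ¬ (i : ℝ) / N ≤ 1 / 2 := by
      rw [not_le, div_lt_div_iff₀ two_pos hN0]
      have : (N : ℝ) < 2 * i := by exact_mod_cast h
      linarith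
    rw [meshPt, if_neg this]

/-- The generated meshes have the properties used in the error analysis. -/
lemma isLayerMesh_meshPt (hα : 0 < α) (hσ : 0 < σ) (hε : 0 < ε) {n : ℕ} (hN : 2 ≤ n + 1)
    (hNe : Even (n + 1)) (hεN : ε ≤ 1 / ((n + 1 : ℕ) : ℝ)) (hφ : IsMeshFunction ε (n + 1) φ)
    (hτ : σ * ε / α * φ (1 / 2) ≤ 1 / 2) :
    IsLayerMesh α σ ε (min 1 (((n + 1 : ℕ) : ℝ)⁻¹ * maxPsi' φ)) (2 * max 1 (σ / α) + 1) n
      (meshPt σ α ε φ (n + 1)) := by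
  set N := n + 1 with hNdef
  have hN0 : (0 : ℝ) < N := by positivity
  obtain ⟨h1, h2⟩ := hφ.exp_half hε hN hεN
  have hM := hφ.one_le_maxPsi' hε hN hεN
  set ϖ := (N : ℝ)⁻¹ * maxPsi' φ with hϖ
  set c := max 1 (σ / α) with hc
  have hc1 : 1 ≤ c := le_max_left _ _
  have hc2 : σ / α ≤ c := le_max_right _ _
  have hNϖ : (N : ℝ)⁻¹ ≤ ϖ := by
    rw [hϖ]; nlinarith [inv_pos.2 hN0]
  have hφ0 := hφ.nonneg (t := 1 / 2) (by norm_num)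
  have hτ0 : 0 ≤ σ * ε / α * φ (1 / 2) := by positivity
  set X := meshPt σ α ε φ N with hX
  set e := layerFn α σ ε with he
  -- the fine part of the mesh
  have fine : ∀ j, N ≤ 2 * j → j < N → ∃ y, 0 < y ∧ X (j + 1) - X j = σ * ε / α * y ∧
      e (X j) = Real.exp (-y) * e (X (j + 1)) ∧ e (X (j + 1)) - e (X j) ≤ ϖ ∧ ε ≤ e (X j) ∧
      X (j + 1) ≤ 1 := by
    intro j hj hjN
    have hj' : (N : ℝ) ≤ 2 * j := by exact_mod_cast hj
    have hjN' : (j : ℝ) + 1 ≤ N := by exact_mod_cast hjN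
    have m1 : 1 - (j : ℝ) / N ∈ Icc (0 : ℝ) (1 / 2) := by
      constructor
      · have : (j : ℝ) / N ≤ 1 := (div_le_one hN0).2 (by linarith)
        linarith
      · have : 1 / 2 ≤ (j : ℝ) / N := by rw [div_le_div_iff₀ two_pos hN0]; linarith
        linarith
    have m2 : 1 - ((j + 1 : ℕ) : ℝ) / N ∈ Icc (0 : ℝ) (1 / 2) := by
      push_cast
      constructor
      · have : ((j : ℝ) + 1) / N ≤ 1 := (div_le_one hN0).2 (by linarith)
        linarith
      · have : 1 / 2 ≤ ((j : ℝ) + 1) / N := by rw [div_le_div_iff₀ two_pos hN0]; linarith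
        linarith
    have hdiff : (1 - (j : ℝ) / N) - (1 - ((j + 1 : ℕ) : ℝ) / N) = (N : ℝ)⁻¹ := by
      push_cast; field_simp; ring
    have hlt : φ (1 - ((j + 1 : ℕ) : ℝ) / N) < φ (1 - (j : ℝ) / N) :=
      hφ.strictMonoOn m2 m1 (by linarith [inv_pos.2 hN0])
    -- The exponent α/(σε) is chosen so that at the fine mesh points the layer function takes the
    -- values of ψ at equidistant points. Its increment over a cell is then at most N⁻¹ max|ψ'|.
    have eX : ∀ t, e (1 - σ * ε / α * t) = Real.exp (-t) := by
      intro t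
      rw [he, layerFn_apply]
      congr 1
      field_simp
      ring
    have hXj : X j = 1 - σ * ε / α * φ (1 - (j : ℝ) / N) := meshPt_fine hN hτ hj
    have hXj1 : X (j + 1) = 1 - σ * ε / α * φ (1 - ((j + 1 : ℕ) : ℝ) / N) :=
      meshPt_fine hN hτ (by omega)
    refine ⟨φ (1 - (j : ℝ) / N) - φ (1 - ((j + 1 : ℕ) : ℝ) / N), sub_pos.2 hlt, ?_, ?_, ?_, ?_, ?_⟩
    · rw [hXj, hXj1]; ring
    · rw [hXj, hXj1, eX, eX, ← Real.exp_add]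
      congr 1; ring
    · rw [hXj, hXj1, eX, eX]
      refine (le_abs_self _).trans ((hφ.abs_exp_sub_le m1 m2).trans ?_)
      rw [abs_sub_comm, hdiff, abs_of_pos (inv_pos.2 hN0), mul_comm]
    · rw [hXj, eX]
      refine h2.trans (Real.exp_le_exp.2 ?_)
      have := hφ.strictMonoOn.monotoneOn m1 (by norm_num : (1 / 2 : ℝ) ∈ Icc (0 : ℝ) (1 / 2)) m1.2
      linarith
    · rw [hXj1]
      have := hφ.nonneg m2
      have : 0 ≤ σ * ε / α * φ (1 - ((j + 1 : ℕ) : ℝ) / N) := by positivity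
      linarith
  -- the coarse part of the mesh
  have coarse : ∀ j, 2 * (j + 1) ≤ N → X (j + 1) - X j = 2 * (1 - σ * ε / α * φ (1 / 2)) / N ∧
      e (X (j + 1)) ≤ (N : ℝ)⁻¹ ∧ X (j + 1) ≤ 1 := by
    intro j hj
    have hj' : 2 * ((j : ℝ) + 1) ≤ N := by exact_mod_cast hj
    have hXj : X j = _ := meshPt_coarse hN hτ (by omega)
    have hXj1 : X (j + 1) = _ := meshPt_coarse hN hτ hj
    have hle : X (j + 1) ≤ 1 - σ * ε / α * φ (1 / 2) := by
      rw [hXj1]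
      push_cast
      have : 2 * (((j : ℝ) + 1) / N) ≤ 1 := by
        rw [← mul_div_assoc, div_le_one hN0]; exact hj'
      nlinarith
    refine ⟨?_, ?_, by linarith⟩
    · rw [hXj, hXj1]; push_cast; field_simp; ring
    · refine (layerFn_mono hα hσ hε hle).trans ?_
      rw [inv_eq_one_div]
      refine le_trans (le_of_eq ?_) h1
      rw [layerFn_apply]
      congr 1
      field_simp
      ring
  have split : ∀ j ≤ n, 2 * (j + 1) ≤ N ∨ (N ≤ 2 * j ∧ j < N) := by
    intro j hj
    obtain ⟨m, hm⟩ := hNe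
    omega
  have hlt : ∀ j ≤ n, X j < X (j + 1) := by
    intro j hj
    rw [← sub_pos]
    rcases split j hj with h | ⟨h, h'⟩
    · rw [(coarse j h).1]
      have : 0 < 1 - σ * ε / α * φ (1 / 2) := by linarith
      positivity
    · obtain ⟨y, hy, hy', -⟩ := fine j h h'
      rw [hy']; positivity
  have hle1 : ∀ j ≤ n, X (j + 1) ≤ 1 := by
    intro j hj
    rcases split j hj with h | ⟨h, h'⟩
    · exact (coarse j h).2.2
    · obtain ⟨y, -, -, -, -, -, h⟩ := fine j h h'
      exact h
  have hzero : X 0 = 0 := by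
    rw [hX, meshPt_coarse hN hτ (by omega)]; simp
  have hone : X (n + 1) = 1 := by
    rw [hX, meshPt_fine hN hτ (by omega)]
    simp [hN0.ne', ← hNdef, hφ.zero]
  have hnn : ∀ j ≤ n + 1, 0 ≤ X j := by
    intro j
    induction j with
    | zero => intro _; exact hzero.ge
    | succ j ih => intro hj; exact (ih (by omega)).trans (hlt j (by omega)).le
  -- the resolution on a fine cell
  have resFine : ∀ j, N ≤ 2 * j → j < N →
      cellRes α σ ε X j ≤ 2 * c * (e (X (j + 1)) - e (X j)) := by
    intro j h h'
    obtain ⟨y, hy, hXy, hey, -, -, -⟩ := fine j h h'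
    have hep : 0 < e (X (j + 1)) := layerFn_pos _ _ _ _
    have h3 : min 1 ((X (j + 1) - X j) / ε) ≤ c * min 1 y := by
      have : (X (j + 1) - X j) / ε = σ / α * y := by rw [hXy]; field_simp
      rw [this]
      rcases le_total 1 y with h4 | h4
      · rw [min_eq_left h4]
        exact (min_le_left _ _).trans (by linarith)
      · rw [min_eq_right h4]
        exact (min_le_right _ _).trans (by gcongr)
    -- With e(X j) = e^{-y} e(X (j+1)), the factor 1 - e^{-y} turns into the increment of the layer
    -- function over the cell.
    have h4 := min_one_le_two_mul_one_sub_exp hy.le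
    calc cellRes α σ ε X j ≤ (c * (2 * (1 - Real.exp (-y)))) * e (X (j + 1)) := by
          unfold cellRes
          apply mul_le_mul_of_nonneg_right _ hep.le
          exact h3.trans (mul_le_mul_of_nonneg_left h4 (by linarith))
      _ = _ := by rw [hey]; ring
  have resCoarse : ∀ j, 2 * (j + 1) ≤ N → cellRes α σ ε X j ≤ (N : ℝ)⁻¹ := by
    intro j h
    obtain ⟨-, h3, -⟩ := coarse j h
    calc cellRes α σ ε X j ≤ 1 * e (X (j + 1)) := by
          unfold cellRes
          exact mul_le_mul_of_nonneg_right (min_le_left _ _) (layerFn_pos _ _ _ _).le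
      _ ≤ _ := by rw [one_mul]; exact h3
  -- Widths and resolutions never exceed 1, so ϖ may be capped at 1; the cap is needed later, when
  -- powers of ϖ are compared.
  have both : ∀ z, z ≤ 1 → z ≤ (2 * c + 1) * ϖ → z ≤ (2 * c + 1) * min 1 ϖ := by
    intro z h3 h4
    rcases le_total 1 ϖ with h | h
    · rw [min_eq_left h]; linarith
    · rw [min_eq_right h]; exact h4
  have hϖ0 : 0 < ϖ := (inv_pos.2 hN0).trans_le hNϖ
  refine ⟨hzero, hone, hlt, fun j hj => both _ ?_ ?_, fun j hj => both _ ?_ ?_, ?_⟩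
  · linarith [hnn j (by omega), hle1 j hj]
  · rcases split j hj with h | ⟨h, h'⟩
    · rw [(coarse j h).1, div_eq_mul_inv]
      have h3 : 0 < (N : ℝ)⁻¹ := inv_pos.2 hN0
      calc 2 * (1 - σ * ε / α * φ (1 / 2)) * (N : ℝ)⁻¹ ≤ 2 * 1 * (N : ℝ)⁻¹ := by
            gcongr; linarith
        _ ≤ 2 * c * ϖ := by gcongr
        _ ≤ _ := by linarith
    · obtain ⟨y, hy, hXy, hey, h3, h4, -⟩ := fine j h h'
      -- Here y ≤ e^y - 1, and (e^y - 1) e(X j) is the increment of the layer function over the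
      -- cell. Since ε ≤ e(X j), this also bounds εy, which is the cell width up to the factor σ/α.
      have h5 : y * e (X j) ≤ ϖ := by
        have h6 := Real.add_one_le_exp y
        have h7 : e (X (j + 1)) = Real.exp y * e (X j) := by
          rw [hey, ← mul_assoc, ← Real.exp_add]; simp
        have h8 : 0 < e (X j) := layerFn_pos _ _ _ _
        rw [h7] at h3
        nlinarith
      have h6 : ε * y ≤ ϖ := by
        rw [mul_comm]
        exact (mul_le_mul_of_nonneg_left h4 hy.le).trans h5
      calc X (j + 1) - X j = σ / α * (ε * y) := by rw [hXy]; ring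
        _ ≤ c * ϖ := by gcongr
        _ ≤ _ := by nlinarith
  · exact cellRes_le_one hα hσ hε (hle1 j hj)
  · rcases split j hj with h | ⟨h, h'⟩
    · refine (resCoarse j h).trans (hNϖ.trans ?_)
      exact le_mul_of_one_le_left hϖ0.le (by linarith)
    · obtain ⟨y, hy, hXy, hey, h3, h4, -⟩ := fine j h h'
      calc cellRes α σ ε X j ≤ 2 * c * ϖ := (resFine j h h').trans (by gcongr)
        _ ≤ _ := by linarith
  -- Each coarse cell contributes at most 1/N, while the contributions of the fine cells telescope
  -- in the layer function.
  · have hsum : ∀ m ≤ n + 1, ∑ j ∈ Finset.range m, cellRes α σ ε X j ≤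
        (m : ℝ) * (N : ℝ)⁻¹ + 2 * c * e (X m) := by
      intro m
      induction m with
      | zero =>
        intro _
        have : 0 < e (X 0) := layerFn_pos _ _ _ _
        simp
        positivity
      | succ m ih =>
        intro hm
        rw [Finset.sum_range_succ]
        have h3 := ih (by omega)
        have h5 : e (X m) ≤ e (X (m + 1)) := layerFn_mono hα hσ hε (hlt m (by omega)).le
        have h6 : 0 < (N : ℝ)⁻¹ := inv_pos.2 hN0
        push_cast
        rcases split m (by omega) with h | ⟨h, h'⟩
        · have h7 := resCoarse m h
          have h8 : 2 * c * e (X m) ≤ 2 * c * e (X (m + 1)) := by gcongr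
          linarith
        · have h7 := resFine m h h'
          linarith
    have h9 := hsum (n + 1) le_rfl
    rw [← hNdef, mul_inv_cancel₀ hN0.ne'] at h9
    have : 2 * c * e (X N) ≤ 2 * c * 1 := by
      gcongr
      exact layerFn_le_one hα hσ hε hone.le
    linarith

end

end LDG

end

noncomputable section

namespace LDG

/-! ### Smooth functions on the rectangle -/

/-- `H j i` is a continuous family of mixed derivatives `∂ₓʲ ∂ₜⁱ` on `[0,1] × [0,T]`. -/
structure IsJet (T : ℝ) (H : ℕ → ℕ → ℝ → ℝ → ℝ) : Prop where
  cont : ∀ j i, ContinuousOn (Function.uncurry (H j i)) (Icc 0 1 ×ˢ Icc 0 T)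
  dx : ∀ j i, ∀ x ∈ Icc (0 : ℝ) 1, ∀ t ∈ Icc 0 T,
    HasDerivWithinAt (fun y => H j i y t) (H (j + 1) i x t) (Icc 0 1) x
  dt : ∀ j i, ∀ x ∈ Icc (0 : ℝ) 1, ∀ t ∈ Icc 0 T,
    HasDerivWithinAt (fun s => H j i x s) (H j (i + 1) x t) (Icc 0 T) t

lemma IsJet.iteratedDerivWithin_t {T : ℝ} (hT : 0 < T) {H : ℕ → ℕ → ℝ → ℝ → ℝ} (h : IsJet T H)
    {g : ℝ → ℝ → ℝ} (hg : ∀ x ∈ Icc (0 : ℝ) 1, ∀ t ∈ Icc 0 T, g x t = H 0 0 x t) (i : ℕ) {x : ℝ}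
    (hx : x ∈ Icc (0 : ℝ) 1) {t : ℝ} (ht : t ∈ Icc 0 T) :
    iteratedDerivWithin i (fun s => g x s) (Icc 0 T) t = H 0 i x t := by
  induction i generalizing t with
  | zero => rw [iteratedDerivWithin_zero]; exact hg x hx t ht
  | succ i ih =>
    rw [iteratedDerivWithin_succ, derivWithin_congr (fun s hs => ih hs) (ih ht)]
    exact (h.dt 0 i x hx t ht).derivWithin (uniqueDiffOn_Icc hT t ht)

lemma IsJet.mixedDeriv_eq {T : ℝ} (hT : 0 < T) {H : ℕ → ℕ → ℝ → ℝ → ℝ} (h : IsJet T H)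
    {g : ℝ → ℝ → ℝ} (hg : ∀ x ∈ Icc (0 : ℝ) 1, ∀ t ∈ Icc 0 T, g x t = H 0 0 x t) (j i : ℕ) {x : ℝ}
    (hx : x ∈ Icc (0 : ℝ) 1) {t : ℝ} (ht : t ∈ Icc 0 T) :
    mixedDeriv T g j i x t = H j i x t := by
  unfold mixedDeriv
  induction j generalizing x with
  | zero =>
    rw [iteratedDerivWithin_zero]
    exact h.iteratedDerivWithin_t hT hg i hx ht
  | succ j ih =>
    rw [iteratedDerivWithin_succ, derivWithin_congr (fun s hs => ih hs) (ih hx)]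
    exact (h.dx j i x hx t ht).derivWithin (uniqueDiffOn_Icc one_pos x hx)

lemma IsJet.add {T : ℝ} {H H' : ℕ → ℕ → ℝ → ℝ → ℝ} (h : IsJet T H) (h' : IsJet T H') :
    IsJet T (fun j i x t => H j i x t + H' j i x t) where
  cont j i := (h.cont j i).add (h'.cont j i)
  dx j i x hx t ht := (h.dx j i x hx t ht).add (h'.dx j i x hx t ht)
  dt j i x hx t ht := (h.dt j i x hx t ht).add (h'.dt j i x hx t ht)

/-- The directional derivative of a function on the rectangle `R`. -/
def dirDeriv (R : Set (ℝ × ℝ)) (e : ℝ × ℝ) (g : ℝ × ℝ → ℝ) (p : ℝ × ℝ) : ℝ :=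
  fderivWithin ℝ g R p e

lemma contDiffOn_dirDeriv {R : Set (ℝ × ℝ)} (hR : UniqueDiffOn ℝ R) (e : ℝ × ℝ) {g : ℝ × ℝ → ℝ}
    (hg : ContDiffOn ℝ ∞ g R) : ContDiffOn ℝ ∞ (dirDeriv R e g) R :=
  (hg.fderivWithin hR (m := ∞) (by simp)).clm_apply contDiffOn_const

lemma dirDeriv_congr {R : Set (ℝ × ℝ)} (e : ℝ × ℝ) {g g' : ℝ × ℝ → ℝ} (h : EqOn g g' R) :
    EqOn (dirDeriv R e g) (dirDeriv R e g') R := fun p hp => by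
  unfold dirDeriv
  rw [fderivWithin_congr h (h hp)]

/-- Symmetry of the second derivative up to the boundary of the closed rectangle, whose points are
limits of interior points. -/
lemma dirDeriv_comm {R : Set (ℝ × ℝ)} (hR : UniqueDiffOn ℝ R) (hc : R ⊆ closure (interior R))
    (e e' : ℝ × ℝ) {g : ℝ × ℝ → ℝ} (hg : ContDiffOn ℝ ∞ g R) :
    EqOn (dirDeriv R e (dirDeriv R e' g)) (dirDeriv R e' (dirDeriv R e g)) R := by
  have key : ∀ e e' : ℝ × ℝ, ∀ p ∈ R, dirDeriv R e (dirDeriv R e' g) p =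
      fderivWithin ℝ (fderivWithin ℝ g R) R p e e' := by
    intro e e' p hp
    have h1 : DifferentiableWithinAt ℝ (fderivWithin ℝ g R) R p :=
      ((hg.fderivWithin hR (m := ∞) (by simp)).differentiableOn (by simp)) p hp
    unfold dirDeriv
    have h2 := (h1.hasFDerivWithinAt.clm_apply (hasFDerivWithinAt_const e' p R))
    rw [h2.fderivWithin (hR p hp)]
    simp
  intro p hp
  rw [key e e' p hp, key e' e p hp]
  exact ((hg p hp).isSymmSndFDerivWithinAt (by simpa using ENat.LEInfty.out) hR (hc hp) hp).eq e e'

/-- Every smooth function on the rectangle has a family of mixed derivatives. -/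
lemma exists_isJet {T : ℝ} (hT : 0 < T) {g : ℝ → ℝ → ℝ}
    (hg : ContDiffOn ℝ ∞ (Function.uncurry g) (Icc 0 1 ×ˢ Icc 0 T)) :
    ∃ H, IsJet T H ∧ H 0 0 = g := by
  set R : Set (ℝ × ℝ) := Icc 0 1 ×ˢ Icc 0 T with hRdef
  have hR : UniqueDiffOn ℝ R := (uniqueDiffOn_Icc one_pos).prod (uniqueDiffOn_Icc hT)
  have hc : R ⊆ closure (interior R) := by
    rw [hRdef, interior_prod_eq, interior_Icc, interior_Icc, closure_prod_eq,
      closure_Ioo one_pos.ne, closure_Ioo hT.ne]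
  set D1 := dirDeriv R (1, 0)
  set D2 := dirDeriv R (0, 1)
  -- Time derivatives are taken first, as in `mixedDeriv`. The relation in x is then immediate, and
  -- the one in t requires commuting derivatives.
  set G : ℕ → ℕ → ℝ × ℝ → ℝ := fun j i => D1^[j] (D2^[i] (Function.uncurry g)) with hG
  have smooth2 : ∀ i, ContDiffOn ℝ ∞ (D2^[i] (Function.uncurry g)) R := by
    intro i
    induction i with
    | zero => exact hg
    | succ i ih =>
      rw [Function.iterate_succ_apply']
      exact contDiffOn_dirDeriv hR _ ih
  have smooth : ∀ j i, ContDiffOn ℝ ∞ (G j i) R := by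
    intro j i
    induction j with
    | zero => exact smooth2 i
    | succ j ih =>
      simp only [hG, Function.iterate_succ_apply']
      exact contDiffOn_dirDeriv hR _ ih
  have hD1 : ∀ j i, G (j + 1) i = D1 (G j i) := fun j i => by
    simp only [hG, Function.iterate_succ_apply']
  have hD2 : ∀ j i, EqOn (G j (i + 1)) (D2 (G j i)) R := by
    intro j i
    induction j with
    | zero =>
      simp only [hG, Function.iterate_zero, id, Function.iterate_succ_apply']
      exact fun _ _ => rfl
    | succ j ih =>
      rw [hD1, hD1]
      exact (dirDeriv_congr _ ih).trans (dirDeriv_comm hR hc _ _ (smooth j i))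
  refine ⟨fun j i x t => G j i (x, t), ⟨fun j i => (smooth j i).continuousOn, ?_, ?_⟩, rfl⟩
  · intro j i x hx t ht
    have h1 : HasFDerivWithinAt (G j i) (fderivWithin ℝ (G j i) R (x, t)) R (x, t) :=
      (((smooth j i).differentiableOn (by simp)) (x, t) ⟨hx, ht⟩).hasFDerivWithinAt
    have h2 : HasDerivWithinAt (fun y : ℝ => (y, t)) ((1 : ℝ), (0 : ℝ)) (Icc 0 1) x :=
      (hasDerivWithinAt_id x _).prodMk (hasDerivWithinAt_const x _ t)
    have h3 := h1.comp_hasDerivWithinAt x h2 (t := R)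
      (fun y (hy : y ∈ Icc (0 : ℝ) 1) => (⟨hy, ht⟩ : (y, t) ∈ Icc (0 : ℝ) 1 ×ˢ Icc 0 T))
    rw [hD1]
    exact h3
  · intro j i x hx t ht
    have h1 : HasFDerivWithinAt (G j i) (fderivWithin ℝ (G j i) R (x, t)) R (x, t) :=
      (((smooth j i).differentiableOn (by simp)) (x, t) ⟨hx, ht⟩).hasFDerivWithinAt
    have h2 : HasDerivWithinAt (fun s : ℝ => (x, s)) ((0 : ℝ), (1 : ℝ)) (Icc 0 T) t :=
      (hasDerivWithinAt_const t _ x).prodMk (hasDerivWithinAt_id t _)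
    have h3 := h1.comp_hasDerivWithinAt t h2 (t := R)
      (fun y (hy : y ∈ Icc 0 T) => (⟨hx, hy⟩ : (x, y) ∈ Icc (0 : ℝ) 1 ×ˢ Icc 0 T))
    rw [hD2 j i ⟨hx, ht⟩]
    exact h3

/-- A family of functions, continuous in `(x,t)`, with the mixed derivatives of a smooth function
on `[0,1] × [0,T]`. -/
structure IsSmoothFamily (T : ℝ) (G : ℕ → ℕ → ℝ → C(ℝ, ℝ)) : Prop where
  cont : ∀ j i, Continuous fun p : ℝ × ℝ => G j i p.1 p.2
  dx : ∀ j i, ∀ x ∈ Ioo (0 : ℝ) 1, ∀ t ∈ Icc 0 T, HasDerivAt (G j i t) (G (j + 1) i t x) x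
  dt : ∀ j i, ∀ x ∈ Icc (0 : ℝ) 1, ∀ t ∈ Ioo 0 T,
    HasDerivAt (fun s => G j i s x) (G j (i + 1) t x) t

/-- Composing with the projection onto the rectangle yields functions continuous on the whole plane,
for which integrability is automatic. The price is that differentiability in a variable is asserted
only in the interior of its interval. -/
lemma IsJet.exists_isSmoothFamily {T : ℝ} (hT : 0 < T) {H : ℕ → ℕ → ℝ → ℝ → ℝ} (h : IsJet T H) :
    ∃ G, IsSmoothFamily T G ∧
      ∀ j i, ∀ x ∈ Icc (0 : ℝ) 1, ∀ t ∈ Icc 0 T, G j i t x = H j i x t := by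
  set E : ℕ → ℕ → ℝ × ℝ → ℝ := fun j i p =>
    H j i (projIcc 0 1 zero_le_one p.2) (projIcc 0 T hT.le p.1) with hE
  have hEc : ∀ j i, Continuous (E j i) := by
    intro j i
    have h1 : Continuous fun p : ℝ × ℝ =>
        (((projIcc 0 1 zero_le_one p.2 : Icc (0 : ℝ) 1) : ℝ),
          ((projIcc 0 T hT.le p.1 : Icc (0 : ℝ) T) : ℝ)) := by
      refine Continuous.prodMk ?_ ?_
      · exact continuous_subtype_val.comp (continuous_projIcc.comp continuous_snd)
      · exact continuous_subtype_val.comp (continuous_projIcc.comp continuous_fst)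
    exact (h.cont j i).comp_continuous h1 fun p => ⟨Subtype.coe_prop _, Subtype.coe_prop _⟩
  have hval : ∀ j i, ∀ x ∈ Icc (0 : ℝ) 1, ∀ t ∈ Icc 0 T, E j i (t, x) = H j i x t := by
    intro j i x hx t ht
    simp only [hE]
    rw [projIcc_of_mem _ hx, projIcc_of_mem _ ht]
  refine ⟨fun j i t => ⟨fun x => E j i (t, x), by have := hEc j i; fun_prop⟩,
    ⟨hEc, ?_, ?_⟩, hval⟩
  · intro j i x hx t ht
    have h1 := (h.dx j i x (Ioo_subset_Icc_self hx) t ht).hasDerivAt (Icc_mem_nhds hx.1 hx.2)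
    simp only [ContinuousMap.coe_mk]
    rw [hval _ _ x (Ioo_subset_Icc_self hx) t ht]
    refine h1.congr_of_eventuallyEq ?_
    filter_upwards [Ioo_mem_nhds hx.1 hx.2] with y hy
    exact hval _ _ y (Ioo_subset_Icc_self hy) t ht
  · intro j i x hx t ht
    have h1 := (h.dt j i x hx t (Ioo_subset_Icc_self ht)).hasDerivAt (Icc_mem_nhds ht.1 ht.2)
    simp only [ContinuousMap.coe_mk]
    rw [hval _ _ x hx t (Ioo_subset_Icc_self ht)]
    refine h1.congr_of_eventuallyEq ?_
    filter_upwards [Ioo_mem_nhds ht.1 ht.2] with y hy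
    exact hval _ _ x hx y (Ioo_subset_Icc_self hy)

/-- The decomposition of the solution in terms of families of derivatives. -/
lemma HasLayerDecomposition.exists_families {T ε α : ℝ} (hT : 0 < T) {K : ℕ → ℕ → ℝ}
    {u : ℝ → ℝ → ℝ} (h : HasLayerDecomposition T ε α K u) :
    ∃ S E : ℕ → ℕ → ℝ → C(ℝ, ℝ), IsSmoothFamily T S ∧ IsSmoothFamily T E ∧
      (∀ j i, ∀ x ∈ Icc (0 : ℝ) 1, ∀ t ∈ Icc 0 T, |S j i t x| ≤ K j i) ∧
      (∀ j i, ∀ x ∈ Icc (0 : ℝ) 1, ∀ t ∈ Icc 0 T,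
        |E j i t x| ≤ K j i * (ε ^ j)⁻¹ * Real.exp (-α * (1 - x) / ε)) ∧
      (∀ j i, ∀ x ∈ Icc (0 : ℝ) 1, ∀ t ∈ Icc 0 T,
        mixedDeriv T u j i x t = S j i t x + E j i t x) ∧
      ∀ x ∈ Icc (0 : ℝ) 1, ∀ t ∈ Icc 0 T,
        derivWithin (fun y => u y t) (Icc 0 1) x = S 1 0 t x + E 1 0 t x := by
  obtain ⟨s, e, hs, he, hu, hsK, heK⟩ := h
  obtain ⟨Hs, hHs, rfl⟩ := exists_isJet hT hs
  obtain ⟨He, hHe, rfl⟩ := exists_isJet hT he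
  obtain ⟨S, hS, hS'⟩ := hHs.exists_isSmoothFamily hT
  obtain ⟨E, hE, hE'⟩ := hHe.exists_isSmoothFamily hT
  refine ⟨S, E, hS, hE, ?_, ?_, ?_, ?_⟩
  · intro j i x hx t ht
    rw [hS' j i x hx t ht, ← hHs.mixedDeriv_eq hT (fun _ _ _ _ => rfl) j i hx ht]
    exact hsK j i x hx t ht
  · intro j i x hx t ht
    rw [hE' j i x hx t ht, ← hHe.mixedDeriv_eq hT (fun _ _ _ _ => rfl) j i hx ht]
    exact heK j i x hx t ht
  · intro j i x hx t ht
    rw [hS' j i x hx t ht, hE' j i x hx t ht]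
    exact (hHs.add hHe).mixedDeriv_eq hT hu j i hx ht
  · intro x hx t ht
    rw [hS' 1 0 x hx t ht, hE' 1 0 x hx t ht,
      derivWithin_congr (fun y hy => hu y hy t ht) (hu x hx t ht)]
    exact ((hHs.add hHe).dx 0 0 x hx t ht).derivWithin (uniqueDiffOn_Icc one_pos x hx)

end LDG

end

/-! ### Cellwise functions and the LDG form: coercivity and consistency. -/

noncomputable section

namespace LDG

open scoped Polynomial

/-! ### Cellwise functions -/

/-- Functions that are continuous on each cell; the index is the number of the cell. -/
abbrev CellFn := ℕ → C(ℝ, ℝ)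

/-- Cellwise polynomials. -/
abbrev CellPoly := ℕ → ℝ[X]

/-- The `L²` inner product of cellwise functions on the cells with index less than `N`. -/
def cip (N : ℕ) (X : ℕ → ℝ) : CellFn →ₗ[ℝ] CellFn →ₗ[ℝ] ℝ :=
  LinearMap.mk₂ ℝ (fun f g => ∑ j ∈ Finset.range N, ∫ x in (X j)..(X (j + 1)), f j x * g j x)
    (by
      intro f f' g
      rw [← Finset.sum_add_distrib]
      refine Finset.sum_congr rfl fun j _ => ?_
      rw [← intervalIntegral.integral_add]
      · exact intervalIntegral.integral_congr fun x _ => by simp [add_mul]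
      all_goals exact Continuous.intervalIntegrable (by fun_prop) _ _)
    (by
      intro c f g
      rw [smul_eq_mul, Finset.mul_sum]
      refine Finset.sum_congr rfl fun j _ => ?_
      rw [← intervalIntegral.integral_const_mul]
      exact intervalIntegral.integral_congr fun x _ => by simp [mul_assoc])
    (by
      intro f g g'
      rw [← Finset.sum_add_distrib]
      refine Finset.sum_congr rfl fun j _ => ?_
      rw [← intervalIntegral.integral_add]
      · exact intervalIntegral.integral_congr fun x _ => by simp [mul_add]
      all_goals exact Continuous.intervalIntegrable (by fun_prop) _ _)
    (by
      intro c f g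
      rw [smul_eq_mul, Finset.mul_sum]
      refine Finset.sum_congr rfl fun j _ => ?_
      rw [← intervalIntegral.integral_const_mul]
      exact intervalIntegral.integral_congr fun x _ => by simp; ring)

lemma cip_apply (N : ℕ) (X : ℕ → ℝ) (f g : CellFn) :
    cip N X f g = ∑ j ∈ Finset.range N, ∫ x in (X j)..(X (j + 1)), f j x * g j x := rfl

lemma cip_comm (N : ℕ) (X : ℕ → ℝ) (f g : CellFn) : cip N X f g = cip N X g f := by
  simp_rw [cip_apply, mul_comm]

lemma cip_mul_left (N : ℕ) (X : ℕ → ℝ) (c f g : CellFn) :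
    cip N X (c * f) g = cip N X f (c * g) := by
  simp_rw [cip_apply]
  refine Finset.sum_congr rfl fun j _ => intervalIntegral.integral_congr fun x _ => ?_
  simp only [Pi.mul_apply, ContinuousMap.mul_apply]
  ring

/-- Cellwise polynomials as cellwise functions. -/
def emb : CellPoly →ₗ[ℝ] CellFn := polyC.compLeft ℕ

@[simp] lemma emb_apply (v : CellPoly) (j : ℕ) (x : ℝ) : emb v j x = (v j).eval x := rfl

/-- The cellwise derivative. -/
def dP : CellPoly →ₗ[ℝ] CellPoly := Polynomial.derivative.compLeft ℕ

@[simp] lemma dP_apply (v : CellPoly) (j : ℕ) : dP v j = (v j).derivative := rfl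

/-- A continuous function as a cellwise function. -/
def cst : C(ℝ, ℝ) →ₗ[ℝ] CellFn := LinearMap.pi fun _ => LinearMap.id

@[simp] lemma cst_apply (w : C(ℝ, ℝ)) (j : ℕ) : cst w j = w := rfl

/-- A grid `0 = X 0 < … < X (n+1) = 1`. -/
structure IsGrid (n : ℕ) (X : ℕ → ℝ) : Prop where
  zero : X 0 = 0
  one : X (n + 1) = 1
  lt : ∀ j ≤ n, X j < X (j + 1)

lemma IsLayerMesh.isGrid {α σ ε ϖ Cm : ℝ} {n : ℕ} {X : ℕ → ℝ}
    (h : IsLayerMesh α σ ε ϖ Cm n X) : IsGrid n X := ⟨h.zero, h.one, h.lt⟩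

section Grid

variable {n : ℕ} {X : ℕ → ℝ}

lemma IsGrid.mono (h : IsGrid n X) {i j : ℕ} (hij : i ≤ j) (hj : j ≤ n + 1) : X i ≤ X j := by
  induction j, hij using Nat.le_induction with
  | base => exact le_rfl
  | succ j _ ih => exact (ih (by omega)).trans (h.lt j (by omega)).le

lemma IsGrid.mem (h : IsGrid n X) {j : ℕ} (hj : j ≤ n + 1) : X j ∈ Icc (0 : ℝ) 1 := by
  constructor
  · rw [← h.zero]; exact h.mono (Nat.zero_le _) hj
  · rw [← h.one]; exact h.mono hj le_rfl

lemma IsGrid.Icc_subset (h : IsGrid n X) {j : ℕ} (hj : j ≤ n) :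
    Icc (X j) (X (j + 1)) ⊆ Icc 0 1 :=
  Icc_subset_Icc (h.mem (by omega)).1 (h.mem (by omega)).2

lemma IsGrid.Ioo_subset (h : IsGrid n X) {j : ℕ} (hj : j ≤ n) :
    Ioo (X j) (X (j + 1)) ⊆ Ioo 0 1 :=
  Ioo_subset_Ioo (h.mem (by omega)).1 (h.mem (by omega)).2

lemma cip_mono (h : IsGrid n X) {f g f' g' : CellFn}
    (hfg : ∀ j ≤ n, ∀ x ∈ Icc (X j) (X (j + 1)), f j x * g j x ≤ f' j x * g' j x) :
    cip (n + 1) X f g ≤ cip (n + 1) X f' g' := by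
  rw [cip_apply, cip_apply]
  refine Finset.sum_le_sum fun j hj => ?_
  have hj : j ≤ n := by simpa [Nat.lt_succ_iff] using hj
  refine intervalIntegral.integral_mono_on (h.lt j hj).le ?_ ?_ (hfg j hj)
  all_goals exact Continuous.intervalIntegrable (by fun_prop) _ _

lemma cip_self_nonneg (h : IsGrid n X) (f : CellFn) : 0 ≤ cip (n + 1) X f f := by
  rw [cip_apply]
  refine Finset.sum_nonneg fun j hj => ?_
  have hj : j ≤ n := by simpa [Nat.lt_succ_iff] using hj
  exact intervalIntegral.integral_nonneg (h.lt j hj).le fun x _ => mul_self_nonneg _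

lemma cip_sq_le (h : IsGrid n X) (f g : CellFn) :
    cip (n + 1) X f g ^ 2 ≤ cip (n + 1) X f f * cip (n + 1) X g g := by
  apply sq_le_mul_of_quadratic_nonneg
  intro t
  have h1 := cip_self_nonneg h (f + t • g)
  simp only [map_add, map_smul, LinearMap.add_apply, LinearMap.smul_apply, smul_eq_mul] at h1
  rw [cip_comm _ _ g f] at h1
  linarith

lemma abs_cip_le (h : IsGrid n X) (f g : CellFn) :
    |cip (n + 1) X f g| ≤ Real.sqrt (cip (n + 1) X f f) * Real.sqrt (cip (n + 1) X g g) := by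
  rw [← Real.sqrt_mul (cip_self_nonneg h f)]
  exact Real.abs_le_sqrt (cip_sq_le h f g)

lemma abs_cip_le_of_sq_le (h : IsGrid n X) {f g : CellFn} {a b : ℝ}
    (hf : cip (n + 1) X f f ≤ a ^ 2) (hg : cip (n + 1) X g g ≤ b ^ 2) (ha : 0 ≤ a) (hb : 0 ≤ b) :
    |cip (n + 1) X f g| ≤ a * b :=
  (abs_cip_le h f g).trans (mul_le_mul (Real.sqrt_le_iff.2 ⟨ha, hf⟩) (Real.sqrt_le_iff.2 ⟨hb, hg⟩)
    (Real.sqrt_nonneg _) ha)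

lemma cip_add_self_le (h : IsGrid n X) (f g : CellFn) :
    cip (n + 1) X (f + g) (f + g) ≤ 2 * cip (n + 1) X f f + 2 * cip (n + 1) X g g := by
  have h1 := cip_self_nonneg h (f - g)
  simp only [map_add, map_sub, LinearMap.add_apply, LinearMap.sub_apply] at h1 ⊢
  linarith

lemma integral_eq_sum_cells (h : IsGrid n X) (f : C(ℝ, ℝ)) :
    ∑ j ∈ Finset.range (n + 1), ∫ x in (X j)..(X (j + 1)), f x = ∫ x in (0 : ℝ)..1, f x := by
  rw [intervalIntegral.sum_integral_adjacent_intervals, h.zero, h.one]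
  intro j _
  exact Continuous.intervalIntegrable (by fun_prop) _ _

lemma cip_self_le_of_abs_le (h : IsGrid n X) {f : CellFn} {A : ℝ}
    (hf : ∀ j ≤ n, ∀ x ∈ Icc (X j) (X (j + 1)), |f j x| ≤ A) : cip (n + 1) X f f ≤ A ^ 2 := by
  have h1 : cip (n + 1) X f f ≤ cip (n + 1) X (cst (ContinuousMap.const ℝ A))
      (cst (ContinuousMap.const ℝ A)) := by
    refine cip_mono h fun j hj x hx => ?_
    rw [← sq, cst_apply, ContinuousMap.const_apply, ← sq]
    exact sq_le_sq' (abs_le.1 (hf j hj x hx)).1 (abs_le.1 (hf j hj x hx)).2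
  refine h1.trans (le_of_eq ?_)
  have := integral_eq_sum_cells h (ContinuousMap.const ℝ (A * A))
  rw [cip_apply]
  simp only [cst_apply, ContinuousMap.const_apply] at this ⊢
  rw [this]
  simp [sq]

lemma cell_ibp {l r : ℝ} (hlr : l ≤ r) {f f' g g' : C(ℝ, ℝ)}
    (hf : ∀ x ∈ Ioo l r, HasDerivAt f (f' x) x) (hg : ∀ x ∈ Ioo l r, HasDerivAt g (g' x) x) :
    (∫ x in l..r, f x * g' x) + ∫ x in l..r, f' x * g x = f r * g r - f l * g l := by
  rw [← intervalIntegral.integral_add]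
  · refine intervalIntegral.integral_eq_sub_of_hasDerivAt_of_le hlr
      (f := fun x => f x * g x) (by fun_prop) (fun x hx => ?_)
      (Continuous.intervalIntegrable (by fun_prop) _ _)
    exact ((hf x hx).mul (hg x hx)).congr_deriv (by ring)
  all_goals exact Continuous.intervalIntegrable (by fun_prop) _ _

/-- Regroups the end-point contributions of the cells by interior nodes, where they become jumps. -/
lemma sum_sub_eq_telescope (n : ℕ) (R L : ℕ → ℝ) :
    ∑ j ∈ Finset.range (n + 1), (R j - L j) =
      R n - L 0 + ∑ j ∈ Finset.range n, (R j - L (j + 1)) := by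
  rw [Finset.sum_sub_distrib, Finset.sum_range_succ, Finset.sum_range_succ' L,
    Finset.sum_sub_distrib]
  ring

/-- Cellwise integration by parts. -/
lemma cip_ibp (h : IsGrid n X) {f f' g g' : CellFn}
    (hf : ∀ j ≤ n, ∀ x ∈ Ioo (X j) (X (j + 1)), HasDerivAt (f j) (f' j x) x)
    (hg : ∀ j ≤ n, ∀ x ∈ Ioo (X j) (X (j + 1)), HasDerivAt (g j) (g' j x) x) :
    cip (n + 1) X f g' + cip (n + 1) X f' g =
      f n (X (n + 1)) * g n (X (n + 1)) - f 0 (X 0) * g 0 (X 0) +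
        ∑ j ∈ Finset.range n, (f j (X (j + 1)) * g j (X (j + 1)) -
          f (j + 1) (X (j + 1)) * g (j + 1) (X (j + 1))) := by
  rw [cip_apply, cip_apply, ← Finset.sum_add_distrib, ← sum_sub_eq_telescope n
    (fun j => f j (X (j + 1)) * g j (X (j + 1))) (fun j => f j (X j) * g j (X j))]
  refine Finset.sum_congr rfl fun j hj => ?_
  have hj : j ≤ n := by simpa [Nat.lt_succ_iff] using hj
  exact cell_ibp (h.lt j hj).le (hf j hj) (hg j hj)

end Grid

/-! ### The LDG form for cellwise functions -/

/-- `∑ f_j⁻ ⟦z⟧_j` over the interior nodes. -/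
def jumpL (n : ℕ) (X : ℕ → ℝ) : CellFn →ₗ[ℝ] CellPoly →ₗ[ℝ] ℝ :=
  LinearMap.mk₂ ℝ (fun f z => ∑ j ∈ Finset.range n,
      f j (X (j + 1)) * ((z (j + 1)).eval (X (j + 1)) - (z j).eval (X (j + 1))))
    (fun f f' z => by
      rw [← Finset.sum_add_distrib]
      exact Finset.sum_congr rfl fun j _ => by simp [add_mul])
    (fun c f z => by
      rw [smul_eq_mul, Finset.mul_sum]
      exact Finset.sum_congr rfl fun j _ => by simp [mul_assoc])
    (fun f z z' => by
      rw [← Finset.sum_add_distrib]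
      exact Finset.sum_congr rfl fun j _ => by simp; ring)
    (fun c f z => by
      rw [smul_eq_mul, Finset.mul_sum]
      exact Finset.sum_congr rfl fun j _ => by simp; ring)

lemma jumpL_apply (n : ℕ) (X : ℕ → ℝ) (f : CellFn) (z : CellPoly) :
    jumpL n X f z = ∑ j ∈ Finset.range n,
      f j (X (j + 1)) * ((z (j + 1)).eval (X (j + 1)) - (z j).eval (X (j + 1))) := rfl

/-- `∑ f_j⁺ ⟦z⟧_j` over the interior nodes. -/
def jumpR (n : ℕ) (X : ℕ → ℝ) : CellFn →ₗ[ℝ] CellPoly →ₗ[ℝ] ℝ :=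
  LinearMap.mk₂ ℝ (fun f z => ∑ j ∈ Finset.range n,
      f (j + 1) (X (j + 1)) * ((z (j + 1)).eval (X (j + 1)) - (z j).eval (X (j + 1))))
    (fun f f' z => by
      rw [← Finset.sum_add_distrib]
      exact Finset.sum_congr rfl fun j _ => by simp [add_mul])
    (fun c f z => by
      rw [smul_eq_mul, Finset.mul_sum]
      exact Finset.sum_congr rfl fun j _ => by simp [mul_assoc])
    (fun f z z' => by
      rw [← Finset.sum_add_distrib]
      exact Finset.sum_congr rfl fun j _ => by simp; ring)
    (fun c f z => by
      rw [smul_eq_mul, Finset.mul_sum]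
      exact Finset.sum_congr rfl fun j _ => by simp; ring)

lemma jumpR_apply (n : ℕ) (X : ℕ → ℝ) (f : CellFn) (z : CellPoly) :
    jumpR n X f z = ∑ j ∈ Finset.range n,
      f (j + 1) (X (j + 1)) * ((z (j + 1)).eval (X (j + 1)) - (z j).eval (X (j + 1))) := rfl

/-- The LDG form on cellwise functions, with coefficients `A = a` and `c₀ = b - a_x`. -/
def ldgFun (ε lam : ℝ) (A c₀ : C(ℝ, ℝ)) (n : ℕ) (X : ℕ → ℝ) (f g : CellFn) (v s : CellPoly) : ℝ :=
  (ε⁻¹ * cip (n + 1) X g (emb s) + cip (n + 1) X (cst c₀ * f) (emb v))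
  + (cip (n + 1) X f (emb (dP s)) + jumpL n X f s)
  + (cip (n + 1) X g (emb (dP v)) + g 0 (X 0) * (v 0).eval (X 0) + jumpR n X g v
      - g n (X (n + 1)) * (v n).eval (X (n + 1)))
  + (-cip (n + 1) X (cst A * f) (emb (dP v)) - jumpL n X (cst A * f) v
      + A (X (n + 1)) * f n (X (n + 1)) * (v n).eval (X (n + 1))
      + lam * f n (X (n + 1)) * (v n).eval (X (n + 1)))

/-- The LDG form as a bilinear map. -/
def ldgForm (ε lam : ℝ) (A c₀ : C(ℝ, ℝ)) (n : ℕ) (X : ℕ → ℝ) :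
    (CellFn × CellFn) →ₗ[ℝ] (CellPoly × CellPoly) →ₗ[ℝ] ℝ :=
  LinearMap.mk₂ ℝ (fun w z => ldgFun ε lam A c₀ n X w.1 w.2 z.1 z.2)
    (fun w w' z => by
      simp only [ldgFun, Prod.fst_add, Prod.snd_add, mul_add, map_add, LinearMap.add_apply,
        Pi.add_apply, ContinuousMap.add_apply]
      ring)
    (fun c w z => by
      simp only [ldgFun, Prod.smul_fst, Prod.smul_snd, mul_smul_comm, map_smul,
        LinearMap.smul_apply, Pi.smul_apply, ContinuousMap.smul_apply, smul_eq_mul]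
      ring)
    (fun w z z' => by
      simp only [ldgFun, Prod.fst_add, Prod.snd_add, map_add,
        Pi.add_apply, Polynomial.eval_add]
      ring)
    (fun c w z => by
      simp only [ldgFun, Prod.smul_fst, Prod.smul_snd, map_smul,
        Pi.smul_apply, Polynomial.eval_smul, smul_eq_mul]
      ring)

lemma ldgForm_apply (ε lam : ℝ) (A c₀ : C(ℝ, ℝ)) (n : ℕ) (X : ℕ → ℝ) (f g : CellFn)
    (v s : CellPoly) :
    ldgForm ε lam A c₀ n X (f, g) (v, s) = ldgFun ε lam A c₀ n X f g v s := rfl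

/-- The square of the energy norm for cellwise functions, with `A = a` and `ρ = b - a_x / 2`. -/
def ldgEnergy (ε lam : ℝ) (A ρ : C(ℝ, ℝ)) (n : ℕ) (X : ℕ → ℝ) (f g : CellFn) : ℝ :=
  ε⁻¹ * cip (n + 1) X g g + cip (n + 1) X (cst ρ * f) f
  + 1 / 2 * (A (X 0) * f 0 (X 0) ^ 2
      + ∑ j ∈ Finset.range n, A (X (j + 1)) * (f (j + 1) (X (j + 1)) - f j (X (j + 1))) ^ 2
      + A (X (n + 1)) * f n (X (n + 1)) ^ 2)
  + lam * f n (X (n + 1)) ^ 2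

section Form

variable {ε lam : ℝ} {A A' b : C(ℝ, ℝ)} {n : ℕ} {X : ℕ → ℝ}

lemma hasDerivAt_emb (v : CellPoly) (j : ℕ) (x : ℝ) :
    HasDerivAt (emb v j) (emb (dP v) j x) x := (v j).hasDerivAt x

/-- Coercivity of the LDG form. -/
lemma ldgFun_self (h : IsGrid n X) (hA : ∀ x ∈ Ioo (0 : ℝ) 1, HasDerivAt A (A' x) x)
    (v s : CellPoly) :
    ldgFun ε lam A (b - A') n X (emb v) (emb s) v s =
      ldgEnergy ε lam A (b - (1 / 2 : ℝ) • A') n X (emb v) (emb s) := by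
  -- Because the traces alternate, left for u and right for q, the two mixed terms of the form
  -- cancel after one integration by parts, boundary terms included.
  have h1 := cip_ibp h (f := emb v) (f' := emb (dP v)) (g := emb s) (g' := emb (dP s))
    (fun j _ x _ => hasDerivAt_emb v j x) (fun j _ x _ => hasDerivAt_emb s j x)
  -- The convective term is half of an exact derivative: it shifts b - a_x to b - a_x/2, and its
  -- upwind traces leave half the squared jumps.
  have h2 := cip_ibp h (f := cst A * emb v) (f' := cst A' * emb v + cst A * emb (dP v))
    (g := emb v) (g' := emb (dP v))
    (fun j hj x hx => (hA x (h.Ioo_subset hj hx)).mul (hasDerivAt_emb v j x))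
    (fun j _ x _ => hasDerivAt_emb v j x)
  rw [map_add, LinearMap.add_apply, cip_mul_left _ _ (cst A) (emb (dP v)),
    cip_comm _ _ (emb (dP v)) (cst A * emb v)] at h2
  have h3 : cip (n + 1) X (cst (b - (1 / 2 : ℝ) • A') * emb v) (emb v) =
      cip (n + 1) X (cst (b - A') * emb v) (emb v) +
        1 / 2 * cip (n + 1) X (cst A' * emb v) (emb v) := by
    simp only [map_sub, map_smul, sub_mul, smul_mul_assoc, LinearMap.sub_apply,
      LinearMap.smul_apply, smul_eq_mul]
    ring
  rw [cip_comm _ _ (emb (dP v)) (emb s)] at h1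
  unfold ldgFun ldgEnergy
  rw [h3]
  simp only [jumpL_apply, jumpR_apply, Pi.mul_apply, cst_apply, ContinuousMap.mul_apply,
    emb_apply] at h1 h2 ⊢
  have e1 : ∑ j ∈ Finset.range n, ((v j).eval (X (j + 1)) * (s j).eval (X (j + 1)) -
        (v (j + 1)).eval (X (j + 1)) * (s (j + 1)).eval (X (j + 1))) =
      -(∑ j ∈ Finset.range n, (v j).eval (X (j + 1)) *
          ((s (j + 1)).eval (X (j + 1)) - (s j).eval (X (j + 1))))
      - ∑ j ∈ Finset.range n, (s (j + 1)).eval (X (j + 1)) *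
          ((v (j + 1)).eval (X (j + 1)) - (v j).eval (X (j + 1))) := by
    rw [← Finset.sum_neg_distrib, ← Finset.sum_sub_distrib]
    exact Finset.sum_congr rfl fun j _ => by ring
  have e2 : ∑ j ∈ Finset.range n, (A (X (j + 1)) * (v j).eval (X (j + 1)) * (v j).eval (X (j + 1))
        - A (X (j + 1)) * (v (j + 1)).eval (X (j + 1)) * (v (j + 1)).eval (X (j + 1))) =
      -(∑ j ∈ Finset.range n, A (X (j + 1)) *
          ((v (j + 1)).eval (X (j + 1)) - (v j).eval (X (j + 1))) ^ 2)
      - 2 * ∑ j ∈ Finset.range n, A (X (j + 1)) * (v j).eval (X (j + 1)) *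
          ((v (j + 1)).eval (X (j + 1)) - (v j).eval (X (j + 1))) := by
    rw [Finset.mul_sum, ← Finset.sum_neg_distrib, ← Finset.sum_sub_distrib]
    exact Finset.sum_congr rfl fun j _ => by ring
  rw [e1] at h1
  rw [e2] at h2
  linear_combination h1 - 1 / 2 * h2

/-- The flux equation for a smooth function with vanishing boundary values. -/
lemma flux_consistency (h : IsGrid n X) (hε : ε ≠ 0) {w w₁ : C(ℝ, ℝ)}
    (hw : ∀ x ∈ Ioo (0 : ℝ) 1, HasDerivAt w (w₁ x) x) (h0 : w 0 = 0) (h1 : w 1 = 0)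
    (s : CellPoly) :
    ε⁻¹ * cip (n + 1) X (cst (ε • w₁)) (emb s) + cip (n + 1) X (cst w) (emb (dP s))
      + jumpL n X (cst w) s = 0 := by
  have h2 := cip_ibp h (f := cst w) (f' := cst w₁) (g := emb s) (g' := emb (dP s))
    (fun j hj x hx => hw x (h.Ioo_subset hj hx)) (fun j _ x _ => hasDerivAt_emb s j x)
  simp only [cst_apply, emb_apply, h.zero, h.one, h0, h1] at h2
  rw [map_smul, map_smul, LinearMap.smul_apply, smul_eq_mul, inv_mul_cancel_left₀ hε, jumpL_apply]
  have e1 : ∑ j ∈ Finset.range n, (w (X (j + 1)) * (s j).eval (X (j + 1)) -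
        w (X (j + 1)) * (s (j + 1)).eval (X (j + 1))) =
      -(∑ j ∈ Finset.range n, w (X (j + 1)) *
          ((s (j + 1)).eval (X (j + 1)) - (s j).eval (X (j + 1)))) := by
    rw [← Finset.sum_neg_distrib]
    exact Finset.sum_congr rfl fun j _ => by ring
  rw [e1] at h2
  simp only [cst_apply]
  linear_combination h2

/-- Consistency of the LDG form for smooth functions with vanishing boundary values. -/
lemma ldgFun_consistency (h : IsGrid n X) (hε : ε ≠ 0)
    (hA : ∀ x ∈ Ioo (0 : ℝ) 1, HasDerivAt A (A' x) x) {w w₁ w₂ : C(ℝ, ℝ)}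
    (hw : ∀ x ∈ Ioo (0 : ℝ) 1, HasDerivAt w (w₁ x) x)
    (hw₁ : ∀ x ∈ Ioo (0 : ℝ) 1, HasDerivAt w₁ (w₂ x) x) (h0 : w 0 = 0) (h1 : w 1 = 0)
    (v s : CellPoly) :
    ldgFun ε lam A (b - A') n X (cst w) (cst (ε • w₁)) v s =
      cip (n + 1) X (cst (-(ε • w₂) + A * w₁ + b * w)) (emb v) := by
  have h2 := flux_consistency h hε hw h0 h1 s
  have h3 := cip_ibp h (f := cst (ε • w₁)) (f' := cst (ε • w₂)) (g := emb v) (g' := emb (dP v))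
    (fun j hj x hx => (hw₁ x (h.Ioo_subset hj hx)).const_smul ε)
    (fun j _ x _ => hasDerivAt_emb v j x)
  have h4 := cip_ibp h (f := cst A * cst w) (f' := cst (A' * w + A * w₁)) (g := emb v)
    (g' := emb (dP v))
    (fun j hj x hx => (hA x (h.Ioo_subset hj hx)).mul (hw x (h.Ioo_subset hj hx)))
    (fun j _ x _ => hasDerivAt_emb v j x)
  -- The form discretises the convection as (aw)_x, so the term a_x w is compensated by the
  -- coefficient b - a_x.
  have e0 : cip (n + 1) X (cst (b - A') * cst w) (emb v) =
      cip (n + 1) X (cst (-(ε • w₂) + A * w₁ + b * w)) (emb v) + cip (n + 1) X (cst (ε • w₂)) (emb v)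
        - cip (n + 1) X (cst (A' * w + A * w₁)) (emb v) := by
    rw [← LinearMap.add_apply, ← LinearMap.sub_apply, ← map_add, ← map_sub]
    congr 2
    ext j x
    simp
    ring
  unfold ldgFun
  rw [e0]
  simp only [jumpL_apply, jumpR_apply, Pi.mul_apply, cst_apply, ContinuousMap.mul_apply,
    emb_apply, ContinuousMap.smul_apply, smul_eq_mul, h.zero, h.one, h0, h1] at h2 h3 h4 ⊢
  have e1 : ∑ j ∈ Finset.range n, (ε * w₁ (X (j + 1)) * (v j).eval (X (j + 1)) -
        ε * w₁ (X (j + 1)) * (v (j + 1)).eval (X (j + 1))) =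
      -(∑ j ∈ Finset.range n, ε * w₁ (X (j + 1)) *
          ((v (j + 1)).eval (X (j + 1)) - (v j).eval (X (j + 1)))) := by
    rw [← Finset.sum_neg_distrib]
    exact Finset.sum_congr rfl fun j _ => by ring
  have e2 : ∑ j ∈ Finset.range n, (A (X (j + 1)) * w (X (j + 1)) * (v j).eval (X (j + 1)) -
        A (X (j + 1)) * w (X (j + 1)) * (v (j + 1)).eval (X (j + 1))) =
      -(∑ j ∈ Finset.range n, A (X (j + 1)) * w (X (j + 1)) *
          ((v (j + 1)).eval (X (j + 1)) - (v j).eval (X (j + 1)))) := by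
    rw [← Finset.sum_neg_distrib]
    exact Finset.sum_congr rfl fun j _ => by ring
  rw [e1] at h3
  rw [e2] at h4
  linear_combination h2 + h3 - h4

end Form

end LDG

end

/-! ### Layered functions and their Radau projections on one cell. -/

noncomputable section

namespace LDG

open scoped Polynomial

/-! ### Cellwise Gauss–Radau projections -/

/-- The cellwise Gauss–Radau projection interpolating at the left end points. -/
def projL (k : ℕ) (X : ℕ → ℝ) : C(ℝ, ℝ) →ₗ[ℝ] CellPoly :=
  LinearMap.pi fun j => cellRadau k (X j) (X (j + 1) - X j)

/-- The cellwise Gauss–Radau projection interpolating at the right end points. -/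
def projR (k : ℕ) (X : ℕ → ℝ) : C(ℝ, ℝ) →ₗ[ℝ] CellPoly :=
  LinearMap.pi fun j => cellRadau k (X (j + 1)) (X j - X (j + 1))

lemma projL_apply (k : ℕ) (X : ℕ → ℝ) (w : C(ℝ, ℝ)) (j : ℕ) :
    projL k X w j = cellRadau k (X j) (X (j + 1) - X j) w := rfl

lemma projR_apply (k : ℕ) (X : ℕ → ℝ) (w : C(ℝ, ℝ)) (j : ℕ) :
    projR k X w j = cellRadau k (X (j + 1)) (X j - X (j + 1)) w := rfl

lemma projL_natDegree (k : ℕ) (X : ℕ → ℝ) (w : C(ℝ, ℝ)) (j : ℕ) :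
    (projL k X w j).natDegree ≤ k := cellRadau_natDegree _ _ _ _

lemma projR_natDegree (k : ℕ) (X : ℕ → ℝ) (w : C(ℝ, ℝ)) (j : ℕ) :
    (projR k X w j).natDegree ≤ k := cellRadau_natDegree _ _ _ _

section Proj

variable {k n : ℕ} {X : ℕ → ℝ}

lemma projL_eval (h : IsGrid n X) {j : ℕ} (hj : j ≤ n) (w : C(ℝ, ℝ)) :
    (projL k X w j).eval (X j) = w (X j) :=
  cellRadau_eval_base k (sub_pos.2 (h.lt j hj)).ne' w

lemma projR_eval (h : IsGrid n X) {j : ℕ} (hj : j ≤ n) (w : C(ℝ, ℝ)) :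
    (projR k X w j).eval (X (j + 1)) = w (X (j + 1)) :=
  cellRadau_eval_base k (sub_neg.2 (h.lt j hj)).ne w

/-- Differentiation lowers the degree below k, exactly the range in which the Radau projection
preserves inner products. -/
lemma cip_projL (h : IsGrid n X) (w : C(ℝ, ℝ)) {v : CellPoly} (hv : ∀ j, (v j).natDegree ≤ k) :
    cip (n + 1) X (emb (projL k X w)) (emb (dP v)) = cip (n + 1) X (cst w) (emb (dP v)) := by
  rw [cip_apply, cip_apply]
  refine Finset.sum_congr rfl fun j hj => ?_
  have hj : j ≤ n := by simpa [Nat.lt_succ_iff] using hj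
  have := cellRadau_orth (x₀ := X j) (sub_pos.2 (h.lt j hj)).ne' w (derivative_mem_degreeLT (hv j))
  rwa [add_sub_cancel] at this

lemma cip_projR (h : IsGrid n X) (w : C(ℝ, ℝ)) {v : CellPoly} (hv : ∀ j, (v j).natDegree ≤ k) :
    cip (n + 1) X (emb (projR k X w)) (emb (dP v)) = cip (n + 1) X (cst w) (emb (dP v)) := by
  rw [cip_apply, cip_apply]
  refine Finset.sum_congr rfl fun j hj => ?_
  have hj : j ≤ n := by simpa [Nat.lt_succ_iff] using hj
  have := cellRadau_orth (x₀ := X (j + 1)) (sub_neg.2 (h.lt j hj)).ne w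
    (derivative_mem_degreeLT (hv j))
  rw [add_sub_cancel, intervalIntegral.integral_symm, intervalIntegral.integral_symm (X j),
    neg_inj] at this
  exact this

end Proj

/-! ### Layered functions -/

/-- `S` and `E` are the successive derivatives of the smooth part and of the layer part of a
function on `[0,1]`. -/
structure IsLayered (α ε D : ℝ) (k : ℕ) (S E : ℕ → C(ℝ, ℝ)) : Prop where
  dS : ∀ i, ∀ x ∈ Ioo (0 : ℝ) 1, HasDerivAt (S i) (S (i + 1) x) x
  dE : ∀ i, ∀ x ∈ Ioo (0 : ℝ) 1, HasDerivAt (E i) (E (i + 1) x) x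
  bS : ∀ i ≤ k + 2, ∀ x ∈ Icc (0 : ℝ) 1, |S i x| ≤ D
  bE : ∀ i ≤ k + 2, ∀ x ∈ Icc (0 : ℝ) 1,
    |E i x| ≤ D * (ε ^ i)⁻¹ * Real.exp (-α * (1 - x) / ε)

lemma IsLayered.nonneg {α ε D : ℝ} {k : ℕ} {S E : ℕ → C(ℝ, ℝ)} (h : IsLayered α ε D k S E) :
    0 ≤ D := (abs_nonneg _).trans (h.bS 0 (by omega) 0 (by simp))

/-- Here the size of σ enters. Of the k + 2 factors, k + 1 pair with (h/ε)^{k+1} to form the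
resolution; the remaining one is kept for its small L² norm. -/
lemma exp_le_layerFn_pow {α σ ε : ℝ} {k : ℕ} (hα : 0 < α) (hσ : (k : ℝ) + 2 ≤ σ) (hε : 0 < ε)
    {x : ℝ} (hx : x ≤ 1) : Real.exp (-α * (1 - x) / ε) ≤ layerFn α σ ε x ^ (k + 2) := by
  have hσ0 : 0 < σ := by linarith [(Nat.cast_nonneg k : (0 : ℝ) ≤ k)]
  rw [layerFn_apply, ← Real.exp_nat_mul]
  apply Real.exp_le_exp.2
  have h1 : ((k + 2 : ℕ) : ℝ) / σ ≤ 1 := by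
    rw [div_le_one hσ0]; push_cast; exact hσ
  have h2 : 0 ≤ α * (1 - x) / ε := by
    have : 0 ≤ 1 - x := by linarith
    positivity
  calc -α * (1 - x) / ε = -(1 * (α * (1 - x) / ε)) := by ring
    _ ≤ -(((k + 2 : ℕ) : ℝ) / σ * (α * (1 - x) / ε)) := by
      apply neg_le_neg
      exact mul_le_mul_of_nonneg_right h1 h2
    _ = _ := by field_simp

/-- The square has an explicit antiderivative with factor σε/(2α). The resulting factor ε offsets
the weight ε⁻¹ of the flux norm. -/
lemma integral_layerFn_sq_le {α σ ε : ℝ} (hα : 0 < α) (hσ : 0 < σ) (hε : 0 < ε) :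
    ∫ x in (0 : ℝ)..1, layerFn α σ ε x ^ 2 ≤ σ / α * ε := by
  set c := α / (σ * ε) with hc
  have hc0 : 0 < c := by positivity
  have h1 : ∫ x in (0 : ℝ)..1, layerFn α σ ε x ^ 2 =
      (2 * c)⁻¹ * layerFn α σ ε 1 ^ 2 - (2 * c)⁻¹ * layerFn α σ ε 0 ^ 2 := by
    apply intervalIntegral.integral_eq_sub_of_hasDerivAt
      (f := fun x => (2 * c)⁻¹ * layerFn α σ ε x ^ 2)
    · intro x _
      have h2 : HasDerivAt (fun x => Real.exp (-c * (1 - x))) (Real.exp (-c * (1 - x)) * c) x := by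
        have := (((hasDerivAt_id x).const_sub 1).const_mul (-c)).exp
        simpa using this
      have h3 := (h2.pow 2).const_mul (2 * c)⁻¹
      refine h3.congr_deriv ?_
      rw [layerFn_apply, ← hc]
      simp only [Nat.cast_ofNat]
      field_simp
      norm_num
    · exact Continuous.intervalIntegrable (by fun_prop) _ _
  have h2 : layerFn α σ ε 1 = 1 := by simp [layerFn_apply]
  rw [h1, h2]
  have h3 : 0 ≤ (2 * c)⁻¹ * layerFn α σ ε 0 ^ 2 := by positivity
  have h4 : (2 * c)⁻¹ ≤ c⁻¹ := by
    apply inv_anti₀ hc0; linarith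
  have h5 : c⁻¹ = σ / α * ε := by rw [hc]; field_simp
  rw [← h5]
  linarith

/-! ### Polynomial approximation on a cell -/

/-- The Taylor polynomial of degree `k` at `x₀` for a sequence of successive derivatives. -/
def taylorPoly (k : ℕ) (W : ℕ → C(ℝ, ℝ)) (x₀ : ℝ) : ℝ[X] :=
  ∑ i ∈ Finset.range (k + 1), Polynomial.C (W i x₀ / (i.factorial : ℝ)) *
    (Polynomial.X - Polynomial.C x₀) ^ i

lemma taylorPoly_natDegree (k : ℕ) (W : ℕ → C(ℝ, ℝ)) (x₀ : ℝ) :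
    (taylorPoly k W x₀).natDegree ≤ k := by
  apply Polynomial.natDegree_sum_le_of_forall_le
  intro i hi
  refine (Polynomial.natDegree_C_mul_le _ _).trans (Polynomial.natDegree_pow_le.trans ?_)
  rw [Polynomial.natDegree_X_sub_C]
  have := Finset.mem_range.1 hi
  omega

lemma taylorPoly_eval (k : ℕ) (W : ℕ → C(ℝ, ℝ)) (x₀ x : ℝ) : (taylorPoly k W x₀).eval x =
    ∑ i ∈ Finset.range (k + 1), W i x₀ / (i.factorial : ℝ) * (x - x₀) ^ i := by
  simp [taylorPoly, Polynomial.eval_finsetSum]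

lemma exists_poly_smooth {k : ℕ} {F : ℕ → C(ℝ, ℝ)} {D l r x₀ : ℝ}
    (hd : ∀ i, ∀ x ∈ Ioo l r, HasDerivAt (F i) (F (i + 1) x) x)
    (hb : ∀ x ∈ Icc l r, |F (k + 1) x| ≤ D) (hx₀ : x₀ ∈ Icc l r) :
    ∃ p : ℝ[X], p.natDegree ≤ k ∧ ∀ x ∈ Icc l r, |F 0 x - p.eval x| ≤ D * (r - l) ^ (k + 1) := by
  refine ⟨taylorPoly k F x₀, taylorPoly_natDegree _ _ _, fun x hx => ?_⟩
  have hsub : uIcc x₀ x ⊆ Icc l r := uIcc_subset_Icc hx₀ hx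
  rw [taylorPoly_eval]
  refine (abs_taylor_remainder_le (k + 1) (fun i => F i) D (fun i => (F i).continuous.continuousOn)
    hd x₀ hx₀ x hx (fun y hy => hb y (hsub hy))).trans ?_
  have hD : 0 ≤ D := (abs_nonneg _).trans (hb x hx)
  apply mul_le_mul_of_nonneg_left _ hD
  apply pow_le_pow_left₀ (abs_nonneg _)
  rw [abs_le]
  constructor <;> linarith [hx.1, hx.2, hx₀.1, hx₀.2]

/-- On a cell wider than ε the layer is approximated by zero, since its size is already a power of
the resolution; on a narrower cell a Taylor polynomial gains (h/ε)^{k+1}. One factor of the layer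
function is left over, evaluated at max(x₀, x). Expanding at the left end makes this e(x), an
increasing majorant. -/
lemma exists_poly_layer {k : ℕ} {α σ ε D : ℝ} {F : ℕ → C(ℝ, ℝ)} {X : ℕ → ℝ} {j : ℕ} {x₀ : ℝ}
    (hα : 0 < α) (hσ : 0 < σ) (hε : 0 < ε) (hD : 0 ≤ D)
    (hd : ∀ i, ∀ x ∈ Ioo (X j) (X (j + 1)), HasDerivAt (F i) (F (i + 1) x) x)
    (hb : ∀ i ≤ k + 1, ∀ x ∈ Icc (X j) (X (j + 1)),
      |F i x| ≤ D * (ε ^ i)⁻¹ * layerFn α σ ε x ^ (k + 2))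
    (hx₀ : x₀ ∈ Icc (X j) (X (j + 1))) :
    ∃ p : ℝ[X], p.natDegree ≤ k ∧ ∀ x ∈ Icc (X j) (X (j + 1)),
      |F 0 x - p.eval x| ≤ D * cellRes α σ ε X j ^ (k + 1) * layerFn α σ ε (max x₀ x) := by
  set e := layerFn α σ ε with he
  have epos : ∀ x, 0 < e x := layerFn_pos α σ ε
  have emono : Monotone e := layerFn_mono hα hσ hε
  have hlr : X j ≤ X (j + 1) := hx₀.1.trans hx₀.2
  have hr : ∀ x ∈ Icc (X j) (X (j + 1)), e x ^ (k + 1) ≤ e (X (j + 1)) ^ (k + 1) := fun x hx =>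
    pow_le_pow_left₀ (epos x).le (emono hx.2) _
  rcases le_total 1 ((X (j + 1) - X j) / ε) with hh | hh
  · refine ⟨0, by simp, fun x hx => ?_⟩
    have h2 := hb 0 (by omega) x hx
    rw [cellRes, min_eq_left hh, one_mul, Polynomial.eval_zero, sub_zero]
    simp only [pow_zero, inv_one, mul_one] at h2
    refine h2.trans ?_
    rw [mul_assoc, pow_succ]
    apply mul_le_mul_of_nonneg_left _ hD
    exact mul_le_mul (hr x hx) (emono (le_max_right _ _)) (epos x).le
      (pow_nonneg (epos _).le _)
  · refine ⟨taylorPoly k F x₀, taylorPoly_natDegree _ _ _, fun x hx => ?_⟩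
    have hm : max x₀ x ∈ Icc (X j) (X (j + 1)) :=
      ⟨hx₀.1.trans (le_max_left _ _), max_le hx₀.2 hx.2⟩
    rw [taylorPoly_eval]
    have hsub : uIcc x₀ x ⊆ Icc (X j) (X (j + 1)) := uIcc_subset_Icc hx₀ hx
    refine (abs_taylor_remainder_le (k + 1) (fun i => F i)
      (D * (ε ^ (k + 1))⁻¹ * e (max x₀ x) ^ (k + 2)) (fun i => (F i).continuous.continuousOn)
      hd x₀ hx₀ x hx (fun y hy => (hb (k + 1) le_rfl y (hsub hy)).trans ?_)).trans ?_
    · apply mul_le_mul_of_nonneg_left _ (by positivity)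
      exact pow_le_pow_left₀ (epos y).le (emono (by
        rw [uIcc, mem_Icc] at hy; exact hy.2)) _
    · have h3 : |x - x₀| ≤ X (j + 1) - X j := by
        rw [abs_le]
        constructor <;> linarith [hx.1, hx.2, hx₀.1, hx₀.2]
      have h4 : |x - x₀| ^ (k + 1) ≤ (X (j + 1) - X j) ^ (k + 1) :=
        pow_le_pow_left₀ (abs_nonneg _) h3 _
      rw [cellRes, min_eq_right hh]
      calc D * (ε ^ (k + 1))⁻¹ * e (max x₀ x) ^ (k + 2) * |x - x₀| ^ (k + 1)
          ≤ D * (ε ^ (k + 1))⁻¹ * (e (X (j + 1)) ^ (k + 1) * e (max x₀ x)) *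
              (X (j + 1) - X j) ^ (k + 1) := by
            have h5 : e (max x₀ x) ^ (k + 2) ≤ e (X (j + 1)) ^ (k + 1) * e (max x₀ x) := by
              rw [pow_succ]
              exact mul_le_mul_of_nonneg_right (hr _ hm) (epos _).le
            have h6 := epos (max x₀ x)
            have h7 := epos (X (j + 1))
            have h8 : 0 ≤ D * (ε ^ (k + 1))⁻¹ * (e (X (j + 1)) ^ (k + 1) * e (max x₀ x)) := by
              positivity
            gcongr
        _ = _ := by rw [← he, mul_pow, div_pow]; field_simp

/-! ### Errors of the projections -/

/-- The smooth part is compared with its Taylor polynomial and the layer part with the polynomial of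
`exists_poly_layer`. The projection being quasi-optimal in the maximum norm, the two errors add. -/
lemma exists_projR_error (k : ℕ) : ∃ C, 1 ≤ C ∧ ∀ {α σ ε D ϖ Cm : ℝ} {n : ℕ} {X : ℕ → ℝ}
    {S E : ℕ → C(ℝ, ℝ)}, 0 < α → (k : ℝ) + 2 ≤ σ → 0 < ε → IsLayerMesh α σ ε ϖ Cm n X →
    IsLayered α ε D k S E → ∀ j ≤ n, ∀ x ∈ Icc (X j) (X (j + 1)),
      |(projR k X (S 0 + E 0) j).eval x - (S 0 + E 0) x| ≤
        C * D * ((X (j + 1) - X j) ^ (k + 1) + cellRes α σ ε X j ^ (k + 1)) := by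
  obtain ⟨C, hC, herr⟩ := exists_cellRadau_error k
  refine ⟨C, hC, ?_⟩
  intro α σ ε D ϖ Cm n X S E hα hσ hε hX hSE j hj x hx
  have hσ0 : 0 < σ := by linarith [(Nat.cast_nonneg k : (0 : ℝ) ≤ k)]
  have hg := hX.isGrid
  have hlt := hX.lt j hj
  have hD := hSE.nonneg
  have hH : X j - X (j + 1) ≠ 0 := (sub_neg.2 hlt).ne
  have hcell : ∀ y ∈ Icc (0 : ℝ) 1, X (j + 1) + (X j - X (j + 1)) * y ∈ Icc (X j) (X (j + 1)) :=
    fun y hy => ⟨by nlinarith [hy.1, hy.2], by nlinarith [hy.1, hy.2]⟩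
  obtain ⟨y, hy, rfl⟩ : ∃ y ∈ Icc (0 : ℝ) 1, X (j + 1) + (X j - X (j + 1)) * y = x := by
    refine ⟨(X (j + 1) - x) / (X (j + 1) - X j), ⟨div_nonneg (by linarith [hx.2]) (by linarith),
      (div_le_one (by linarith)).2 (by linarith [hx.1])⟩, ?_⟩
    have : X (j + 1) - X j ≠ 0 := (sub_pos.2 hlt).ne'
    field_simp
    ring
  have h1 : X (j + 1) ≤ 1 := (hg.mem (by omega)).2
  obtain ⟨p, hp, hpb⟩ := exists_poly_smooth (k := k) (x₀ := X j) (D := D)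
    (fun i x hx => hSE.dS i x (hg.Ioo_subset hj hx))
    (fun x hx => hSE.bS (k + 1) (by omega) x (hg.Icc_subset hj hx)) (left_mem_Icc.2 hlt.le)
  obtain ⟨p', hp', hpb'⟩ := exists_poly_layer (k := k) (x₀ := X j) (σ := σ) hα hσ0 hε hD
    (fun i x hx => hSE.dE i x (hg.Ioo_subset hj hx))
    (fun i hi x hx => (hSE.bE i (by omega) x (hg.Icc_subset hj hx)).trans
      (mul_le_mul_of_nonneg_left (exp_le_layerFn_pow hα hσ hε (hx.2.trans h1))
        (by positivity))) (left_mem_Icc.2 hlt.le)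
  have hres := cellRes_nonneg (α := α) (σ := σ) hε hlt.le
  have e1 := herr (X (j + 1)) (X j - X (j + 1)) (S 0) p _ hH hp
    (fun y hy => hpb _ (hcell y hy)) y hy
  have e2 := herr (X (j + 1)) (X j - X (j + 1)) (E 0) p' (D * cellRes α σ ε X j ^ (k + 1)) hH hp'
    (fun y hy => (hpb' _ (hcell y hy)).trans (mul_le_of_le_one_right (by positivity)
      (layerFn_le_one hα hσ0 hε (max_le (hlt.le.trans h1) ((hcell y hy).2.trans h1))))) y hy
  rw [projR_apply, map_add, Polynomial.eval_add, ContinuousMap.add_apply]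
  rw [abs_le] at e1 e2 ⊢
  constructor <;> linarith

/-- The smooth part of the flux keeps a factor ε. The layer part of εu_x is of order one, so besides
the pointwise bound for the outflow trace it needs an L² bound that retains ∫ e². -/
lemma exists_projL_error (k : ℕ) : ∃ C, 1 ≤ C ∧ ∀ {α σ ε D ϖ Cm : ℝ} {n : ℕ} {X : ℕ → ℝ}
    {S E : ℕ → C(ℝ, ℝ)}, 0 < α → (k : ℝ) + 2 ≤ σ → 0 < ε → IsLayerMesh α σ ε ϖ Cm n X →
    IsLayered α ε D k S E → ∀ j ≤ n,
      (∀ x ∈ Icc (X j) (X (j + 1)),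
        |(projL k X (ε • S 1) j).eval x - (ε • S 1) x| ≤
          C * D * ε * (X (j + 1) - X j) ^ (k + 1)) ∧
      (∀ x ∈ Icc (X j) (X (j + 1)),
        |(projL k X (ε • E 1) j).eval x - (ε • E 1) x| ≤
          C * D * cellRes α σ ε X j ^ (k + 1)) ∧
      ∫ x in (X j)..(X (j + 1)), ((projL k X (ε • E 1) j).eval x - (ε • E 1) x) ^ 2 ≤
        C * (D * cellRes α σ ε X j ^ (k + 1)) ^ 2 *
          ∫ x in (X j)..(X (j + 1)), layerFn α σ ε x ^ 2 := by
  obtain ⟨C, hC, herr⟩ := exists_cellRadau_error k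
  obtain ⟨C', hC', hl2⟩ := exists_cellRadau_l2 k
  refine ⟨C + (2 * C' + 2), by linarith, ?_⟩
  intro α σ ε D ϖ Cm n X S E hα hσ hε hX hSE j hj
  have hσ0 : 0 < σ := by linarith [(Nat.cast_nonneg k : (0 : ℝ) ≤ k)]
  have hg := hX.isGrid
  have hlt := hX.lt j hj
  have hD := hSE.nonneg
  have hH : X (j + 1) - X j ≠ 0 := (sub_pos.2 hlt).ne'
  have hcell : ∀ y ∈ Icc (0 : ℝ) 1, X j + (X (j + 1) - X j) * y ∈ Icc (X j) (X (j + 1)) :=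
    fun y hy => ⟨by nlinarith [hy.1, hy.2], by nlinarith [hy.1, hy.2]⟩
  have hcell' : ∀ x ∈ Icc (X j) (X (j + 1)), ∃ y ∈ Icc (0 : ℝ) 1,
      X j + (X (j + 1) - X j) * y = x := by
    intro x hx
    refine ⟨(x - X j) / (X (j + 1) - X j), ⟨div_nonneg (by linarith [hx.1]) (by linarith),
      (div_le_one (by linarith)).2 (by linarith [hx.2])⟩, ?_⟩
    field_simp
    ring
  have h1 : X (j + 1) ≤ 1 := (hg.mem (by omega)).2
  obtain ⟨p, hp, hpb⟩ := exists_poly_smooth (k := k) (x₀ := X j) (D := ε * D)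
    (F := fun i => ε • S (i + 1))
    (fun i x hx => (hSE.dS (i + 1) x (hg.Ioo_subset hj hx)).const_smul ε)
    (fun x hx => by
      rw [ContinuousMap.smul_apply, smul_eq_mul, abs_mul, abs_of_pos hε]
      exact mul_le_mul_of_nonneg_left (hSE.bS (k + 2) (by omega) x (hg.Icc_subset hj hx)) hε.le)
    (left_mem_Icc.2 hlt.le)
  obtain ⟨p', hp', hpb'⟩ := exists_poly_layer (k := k) (x₀ := X j) (σ := σ) hα hσ0 hε hD
    (F := fun i => ε • E (i + 1))
    (fun i x hx => (hSE.dE (i + 1) x (hg.Ioo_subset hj hx)).const_smul ε)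
    (fun i hi x hx => by
      rw [ContinuousMap.smul_apply, smul_eq_mul, abs_mul, abs_of_pos hε]
      calc ε * |E (i + 1) x| ≤ ε * (D * (ε ^ (i + 1))⁻¹ * layerFn α σ ε x ^ (k + 2)) := by
            apply mul_le_mul_of_nonneg_left _ hε.le
            exact (hSE.bE (i + 1) (by omega) x (hg.Icc_subset hj hx)).trans
              (mul_le_mul_of_nonneg_left (exp_le_layerFn_pow hα hσ hε (hx.2.trans h1))
                (by positivity))
        _ = _ := by rw [pow_succ]; field_simp) (left_mem_Icc.2 hlt.le)
  have hres := cellRes_nonneg (α := α) (σ := σ) hε hlt.le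
  have hmax : ∀ x ∈ Icc (X j) (X (j + 1)), max (X j) x = x := fun x hx => max_eq_right hx.1
  refine ⟨?_, ?_, ?_⟩
  · intro x hx
    obtain ⟨y, hy, rfl⟩ := hcell' x hx
    refine (herr (X j) (X (j + 1) - X j) (ε • S 1) p _ hH hp
      (fun y hy => hpb _ (hcell y hy)) y hy).trans ?_
    have : 0 ≤ ε * D * (X (j + 1) - X j) ^ (k + 1) := by
      have := (sub_pos.2 hlt).le
      positivity
    nlinarith
  · intro x hx
    obtain ⟨y, hy, rfl⟩ := hcell' x hx
    refine (herr (X j) (X (j + 1) - X j) (ε • E 1) p' (D * cellRes α σ ε X j ^ (k + 1)) hH hp'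
      (fun y hy => (hpb' _ (hcell y hy)).trans (mul_le_of_le_one_right (by positivity)
        (layerFn_le_one hα hσ0 hε (max_le (hlt.le.trans h1) ((hcell y hy).2.trans h1)))))
      y hy).trans ?_
    have : 0 ≤ D * cellRes α σ ε X j ^ (k + 1) := by positivity
    nlinarith
  · set A := D * cellRes α σ ε X j ^ (k + 1) with hA
    have hA0 : 0 ≤ A := by positivity
    -- After subtracting p', the remainder has the increasing majorant A e(x), as required by the L²
    -- stability of the left projection.
    have hgb : ∀ x ∈ Icc (X j) (X (j + 1)), |(ε • E 1 - polyC p') x| ≤ (A • layerFn α σ ε) x := by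
      intro x hx
      have := hpb' x hx
      rw [hmax x hx] at this
      exact this
    have h3 := hl2 (X j) (X (j + 1)) (ε • E 1 - polyC p') (A • layerFn α σ ε) hlt
      (((layerFn_mono hα hσ0 hε).const_mul hA0).monotoneOn _) hgb
    have h4 : ∫ x in (X j)..(X (j + 1)), (A • layerFn α σ ε) x ^ 2 =
        A ^ 2 * ∫ x in (X j)..(X (j + 1)), layerFn α σ ε x ^ 2 := by
      rw [← intervalIntegral.integral_const_mul]
      exact intervalIntegral.integral_congr fun x _ => by simp [mul_pow]
    rw [map_sub, cellRadau_polyC hH hp', h4] at h3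
    have h5 : ∫ x in (X j)..(X (j + 1)), ((projL k X (ε • E 1) j).eval x - (ε • E 1) x) ^ 2 ≤
        ∫ x in (X j)..(X (j + 1)),
          (2 * (cellRadau k (X j) (X (j + 1) - X j) (ε • E 1) - p').eval x ^ 2 +
            2 * A ^ 2 * layerFn α σ ε x ^ 2) := by
      apply intervalIntegral.integral_mono_on hlt.le
      · exact Continuous.intervalIntegrable (by fun_prop) _ _
      · exact Continuous.intervalIntegrable (by fun_prop) _ _
      · intro x hx
        have h6 := hgb x hx
        have h7 : (ε • E 1 - polyC p') x ^ 2 ≤ (A * layerFn α σ ε x) ^ 2 :=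
          sq_le_sq' (abs_le.1 h6).1 (abs_le.1 h6).2
        rw [projL_apply, Polynomial.eval_sub]
        simp only [ContinuousMap.sub_apply, polyC_apply] at h7
        nlinarith [sq_nonneg (((cellRadau k (X j) (X (j + 1) - X j)) (ε • E 1)).eval x -
          p'.eval x + ((ε • E 1) x - p'.eval x))]
    rw [intervalIntegral.integral_add (Continuous.intervalIntegrable (by fun_prop) _ _)
      (Continuous.intervalIntegrable (by fun_prop) _ _), intervalIntegral.integral_const_mul,
      intervalIntegral.integral_const_mul] at h5
    have h6 : 0 ≤ ∫ x in (X j)..(X (j + 1)), layerFn α σ ε x ^ 2 :=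
      intervalIntegral.integral_nonneg hlt.le fun x _ => sq_nonneg _
    nlinarith [mul_nonneg (sq_nonneg A) h6]

end LDG

end

/-! ### Global projection errors and the error functional of the form. -/

noncomputable section

namespace LDG

open scoped Polynomial

section

variable {n : ℕ} {X : ℕ → ℝ} {α σ ε D ϖ Cm : ℝ}

lemma IsLayerMesh.cm_nonneg (h : IsLayerMesh α σ ε ϖ Cm n X) (hε : 0 < ε) : 0 ≤ Cm :=
  (Finset.sum_nonneg fun j hj => cellRes_nonneg hε
    (h.lt j (by simpa [Nat.lt_succ_iff] using hj)).le).trans h.sum_res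

lemma IsLayerMesh.width_pow_le (h : IsLayerMesh α σ ε ϖ Cm n X) {j : ℕ} (hj : j ≤ n) (i : ℕ) :
    (X (j + 1) - X j) ^ i ≤ (Cm * ϖ) ^ i :=
  pow_le_pow_left₀ (sub_nonneg.2 (h.lt j hj).le) (h.width j hj) _

lemma IsLayerMesh.res_pow_le (h : IsLayerMesh α σ ε ϖ Cm n X) (hε : 0 < ε) {j : ℕ} (hj : j ≤ n)
    (i : ℕ) : cellRes α σ ε X j ^ i ≤ (Cm * ϖ) ^ i :=
  pow_le_pow_left₀ (cellRes_nonneg hε (h.lt j hj).le) (h.res j hj) _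

/-- The error of the projection of a layered function in `L²`. -/
lemma exists_projR_l2 (k : ℕ) (Cm : ℝ) : ∃ C, 0 ≤ C ∧ ∀ {α σ ε D ϖ : ℝ} {n : ℕ} {X : ℕ → ℝ}
    {S E : ℕ → C(ℝ, ℝ)}, 0 < α → (k : ℝ) + 2 ≤ σ → 0 < ε → 0 ≤ ϖ → IsLayerMesh α σ ε ϖ Cm n X →
    IsLayered α ε D k S E →
      cip (n + 1) X (emb (projR k X (S 0 + E 0)) - cst (S 0 + E 0))
        (emb (projR k X (S 0 + E 0)) - cst (S 0 + E 0)) ≤ (C * (D * ϖ ^ (k + 1))) ^ 2 ∧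
      ∑ j ∈ Finset.range (n + 1),
        ((projR k X (S 0 + E 0) j).eval (X j) - (S 0 + E 0) (X j)) ^ 2 ≤
          (C * D) ^ 2 * ϖ ^ (2 * k + 1) := by
  obtain ⟨C, hC, h⟩ := exists_projR_error k
  refine ⟨2 * C * (1 + |Cm|) ^ (k + 1), by positivity, ?_⟩
  intro α σ ε D ϖ n X S E hα hσ hε hϖ hX hSE
  have hD := hSE.nonneg
  have hCm := hX.cm_nonneg hε
  have hC0 : 0 ≤ C := by linarith
  rw [abs_of_nonneg hCm]
  constructor
  · apply cip_self_le_of_abs_le hX.isGrid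
    intro j hj x hx
    refine (h hα hσ hε hX hSE j hj x hx).trans ?_
    calc C * D * ((X (j + 1) - X j) ^ (k + 1) + cellRes α σ ε X j ^ (k + 1))
        ≤ C * D * ((Cm * ϖ) ^ (k + 1) + (Cm * ϖ) ^ (k + 1)) := by
          exact mul_le_mul_of_nonneg_left
            (add_le_add (hX.width_pow_le hj _) (hX.res_pow_le hε hj _)) (by positivity)
      _ = 2 * C * Cm ^ (k + 1) * (D * ϖ ^ (k + 1)) := by rw [mul_pow]; ring
      _ ≤ 2 * C * (1 + Cm) ^ (k + 1) * (D * ϖ ^ (k + 1)) := by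
          gcongr; linarith
  -- Only 2k + 1 of the 2k + 2 powers are replaced by ϖ. The last factor h_j or resolution is kept
  -- because its sum over the cells is bounded, so the number of cells does not enter. This costs
  -- half an order.
  · have key : ∀ j ∈ Finset.range (n + 1),
        ((projR k X (S 0 + E 0) j).eval (X j) - (S 0 + E 0) (X j)) ^ 2 ≤
          2 * (C * D) ^ 2 * (Cm * ϖ) ^ (2 * k + 1) *
            ((X (j + 1) - X j) + cellRes α σ ε X j) := by
      intro j hj
      have hj : j ≤ n := by simpa [Nat.lt_succ_iff] using hj
      have hw0 : 0 ≤ X (j + 1) - X j := sub_nonneg.2 (hX.lt j hj).le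
      have hr0 : 0 ≤ cellRes α σ ε X j := cellRes_nonneg hε (hX.lt j hj).le
      have h1 := h hα hσ hε hX hSE j hj (X j) (left_mem_Icc.2 (hX.lt j hj).le)
      have h2 : ∀ z : ℝ, 0 ≤ z → z ^ (2 * k + 1) ≤ (Cm * ϖ) ^ (2 * k + 1) →
          (z ^ (k + 1)) ^ 2 ≤ (Cm * ϖ) ^ (2 * k + 1) * z := by
        intro z hz hz'
        calc (z ^ (k + 1)) ^ 2 = z ^ (2 * k + 1) * z := by ring
          _ ≤ _ := by gcongr
      have h3 := h2 _ hw0 (hX.width_pow_le hj _)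
      have h4 := h2 _ hr0 (hX.res_pow_le hε hj _)
      calc ((projR k X (S 0 + E 0) j).eval (X j) - (S 0 + E 0) (X j)) ^ 2
          ≤ (C * D * ((X (j + 1) - X j) ^ (k + 1) + cellRes α σ ε X j ^ (k + 1))) ^ 2 :=
            sq_le_sq' (abs_le.1 h1).1 (abs_le.1 h1).2
        _ = (C * D) ^ 2 * ((X (j + 1) - X j) ^ (k + 1) + cellRes α σ ε X j ^ (k + 1)) ^ 2 := by ring
        _ ≤ (C * D) ^ 2 * (2 * ((Cm * ϖ) ^ (2 * k + 1) *
              ((X (j + 1) - X j) + cellRes α σ ε X j))) := by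
            gcongr
            nlinarith [sq_nonneg ((X (j + 1) - X j) ^ (k + 1) - cellRes α σ ε X j ^ (k + 1))]
        _ = _ := by ring
    refine (Finset.sum_le_sum key).trans ?_
    rw [← Finset.mul_sum, Finset.sum_add_distrib, Finset.sum_range_sub, hX.one, hX.zero]
    have h5 := hX.sum_res
    calc 2 * (C * D) ^ 2 * (Cm * ϖ) ^ (2 * k + 1) *
          (1 - 0 + ∑ j ∈ Finset.range (n + 1), cellRes α σ ε X j)
        ≤ 2 * (C * D) ^ 2 * (Cm * ϖ) ^ (2 * k + 1) * (1 + Cm) := by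
          gcongr; linarith
      _ = (C * D) ^ 2 * (2 * (Cm ^ (2 * k + 1) * (1 + Cm))) * ϖ ^ (2 * k + 1) := by
          rw [mul_pow]; ring
      _ ≤ (C * D) ^ 2 * (4 * ((1 + Cm) ^ (2 * k + 1) * (1 + Cm))) * ϖ ^ (2 * k + 1) := by
          gcongr <;> linarith
      _ = _ := by ring

/-- Stability of the left projection for functions bounded by the layer function. -/
lemma exists_projL_layer (k : ℕ) (α σ : ℝ) (hα : 0 < α) (hσ : 0 < σ) : ∃ C, 1 ≤ C ∧
    ∀ {ε ϖ G Cm : ℝ} {n : ℕ} {X : ℕ → ℝ} (g : C(ℝ, ℝ)), 0 < ε → IsLayerMesh α σ ε ϖ Cm n X →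
    0 ≤ G → (∀ x ∈ Icc (0 : ℝ) 1, |g x| ≤ G * layerFn α σ ε x) →
      ε⁻¹ * cip (n + 1) X (emb (projL k X g)) (emb (projL k X g)) ≤ (C * G) ^ 2 ∧
      |(projL k X g n).eval (X (n + 1))| ≤ C * G := by
  obtain ⟨C, hC, hl2⟩ := exists_cellRadau_l2 k
  obtain ⟨C', hC', hsup⟩ := exists_cellRadau_sup k
  have h0 : 0 < σ / α := by positivity
  refine ⟨C' + C * (1 + σ / α), by nlinarith, ?_⟩
  intro ε ϖ G Cm n X g hε hX hG hg
  have hgr := hX.isGrid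
  constructor
  · have h1 : cip (n + 1) X (emb (projL k X g)) (emb (projL k X g)) ≤
        ∑ j ∈ Finset.range (n + 1), C * G ^ 2 * ∫ x in (X j)..(X (j + 1)), layerFn α σ ε x ^ 2 := by
      rw [cip_apply]
      refine Finset.sum_le_sum fun j hj => ?_
      have hj : j ≤ n := by simpa [Nat.lt_succ_iff] using hj
      -- The layer function is increasing, so it serves as the majorant for L² stability on every
      -- cell.
      have h2 := hl2 (X j) (X (j + 1)) g (G • layerFn α σ ε) (hX.lt j hj)
        (((layerFn_mono hα hσ hε).const_mul hG).monotoneOn _)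
        (fun x hx => hg x (hgr.Icc_subset hj hx))
      have h3 : ∫ x in (X j)..(X (j + 1)), (G • layerFn α σ ε) x ^ 2 =
          G ^ 2 * ∫ x in (X j)..(X (j + 1)), layerFn α σ ε x ^ 2 := by
        rw [← intervalIntegral.integral_const_mul]
        exact intervalIntegral.integral_congr fun x _ => by simp [mul_pow]
      rw [h3, ← mul_assoc] at h2
      simp_rw [sq] at h2 ⊢
      exact h2
    rw [← Finset.mul_sum] at h1
    have h4 := integral_eq_sum_cells hgr (layerFn α σ ε ^ 2)
    simp only [ContinuousMap.pow_apply] at h4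
    rw [h4] at h1
    have h5 := integral_layerFn_sq_le hα hσ hε
    calc ε⁻¹ * cip (n + 1) X (emb (projL k X g)) (emb (projL k X g))
        ≤ ε⁻¹ * (C * G ^ 2 * (σ / α * ε)) := by
          gcongr
          exact h1.trans (by gcongr)
      _ = (C * (σ / α)) * G ^ 2 := by field_simp
      _ ≤ (C' + C * (1 + σ / α)) ^ 2 * G ^ 2 := by
          gcongr
          nlinarith [mul_pos (show 0 < C by linarith) h0]
      _ = _ := by ring
  · have hlt := hX.lt n le_rfl
    have h1 := (hsup (X n) (X (n + 1) - X n) g G (sub_pos.2 hlt).ne' (fun y hy => by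
      have hmem : X n + (X (n + 1) - X n) * y ∈ Icc (X n) (X (n + 1)) :=
        ⟨by nlinarith [hy.1, hy.2], by nlinarith [hy.1, hy.2]⟩
      have hm := hgr.Icc_subset le_rfl hmem
      refine (hg _ hm).trans ?_
      have := layerFn_le_one hα hσ hε hm.2
      nlinarith) 1 (by simp)).1
    rw [mul_one, add_sub_cancel] at h1
    rw [projL_apply]
    refine h1.trans ?_
    have : 0 ≤ C * (1 + σ / α) := by positivity
    nlinarith

/-- The error of the projection of the flux of a layered function. -/
lemma exists_projL_l2 (k : ℕ) (α σ Cm : ℝ) (hα : 0 < α) (hσ : (k : ℝ) + 2 ≤ σ) : ∃ C, 0 ≤ C ∧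
    ∀ {ε D ϖ : ℝ} {n : ℕ} {X : ℕ → ℝ}
    {S E : ℕ → C(ℝ, ℝ)}, 0 < ε → ε ≤ 1 → 0 ≤ ϖ → IsLayerMesh α σ ε ϖ Cm n X →
    IsLayered α ε D k S E →
      ε⁻¹ * cip (n + 1) X (emb (projL k X (ε • (S 1 + E 1))) - cst (ε • (S 1 + E 1)))
        (emb (projL k X (ε • (S 1 + E 1))) - cst (ε • (S 1 + E 1))) ≤
          (C * (D * ϖ ^ (k + 1))) ^ 2 ∧
      |(projL k X (ε • (S 1 + E 1)) n).eval (X (n + 1)) - (ε • (S 1 + E 1)) (X (n + 1))| ≤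
          C * (D * ϖ ^ (k + 1)) := by
  obtain ⟨C, hC, h⟩ := exists_projL_error k
  have hσ0 : 0 < σ := by linarith [(Nat.cast_nonneg k : (0 : ℝ) ≤ k)]
  have h0 : 0 < σ / α := by positivity
  refine ⟨2 * C * (1 + |Cm|) ^ (k + 1) * (1 + σ / α), by positivity, ?_⟩
  intro ε D ϖ n X S E hε hε1 hϖ hX hSE
  have hD := hSE.nonneg
  have hCm := hX.cm_nonneg hε
  have hC0 : 0 ≤ C := by linarith
  have hgr := hX.isGrid
  rw [abs_of_nonneg hCm]
  set Z := D * ϖ ^ (k + 1) with hZ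
  have hZ0 : 0 ≤ Z := by positivity
  have hB0 : 1 ≤ (1 + Cm) ^ (k + 1) := one_le_pow₀ (by linarith)
  have hBC : Cm ^ (k + 1) ≤ (1 + Cm) ^ (k + 1) := pow_le_pow_left₀ hCm (by linarith) _
  set B := (1 + Cm) ^ (k + 1) with hB
  have hw : ∀ j ≤ n, D * (X (j + 1) - X j) ^ (k + 1) ≤ B * Z := fun j hj => by
    calc D * (X (j + 1) - X j) ^ (k + 1) ≤ D * (Cm * ϖ) ^ (k + 1) := by
          exact mul_le_mul_of_nonneg_left (hX.width_pow_le hj _) hD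
      _ = Cm ^ (k + 1) * Z := by rw [mul_pow]; ring
      _ ≤ B * Z := by gcongr
  have hr : ∀ j ≤ n, D * cellRes α σ ε X j ^ (k + 1) ≤ B * Z := fun j hj => by
    calc D * cellRes α σ ε X j ^ (k + 1) ≤ D * (Cm * ϖ) ^ (k + 1) := by
          exact mul_le_mul_of_nonneg_left (hX.res_pow_le hε hj _) hD
      _ = Cm ^ (k + 1) * Z := by rw [mul_pow]; ring
      _ ≤ B * Z := by gcongr
  set ηS : CellFn := emb (projL k X (ε • S 1)) - cst (ε • S 1) with hηS
  set ηE : CellFn := emb (projL k X (ε • E 1)) - cst (ε • E 1) with hηE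
  have hsplit : emb (projL k X (ε • (S 1 + E 1))) - cst (ε • (S 1 + E 1)) = ηS + ηE := by
    rw [hηS, hηE, smul_add, map_add, map_add, map_add]
    abel
  constructor
  · rw [hsplit]
    -- The weight ε⁻¹ is offset by the explicit factor ε in the smooth part, and by ∫ e² ≤ (σ/α)ε in
    -- the layer part.
    have h1 : cip (n + 1) X ηS ηS ≤ (C * ε * (B * Z)) ^ 2 := by
      apply cip_self_le_of_abs_le hgr
      intro j hj x hx
      refine ((h hα hσ hε hX hSE j hj).1 x hx).trans ?_
      calc C * D * ε * (X (j + 1) - X j) ^ (k + 1)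
          = C * ε * (D * (X (j + 1) - X j) ^ (k + 1)) := by ring
        _ ≤ _ := mul_le_mul_of_nonneg_left (hw j hj) (by positivity)
    have h2 : cip (n + 1) X ηE ηE ≤
        ∑ j ∈ Finset.range (n + 1),
          C * (B * Z) ^ 2 * ∫ x in (X j)..(X (j + 1)), layerFn α σ ε x ^ 2 := by
      rw [cip_apply]
      refine Finset.sum_le_sum fun j hj => ?_
      have hj : j ≤ n := by simpa [Nat.lt_succ_iff] using hj
      have h3 := (h hα hσ hε hX hSE j hj).2.2
      have h4 : 0 ≤ ∫ x in (X j)..(X (j + 1)), layerFn α σ ε x ^ 2 :=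
        intervalIntegral.integral_nonneg (hX.lt j hj).le fun x _ => sq_nonneg _
      have h5 : 0 ≤ D * cellRes α σ ε X j ^ (k + 1) := by
        have := cellRes_nonneg (α := α) (σ := σ) hε (hX.lt j hj).le
        positivity
      have h6 : (D * cellRes α σ ε X j ^ (k + 1)) ^ 2 ≤ (B * Z) ^ 2 :=
        pow_le_pow_left₀ h5 (hr j hj) 2
      simp only [hηE, Pi.sub_apply, ContinuousMap.sub_apply, emb_apply, cst_apply, ← sq]
      refine h3.trans ?_
      gcongr
    rw [← Finset.mul_sum] at h2
    have h4 := integral_eq_sum_cells hgr (layerFn α σ ε ^ 2)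
    simp only [ContinuousMap.pow_apply] at h4
    rw [h4] at h2
    have h5 := integral_layerFn_sq_le hα hσ0 hε
    have h6 : cip (n + 1) X ηE ηE ≤ C * (B * Z) ^ 2 * (σ / α * ε) := h2.trans (by gcongr)
    calc ε⁻¹ * cip (n + 1) X (ηS + ηE) (ηS + ηE)
        ≤ ε⁻¹ * (2 * (C * ε * (B * Z)) ^ 2 + 2 * (C * (B * Z) ^ 2 * (σ / α * ε))) := by
          gcongr
          refine (cip_add_self_le hgr _ _).trans ?_
          linarith
      _ = (2 * C ^ 2 * ε + 2 * C * (σ / α)) * (B * Z) ^ 2 := by field_simp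
      _ ≤ (2 * C * (1 + σ / α)) ^ 2 * (B * Z) ^ 2 := by
          gcongr
          have e1 : C ^ 2 * ε ≤ C ^ 2 := mul_le_of_le_one_right (sq_nonneg _) hε1
          have e2 : C * (σ / α) ≤ C ^ 2 * (σ / α) := by
            gcongr; nlinarith
          have e3 : 0 ≤ C ^ 2 * (σ / α) := by positivity
          have e4 : 0 ≤ C ^ 2 * (σ / α) ^ 2 := by positivity
          nlinarith
      _ = _ := by ring
  · have h1 := (h hα hσ hε hX hSE n le_rfl).1 (X (n + 1)) (right_mem_Icc.2 (hX.lt n le_rfl).le)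
    have h2 := (h hα hσ hε hX hSE n le_rfl).2.1 (X (n + 1)) (right_mem_Icc.2 (hX.lt n le_rfl).le)
    have h3 : C * D * ε * (X (n + 1) - X n) ^ (k + 1) ≤ C * (B * Z) := by
      calc C * D * ε * (X (n + 1) - X n) ^ (k + 1)
          = C * ε * (D * (X (n + 1) - X n) ^ (k + 1)) := by ring
        _ ≤ C * ε * (B * Z) := mul_le_mul_of_nonneg_left (hw n le_rfl) (by positivity)
        _ ≤ C * 1 * (B * Z) := by gcongr
        _ = _ := by ring
    have h4 : C * D * cellRes α σ ε X n ^ (k + 1) ≤ C * (B * Z) := by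
      rw [mul_assoc]; exact mul_le_mul_of_nonneg_left (hr n le_rfl) hC0
    have h5 : (projL k X (ε • (S 1 + E 1)) n).eval (X (n + 1)) - (ε • (S 1 + E 1)) (X (n + 1)) =
        ((projL k X (ε • S 1) n).eval (X (n + 1)) - (ε • S 1) (X (n + 1))) +
        ((projL k X (ε • E 1) n).eval (X (n + 1)) - (ε • E 1) (X (n + 1))) := by
      rw [smul_add, map_add, Pi.add_apply, Polynomial.eval_add, ContinuousMap.add_apply]
      ring
    rw [h5]
    have h6 : 0 ≤ C * (B * Z) * (σ / α) := by positivity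
    calc _ ≤ _ := abs_add_le _ _
      _ ≤ C * (B * Z) + C * (B * Z) := add_le_add (h1.trans h3) (h2.trans h4)
      _ ≤ _ := by nlinarith

/-! ### The error functional of the projections -/

/-- The coefficients `A = a`, `A' = a_x` and `b` on `[0,1]`. -/
structure IsCoeff (L : ℝ) (A A' b : C(ℝ, ℝ)) : Prop where
  dA : ∀ x ∈ Ioo (0 : ℝ) 1, HasDerivAt A (A' x) x
  bA : ∀ x ∈ Icc (0 : ℝ) 1, |A x| ≤ L
  bA' : ∀ x ∈ Icc (0 : ℝ) 1, |A' x| ≤ L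
  bb : ∀ x ∈ Icc (0 : ℝ) 1, |b x| ≤ L

lemma IsCoeff.nonneg {L : ℝ} {A A' b : C(ℝ, ℝ)} (h : IsCoeff L A A' b) : 0 ≤ L :=
  (abs_nonneg _).trans (h.bA 0 (by simp))

lemma IsCoeff.lipschitz {L : ℝ} {A A' b : C(ℝ, ℝ)} (h : IsCoeff L A A' b) {x y : ℝ}
    (hx : x ∈ Icc (0 : ℝ) 1) (hy : y ∈ Icc (0 : ℝ) 1) (hxy : x ≤ y) :
    |A x - A y| ≤ L * (y - x) := by
  rcases hxy.eq_or_lt with rfl | hlt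
  · simp
  obtain ⟨z, hz, hz'⟩ := exists_hasDerivAt_eq_slope A A' hlt A.continuous.continuousOn
    (fun z hz => h.dA z ⟨hx.1.trans_lt hz.1, hz.2.trans_le hy.2⟩)
  have h1 : A x - A y = -(A' z * (y - x)) := by
    rw [hz', div_mul_cancel₀ _ (sub_pos.2 hlt).ne']; ring
  rw [h1, abs_neg, abs_mul, abs_of_pos (sub_pos.2 hlt)]
  exact mul_le_mul_of_nonneg_right
    (h.bA' z ⟨hx.1.trans hz.1.le, hz.2.le.trans hy.2⟩) (sub_pos.2 hlt).le

lemma cip_mul_self_le {c f : CellFn} {B : ℝ} (h : IsGrid n X)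
    (hc : ∀ j ≤ n, ∀ x ∈ Icc (X j) (X (j + 1)), |c j x| ≤ B) :
    cip (n + 1) X (c * f) (c * f) ≤ B ^ 2 * cip (n + 1) X f f := by
  have h1 : B ^ 2 * cip (n + 1) X f f = cip (n + 1) X (B • f) (B • f) := by
    simp only [map_smul, LinearMap.smul_apply, smul_eq_mul]; ring
  rw [h1]
  refine cip_mono h fun j hj x hx => ?_
  have h2 := hc j hj x hx
  have h3 : c j x ^ 2 ≤ B ^ 2 := sq_le_sq' (abs_le.1 h2).1 (abs_le.1 h2).2
  simp only [Pi.mul_apply, ContinuousMap.mul_apply, Pi.smul_apply, ContinuousMap.smul_apply,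
    smul_eq_mul]
  nlinarith [mul_le_mul_of_nonneg_right h3 (sq_nonneg (f j x))]

lemma sqrt_cip_mul_le {c f : CellFn} {B : ℝ} (h : IsGrid n X) (hB : 0 ≤ B)
    (hc : ∀ j ≤ n, ∀ x ∈ Icc (X j) (X (j + 1)), |c j x| ≤ B) :
    Real.sqrt (cip (n + 1) X (c * f) (c * f)) ≤ B * Real.sqrt (cip (n + 1) X f f) := by
  rw [Real.sqrt_le_iff]
  refine ⟨by positivity, (cip_mul_self_le h hc).trans (le_of_eq ?_)⟩
  rw [mul_pow, Real.sq_sqrt (cip_self_nonneg h f)]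

/-- The quantity by which the error functionals are bounded. -/
def testNorm (ε : ℝ) (n : ℕ) (X : ℕ → ℝ) (v s : CellPoly) : ℝ :=
  Real.sqrt (cip (n + 1) X (emb v) (emb v)) + Real.sqrt (ε⁻¹ * cip (n + 1) X (emb s) (emb s)) +
    |(v n).eval (X (n + 1))|

/-- The error functional of the projections for a layered function. -/
lemma exists_projection_functional_bound (k : ℕ) (α σ Cm L : ℝ) (hα : 0 < α)
    (hσ : (k : ℝ) + 2 ≤ σ) : ∃ C, 0 ≤ C ∧ ∀ {ε lam D ϖ : ℝ} {n : ℕ} {X : ℕ → ℝ}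
    {S E : ℕ → C(ℝ, ℝ)} {A A' b : C(ℝ, ℝ)}, 0 < ε → ε ≤ 1 → 0 ≤ ϖ →
    IsLayerMesh α σ ε ϖ Cm n X → IsCoeff L A A' b → IsLayered α ε D k S E →
    ∀ v s : CellPoly, (∀ j, (v j).natDegree ≤ k) → (∀ j, (s j).natDegree ≤ k) →
      |ldgFun ε lam A (b - A') n X (emb (projR k X (S 0 + E 0)))
          (emb (projL k X (ε • (S 1 + E 1)))) v s -
        ldgFun ε lam A (b - A') n X (cst (S 0 + E 0)) (cst (ε • (S 1 + E 1))) v s| ≤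
      C * (D * ϖ ^ (k + 1)) * testNorm ε n X v s := by
  obtain ⟨C₁, hC₁, hR⟩ := exists_projR_l2 k Cm
  obtain ⟨C₂, hC₂, hL⟩ := exists_projL_l2 k α σ Cm hα hσ
  obtain ⟨C₃, hC₃, hinv⟩ := exists_inverse k
  refine ⟨C₁ * (2 * |L|) + C₁ * (|L| * Real.sqrt C₃) + C₂, by positivity, ?_⟩
  intro ε lam D ϖ n X S E A A' b hε hε1 hϖ hX hco hSE v s hv hs
  have hgr := hX.isGrid
  have hD := hSE.nonneg
  have hL0 := hco.nonneg
  rw [abs_of_nonneg hL0]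
  set w := S 0 + E 0 with hw
  set q := ε • (S 1 + E 1) with hq
  set ηu : CellFn := emb (projR k X w) - cst w with hηu
  set ηq : CellFn := emb (projL k X q) - cst q with hηq
  set Z := D * ϖ ^ (k + 1) with hZ
  have hZ0 : 0 ≤ Z := by positivity
  have h1 : cip (n + 1) X ηu ηu ≤ (C₁ * Z) ^ 2 := (hR hα hσ hε hϖ hX hSE).1
  have h2 : ε⁻¹ * cip (n + 1) X ηq ηq ≤ (C₂ * Z) ^ 2 := (hL hε hε1 hϖ hX hSE).1
  have h3 : |ηq n (X (n + 1))| ≤ C₂ * Z := (hL hε hε1 hϖ hX hSE).2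
  -- The form uses left traces of u and, except at the outflow node, right traces of q. The
  -- projections interpolate at exactly these end points, so the only nodal error left is that of q
  -- at x = 1.
  have hηu0 : ∀ j ≤ n, ηu j (X (j + 1)) = 0 := fun j hj => by
    simp only [hηu, Pi.sub_apply, ContinuousMap.sub_apply, emb_apply, cst_apply,
      projR_eval hgr hj, sub_self]
  have hηq0 : ∀ j ≤ n, ηq j (X j) = 0 := fun j hj => by
    simp only [hηq, Pi.sub_apply, ContinuousMap.sub_apply, emb_apply, cst_apply,
      projL_eval hgr hj, sub_self]
  have horthu : ∀ v : CellPoly, (∀ j, (v j).natDegree ≤ k) →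
      cip (n + 1) X ηu (emb (dP v)) = 0 := fun v hv => by
    rw [hηu, map_sub, LinearMap.sub_apply, cip_projR hgr w hv, sub_self]
  have horthq : cip (n + 1) X ηq (emb (dP v)) = 0 := by
    rw [hηq, map_sub, LinearMap.sub_apply, cip_projL hgr q hv, sub_self]
  -- the error functional
  have hdiff : ldgFun ε lam A (b - A') n X (emb (projR k X w)) (emb (projL k X q)) v s -
      ldgFun ε lam A (b - A') n X (cst w) (cst q) v s =
      ε⁻¹ * cip (n + 1) X ηq (emb s) + cip (n + 1) X (cst (b - A') * ηu) (emb v)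
        - ηq n (X (n + 1)) * (v n).eval (X (n + 1)) - cip (n + 1) X (cst A * ηu) (emb (dP v)) := by
    rw [← ldgForm_apply, ← ldgForm_apply, ← LinearMap.sub_apply, ← map_sub, Prod.mk_sub_mk,
      ldgForm_apply]
    unfold ldgFun
    rw [← hηu, ← hηq, horthu s hs, horthq]
    have e1 : jumpL n X ηu s = 0 := (jumpL_apply _ _ _ _).trans <| Finset.sum_eq_zero fun j hj => by
      rw [hηu0 j (Finset.mem_range.1 hj).le, zero_mul]
    have e2 : jumpL n X (cst A * ηu) v = 0 := (jumpL_apply _ _ _ _).trans <| Finset.sum_eq_zero fun j hj => by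
      rw [Pi.mul_apply, ContinuousMap.mul_apply, hηu0 j (Finset.mem_range.1 hj).le, mul_zero,
        zero_mul]
    have e3 : jumpR n X ηq v = 0 := (jumpR_apply _ _ _ _).trans <| Finset.sum_eq_zero fun j hj => by
      rw [hηq0 (j + 1) (Finset.mem_range.1 hj), zero_mul]
    rw [e1, e2, e3, hηu0 n le_rfl, hηq0 0 (Nat.zero_le _)]
    ring
  rw [hdiff]
  set nv := Real.sqrt (cip (n + 1) X (emb v) (emb v)) with hnv
  set ns := Real.sqrt (ε⁻¹ * cip (n + 1) X (emb s) (emb s)) with hns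
  have hsu : Real.sqrt (cip (n + 1) X ηu ηu) ≤ C₁ * Z := Real.sqrt_le_iff.2 ⟨by positivity, h1⟩
  have b1 : |ε⁻¹ * cip (n + 1) X ηq (emb s)| ≤ C₂ * Z * ns := by
    rw [abs_mul, abs_of_pos (inv_pos.2 hε)]
    calc ε⁻¹ * |cip (n + 1) X ηq (emb s)|
        ≤ ε⁻¹ * (Real.sqrt (cip (n + 1) X ηq ηq) * Real.sqrt (cip (n + 1) X (emb s) (emb s))) := by
          gcongr; exact abs_cip_le hgr _ _
      _ = Real.sqrt (ε⁻¹ * cip (n + 1) X ηq ηq) * ns := by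
          rw [hns, Real.sqrt_mul (inv_pos.2 hε).le, Real.sqrt_mul (inv_pos.2 hε).le]
          have := Real.mul_self_sqrt (inv_pos.2 hε).le
          linear_combination (Real.sqrt (cip (n + 1) X ηq ηq) *
            Real.sqrt (cip (n + 1) X (emb s) (emb s))) * (-this)
      _ ≤ C₂ * Z * ns := by
          gcongr
          exact Real.sqrt_le_iff.2 ⟨by positivity, h2⟩
  have b2 : |cip (n + 1) X (cst (b - A') * ηu) (emb v)| ≤ 2 * L * (C₁ * Z) * nv := by
    refine (abs_cip_le hgr _ _).trans ?_
    gcongr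
    refine (sqrt_cip_mul_le hgr (B := 2 * L) (by positivity) fun j hj x hx => ?_).trans (by gcongr)
    have hm := hgr.Icc_subset hj hx
    rw [cst_apply, ContinuousMap.sub_apply]
    have := hco.bA' x hm
    have := hco.bb x hm
    calc |b x - A' x| ≤ |b x| + |A' x| := abs_sub _ _
      _ ≤ 2 * L := by linarith
  have b3 : |ηq n (X (n + 1)) * (v n).eval (X (n + 1))| ≤ C₂ * Z * |(v n).eval (X (n + 1))| := by
    rw [abs_mul]; gcongr
  have b4 : |cip (n + 1) X (cst A * ηu) (emb (dP v))| ≤ C₁ * Z * (L * Real.sqrt C₃ * nv) := by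
    -- With a frozen on each cell the term vanishes by orthogonality. The difference is O(h_j),
    -- which compensates the factor h_j⁻¹ of the inverse inequality for v_x.
    set Ab : CellFn := fun j => ContinuousMap.const ℝ (A (X (j + 1))) with hAb
    have e1 : cip (n + 1) X (cst A * ηu) (emb (dP v)) =
        cip (n + 1) X ηu ((cst A - Ab) * emb (dP v)) := by
      have e2 := horthu (fun j => A (X (j + 1)) • v j) fun j =>
        (Polynomial.natDegree_smul_le _ _).trans (hv j)
      have e3 : emb (dP fun j => A (X (j + 1)) • v j) = Ab * emb (dP v) := by
        ext j x
        simp [hAb]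
      rw [e3] at e2
      rw [sub_mul, map_sub, e2, sub_zero, cip_mul_left]
    rw [e1]
    refine (abs_cip_le hgr _ _).trans ?_
    gcongr
    rw [Real.sqrt_le_iff]
    refine ⟨by positivity, ?_⟩
    rw [mul_pow, mul_pow, Real.sq_sqrt hC₃.le, hnv, Real.sq_sqrt (cip_self_nonneg hgr _),
      cip_apply, cip_apply, Finset.mul_sum]
    refine Finset.sum_le_sum fun j hj => ?_
    have hj : j ≤ n := by simpa [Nat.lt_succ_iff] using hj
    have hlt := hgr.lt j hj
    have hd : 0 < X (j + 1) - X j := sub_pos.2 hlt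
    calc ∫ x in (X j)..(X (j + 1)), ((cst A - Ab) * emb (dP v)) j x * ((cst A - Ab) * emb (dP v)) j x
        ≤ ∫ x in (X j)..(X (j + 1)), L ^ 2 * ((X (j + 1) - X j)⁻¹ *
            (C₃ * ∫ y in (X j)..(X (j + 1)), (v j).eval y ^ 2)) := by
          apply intervalIntegral.integral_mono_on hlt.le
          · exact Continuous.intervalIntegrable (by fun_prop) _ _
          · exact Continuous.intervalIntegrable (by fun_prop) _ _
          · intro x hx
            have e4 := hco.lipschitz (hgr.Icc_subset hj hx)
              (hgr.Icc_subset hj (right_mem_Icc.2 hlt.le)) hx.2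
            have e5 : |A x - A (X (j + 1))| ≤ L * (X (j + 1) - X j) :=
              e4.trans (by gcongr; exact hx.1)
            have e6 : (A x - A (X (j + 1))) ^ 2 ≤ (L * (X (j + 1) - X j)) ^ 2 :=
              sq_le_sq' (abs_le.1 e5).1 (abs_le.1 e5).2
            have e7 := (hinv (v j) (hv j) (X j) (X (j + 1)) hlt x hx).2
            have e8 : ((cst A - Ab) * emb (dP v)) j x =
              (A x - A (X (j + 1))) * (v j).derivative.eval x := rfl
            rw [e8]
            calc (A x - A (X (j + 1))) * (v j).derivative.eval x *
                  ((A x - A (X (j + 1))) * (v j).derivative.eval x)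
                = (A x - A (X (j + 1))) ^ 2 * (v j).derivative.eval x ^ 2 := by ring
              _ ≤ (L * (X (j + 1) - X j)) ^ 2 * (v j).derivative.eval x ^ 2 := by gcongr
              _ = L ^ 2 * ((X (j + 1) - X j)⁻¹ *
                  ((X (j + 1) - X j) ^ 3 * (v j).derivative.eval x ^ 2)) := by
                field_simp
              _ ≤ _ := by gcongr
      _ = L ^ 2 * C₃ * ∫ x in (X j)..(X (j + 1)), emb v j x * emb v j x := by
          rw [intervalIntegral.integral_const, smul_eq_mul]
          simp only [emb_apply, ← sq]
          field_simp
  have hnv0 : 0 ≤ nv := Real.sqrt_nonneg _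
  have hns0 : 0 ≤ ns := Real.sqrt_nonneg _
  set vN := |(v n).eval (X (n + 1))| with hvN
  have hvN0 : 0 ≤ vN := abs_nonneg _
  have htn : testNorm ε n X v s = nv + ns + vN := rfl
  rw [htn]
  have hsq0 : 0 ≤ Real.sqrt C₃ := Real.sqrt_nonneg _
  calc |ε⁻¹ * cip (n + 1) X ηq (emb s) + cip (n + 1) X (cst (b - A') * ηu) (emb v)
        - ηq n (X (n + 1)) * (v n).eval (X (n + 1)) - cip (n + 1) X (cst A * ηu) (emb (dP v))|
      ≤ C₂ * Z * ns + 2 * L * (C₁ * Z) * nv + C₂ * Z * vN + C₁ * Z * (L * Real.sqrt C₃ * nv) := by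
        rw [abs_le] at b1 b2 b3 b4 ⊢
        constructor <;> linarith
    _ ≤ (C₁ * (2 * L) + C₁ * (L * Real.sqrt C₃)) * Z * (nv + ns + vN) +
          C₂ * Z * (nv + ns + vN) := by
        have e1 : C₂ * Z * ns + C₂ * Z * vN ≤ C₂ * Z * (nv + ns + vN) := by
          have : 0 ≤ C₂ * Z * nv := by positivity
          linarith
        have e2 : (C₁ * (2 * L) + C₁ * (L * Real.sqrt C₃)) * Z * nv ≤
            (C₁ * (2 * L) + C₁ * (L * Real.sqrt C₃)) * Z * (nv + ns + vN) := by
          gcongr; linarith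
        linarith
    _ = _ := by ring

end

end LDG

end

noncomputable section

namespace LDG

open scoped Polynomial

/-! ### The action of derivatives on the discrete error -/

/-- The discrete flux equation. -/
def FluxEq (ε : ℝ) (k n : ℕ) (X : ℕ → ℝ) (U Q : CellPoly) : Prop :=
  ∀ s : CellPoly, (∀ j, (s j).natDegree ≤ k) →
    ε⁻¹ * cip (n + 1) X (emb Q) (emb s) + cip (n + 1) X (emb U) (emb (dP s))
      + jumpL n X (emb U) s = 0

/-- The derivative of a function, tested with the discrete error of a smooth function. -/
lemma cip_deriv_eq {k n : ℕ} {X : ℕ → ℝ} {ε : ℝ} (h : IsGrid n X) (hε : ε ≠ 0)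
    {w w₁ g g' : C(ℝ, ℝ)} (hw : ∀ x ∈ Ioo (0 : ℝ) 1, HasDerivAt w (w₁ x) x) (h0 : w 0 = 0)
    (h1 : w 1 = 0) (hg : ∀ x ∈ Ioo (0 : ℝ) 1, HasDerivAt g (g' x) x) {U Q : CellPoly}
    (hU : ∀ j, (U j).natDegree ≤ k) (hUQ : FluxEq ε k n X U Q) :
    cip (n + 1) X (cst g') (emb (projR k X w - U)) =
      -(ε⁻¹ * cip (n + 1) X (cst (ε • w₁) - emb Q) (emb (projL k X g))) +
        (g 1 - (projL k X g n).eval (X (n + 1))) * ((projR k X w - U) n).eval (X (n + 1)) := by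
  set s := projL k X g with hs
  set v := projR k X w - U with hv
  have hsd : ∀ j, (s j).natDegree ≤ k := projL_natDegree k X g
  have hvd : ∀ j, (v j).natDegree ≤ k := fun j =>
    (Polynomial.natDegree_sub_le_of_le (projR_natDegree k X w j) (hU j)).trans (by simp)
  -- The exact and the discrete flux equation are both tested with the left Radau projection s of g;
  -- their difference is an equation for v and the flux error.
  have h2 := flux_consistency h hε hw h0 h1 s
  have h3 := hUQ s hsd
  have h4 : jumpL n X (cst w) s = jumpL n X (emb (projR k X w)) s := by
    rw [jumpL_apply, jumpL_apply]
    refine Finset.sum_congr rfl fun j hj => ?_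
    rw [emb_apply, projR_eval h (Finset.mem_range.1 hj).le, cst_apply]
  rw [h4, ← cip_projR h w hsd] at h2
  have h5 : ε⁻¹ * cip (n + 1) X (cst (ε • w₁) - emb Q) (emb s) + cip (n + 1) X (emb v) (emb (dP s))
      + jumpL n X (emb v) s = 0 := by
    rw [hv]
    simp only [map_sub, LinearMap.sub_apply] at h2 h3 ⊢
    linear_combination h2 - h3
  have h6 := cip_ibp h (f := emb v) (f' := emb (dP v)) (g := emb s) (g' := emb (dP s))
    (fun j _ x _ => hasDerivAt_emb v j x) (fun j _ x _ => hasDerivAt_emb s j x)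
  have h7 := cip_ibp h (f := cst g) (f' := cst g') (g := emb v) (g' := emb (dP v))
    (fun j hj x hx => hg x (h.Ioo_subset hj hx)) (fun j _ x _ => hasDerivAt_emb v j x)
  -- Against v_x the projection s may be replaced by g. This lets the term with v_x be eliminated
  -- between the two integrations by parts.
  rw [cip_comm _ _ (emb (dP v)) (emb s), hs, cip_projL h g hvd, ← hs] at h6
  rw [jumpL_apply] at h5
  simp only [cst_apply, emb_apply] at h5 h6 h7 ⊢
  have h8 : ∀ j ≤ n, (s j).eval (X j) = g (X j) := fun j hj => projL_eval h hj g
  rw [h8 0 (Nat.zero_le _)] at h6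
  have e1 : ∑ j ∈ Finset.range n, ((v j).eval (X (j + 1)) * (s j).eval (X (j + 1)) -
        (v (j + 1)).eval (X (j + 1)) * (s (j + 1)).eval (X (j + 1))) =
      ∑ j ∈ Finset.range n, (g (X (j + 1)) * (v j).eval (X (j + 1)) -
        g (X (j + 1)) * (v (j + 1)).eval (X (j + 1))) -
      ∑ j ∈ Finset.range n, (v j).eval (X (j + 1)) *
          ((s (j + 1)).eval (X (j + 1)) - (s j).eval (X (j + 1))) := by
    rw [← Finset.sum_sub_distrib]
    refine Finset.sum_congr rfl fun j hj => ?_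
    rw [h8 (j + 1) (Finset.mem_range.1 hj)]
    ring
  rw [e1] at h6
  rw [h.one] at *
  linear_combination h5 + h7 - h6

/-- The differential operator applied to a function with a layer, tested with the discrete error
of a smooth function. -/
lemma exists_operator_bound (k : ℕ) (α σ L : ℝ) (hα : 0 < α) (hσ : (k : ℝ) + 2 ≤ σ) :
    ∃ C, 0 ≤ C ∧ ∀ {ε ϖ Cm Z : ℝ} {n : ℕ} {X : ℕ → ℝ}
    {A A' b w w₁ S₀ S₁ S₂ E₀ E₁ E₂ : C(ℝ, ℝ)} {U Q : CellPoly}, 0 < ε → ε ≤ 1 →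
    IsLayerMesh α σ ε ϖ Cm n X → IsCoeff L A A' b →
    (∀ x ∈ Ioo (0 : ℝ) 1, HasDerivAt w (w₁ x) x) → w 0 = 0 → w 1 = 0 →
    (∀ j, (U j).natDegree ≤ k) → FluxEq ε k n X U Q →
    (∀ x ∈ Ioo (0 : ℝ) 1, HasDerivAt E₀ (E₁ x) x) →
    (∀ x ∈ Ioo (0 : ℝ) 1, HasDerivAt E₁ (E₂ x) x) →
    (∀ x ∈ Icc (0 : ℝ) 1, |S₀ x| ≤ Z) → (∀ x ∈ Icc (0 : ℝ) 1, |S₁ x| ≤ Z) →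
    (∀ x ∈ Icc (0 : ℝ) 1, |S₂ x| ≤ Z) →
    (∀ x ∈ Icc (0 : ℝ) 1, |E₀ x| ≤ Z * Real.exp (-α * (1 - x) / ε)) →
    (∀ x ∈ Icc (0 : ℝ) 1, |E₁ x| ≤ Z * ε⁻¹ * Real.exp (-α * (1 - x) / ε)) →
      |cip (n + 1) X (cst (-(ε • (S₂ + E₂)) + A * (S₁ + E₁) + b * (S₀ + E₀)))
          (emb (projR k X w - U))| ≤
        C * Z * (Real.sqrt (cip (n + 1) X (emb (projR k X w - U)) (emb (projR k X w - U))) +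
          Real.sqrt (ε⁻¹ * cip (n + 1) X (cst (ε • w₁) - emb Q) (cst (ε • w₁) - emb Q)) +
          |((projR k X w - U) n).eval (X (n + 1))|) := by
  have hσ0 : 0 < σ := by linarith [(Nat.cast_nonneg k : (0 : ℝ) ≤ k)]
  obtain ⟨C, hC, hP⟩ := exists_projL_layer k α σ hα hσ0
  refine ⟨(1 + 4 * |L|) + (C + 1) * (1 + |L|), by positivity, ?_⟩
  intro ε ϖ Cm Z n X A A' b w w₁ S₀ S₁ S₂ E₀ E₁ E₂ U Q hε hε1 hX hco hw h0 h1 hU hUQ hE₀ hE₁ bS₀ bS₁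
    bS₂ bE₀ bE₁
  have hgr := hX.isGrid
  have hL0 := hco.nonneg
  rw [abs_of_nonneg hL0]
  have hZ0 : 0 ≤ Z := (abs_nonneg _).trans (bS₀ 0 (by simp))
  have hexp1 : ∀ x ∈ Icc (0 : ℝ) 1, Real.exp (-α * (1 - x) / ε) ≤ 1 := fun x hx => by
    rw [Real.exp_le_one_iff]
    apply div_nonpos_of_nonpos_of_nonneg _ hε.le
    nlinarith [hx.2]
  have hexpl : ∀ x ∈ Icc (0 : ℝ) 1, Real.exp (-α * (1 - x) / ε) ≤ layerFn α σ ε x := fun x hx => by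
    refine (exp_le_layerFn_pow hα hσ hε hx.2).trans ?_
    exact pow_le_of_le_one (layerFn_pos _ _ _ _).le (layerFn_le_one hα hσ0 hε hx.2) (by omega)
  -- Both εE₂ and A E₁ are of size ε⁻¹ in the layer, so a direct L² estimate is not uniform in ε.
  -- But A E₁ - εE₂ = g' - A'E₀, where g and E₀ are free of negative powers of ε; the derivative of
  -- g is handled by `cip_deriv_eq`.
  set g : C(ℝ, ℝ) := A * E₀ - ε • E₁ with hg
  set g' : C(ℝ, ℝ) := A' * E₀ + A * E₁ - ε • E₂ with hg'
  set S : C(ℝ, ℝ) := -(ε • S₂) + A * S₁ + b * S₀ + (b - A') * E₀ with hS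
  have hgd : ∀ x ∈ Ioo (0 : ℝ) 1, HasDerivAt g (g' x) x := fun x hx =>
    ((hco.dA x hx).mul (hE₀ x hx)).sub ((hE₁ x hx).const_smul ε)
  have hdec : -(ε • (S₂ + E₂)) + A * (S₁ + E₁) + b * (S₀ + E₀) = S + g' := by
    ext x
    simp [hS, hg']
    ring
  set v := projR k X w - U with hv
  set p : CellFn := cst (ε • w₁) - emb Q with hp
  have hSb : ∀ x ∈ Icc (0 : ℝ) 1, |S x| ≤ (1 + 4 * L) * Z := by
    intro x hx
    have e1 : |ε * S₂ x| ≤ Z := by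
      rw [abs_mul, abs_of_pos hε]
      calc ε * |S₂ x| ≤ 1 * Z := mul_le_mul hε1 (bS₂ x hx) (abs_nonneg _) zero_le_one
        _ = Z := one_mul _
    have e2 : |A x * S₁ x| ≤ L * Z := by
      rw [abs_mul]; exact mul_le_mul (hco.bA x hx) (bS₁ x hx) (abs_nonneg _) hL0
    have e3 : |b x * S₀ x| ≤ L * Z := by
      rw [abs_mul]; exact mul_le_mul (hco.bb x hx) (bS₀ x hx) (abs_nonneg _) hL0
    have e0 : |E₀ x| ≤ Z := (bE₀ x hx).trans (mul_le_of_le_one_right hZ0 (hexp1 x hx))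
    have e4 : |b x * E₀ x| ≤ L * Z := by
      rw [abs_mul]; exact mul_le_mul (hco.bb x hx) e0 (abs_nonneg _) hL0
    have e5 : |A' x * E₀ x| ≤ L * Z := by
      rw [abs_mul]; exact mul_le_mul (hco.bA' x hx) e0 (abs_nonneg _) hL0
    have e6 : S x = -(ε * S₂ x) + A x * S₁ x + b x * S₀ x + (b x * E₀ x - A' x * E₀ x) := by
      simp [hS]; ring
    rw [e6]
    rw [abs_le] at e1 e2 e3 e4 e5 ⊢
    constructor <;> linarith
  have hgb : ∀ x ∈ Icc (0 : ℝ) 1, |g x| ≤ (1 + L) * Z * layerFn α σ ε x := by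
    intro x hx
    have e1 : |ε * E₁ x| ≤ Z * layerFn α σ ε x := by
      rw [abs_mul, abs_of_pos hε]
      calc ε * |E₁ x| ≤ ε * (Z * ε⁻¹ * Real.exp (-α * (1 - x) / ε)) :=
            mul_le_mul_of_nonneg_left (bE₁ x hx) hε.le
        _ = Z * Real.exp (-α * (1 - x) / ε) := by field_simp
        _ ≤ _ := mul_le_mul_of_nonneg_left (hexpl x hx) hZ0
    have e2 : |A x * E₀ x| ≤ L * (Z * layerFn α σ ε x) := by
      rw [abs_mul]
      exact mul_le_mul (hco.bA x hx)
        ((bE₀ x hx).trans (mul_le_mul_of_nonneg_left (hexpl x hx) hZ0)) (abs_nonneg _) hL0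
    have e3 : g x = A x * E₀ x - ε * E₁ x := by simp [hg]
    rw [e3]
    rw [abs_le] at e1 e2 ⊢
    constructor <;> linarith
  -- The projection of g has ε^{-1/2}-weighted L² norm O(Z), because the layer has width of order ε.
  -- This matches the weighted norm of the flux error.
  obtain ⟨hP1, hP2⟩ := hP g hε hX (by positivity) hgb
  set nv := Real.sqrt (cip (n + 1) X (emb v) (emb v)) with hnv
  set np := Real.sqrt (ε⁻¹ * cip (n + 1) X p p) with hnp
  set vN := |(v n).eval (X (n + 1))| with hvN
  have hnv0 : 0 ≤ nv := Real.sqrt_nonneg _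
  have hnp0 : 0 ≤ np := Real.sqrt_nonneg _
  have hvN0 : 0 ≤ vN := abs_nonneg _
  have b1 : |cip (n + 1) X (cst S) (emb v)| ≤ (1 + 4 * L) * Z * nv := by
    refine (abs_cip_le hgr _ _).trans ?_
    gcongr
    refine Real.sqrt_le_iff.2 ⟨by positivity, cip_self_le_of_abs_le hgr fun j hj x hx => ?_⟩
    exact hSb x (hgr.Icc_subset hj hx)
  have b2 : |ε⁻¹ * cip (n + 1) X p (emb (projL k X g))| ≤ C * ((1 + L) * Z) * np := by
    rw [abs_mul, abs_of_pos (inv_pos.2 hε)]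
    calc ε⁻¹ * |cip (n + 1) X p (emb (projL k X g))|
        ≤ ε⁻¹ * (Real.sqrt (cip (n + 1) X p p) *
            Real.sqrt (cip (n + 1) X (emb (projL k X g)) (emb (projL k X g)))) := by
          gcongr; exact abs_cip_le hgr _ _
      _ = Real.sqrt (ε⁻¹ * cip (n + 1) X (emb (projL k X g)) (emb (projL k X g))) * np := by
          rw [hnp, Real.sqrt_mul (inv_pos.2 hε).le, Real.sqrt_mul (inv_pos.2 hε).le]
          have := Real.mul_self_sqrt (inv_pos.2 hε).le
          linear_combination (Real.sqrt (cip (n + 1) X p p) *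
            Real.sqrt (cip (n + 1) X (emb (projL k X g)) (emb (projL k X g)))) * (-this)
      _ ≤ _ := by
          gcongr
          exact Real.sqrt_le_iff.2 ⟨by positivity, hP1⟩
  have b3 : |(g 1 - (projL k X g n).eval (X (n + 1))) * (v n).eval (X (n + 1))| ≤
      (C + 1) * ((1 + L) * Z) * vN := by
    rw [abs_mul]
    gcongr
    have e1 := hgb 1 (by simp)
    have e2 : layerFn α σ ε 1 = 1 := by simp [layerFn_apply]
    rw [e2, mul_one] at e1
    rw [abs_le] at e1 hP2 ⊢
    constructor <;> linarith
  have hid := cip_deriv_eq hgr hε.ne' hw h0 h1 hgd hU hUQ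
  rw [← hv, ← hp] at hid
  rw [hdec, map_add, map_add, LinearMap.add_apply, hid]
  have e1 : C * ((1 + L) * Z) * np ≤ (C + 1) * ((1 + L) * Z) * np := by
    gcongr; linarith
  have e2 : 0 ≤ (1 + 4 * L) * Z * (np + vN) := by positivity
  have e3 : 0 ≤ (C + 1) * ((1 + L) * Z) * nv := by positivity
  rw [abs_le] at b1 b2 b3 ⊢
  constructor <;> linarith

end LDG

end

/-! ### Polynomials in time and Taylor–Radau approximation in time. -/

noncomputable section

namespace LDG

open scoped Polynomial

/-! ### Polynomials in time -/

section TimePoly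

variable {V W : Type*} [AddCommGroup V] [Module ℝ V] [AddCommGroup W] [Module ℝ W]

/-- The value at time `t` of a polynomial in time of degree at most `r` with coefficients `e`. -/
def tev (r : ℕ) (e : ℕ → V) (t : ℝ) : V := ∑ i ∈ Finset.range (r + 1), t ^ i • e i

/-- The time derivative of `tev r e`. -/
def tdv (r : ℕ) (e : ℕ → V) (t : ℝ) : V :=
  ∑ i ∈ Finset.range (r + 1), ((i : ℝ) * t ^ (i - 1)) • e i

lemma map_tev (L : V →ₗ[ℝ] W) (r : ℕ) (e : ℕ → V) (t : ℝ) :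
    L (tev r e t) = tev r (fun i => L (e i)) t := by
  simp [tev]

lemma map_tdv (L : V →ₗ[ℝ] W) (r : ℕ) (e : ℕ → V) (t : ℝ) :
    L (tdv r e t) = tdv r (fun i => L (e i)) t := by
  simp [tdv]

lemma tev_sub (r : ℕ) (e e' : ℕ → V) (t : ℝ) :
    tev r (fun i => e i - e' i) t = tev r e t - tev r e' t := by
  simp [tev, smul_sub, Finset.sum_sub_distrib]

lemma tdv_sub (r : ℕ) (e e' : ℕ → V) (t : ℝ) :
    tdv r (fun i => e i - e' i) t = tdv r e t - tdv r e' t := by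
  simp [tdv, smul_sub, Finset.sum_sub_distrib]

lemma tev_prod (r : ℕ) (e : ℕ → V) (e' : ℕ → W) (t : ℝ) :
    tev r (fun i => (e i, e' i)) t = (tev r e t, tev r e' t) := by
  simp [tev, Prod.ext_iff, Prod.fst_sum, Prod.snd_sum]

lemma hasDerivAt_tev (r : ℕ) (c : ℕ → ℝ) (t : ℝ) :
    HasDerivAt (fun t => tev r c t) (tdv r c t) t := by
  unfold tev tdv
  apply HasDerivAt.fun_sum
  intro i _
  simpa using (hasDerivAt_pow i t).smul_const (c i)

lemma continuous_tev (r : ℕ) (c : ℕ → ℝ) : Continuous fun t => tev r c t := by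
  unfold tev; fun_prop

lemma bilin_tev (β : V →ₗ[ℝ] W →ₗ[ℝ] ℝ) (r : ℕ) (e : ℕ → V) (e' : ℕ → W) (t : ℝ) :
    β (tev r e t) (tev r e' t) = tev r (fun i => tev r (fun j => β (e i) (e' j)) t) t := by
  have h : β (tev r e t) (tev r e' t) = tev r (fun i => β (e i) (tev r e' t)) t := by
    rw [← LinearMap.flip_apply, map_tev]
    simp
  rw [h]
  congr 1
  funext i
  rw [map_tev]

lemma continuous_bilin_tev (β : V →ₗ[ℝ] W →ₗ[ℝ] ℝ) (r : ℕ) (e : ℕ → V) (e' : ℕ → W) :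
    Continuous fun t => β (tev r e t) (tev r e' t) := by
  simp_rw [bilin_tev]
  unfold tev
  fun_prop

lemma continuous_bilin_tdv (β : V →ₗ[ℝ] W →ₗ[ℝ] ℝ) (r : ℕ) (e : ℕ → V) (e' : ℕ → W) :
    Continuous fun t => β (tdv r e t) (tev r e' t) := by
  simp only [tev, tdv, LinearMap.sum_apply, LinearMap.smul_apply, map_sum, map_smul, smul_eq_mul]
  fun_prop

lemma hasDerivAt_bilin_tev (β : V →ₗ[ℝ] W →ₗ[ℝ] ℝ) (r : ℕ) (e : ℕ → V) (e' : ℕ → W) (t : ℝ) :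
    HasDerivAt (fun t => β (tev r e t) (tev r e' t))
      (β (tdv r e t) (tev r e' t) + β (tev r e t) (tdv r e' t)) t := by
  have h1 : ∀ t, β (tev r e t) (tev r e' t) = ∑ i ∈ Finset.range (r + 1),
      ∑ j ∈ Finset.range (r + 1), t ^ i * (t ^ j * β (e i) (e' j)) := by
    intro t
    rw [bilin_tev]
    simp only [tev, smul_eq_mul, Finset.mul_sum]
  have h2 : β (tdv r e t) (tev r e' t) + β (tev r e t) (tdv r e' t) =
      ∑ i ∈ Finset.range (r + 1), ∑ j ∈ Finset.range (r + 1),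
        ((i : ℝ) * t ^ (i - 1) * (t ^ j * β (e i) (e' j)) +
          t ^ i * ((j : ℝ) * t ^ (j - 1) * β (e i) (e' j))) := by
    simp only [tev, tdv, LinearMap.sum_apply, LinearMap.smul_apply, map_sum, map_smul,
      smul_eq_mul, Finset.sum_add_distrib, Finset.mul_sum]
    congr 1
    all_goals
      rw [Finset.sum_comm]
      exact Finset.sum_congr rfl fun i _ => Finset.sum_congr rfl fun j _ => by ring
  simp_rw [h1]
  rw [h2]
  refine HasDerivAt.fun_sum fun i _ => HasDerivAt.fun_sum fun j _ => ?_
  exact (hasDerivAt_pow i t).mul ((hasDerivAt_pow j t).mul_const _)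

/-- A combination of vectors with polynomial coefficients is a polynomial in time. -/
lemma sum_eval_smul_eq_tev {r m : ℕ} {κ : ℕ → ℝ[X]} (hκ : ∀ i < m, (κ i).natDegree ≤ r)
    (p : ℕ → V) (t : ℝ) : ∑ i ∈ Finset.range m, (κ i).eval t • p i =
      tev r (fun l => ∑ i ∈ Finset.range m, (κ i).coeff l • p i) t := by
  simp only [tev, Finset.smul_sum]
  rw [Finset.sum_comm]
  refine Finset.sum_congr rfl fun i hi => ?_
  rw [Polynomial.eval_eq_sum_range' (Nat.lt_succ_of_le (hκ i (Finset.mem_range.1 hi))),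
    Finset.sum_smul]
  exact Finset.sum_congr rfl fun l _ => by rw [smul_smul, mul_comm]

lemma sum_derivative_eval_smul_eq_tdv {r m : ℕ} {κ : ℕ → ℝ[X]}
    (hκ : ∀ i < m, (κ i).natDegree ≤ r) (p : ℕ → V) (t : ℝ) :
    ∑ i ∈ Finset.range m, (κ i).derivative.eval t • p i =
      tdv r (fun l => ∑ i ∈ Finset.range m, (κ i).coeff l • p i) t := by
  simp only [tdv, Finset.smul_sum]
  rw [Finset.sum_comm]
  refine Finset.sum_congr rfl fun i hi => ?_
  rw [Polynomial.derivative_eval, Polynomial.sum_over_range' _ _ (r + 1)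
    (Nat.lt_succ_of_le (hκ i (Finset.mem_range.1 hi))), Finset.sum_smul]
  · exact Finset.sum_congr rfl fun l _ => by rw [smul_smul]; ring_nf
  · simp

/-- `tev` with scalar coefficients as a polynomial. -/
lemma exists_poly_tev (r : ℕ) (c : ℕ → ℝ) :
    ∃ p : ℝ[X], p.natDegree ≤ r ∧ ∀ t, p.eval t = tev r c t := by
  refine ⟨∑ i ∈ Finset.range (r + 1), Polynomial.C (c i) * Polynomial.X ^ i, ?_, fun t => ?_⟩
  · apply Polynomial.natDegree_sum_le_of_forall_le
    intro i hi
    refine (Polynomial.natDegree_C_mul_X_pow_le _ _).trans ?_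
    have := Finset.mem_range.1 hi
    omega
  · rw [Polynomial.eval_finsetSum, tev]
    refine Finset.sum_congr rfl fun i _ => ?_
    simp only [Polynomial.eval_mul, Polynomial.eval_C, Polynomial.eval_pow, Polynomial.eval_X,
      smul_eq_mul]
    ring

end TimePoly

/-! ### Approximation in time -/

/-- The scaled monomial `(t - t₀)ⁱ / i!`. -/
def monoT (t₀ : ℝ) (i : ℕ) : ℝ[X] :=
  Polynomial.C ((i.factorial : ℝ)⁻¹) * (Polynomial.X - Polynomial.C t₀) ^ i

lemma monoT_eval (t₀ : ℝ) (i : ℕ) (t : ℝ) :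
    (monoT t₀ i).eval t = (i.factorial : ℝ)⁻¹ * (t - t₀) ^ i := by simp [monoT]

lemma monoT_natDegree (t₀ : ℝ) (i : ℕ) : (monoT t₀ i).natDegree ≤ i := by
  refine (Polynomial.natDegree_C_mul_le _ _).trans (Polynomial.natDegree_pow_le.trans ?_)
  rw [Polynomial.natDegree_X_sub_C, mul_one]

lemma monoT_derivative_zero (t₀ : ℝ) : (monoT t₀ 0).derivative = 0 := by simp [monoT]

lemma monoT_derivative_succ (t₀ : ℝ) (i : ℕ) : (monoT t₀ (i + 1)).derivative = monoT t₀ i := by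
  rw [monoT, monoT, Polynomial.derivative_C_mul, Polynomial.derivative_X_sub_C_pow,
    Nat.add_sub_cancel, ← mul_assoc, Nat.factorial_succ]
  congr 1
  rw [← Polynomial.C_mul]
  congr 1
  have h1 : ((i : ℝ) + 1) ≠ 0 := by positivity
  have h2 : (i.factorial : ℝ) ≠ 0 := by positivity
  push_cast
  field_simp

/-- The coefficient polynomials of the comparison function on the time interval `(l,t₀)`: a Taylor
polynomial at `t₀` whose term of degree `r + 1` is replaced by its Gauss–Radau projection. -/
def timeCoeff (r : ℕ) (l t₀ : ℝ) (i : ℕ) : ℝ[X] :=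
  if i ≤ r then monoT t₀ i else cellRadau r t₀ (l - t₀) (polyC (monoT t₀ (r + 1)))

/-- The defect of the Gauss–Radau projection of the term of degree `r + 1`. -/
def timeDefect (r : ℕ) (l t₀ : ℝ) : ℝ[X] := timeCoeff r l t₀ (r + 1) - monoT t₀ (r + 1)

lemma timeCoeff_natDegree (r : ℕ) (l t₀ : ℝ) (i : ℕ) : (timeCoeff r l t₀ i).natDegree ≤ r := by
  unfold timeCoeff
  split_ifs with h
  · exact (monoT_natDegree _ _).trans h
  · exact cellRadau_natDegree _ _ _ _

lemma timeCoeff_last (r : ℕ) (l t₀ : ℝ) : timeCoeff r l t₀ (r + 1) =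
    cellRadau r t₀ (l - t₀) (polyC (monoT t₀ (r + 1))) := by simp [timeCoeff]

lemma timeCoeff_eval_right {r : ℕ} {l t₀ : ℝ} (hl : l < t₀) (i : ℕ) (hi : i ≤ r + 1) :
    (timeCoeff r l t₀ i).eval t₀ = if i = 0 then 1 else 0 := by
  rcases hi.lt_or_eq with h | rfl
  · rw [timeCoeff, if_pos (by omega), monoT_eval]
    split_ifs with h0
    · simp [h0]
    · simp [h0]
  · rw [timeCoeff_last, cellRadau_eval_base r (sub_neg.2 hl).ne, polyC_apply, monoT_eval]
    simp

lemma timeDefect_eval_right {r : ℕ} {l t₀ : ℝ} (hl : l < t₀) : (timeDefect r l t₀).eval t₀ = 0 := by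
  rw [timeDefect, Polynomial.eval_sub, timeCoeff_eval_right hl _ le_rfl, monoT_eval]
  simp

lemma timeDefect_orth {r : ℕ} {l t₀ : ℝ} (hl : l < t₀) {p : ℝ[X]}
    (hp : p ∈ Polynomial.degreeLT ℝ r) :
    ∫ t in l..t₀, (timeDefect r l t₀).eval t * p.eval t = 0 := by
  have h1 := cellRadau_orth (x₀ := t₀) (sub_neg.2 hl).ne (polyC (monoT t₀ (r + 1))) hp
  rw [add_sub_cancel, intervalIntegral.integral_symm, intervalIntegral.integral_symm l,
    neg_inj, ← sub_eq_zero, ← intervalIntegral.integral_sub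
      (Continuous.intervalIntegrable (by fun_prop) _ _)
      (Continuous.intervalIntegrable (by fun_prop) _ _)] at h1
  rw [← h1]
  refine intervalIntegral.integral_congr fun x _ => ?_
  simp [timeDefect, timeCoeff_last, sub_mul]

/-- The consistency of the time discretization for the term of degree `r + 1`. -/
lemma timeDefect_consistency {r : ℕ} {l t₀ : ℝ} (hl : l < t₀) {p : ℝ[X]} (hp : p.natDegree ≤ r) :
    (∫ t in l..t₀, (timeDefect r l t₀).derivative.eval t * p.eval t) +
      (timeDefect r l t₀).eval l * p.eval l = 0 := by
  -- The defect vanishes at t₀ and is orthogonal to p', so integration by parts leaves only the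
  -- boundary term at l.
  have h1 := cell_ibp hl.le (f := polyC (timeDefect r l t₀))
    (f' := polyC (timeDefect r l t₀).derivative) (g := polyC p) (g' := polyC p.derivative)
    (fun x _ => (timeDefect r l t₀).hasDerivAt x) (fun x _ => p.hasDerivAt x)
  simp only [polyC_apply, timeDefect_eval_right hl, zero_mul, zero_sub,
    timeDefect_orth hl (derivative_mem_degreeLT hp), zero_add] at h1
  linarith

/-- The scaled stability of the Radau projection gives Δ^{r+1} for the top coefficient and Δ^r for
its derivative, with Δ = t₀ - l. The restriction Δ ≤ T turns lower powers into constants. -/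
lemma exists_time_bound (r : ℕ) (T : ℝ) (hT : 0 < T) : ∃ C, 1 ≤ C ∧ ∀ l t₀ : ℝ, l < t₀ →
    t₀ - l ≤ T → ∀ t ∈ Icc l t₀,
      |(timeDefect r l t₀).eval t| ≤ C * (t₀ - l) ^ (r + 1) ∧
      ∀ i ≤ r + 1, |(timeCoeff r l t₀ i).eval t| ≤ C ∧ |(timeCoeff r l t₀ i).derivative.eval t| ≤ C := by
  obtain ⟨C, hC, h⟩ := exists_cellRadau_sup r
  have hone : 1 ≤ (1 + T) ^ (r + 1) := one_le_pow₀ (by linarith)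
  refine ⟨(C + 1) * (1 + T) ^ (r + 1), by nlinarith, fun l t₀ hl hlT t ht => ?_⟩
  set Δ := t₀ - l with hΔ
  have hΔ0 : 0 < Δ := sub_pos.2 hl
  have hmono : ∀ i, ∀ s ∈ Icc l t₀, |(monoT t₀ i).eval s| ≤ Δ ^ i := by
    intro i s hs
    rw [monoT_eval, abs_mul, abs_pow]
    have h1 : |(i.factorial : ℝ)⁻¹| ≤ 1 := by
      rw [abs_of_nonneg (by positivity)]
      exact inv_le_one_of_one_le₀ (by exact_mod_cast Nat.one_le_iff_ne_zero.2 (Nat.factorial_ne_zero i))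
    have h2 : |s - t₀| ≤ Δ := by rw [abs_le]; constructor <;> linarith [hs.1, hs.2]
    calc _ ≤ 1 * Δ ^ i := by gcongr
      _ = _ := one_mul _
  have hpow : ∀ i ≤ r + 1, Δ ^ i ≤ (1 + T) ^ (r + 1) := fun i hi => by
    calc Δ ^ i ≤ (1 + T) ^ i := by gcongr; linarith
      _ ≤ _ := pow_le_pow_right₀ (by linarith) hi
  have hmem : ∀ y ∈ Icc (0 : ℝ) 1, t₀ + (l - t₀) * y ∈ Icc l t₀ := fun y hy =>
    ⟨by nlinarith [hy.1, hy.2], by nlinarith [hy.1, hy.2]⟩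
  obtain ⟨y, hy, hyt⟩ : ∃ y ∈ Icc (0 : ℝ) 1, t₀ + (l - t₀) * y = t := by
    refine ⟨(t₀ - t) / Δ, ⟨div_nonneg (by linarith [ht.2]) hΔ0.le,
      (div_le_one hΔ0).2 (by linarith [ht.1])⟩, ?_⟩
    have : l - t₀ = -Δ := by rw [hΔ]; ring
    rw [this]
    field_simp
    ring
  have hlast := h t₀ (l - t₀) (polyC (monoT t₀ (r + 1))) (Δ ^ (r + 1)) (sub_neg.2 hl).ne
    (fun y hy => hmono (r + 1) _ (hmem y hy)) y hy
  rw [hyt, ← timeCoeff_last, show |l - t₀| = Δ by rw [abs_sub_comm, abs_of_pos hΔ0]] at hlast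
  obtain ⟨hl1, hl2⟩ := hlast
  have hl3 : |(timeCoeff r l t₀ (r + 1)).derivative.eval t| ≤ C * Δ ^ r := by
    rw [pow_succ, ← mul_assoc, mul_comm] at hl2
    exact le_of_mul_le_mul_right hl2 hΔ0
  have hP : 0 < (1 + T) ^ (r + 1) := by positivity
  refine ⟨?_, fun i hi => ?_⟩
  · have h3 := hmono (r + 1) t ht
    rw [timeDefect, Polynomial.eval_sub]
    calc _ ≤ _ := abs_sub _ _
      _ ≤ C * Δ ^ (r + 1) + Δ ^ (r + 1) := add_le_add hl1 h3
      _ = (C + 1) * 1 * Δ ^ (r + 1) := by ring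
      _ ≤ _ := by gcongr
  · rcases hi.lt_or_eq with hi | rfl
    · have hc : timeCoeff r l t₀ i = monoT t₀ i := by rw [timeCoeff, if_pos (by omega)]
      rw [hc]
      have hbig : (1 + T) ^ (r + 1) ≤ (C + 1) * (1 + T) ^ (r + 1) :=
        le_mul_of_one_le_left hP.le (by linarith)
      refine ⟨(hmono i t ht).trans ((hpow i (by omega)).trans hbig), ?_⟩
      cases i with
      | zero => rw [monoT_derivative_zero]; simp; positivity
      | succ i =>
        rw [monoT_derivative_succ]
        exact (hmono i t ht).trans ((hpow i (by omega)).trans hbig)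
    · have h4 := hpow r (by omega)
      have h5 := hpow (r + 1) le_rfl
      constructor
      · refine hl1.trans ?_
        calc C * Δ ^ (r + 1) ≤ C * (1 + T) ^ (r + 1) := by gcongr
          _ ≤ _ := by gcongr; linarith
      · refine hl3.trans ?_
        calc C * Δ ^ r ≤ C * (1 + T) ^ (r + 1) := mul_le_mul_of_nonneg_left h4 (by linarith)
          _ ≤ _ := by gcongr; linarith

/-- Errors of the comparison function for a scalar function of time. -/
lemma exists_time_error (r : ℕ) (T : ℝ) (hT : 0 < T) : ∃ C, 1 ≤ C ∧ ∀ (l t₀ : ℝ), l < t₀ →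
    t₀ - l ≤ T → ∀ (W : ℕ → ℝ → ℝ) (B : ℝ), (∀ i, Continuous (W i)) →
    (∀ i, ∀ t ∈ Ioo l t₀, HasDerivAt (W i) (W (i + 1) t) t) →
    (∀ i ≤ r + 2, ∀ t ∈ Icc l t₀, |W i t| ≤ B) → ∀ t ∈ Icc l t₀,
      |∑ i ∈ Finset.range (r + 2), (timeCoeff r l t₀ i).eval t * W i t₀| ≤ C * B ∧
      |∑ i ∈ Finset.range (r + 2), (timeCoeff r l t₀ i).derivative.eval t * W i t₀| ≤ C * B ∧
      |W 0 t - ∑ i ∈ Finset.range (r + 2), (timeCoeff r l t₀ i).eval t * W i t₀| ≤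
        C * (t₀ - l) ^ (r + 1) * B ∧
      |W 0 t - (∑ i ∈ Finset.range (r + 2), (timeCoeff r l t₀ i).eval t * W i t₀) +
        (timeDefect r l t₀).eval t * W (r + 1) t₀| ≤ C * (t₀ - l) ^ (r + 2) * B ∧
      |W 1 t - (∑ i ∈ Finset.range (r + 2), (timeCoeff r l t₀ i).derivative.eval t * W i t₀) +
        (timeDefect r l t₀).derivative.eval t * W (r + 1) t₀| ≤ C * (t₀ - l) ^ (r + 1) * B := by
  obtain ⟨C, hC, h⟩ := exists_time_bound r T hT
  -- The first summand bounds the sums of r + 2 terms. The second bounds the defect plus the Taylor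
  -- remainder, whose extra power of Δ is estimated by T.
  refine ⟨(r + 2) * C + (C + T + 1), by nlinarith [(Nat.cast_nonneg r : (0 : ℝ) ≤ r)], ?_⟩
  intro l t₀ hl hlT W B hW hd hB t ht
  obtain ⟨h1, h2⟩ := h l t₀ hl hlT t ht
  have ht₀ : t₀ ∈ Icc l t₀ := right_mem_Icc.2 hl.le
  have hB0 : 0 ≤ B := (abs_nonneg _).trans (hB 0 (by omega) t ht)
  set Δ := t₀ - l with hΔ
  have hΔ0 : 0 < Δ := sub_pos.2 hl
  have hr0 : (0 : ℝ) ≤ r := Nat.cast_nonneg r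
  have hsum : ∀ c : ℕ → ℝ, (∀ i ≤ r + 1, |c i| ≤ C) →
      |∑ i ∈ Finset.range (r + 2), c i * W i t₀| ≤ ((r + 2) * C + (C + T + 1)) * B := by
    intro c hc
    calc |∑ i ∈ Finset.range (r + 2), c i * W i t₀|
        ≤ ∑ i ∈ Finset.range (r + 2), |c i * W i t₀| := Finset.abs_sum_le_sum_abs _ _
      _ ≤ ∑ i ∈ Finset.range (r + 2), C * B := by
          refine Finset.sum_le_sum fun i hi => ?_
          have hi := Finset.mem_range.1 hi
          rw [abs_mul]
          exact mul_le_mul (hc i (by omega)) (hB i (by omega) t₀ ht₀) (abs_nonneg _) (by linarith)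
      _ = (r + 2) * C * B := by simp; ring
      _ ≤ _ := by gcongr; linarith
  have htΔ : |t - t₀| ≤ Δ := by rw [abs_le]; constructor <;> linarith [ht.1, ht.2]
  have hsub : uIcc t₀ t ⊆ Icc l t₀ := uIcc_subset_Icc ht₀ ht
  have htay0 := abs_taylor_remainder_le (r + 2) W B (fun i => (hW i).continuousOn) hd t₀ ht₀ t ht
    (fun y hy => hB (r + 2) le_rfl y (hsub hy))
  have htay1 := abs_taylor_remainder_le (r + 1) (fun i => W (i + 1)) B
    (fun i => (hW (i + 1)).continuousOn) (fun i => hd (i + 1)) t₀ ht₀ t ht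
    (fun y hy => hB (r + 2) le_rfl y (hsub hy))
  -- The comparison function is the Taylor polynomial of degree r + 1 plus the defect times the
  -- derivative of order r + 1. Once that product is taken out, the error is a Taylor remainder of
  -- order r + 2.
  have e0 : ∑ i ∈ Finset.range (r + 2), W i t₀ / (i.factorial : ℝ) * (t - t₀) ^ i =
      (∑ i ∈ Finset.range (r + 2), (timeCoeff r l t₀ i).eval t * W i t₀) -
        (timeDefect r l t₀).eval t * W (r + 1) t₀ := by
    rw [Finset.sum_range_succ, Finset.sum_range_succ _ (r + 1), timeDefect, Polynomial.eval_sub,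
      monoT_eval]
    have : ∑ i ∈ Finset.range (r + 1), W i t₀ / (i.factorial : ℝ) * (t - t₀) ^ i =
        ∑ i ∈ Finset.range (r + 1), (timeCoeff r l t₀ i).eval t * W i t₀ := by
      refine Finset.sum_congr rfl fun i hi => ?_
      have hi := Finset.mem_range.1 hi
      rw [timeCoeff, if_pos (by omega), monoT_eval]
      ring
    rw [this]
    ring
  have e1 : ∑ i ∈ Finset.range (r + 1), W (i + 1) t₀ / (i.factorial : ℝ) * (t - t₀) ^ i =
      (∑ i ∈ Finset.range (r + 2), (timeCoeff r l t₀ i).derivative.eval t * W i t₀) -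
        (timeDefect r l t₀).derivative.eval t * W (r + 1) t₀ := by
    rw [Finset.sum_range_succ _ (r + 1), timeDefect, Polynomial.derivative_sub,
      Polynomial.eval_sub, monoT_derivative_succ, monoT_eval, Finset.sum_range_succ,
      Finset.sum_range_succ' _ r]
    have : ∑ i ∈ Finset.range r, W (i + 1) t₀ / (i.factorial : ℝ) * (t - t₀) ^ i =
        ∑ i ∈ Finset.range r, (timeCoeff r l t₀ (i + 1)).derivative.eval t * W (i + 1) t₀ := by
      refine Finset.sum_congr rfl fun i hi => ?_
      have hi := Finset.mem_range.1 hi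
      rw [timeCoeff, if_pos (by omega), monoT_derivative_succ, monoT_eval]
      ring
    rw [this]
    have h0 : (timeCoeff r l t₀ 0).derivative = 0 := by
      rw [timeCoeff, if_pos (by omega), monoT_derivative_zero]
    rw [h0, Polynomial.eval_zero]
    ring
  rw [e0] at htay0
  rw [e1] at htay1
  have hp1 : |t - t₀| ^ (r + 2) ≤ Δ ^ (r + 2) := pow_le_pow_left₀ (abs_nonneg _) htΔ _
  have hp2 : |t - t₀| ^ (r + 1) ≤ Δ ^ (r + 1) := pow_le_pow_left₀ (abs_nonneg _) htΔ _
  have f1 : |W 0 t - (∑ i ∈ Finset.range (r + 2), (timeCoeff r l t₀ i).eval t * W i t₀) +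
        (timeDefect r l t₀).eval t * W (r + 1) t₀| ≤ B * Δ ^ (r + 2) := by
    refine le_trans (le_of_eq ?_) (htay0.trans (mul_le_mul_of_nonneg_left hp1 hB0))
    congr 1; ring
  have f2 : |W 1 t - (∑ i ∈ Finset.range (r + 2), (timeCoeff r l t₀ i).derivative.eval t * W i t₀) +
        (timeDefect r l t₀).derivative.eval t * W (r + 1) t₀| ≤ B * Δ ^ (r + 1) := by
    refine le_trans (le_of_eq ?_) (htay1.trans (mul_le_mul_of_nonneg_left hp2 hB0))
    rw [zero_add]
    congr 1; ring
  have hK1 : 1 ≤ (r + 2) * C + (C + T + 1) := by nlinarith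
  have hK2 : C + T ≤ (r + 2) * C + (C + T + 1) := by nlinarith
  refine ⟨hsum _ fun i hi => (h2 i hi).1, hsum _ fun i hi => (h2 i hi).2, ?_, ?_, ?_⟩
  · have f3 : |(timeDefect r l t₀).eval t * W (r + 1) t₀| ≤ C * Δ ^ (r + 1) * B := by
      rw [abs_mul]
      exact mul_le_mul h1 (hB (r + 1) (by omega) t₀ ht₀) (abs_nonneg _) (by positivity)
    have f4 : B * Δ ^ (r + 2) ≤ T * Δ ^ (r + 1) * B := by
      have : 0 ≤ B * Δ ^ (r + 1) := by positivity
      calc B * Δ ^ (r + 2) = Δ * (B * Δ ^ (r + 1)) := by ring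
        _ ≤ T * (B * Δ ^ (r + 1)) := by gcongr
        _ = _ := by ring
    have f5 : (C + T) * (Δ ^ (r + 1) * B) ≤ ((r + 2) * C + (C + T + 1)) * (Δ ^ (r + 1) * B) := by
      gcongr
    rw [abs_le] at f1 f3 ⊢
    constructor <;> linarith
  · refine f1.trans ?_
    calc B * Δ ^ (r + 2) = 1 * (Δ ^ (r + 2) * B) := by ring
      _ ≤ ((r + 2) * C + (C + T + 1)) * (Δ ^ (r + 2) * B) := by gcongr
      _ = _ := by ring
  · refine f2.trans ?_
    calc B * Δ ^ (r + 1) = 1 * (Δ ^ (r + 1) * B) := by ring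
      _ ≤ ((r + 2) * C + (C + T + 1)) * (Δ ^ (r + 1) * B) := by gcongr
      _ = _ := by ring

end LDG

end

/-! ### Translation of the scheme to cellwise polynomials. -/

noncomputable section

namespace LDG

open scoped Polynomial

/-! ### Functions that are given cellwise -/

/-- `w` agrees with the cellwise function `f` in the interior of each cell. -/
def IsRep (n : ℕ) (X : ℕ → ℝ) (w : ℝ → ℝ) (f : CellFn) : Prop :=
  ∀ j ≤ n, ∀ x ∈ Ioo (X j) (X (j + 1)), w x = f j x

section Rep

variable {n : ℕ} {X : ℕ → ℝ} {w v : ℝ → ℝ} {f g : CellFn}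

lemma IsRep.sub (hw : IsRep n X w f) (hv : IsRep n X v g) :
    IsRep n X (fun x => w x - v x) (f - g) := fun j hj x hx => by
  simp only [hw j hj x hx, hv j hj x hx, Pi.sub_apply, ContinuousMap.sub_apply]

lemma IsRep.mul (hw : IsRep n X w f) (hv : IsRep n X v g) :
    IsRep n X (fun x => w x * v x) (f * g) := fun j hj x hx => by
  simp only [hw j hj x hx, hv j hj x hx, Pi.mul_apply, ContinuousMap.mul_apply]

lemma isRep_cst (h : IsGrid n X) {c : C(ℝ, ℝ)} (hc : ∀ x ∈ Ioo (0 : ℝ) 1, w x = c x) :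
    IsRep n X w (cst c) := fun _ hj x hx => hc x (h.Ioo_subset hj hx)

/-- The mesh points form a null set, so the values of a discrete function there play no role. -/
lemma IsRep.intervalIntegral (h : IsGrid n X) (hw : IsRep n X w f) :
    ∫ x in (0 : ℝ)..1, w x = ∑ j ∈ Finset.range (n + 1), ∫ x in (X j)..(X (j + 1)), f j x := by
  rw [← h.zero, ← h.one, ← intervalIntegral.sum_integral_adjacent_intervals]
  · refine Finset.sum_congr rfl fun j hj => ?_
    have hj : j ≤ n := by simpa [Nat.lt_succ_iff] using hj
    exact intervalIntegral.integral_congr_Ioo_of_le (h.lt j hj).le (hw j hj)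
  · intro j hj
    have hj : j ≤ n := by omega
    refine IntervalIntegrable.congr_uIoo (f := fun x => f j x)
      (Continuous.intervalIntegrable (by fun_prop) _ _) ?_
    rw [uIoo_of_le (h.lt j hj).le]
    exact fun x hx => (hw j hj x hx).symm

lemma IsRep.l2 (h : IsGrid n X) (hw : IsRep n X w f) (hv : IsRep n X v g) :
    l2 w v = cip (n + 1) X f g := (hw.mul hv).intervalIntegral h

lemma IsRep.trL (h : IsGrid n X) (hw : IsRep n X w f) {j : ℕ} (hj : j ≤ n) :
    trL X w (j + 1) = f j (X (j + 1)) := by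
  refine leftLim_eq_of_tendsto ?_
  refine Tendsto.congr' ?_ ((f j).continuous.tendsto (X (j + 1)) |>.mono_left nhdsWithin_le_nhds)
  filter_upwards [Ioo_mem_nhdsLT (h.lt j hj)] with x hx
  exact (hw j hj x hx).symm

lemma IsRep.trR (h : IsGrid n X) (hw : IsRep n X w f) {j : ℕ} (hj : j ≤ n) :
    trR X w j = f j (X j) := by
  refine rightLim_eq_of_tendsto ?_
  refine Tendsto.congr' ?_ ((f j).continuous.tendsto (X j) |>.mono_left nhdsWithin_le_nhds)
  filter_upwards [Ioo_mem_nhdsGT (h.lt j hj)] with x hx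
  exact (hw j hj x hx).symm

lemma IsRep.jump_zero (h : IsGrid n X) (hw : IsRep n X w f) :
    jump (n + 1) X w 0 = f 0 (X 0) := by
  rw [jump, if_pos rfl, hw.trR h (Nat.zero_le _)]

lemma IsRep.jump_last (h : IsGrid n X) (hw : IsRep n X w f) :
    jump (n + 1) X w (n + 1) = -f n (X (n + 1)) := by
  rw [jump, if_neg (by omega), if_pos rfl, hw.trL h le_rfl]

lemma IsRep.jump_succ (h : IsGrid n X) (hw : IsRep n X w f) {j : ℕ} (hj : j < n) :
    jump (n + 1) X w (j + 1) = f (j + 1) (X (j + 1)) - f j (X (j + 1)) := by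
  rw [jump, if_neg (by omega), if_neg (by omega), hw.trL h hj.le, hw.trR h (by omega)]

lemma IsRep.deriv {p : CellPoly} (hw : IsRep n X w (emb p)) :
    IsRep n X (_root_.deriv w) (emb (dP p)) := fun j hj x hx => by
  have : w =ᶠ[𝓝 x] fun y => (p j).eval y := by
    filter_upwards [Ioo_mem_nhds hx.1 hx.2] with y hy using hw j hj y hy
  rw [this.deriv_eq, Polynomial.deriv]
  rfl

/-- The bilinear form for functions that are given cellwise. -/
lemma bilin_eq_ldgForm (h : IsGrid n X) {ε : ℝ} {a b u q v s : ℝ → ℝ} {A A' B : C(ℝ, ℝ)}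
    {fu fq : CellFn} {pv ps : CellPoly} (hA : ∀ x ∈ Icc (0 : ℝ) 1, a x = A x)
    (hA' : ∀ x ∈ Icc (0 : ℝ) 1, coefDeriv a x = A' x) (hB : ∀ x ∈ Icc (0 : ℝ) 1, b x = B x)
    (hu : IsRep n X u fu) (hq : IsRep n X q fq) (hv : IsRep n X v (emb pv))
    (hs : IsRep n X s (emb ps)) :
    bilin ε a b (n + 1) X u q v s =
      ldgForm ε (penalty ε (n + 1) X) A (B - A') n X (fu, fq) (pv, ps) := by
  have hcA : IsRep n X a (cst A) := isRep_cst h fun x hx => hA x (Ioo_subset_Icc_self hx)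
  have hcc : IsRep n X (fun x => b x - coefDeriv a x) (cst (B - A')) := isRep_cst h fun x hx => by
    rw [hA' x (Ioo_subset_Icc_self hx), hB x (Ioo_subset_Icc_self hx), ContinuousMap.sub_apply]
  rw [ldgForm_apply, ldgFun, bilin, hq.l2 h hs, (hcc.mul hu).l2 h hv, hu.l2 h hs.deriv,
    hq.l2 h hv.deriv, (hcA.mul hu).l2 h hv.deriv]
  have e1 : ∑ j ∈ Finset.Ico 1 (n + 1), trL X u j * jump (n + 1) X s j = jumpL n X fu ps := by
    rw [Finset.sum_Ico_eq_sum_range, jumpL_apply, Nat.add_sub_cancel]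
    refine Finset.sum_congr rfl fun j hj => ?_
    have hj := Finset.mem_range.1 hj
    rw [add_comm 1 j, hu.trL h hj.le, hs.jump_succ h hj]
    rfl
  have e2 : ∑ j ∈ Finset.range (n + 1), trR X q j * jump (n + 1) X v j =
      fq 0 (X 0) * (pv 0).eval (X 0) + jumpR n X fq pv := by
    rw [Finset.sum_range_succ', jumpR_apply, hq.trR h (Nat.zero_le _), hv.jump_zero h, add_comm]
    congr 1
    refine Finset.sum_congr rfl fun j hj => ?_
    have hj := Finset.mem_range.1 hj
    rw [hq.trR h (by omega), hv.jump_succ h hj]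
    rfl
  have e3 : ∑ j ∈ Finset.Icc 1 (n + 1), a (X j) * trL X u j * jump (n + 1) X v j =
      jumpL n X (cst A * fu) pv - A (X (n + 1)) * fu n (X (n + 1)) * (pv n).eval (X (n + 1)) := by
    rw [show Finset.Icc 1 (n + 1) = Finset.Ico 1 (n + 2) from by ext; simp; omega,
      Finset.sum_Ico_eq_sum_range, show n + 2 - 1 = n + 1 by omega, Finset.sum_range_succ,
      jumpL_apply, add_comm 1 n, hu.trL h le_rfl, hv.jump_last h, hA _ (h.mem le_rfl)]
    have : ∀ j ∈ Finset.range n, a (X (1 + j)) * trL X u (1 + j) * jump (n + 1) X v (1 + j) =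
        (cst A * fu) j (X (j + 1)) * ((pv (j + 1)).eval (X (j + 1)) - (pv j).eval (X (j + 1))) := by
      intro j hj
      have hj := Finset.mem_range.1 hj
      rw [add_comm 1 j, hu.trL h hj.le, hv.jump_succ h hj, hA _ (h.mem (by omega))]
      rfl
    rw [Finset.sum_congr rfl this, emb_apply]
    ring
  rw [e1, e2, e3, hq.trL h le_rfl, hv.trL h le_rfl, hu.trL h le_rfl, emb_apply]
  ring

/-- The energy norm for functions that are given cellwise. -/
lemma energySq_eq_ldgEnergy (h : IsGrid n X) {ε : ℝ} {a b u q : ℝ → ℝ} {A A' B : C(ℝ, ℝ)}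
    {fu fq : CellFn} (hA : ∀ x ∈ Icc (0 : ℝ) 1, a x = A x)
    (hA' : ∀ x ∈ Icc (0 : ℝ) 1, coefDeriv a x = A' x) (hB : ∀ x ∈ Icc (0 : ℝ) 1, b x = B x)
    (hu : IsRep n X u fu) (hq : IsRep n X q fq) :
    energySq ε a b (n + 1) X u q =
      ldgEnergy ε (penalty ε (n + 1) X) A (B - (1 / 2 : ℝ) • A') n X fu fq := by
  have hcc : IsRep n X (fun x => b x - coefDeriv a x / 2) (cst (B - (1 / 2 : ℝ) • A')) :=
    isRep_cst h fun x hx => by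
      rw [hA' x (Ioo_subset_Icc_self hx), hB x (Ioo_subset_Icc_self hx)]
      simp
      ring
  rw [energySq, ldgEnergy, hq.l2 h hq, (hcc.mul hu).l2 h hu, Finset.sum_range_succ,
    Finset.sum_range_succ', hu.jump_zero h, hu.jump_last h, hA _ (h.mem le_rfl),
    hA _ (h.mem (Nat.zero_le _))]
  have : ∀ j ∈ Finset.range n, 1 / 2 * a (X (j + 1)) * jump (n + 1) X u (j + 1) ^ 2 =
      1 / 2 * (A (X (j + 1)) * (fu (j + 1) (X (j + 1)) - fu j (X (j + 1))) ^ 2) := by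
    intro j hj
    have hj := Finset.mem_range.1 hj
    rw [hu.jump_succ h hj, hA _ (h.mem (by omega))]
    ring
  rw [Finset.sum_congr rfl this, ← Finset.mul_sum]
  ring

/-! ### Discrete functions -/

/-- The broken polynomial with the given cellwise polynomials. -/
def glue (n : ℕ) (X : ℕ → ℝ) (p : CellPoly) (x : ℝ) : ℝ :=
  ∑ j ∈ Finset.range (n + 1), (Ioo (X j) (X (j + 1))).indicator (fun x => (p j).eval x) x

lemma isRep_glue (h : IsGrid n X) (p : CellPoly) : IsRep n X (glue n X p) (emb p) := by
  intro j hj x hx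
  rw [glue, Finset.sum_eq_single j]
  · rw [indicator_of_mem hx, emb_apply]
  · intro i hi hij
    refine indicator_of_notMem (fun hxi => ?_) _
    have hi := Finset.mem_range.1 hi
    rcases lt_or_gt_of_ne hij with hlt | hlt
    · have := h.mono (i := i + 1) (j := j) hlt (by omega)
      linarith [hx.1, hxi.2]
    · have := h.mono (i := j + 1) (j := i) hlt (by omega)
      linarith [hx.2, hxi.1]
  · intro hn
    exact absurd (Finset.mem_range.2 (by omega)) hn

lemma IsRep.isBrokenPoly {k : ℕ} {p : CellPoly} (hp : ∀ j, (p j).natDegree ≤ k)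
    (hw : IsRep n X w (emb p)) : IsBrokenPoly k (n + 1) X w :=
  fun j hj => ⟨p j, hp j, fun x hx => hw j (by omega) x hx⟩

lemma IsBrokenPoly.exists_cellPoly {k : ℕ} (hw : IsBrokenPoly k (n + 1) X w) :
    ∃ p : CellPoly, (∀ j, (p j).natDegree ≤ k) ∧ IsRep n X w (emb p) := by
  have h1 : ∀ j, ∃ p : ℝ[X], p.natDegree ≤ k ∧
      (j ≤ n → ∀ x ∈ Ioo (X j) (X (j + 1)), w x = p.eval x) := by
    intro j
    by_cases hj : j ≤ n
    · obtain ⟨p, hp, hpw⟩ := hw j (by omega)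
      exact ⟨p, hp, fun _ => hpw⟩
    -- Indices beyond the grid receive the zero polynomial, so the degree bound holds for every
    -- index.
    · exact ⟨0, by simp, fun h => absurd h hj⟩
  choose p hp hpw using h1
  exact ⟨p, hp, fun j hj x hx => hpw j hj x hx⟩

lemma isRep_sum {r : ℕ} {c : ℕ → ℝ → ℝ} {e : ℕ → CellPoly}
    (hc : ∀ i, IsRep n X (c i) (emb (e i))) (t : ℝ) :
    IsRep n X (fun x => ∑ i ∈ Finset.range (r + 1), t ^ i * c i x) (emb (tev r e t)) := by
  intro j hj x hx
  simp only [emb_apply, tev, Finset.sum_apply, Pi.smul_apply, Polynomial.eval_finsetSum,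
    Polynomial.eval_smul, smul_eq_mul]
  exact Finset.sum_congr rfl fun i _ => by rw [hc i j hj x hx, emb_apply]

lemma tev_eval (r : ℕ) (e : ℕ → CellPoly) (t : ℝ) (j : ℕ) (x : ℝ) :
    (tev r e t j).eval x = tev r (fun i => (e i j).eval x) t := by
  simp [tev, Polynomial.eval_finsetSum]

lemma tdv_eval (r : ℕ) (e : ℕ → CellPoly) (t : ℝ) (j : ℕ) (x : ℝ) :
    (tdv r e t j).eval x = tdv r (fun i => (e i j).eval x) t := by
  simp [tdv, Polynomial.eval_finsetSum]

lemma tev_natDegree {r k : ℕ} {e : ℕ → CellPoly} (he : ∀ i j, (e i j).natDegree ≤ k) (t : ℝ)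
    (j : ℕ) : (tev r e t j).natDegree ≤ k := by
  rw [tev, Finset.sum_apply]
  exact Polynomial.natDegree_sum_le_of_forall_le _ _ fun i _ =>
    (Polynomial.natDegree_smul_le _ _).trans (he i j)

/-- `V` is represented on the time intervals by the coefficients `e m`. -/
def IsTimeRep (r n : ℕ) (X : ℕ → ℝ) (T : ℝ) (M : ℕ) (V : ℝ → ℝ → ℝ) (e : ℕ → ℕ → CellPoly) : Prop :=
  ∀ m < M, ∀ t ∈ Ioc (timePt T M m) (timePt T M (m + 1)), IsRep n X (V t) (emb (tev r (e m) t))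

lemma timePt_lt {T : ℝ} (hT : 0 < T) {M m : ℕ} (hm : m < M) : timePt T M m < timePt T M (m + 1) := by
  have : 0 < T / M := div_pos hT (by exact_mod_cast (Nat.zero_le m).trans_lt hm)
  unfold timePt
  push_cast
  linarith

lemma timePt_sub (T : ℝ) (M m : ℕ) : timePt T M (m + 1) - timePt T M m = T / M := by
  unfold timePt; push_cast; ring

lemma timePt_self (T : ℝ) {M : ℕ} (hM : 1 ≤ M) : timePt T M M = T := by
  have : (M : ℝ) ≠ 0 := by positivity
  unfold timePt
  field_simp

lemma timePt_mem {T : ℝ} (hT : 0 < T) {M m : ℕ} (hm : m ≤ M) : timePt T M m ∈ Icc 0 T := by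
  have h0 : 0 ≤ T / M := by positivity
  refine ⟨by unfold timePt; positivity, ?_⟩
  rcases Nat.eq_zero_or_pos M with rfl | hM
  · simp [timePt]; exact hT.le
  · calc timePt T M m ≤ timePt T M M := by unfold timePt; gcongr
      _ = T := timePt_self T hM

lemma IsSpaceTimePoly.exists_isTimeRep {k r : ℕ} {T : ℝ} {M : ℕ} {V : ℝ → ℝ → ℝ}
    (hV : IsSpaceTimePoly k r (n + 1) X T M V) :
    ∃ e : ℕ → ℕ → CellPoly, (∀ m i j, (e m i j).natDegree ≤ k) ∧ IsTimeRep r n X T M V e := by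
  have h1 : ∀ m, ∃ e : ℕ → CellPoly, (∀ i j, (e i j).natDegree ≤ k) ∧ (m < M →
      ∀ t ∈ Ioc (timePt T M m) (timePt T M (m + 1)), IsRep n X (V t) (emb (tev r e t))) := by
    intro m
    by_cases hm : m < M
    · obtain ⟨c, hc, hcV⟩ := hV m hm
      choose e he hce using fun i => (hc i).exists_cellPoly
      refine ⟨e, he, fun _ t ht => ?_⟩
      rw [show V t = _ from funext (hcV t ht)]
      exact isRep_sum hce t
    · exact ⟨fun _ _ => 0, by simp, fun h => absurd h hm⟩
  choose e he heV using h1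
  exact ⟨e, he, fun m hm => heV m hm⟩

/-- The same coefficients serve on all time intervals. The scheme is posed on one interval at a
time, so test functions need not be localised. -/
lemma isSpaceTimePoly_glue (h : IsGrid n X) {k : ℕ} (r : ℕ) (T : ℝ) (M : ℕ) {e : ℕ → CellPoly}
    (he : ∀ i j, (e i j).natDegree ≤ k) :
    IsSpaceTimePoly k r (n + 1) X T M
      (fun t x => ∑ i ∈ Finset.range (r + 1), t ^ i * glue n X (e i) x) :=
  fun _ _ => ⟨fun i => glue n X (e i), fun i => (isRep_glue h _).isBrokenPoly (he i),
    fun _ _ _ => rfl⟩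

lemma isTimeRep_glue (h : IsGrid n X) (r : ℕ) (T : ℝ) (M : ℕ) (e : ℕ → CellPoly) :
    IsTimeRep r n X T M (fun t x => ∑ i ∈ Finset.range (r + 1), t ^ i * glue n X (e i) x)
      (fun _ => e) :=
  fun _ _ t _ => isRep_sum (fun i => isRep_glue h (e i)) t

section TimeRep

variable {r M m : ℕ} {T : ℝ} {V : ℝ → ℝ → ℝ} {e : ℕ → ℕ → CellPoly}

lemma IsTimeRep.timeR (hT : 0 < T) (hV : IsTimeRep r n X T M V e) (hm : m < M) :
    IsRep n X (timeR T M V m) (emb (tev r (e m) (timePt T M m))) := by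
  intro j hj x hx
  refine rightLim_eq_of_tendsto ?_
  rw [emb_apply, tev_eval]
  refine Tendsto.congr' ?_ ((continuous_tev r (fun i => (e m i j).eval x)).tendsto
    (timePt T M m) |>.mono_left nhdsWithin_le_nhds)
  filter_upwards [Ioc_mem_nhdsGT (timePt_lt hT hm)] with t ht
  rw [hV m hm t ht j hj x hx, emb_apply, tev_eval]

lemma IsTimeRep.timeL_succ (hT : 0 < T) (hV : IsTimeRep r n X T M V e) (hm : m < M)
    (V₀ : ℝ → ℝ) :
    IsRep n X (timeL T M V₀ V (m + 1)) (emb (tev r (e m) (timePt T M (m + 1)))) := by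
  intro j hj x hx
  rw [timeL, if_neg (by omega)]
  refine leftLim_eq_of_tendsto ?_
  rw [emb_apply, tev_eval]
  refine Tendsto.congr' ?_ ((continuous_tev r (fun i => (e m i j).eval x)).tendsto
    (timePt T M (m + 1)) |>.mono_left nhdsWithin_le_nhds)
  filter_upwards [Ioo_mem_nhdsLT (timePt_lt hT hm)] with t ht
  rw [hV m hm t ⟨ht.1, ht.2.le⟩ j hj x hx, emb_apply, tev_eval]

lemma IsTimeRep.deriv (hV : IsTimeRep r n X T M V e) (hm : m < M) {t : ℝ}
    (ht : t ∈ Ioo (timePt T M m) (timePt T M (m + 1))) :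
    IsRep n X (fun x => _root_.deriv (fun s => V s x) t) (emb (tdv r (e m) t)) := by
  intro j hj x hx
  have h1 : (fun s => V s x) =ᶠ[𝓝 t] fun s => tev r (fun i => (e m i j).eval x) s := by
    filter_upwards [Ioo_mem_nhds ht.1 ht.2] with s hs
    rw [hV m hm s ⟨hs.1, hs.2.le⟩ j hj x hx, emb_apply, tev_eval]
  refine h1.deriv_eq.trans ?_
  rw [(hasDerivAt_tev r _ t).deriv, emb_apply, tdv_eval]

end TimeRep

end Rep

/-! ### The scheme in terms of cellwise polynomials -/

/-- The value from the left of a discrete function at a time level. -/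
def prevPoly (r : ℕ) (T : ℝ) (M : ℕ) (p₀ : CellPoly) (e : ℕ → ℕ → CellPoly) : ℕ → CellPoly
  | 0 => p₀
  | m + 1 => tev r (e m) (timePt T M (m + 1))

lemma IsTimeRep.timeL {n r M m : ℕ} {X : ℕ → ℝ} {T : ℝ} {V : ℝ → ℝ → ℝ} {e : ℕ → ℕ → CellPoly}
    (hT : 0 < T) (hV : IsTimeRep r n X T M V e) (hm : m ≤ M) {V₀ : ℝ → ℝ} {p₀ : CellPoly}
    (hp : IsRep n X V₀ (emb p₀)) :
    IsRep n X (LDG.timeL T M V₀ V m) (emb (prevPoly r T M p₀ e m)) := by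
  cases m with
  | zero => intro j hj x hx; simpa [LDG.timeL, prevPoly] using hp j hj x hx
  | succ m => exact hV.timeL_succ hT hm V₀

/-- The space-time scheme in terms of cellwise polynomials. -/
structure IsCellDG (k r n : ℕ) (X : ℕ → ℝ) (T : ℝ) (M : ℕ)
    (form : (CellFn × CellFn) →ₗ[ℝ] (CellPoly × CellPoly) →ₗ[ℝ] ℝ) (F : ℝ → C(ℝ, ℝ))
    (w₀ : C(ℝ, ℝ)) (p₀ : CellPoly) (cu cq : ℕ → ℕ → CellPoly) : Prop where
  degU : ∀ m i j, (cu m i j).natDegree ≤ k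
  degQ : ∀ m i j, (cq m i j).natDegree ≤ k
  deg₀ : ∀ j, (p₀ j).natDegree ≤ k
  initial : ∀ v : CellPoly, (∀ j, (v j).natDegree ≤ k) →
    cip (n + 1) X (emb p₀) (emb v) = cip (n + 1) X (cst w₀) (emb v)
  scheme : ∀ m < M, ∀ ev es : ℕ → CellPoly, (∀ i j, (ev i j).natDegree ≤ k) →
    (∀ i j, (es i j).natDegree ≤ k) →
    (∫ t in (timePt T M m)..(timePt T M (m + 1)),
      (cip (n + 1) X (emb (tdv r (cu m) t)) (emb (tev r ev t)) +
        form (emb (tev r (cu m) t), emb (tev r (cq m) t)) (tev r ev t, tev r es t))) +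
      cip (n + 1) X (emb (tev r (cu m) (timePt T M m)) - emb (prevPoly r T M p₀ cu m))
        (emb (tev r ev (timePt T M m))) =
    ∫ t in (timePt T M m)..(timePt T M (m + 1)), cip (n + 1) X (cst (F t)) (emb (tev r ev t))

/-- Pointwise derivatives and one-sided limits become polynomial expressions. The time integrands
are compared on open intervals only: at the right end of an interval the two-sided derivative of U
need not be that of the polynomial. -/
lemma IsDGSolution.exists_isCellDG {k r n M : ℕ} {X : ℕ → ℝ} {T ε : ℝ} {a b u₀ : ℝ → ℝ}
    {f U Q : ℝ → ℝ → ℝ} {A A' B w₀ : C(ℝ, ℝ)} {F : ℝ → C(ℝ, ℝ)} (hT : 0 < T)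
    (h : IsGrid n X) (hA : ∀ x ∈ Icc (0 : ℝ) 1, a x = A x)
    (hA' : ∀ x ∈ Icc (0 : ℝ) 1, coefDeriv a x = A' x) (hB : ∀ x ∈ Icc (0 : ℝ) 1, b x = B x)
    (hw₀ : ∀ x ∈ Icc (0 : ℝ) 1, u₀ x = w₀ x)
    (hF : ∀ x ∈ Ioo (0 : ℝ) 1, ∀ t ∈ Ioc 0 T, f x t = F t x)
    (hDG : IsDGSolution k r ε a b (n + 1) X T M f u₀ U Q) :
    ∃ (p₀ : CellPoly) (cu cq : ℕ → ℕ → CellPoly), IsTimeRep r n X T M U cu ∧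
      IsTimeRep r n X T M Q cq ∧
      IsCellDG k r n X T M (ldgForm ε (penalty ε (n + 1) X) A (B - A') n X) F w₀ p₀ cu cq := by
  obtain ⟨hU, hQ, U₀, hU₀, hS⟩ := hDG
  obtain ⟨cu, hcud, hcu⟩ := hU.exists_isTimeRep
  obtain ⟨cq, hcqd, hcq⟩ := hQ.exists_isTimeRep
  obtain ⟨p₀, hp₀d, hp₀⟩ := hU₀.1.exists_cellPoly
  refine ⟨p₀, cu, cq, hcu, hcq, hcud, hcqd, hp₀d, fun v hv => ?_, fun m hm ev es hev hes => ?_⟩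
  · rw [cip_apply, cip_apply]
    refine Finset.sum_congr rfl fun j hj => ?_
    have hj' := Finset.mem_range.1 hj
    have hle := (h.lt j (by omega)).le
    have h1 := hU₀.2 j hj' (v j) (hv j)
    rw [intervalIntegral.integral_congr_Ioo_of_le (g := fun x => emb p₀ j x * emb v j x) hle
        (fun x hx => by simp only [hp₀ j (by omega) x hx, emb_apply]),
      intervalIntegral.integral_congr_Ioo_of_le (f := fun x => u₀ x * (v j).eval x)
        (g := fun x => cst w₀ j x * emb v j x) hle
        (fun x hx => by
          simp only [hw₀ x (h.Icc_subset (by omega) (Ioo_subset_Icc_self hx)), emb_apply,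
            cst_apply])] at h1
    exact h1
  · set l := timePt T M m
    set l' := timePt T M (m + 1)
    have hll : l ≤ l' := (timePt_lt hT hm).le
    set V : ℝ → ℝ → ℝ := fun t x => ∑ i ∈ Finset.range (r + 1), t ^ i * glue n X (ev i) x with hVdef
    set R : ℝ → ℝ → ℝ := fun t x => ∑ i ∈ Finset.range (r + 1), t ^ i * glue n X (es i) x with hRdef
    have hV : IsTimeRep r n X T M V fun _ => ev := isTimeRep_glue h r T M ev
    have hR : IsTimeRep r n X T M R fun _ => es := isTimeRep_glue h r T M es
    have h1 := hS V R (isSpaceTimePoly_glue h r T M hev) (isSpaceTimePoly_glue h r T M hes) m hm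
    rw [((hcu.timeR hT hm).sub (hcu.timeL hT hm.le hp₀)).l2 h (hV.timeR hT hm)] at h1
    refine Eq.trans (Eq.trans ?_ h1) ?_
    · congr 1
      refine intervalIntegral.integral_congr_Ioo_of_le hll fun t ht => ?_
      have ht' : t ∈ Ioc l l' := ⟨ht.1, ht.2.le⟩
      rw [(hcu.deriv hm ht).l2 h (hV m hm t ht'), bilin_eq_ldgForm h hA hA' hB (hcu m hm t ht')
        (hcq m hm t ht') (hV m hm t ht') (hR m hm t ht')]
    · refine intervalIntegral.integral_congr_Ioo_of_le hll fun t ht => ?_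
      have ht' : t ∈ Ioc l l' := ⟨ht.1, ht.2.le⟩
      have htT : t ∈ Ioc 0 T := ⟨(timePt_mem hT hm.le).1.trans_lt ht.1,
        ht.2.le.trans (timePt_mem hT hm).2⟩
      change l2 _ (V t) = _
      rw [(isRep_cst h fun x hx => hF x hx t htT).l2 h (hV m hm t ht')]

/-- The flux equation holds at every time. -/
lemma IsCellDG.fluxEq {k r n M : ℕ} {X : ℕ → ℝ} {T ε lam : ℝ} {A c₀ w₀ : C(ℝ, ℝ)}
    {F : ℝ → C(ℝ, ℝ)} {p₀ : CellPoly} {cu cq : ℕ → ℕ → CellPoly} (hT : 0 < T)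
    (h : IsCellDG k r n X T M (ldgForm ε lam A c₀ n X) F w₀ p₀ cu cq) {m : ℕ} (hm : m < M) {t : ℝ}
    (ht : t ∈ Icc (timePt T M m) (timePt T M (m + 1))) :
    FluxEq ε k n X (tev r (cu m) t) (tev r (cq m) t) := by
  intro s hs
  set l := timePt T M m
  set l' := timePt T M (m + 1)
  have hll : l < l' := timePt_lt hT hm
  -- The residual of the flux equation for a fixed s is a polynomial in t of degree at most r.
  -- Multiplied by s it is therefore an admissible test function, and the scheme yields that the
  -- integral of its square vanishes.
  set c : ℕ → ℝ := fun i => ldgForm ε lam A c₀ n X (emb (cu m i), emb (cq m i)) (0, s) with hc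
  have hform : ∀ t, ldgForm ε lam A c₀ n X (emb (tev r (cu m) t), emb (tev r (cq m) t)) (0, s) =
      tev r c t := by
    intro t
    rw [map_tev emb, map_tev emb, ← tev_prod, ← LinearMap.flip_apply, map_tev]
    rfl
  have h1 := h.scheme m hm (fun _ => 0) (fun i => c i • s) (by simp)
    (fun i j => (Polynomial.natDegree_smul_le _ _).trans (hs j))
  have hz : ∀ t, tev r (fun _ => (0 : CellPoly)) t = 0 := by simp [tev]
  have hes : ∀ t, tev r (fun i => c i • s) t = tev r c t • s := by
    intro t
    simp only [tev, smul_eq_mul, Finset.sum_smul, smul_smul]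
  simp only [hz, map_zero, add_zero, zero_add, hes, intervalIntegral.integral_zero] at h1
  have h2 : ∀ t, ldgForm ε lam A c₀ n X (emb (tev r (cu m) t), emb (tev r (cq m) t))
      (0, tev r c t • s) = tev r c t * tev r c t := by
    intro t
    rw [show ((0 : CellPoly), tev r c t • s) = tev r c t • ((0 : CellPoly), s) by simp, map_smul,
      hform, smul_eq_mul]
  simp only [h2] at h1
  have hcont := continuous_tev r c
  have h3 : ∀ t ∈ Icc l l', tev r c t = 0 := by
    by_contra! hne
    obtain ⟨t₁, ht₁, hne⟩ := hne
    have := intervalIntegral.integral_pos hll (f := fun t => tev r c t * tev r c t)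
      (by fun_prop) (fun t _ => mul_self_nonneg _) ⟨t₁, ht₁, mul_self_pos.2 hne⟩
    linarith
  have h4 := hform t
  rw [h3 t ht, ldgForm_apply, ldgFun] at h4
  simpa [jumpR_apply, jumpL_apply, add_assoc] using h4

end LDG

end

/-! ### The comparison function: properties, residual and jump in time. -/

noncomputable section

namespace LDG

open scoped Polynomial

/-! ### The comparison function -/

/-- The comparison function on the time interval `(l,t₀)` for a family of time derivatives. -/
def timeComp (r : ℕ) (l t₀ : ℝ) (G : ℕ → ℝ → C(ℝ, ℝ)) (t : ℝ) : C(ℝ, ℝ) :=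
  ∑ i ∈ Finset.range (r + 2), (timeCoeff r l t₀ i).eval t • G i t₀

/-- The time derivative of the comparison function. -/
def timeCompDeriv (r : ℕ) (l t₀ : ℝ) (G : ℕ → ℝ → C(ℝ, ℝ)) (t : ℝ) : C(ℝ, ℝ) :=
  ∑ i ∈ Finset.range (r + 2), (timeCoeff r l t₀ i).derivative.eval t • G i t₀

lemma timeComp_apply (r : ℕ) (l t₀ : ℝ) (G : ℕ → ℝ → C(ℝ, ℝ)) (t x : ℝ) :
    timeComp r l t₀ G t x =
      ∑ i ∈ Finset.range (r + 2), (timeCoeff r l t₀ i).eval t * G i t₀ x := by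
  simp [timeComp, ContinuousMap.sum_apply]

lemma timeCompDeriv_apply (r : ℕ) (l t₀ : ℝ) (G : ℕ → ℝ → C(ℝ, ℝ)) (t x : ℝ) :
    timeCompDeriv r l t₀ G t x =
      ∑ i ∈ Finset.range (r + 2), (timeCoeff r l t₀ i).derivative.eval t * G i t₀ x := by
  simp [timeCompDeriv, ContinuousMap.sum_apply]

/-- Agreement at the right end makes the discrete error at the end of one interval the initial error
of the next, with no extra term. -/
lemma timeComp_right {r : ℕ} {l t₀ : ℝ} (hl : l < t₀) (G : ℕ → ℝ → C(ℝ, ℝ)) :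
    timeComp r l t₀ G t₀ = G 0 t₀ := by
  rw [timeComp, Finset.sum_eq_single 0]
  · rw [timeCoeff_eval_right hl _ (by omega), if_pos rfl, one_smul]
  · intro i hi h0
    rw [timeCoeff_eval_right hl _ (by have := Finset.mem_range.1 hi; omega), if_neg h0, zero_smul]
  · simp

lemma hasDerivAt_sum_smul {m : ℕ} {c : ℕ → ℝ} {f f' : ℕ → C(ℝ, ℝ)} {x : ℝ}
    (h : ∀ i, HasDerivAt (f i) (f' i x) x) :
    HasDerivAt (∑ i ∈ Finset.range m, c i • f i : C(ℝ, ℝ))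
      ((∑ i ∈ Finset.range m, c i • f' i : C(ℝ, ℝ)) x) x := by
  have h1 : HasDerivAt (fun x => ∑ i ∈ Finset.range m, c i * f i x)
      (∑ i ∈ Finset.range m, c i * f' i x) x :=
    HasDerivAt.fun_sum fun i _ => (h i).const_mul (c i)
  have h2 : ((∑ i ∈ Finset.range m, c i • f i : C(ℝ, ℝ)) : ℝ → ℝ) =
      fun x => ∑ i ∈ Finset.range m, c i * f i x := by
    ext x; simp [ContinuousMap.sum_apply]
  rw [h2]
  simpa [ContinuousMap.sum_apply] using h1

/-- The derivatives of the two parts of a solution with a layer. -/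
structure IsData (k r : ℕ) (T α ε D : ℝ) (S E : ℕ → ℕ → ℝ → C(ℝ, ℝ)) : Prop where
  sS : IsSmoothFamily T S
  sE : IsSmoothFamily T E
  bS : ∀ j ≤ k + 2, ∀ i ≤ r + 2, ∀ x ∈ Icc (0 : ℝ) 1, ∀ t ∈ Icc 0 T, |S j i t x| ≤ D
  bE : ∀ j ≤ k + 2, ∀ i ≤ r + 2, ∀ x ∈ Icc (0 : ℝ) 1, ∀ t ∈ Icc 0 T,
    |E j i t x| ≤ D * (ε ^ j)⁻¹ * Real.exp (-α * (1 - x) / ε)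
  left : ∀ i, ∀ t ∈ Icc 0 T, S 0 i t 0 + E 0 i t 0 = 0
  right : ∀ i, ∀ t ∈ Icc 0 T, S 0 i t 1 + E 0 i t 1 = 0

lemma IsSmoothFamily.continuous_time {T : ℝ} {G : ℕ → ℕ → ℝ → C(ℝ, ℝ)} (h : IsSmoothFamily T G)
    (j i : ℕ) (x : ℝ) : Continuous fun t => G j i t x := by
  have := h.cont j i
  exact this.comp (Continuous.prodMk continuous_id continuous_const)

lemma IsData.isLayered {k r : ℕ} {T α ε D : ℝ} {S E : ℕ → ℕ → ℝ → C(ℝ, ℝ)}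
    (h : IsData k r T α ε D S E) {t : ℝ} (ht : t ∈ Icc 0 T) :
    IsLayered α ε D k (fun j => S j 0 t) (fun j => E j 0 t) :=
  ⟨fun j x hx => h.sS.dx j 0 x hx t ht, fun j x hx => h.sE.dx j 0 x hx t ht,
    fun j hj x hx => h.bS j hj 0 (by omega) x hx t ht,
    fun j hj x hx => h.bE j hj 0 (by omega) x hx t ht⟩

/-- The properties of the comparison function on one time interval. -/
structure IsComparison (k r : ℕ) (α ε D D₁ D₂ l t₀ : ℝ) (S E : ℕ → ℕ → ℝ → C(ℝ, ℝ)) (t : ℝ) :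
    Prop where
  comp : IsLayered α ε D k (fun j => timeComp r l t₀ (S j) t) (fun j => timeComp r l t₀ (E j) t)
  compDeriv : IsLayered α ε D k (fun j => timeCompDeriv r l t₀ (S j) t)
    (fun j => timeCompDeriv r l t₀ (E j) t)
  error : IsLayered α ε D₁ k (fun j => S j 0 t - timeComp r l t₀ (S j) t)
    (fun j => E j 0 t - timeComp r l t₀ (E j) t)
  rem : ∀ x ∈ Icc (0 : ℝ) 1, |(S 0 0 t x + E 0 0 t x) -
    (timeComp r l t₀ (S 0) t x + timeComp r l t₀ (E 0) t x) +
      (timeDefect r l t₀).eval t * (S 0 (r + 1) t₀ x + E 0 (r + 1) t₀ x)| ≤ D₂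
  remDeriv : ∀ x ∈ Icc (0 : ℝ) 1, |(S 0 1 t x + E 0 1 t x) -
    (timeCompDeriv r l t₀ (S 0) t x + timeCompDeriv r l t₀ (E 0) t x) +
      (timeDefect r l t₀).derivative.eval t * (S 0 (r + 1) t₀ x + E 0 (r + 1) t₀ x)| ≤ D₁

/-- The scalar time estimates are applied at each x and for each spatial derivative. They are linear
in the bound on the data, so the weight ε^{-j} e^{-α(1-x)/ε} passes through. The comparison function
and the time error are thus layered again, and the spatial estimates apply to both. -/
lemma exists_comparison (k r : ℕ) (T : ℝ) (hT : 0 < T) : ∃ C, 1 ≤ C ∧ ∀ {α ε D l t₀ : ℝ}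
    {S E : ℕ → ℕ → ℝ → C(ℝ, ℝ)}, 0 < α → 0 < ε → IsData k r T α ε D S E → 0 ≤ l → l < t₀ → t₀ ≤ T →
    ∀ t ∈ Icc l t₀, IsComparison k r α ε (C * D) (C * (t₀ - l) ^ (r + 1) * D)
      (C * (t₀ - l) ^ (r + 2) * D) l t₀ S E t := by
  obtain ⟨C, hC, h⟩ := exists_time_error r T hT
  refine ⟨2 * C, by linarith, ?_⟩
  intro α ε D l t₀ S E hα hε hSE hl hlt ht₀ t ht
  have hΔ : 0 < t₀ - l := sub_pos.2 hlt
  have htT : t ∈ Icc 0 T := ⟨hl.trans ht.1, ht.2.trans ht₀⟩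
  have ht₀T : t₀ ∈ Icc 0 T := ⟨hl.trans hlt.le, ht₀⟩
  have hD : 0 ≤ D := (hSE.isLayered htT).nonneg
  have key : ∀ {G : ℕ → ℕ → ℝ → C(ℝ, ℝ)}, IsSmoothFamily T G → ∀ j, ∀ x ∈ Icc (0 : ℝ) 1, ∀ B,
      (∀ i ≤ r + 2, ∀ s ∈ Icc 0 T, |G j i s x| ≤ B) → _ := fun {G} hG j x hx B hB =>
    h l t₀ hlt (by linarith) (fun i s => G j i s x) B (fun i => hG.continuous_time j i x)
      (fun i s hs => hG.dt j i x hx s ⟨hl.trans_lt hs.1, hs.2.trans_le ht₀⟩)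
      (fun i hi s hs => hB i hi s ⟨hl.trans hs.1, hs.2.trans ht₀⟩) t ht
  have kS := fun j (hj : j ≤ k + 2) x hx =>
    key hSE.sS j x hx D (fun i hi s hs => hSE.bS j hj i hi x hx s hs)
  have kE := fun j (hj : j ≤ k + 2) x hx =>
    key hSE.sE j x hx _ (fun i hi s hs => hSE.bE j hj i hi x hx s hs)
  have hexp : ∀ x ∈ Icc (0 : ℝ) 1, Real.exp (-α * (1 - x) / ε) ≤ 1 := fun x hx => by
    rw [Real.exp_le_one_iff]
    apply div_nonpos_of_nonpos_of_nonneg _ hε.le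
    nlinarith [hx.2]
  have e1 : ∀ {a b Y : ℝ}, 0 ≤ Y → a ≤ C * Y → a ≤ 2 * C * Y := fun hY ha => by
    nlinarith
  have hpos : ∀ j : ℕ, ∀ x : ℝ, 0 ≤ D * (ε ^ j)⁻¹ * Real.exp (-α * (1 - x) / ε) :=
    fun j x => by positivity
  refine ⟨⟨?_, ?_, ?_, ?_⟩, ⟨?_, ?_, ?_, ?_⟩, ⟨?_, ?_, ?_, ?_⟩, ?_, ?_⟩
  · exact fun j x hx => hasDerivAt_sum_smul fun i => hSE.sS.dx j i x hx t₀ ht₀T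
  · exact fun j x hx => hasDerivAt_sum_smul fun i => hSE.sE.dx j i x hx t₀ ht₀T
  · intro j hj x hx
    rw [timeComp_apply]
    refine (kS j hj x hx).1.trans ?_
    nlinarith [mul_nonneg (by linarith : 0 ≤ C) hD]
  · intro j hj x hx
    rw [timeComp_apply]
    refine (kE j hj x hx).1.trans ?_
    nlinarith [mul_nonneg (by linarith : 0 ≤ C) (hpos j x)]
  · exact fun j x hx => hasDerivAt_sum_smul fun i => hSE.sS.dx j i x hx t₀ ht₀T
  · exact fun j x hx => hasDerivAt_sum_smul fun i => hSE.sE.dx j i x hx t₀ ht₀T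
  · intro j hj x hx
    rw [timeCompDeriv_apply]
    refine (kS j hj x hx).2.1.trans ?_
    nlinarith [mul_nonneg (by linarith : 0 ≤ C) hD]
  · intro j hj x hx
    rw [timeCompDeriv_apply]
    refine (kE j hj x hx).2.1.trans ?_
    nlinarith [mul_nonneg (by linarith : 0 ≤ C) (hpos j x)]
  · exact fun j x hx => (hSE.sS.dx j 0 x hx t htT).sub
      (hasDerivAt_sum_smul fun i => hSE.sS.dx j i x hx t₀ ht₀T)
  · exact fun j x hx => (hSE.sE.dx j 0 x hx t htT).sub
      (hasDerivAt_sum_smul fun i => hSE.sE.dx j i x hx t₀ ht₀T)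
  · intro j hj x hx
    rw [ContinuousMap.sub_apply, timeComp_apply]
    refine (kS j hj x hx).2.2.1.trans ?_
    have : 0 ≤ C * (t₀ - l) ^ (r + 1) * D := by positivity
    nlinarith
  · intro j hj x hx
    rw [ContinuousMap.sub_apply, timeComp_apply]
    refine (kE j hj x hx).2.2.1.trans ?_
    have : 0 ≤ C * (t₀ - l) ^ (r + 1) * (D * (ε ^ j)⁻¹ * Real.exp (-α * (1 - x) / ε)) :=
      mul_nonneg (by positivity) (hpos j x)
    nlinarith
  · intro x hx
    rw [timeComp_apply, timeComp_apply]
    have h1 := (kS 0 (by omega) x hx).2.2.2.1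
    have h2 := (kE 0 (by omega) x hx).2.2.2.1
    have h3 : C * (t₀ - l) ^ (r + 2) * (D * (ε ^ 0)⁻¹ * Real.exp (-α * (1 - x) / ε)) ≤
        C * (t₀ - l) ^ (r + 2) * D := by
      refine mul_le_mul_of_nonneg_left ?_ (by positivity)
      rw [pow_zero, inv_one, mul_one]
      exact mul_le_of_le_one_right hD (hexp x hx)
    have h4 := (abs_add_le _ _).trans (add_le_add h1 (h2.trans h3))
    refine le_trans (le_of_eq ?_) (h4.trans (le_of_eq (by ring)))
    congr 1
    ring
  · intro x hx
    rw [timeCompDeriv_apply, timeCompDeriv_apply]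
    have h1 := (kS 0 (by omega) x hx).2.2.2.2
    have h2 := (kE 0 (by omega) x hx).2.2.2.2
    have h3 : C * (t₀ - l) ^ (r + 1) * (D * (ε ^ 0)⁻¹ * Real.exp (-α * (1 - x) / ε)) ≤
        C * (t₀ - l) ^ (r + 1) * D := by
      refine mul_le_mul_of_nonneg_left ?_ (by positivity)
      rw [pow_zero, inv_one, mul_one]
      exact mul_le_of_le_one_right hD (hexp x hx)
    have h4 := (abs_add_le _ _).trans (add_le_add h1 (h2.trans h3))
    refine le_trans (le_of_eq ?_) (h4.trans (le_of_eq (by ring)))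
    congr 1
    ring

/-! ### Continuity in time -/

lemma continuous_cip_cst {F : ℝ → C(ℝ, ℝ)} (hF : Continuous fun p : ℝ × ℝ => F p.1 p.2) (N : ℕ)
    (X : ℕ → ℝ) (r : ℕ) (e : ℕ → CellPoly) :
    Continuous fun t => cip N X (cst (F t)) (emb (tev r e t)) := by
  have h1 : ∀ v : CellPoly, Continuous fun t => cip N X (cst (F t)) (emb v) := by
    intro v
    simp only [cip_apply, cst_apply, emb_apply]
    refine continuous_finsetSum _ fun j _ => ?_
    refine intervalIntegral.continuous_parametric_intervalIntegral_of_continuous' ?_ _ _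
    exact hF.mul ((v j).continuous.comp continuous_snd)
  have h2 : ∀ t, cip N X (cst (F t)) (emb (tev r e t)) =
      ∑ i ∈ Finset.range (r + 1), t ^ i * cip N X (cst (F t)) (emb (e i)) := by
    intro t
    rw [map_tev emb, map_tev]
    simp [tev]
  simp_rw [h2]
  exact continuous_finsetSum _ fun i _ => (continuous_pow i).mul (h1 _)

/-! ### The residual -/

/-- The right-hand side of the differential equation. -/
def rhs (ε : ℝ) (A b : C(ℝ, ℝ)) (S E : ℕ → ℕ → ℝ → C(ℝ, ℝ)) (t : ℝ) : C(ℝ, ℝ) :=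
  (S 0 1 t + E 0 1 t) +
    (-(ε • (S 2 0 t + E 2 0 t)) + A * (S 1 0 t + E 1 0 t) + b * (S 0 0 t + E 0 0 t))

lemma continuous_rhs {T ε : ℝ} {A b : C(ℝ, ℝ)} {S E : ℕ → ℕ → ℝ → C(ℝ, ℝ)}
    (hS : IsSmoothFamily T S) (hE : IsSmoothFamily T E) :
    Continuous fun p : ℝ × ℝ => rhs ε A b S E p.1 p.2 := by
  have h := fun j i => (hS.cont j i).add (hE.cont j i)
  have hA : Continuous fun p : ℝ × ℝ => A p.2 := by fun_prop
  have hb : Continuous fun p : ℝ × ℝ => b p.2 := by fun_prop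
  exact (h 0 1).add (((((h 2 0).const_smul ε).neg).add (hA.mul (h 1 0))).add (hb.mul (h 0 0)))

lemma testNorm_nonneg (ε : ℝ) (n : ℕ) (X : ℕ → ℝ) (v s : CellPoly) : 0 ≤ testNorm ε n X v s := by
  unfold testNorm; positivity

lemma sqrt_cip_add_le {n : ℕ} {X : ℕ → ℝ} {ε a : ℝ} (h : IsGrid n X) (hε : 0 < ε) (ha : 0 ≤ a)
    (f g : CellFn) (hf : ε⁻¹ * cip (n + 1) X f f ≤ a ^ 2) :
    Real.sqrt (ε⁻¹ * cip (n + 1) X (f + g) (f + g)) ≤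
      2 * a + 2 * Real.sqrt (ε⁻¹ * cip (n + 1) X g g) := by
  have hε' : 0 < ε⁻¹ := inv_pos.2 hε
  have hg : 0 ≤ ε⁻¹ * cip (n + 1) X g g := mul_nonneg hε'.le (cip_self_nonneg h g)
  rw [Real.sqrt_le_iff]
  refine ⟨by positivity, ?_⟩
  have h1 := mul_le_mul_of_nonneg_left (cip_add_self_le h f g) hε'.le
  have h2 := Real.sq_sqrt hg
  have h3 := mul_nonneg ha (Real.sqrt_nonneg (ε⁻¹ * cip (n + 1) X g g))
  nlinarith

set_option maxHeartbeats 1000000 in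
-- The residual splits into the projection error of z_t, the time remainder z_t - u_t - χ'a, the
-- projection functional for z, and the spatial operator applied to u - z. The last is controlled by
-- the flux error εz_x - Q instead of s. The two differ by a projection error, which produces the
-- additional summand in the last factor.
lemma exists_residual_bound (k r : ℕ) (T α σ Cm L D : ℝ) (hT : 0 < T) (hα : 0 < α)
    (hσ : (k : ℝ) + 2 ≤ σ) (hD : 0 ≤ D) : ∃ C, 0 ≤ C ∧ ∀ {ε lam ϖ l t₀ : ℝ} {n : ℕ} {X : ℕ → ℝ}
    {A A' b : C(ℝ, ℝ)} {S E : ℕ → ℕ → ℝ → C(ℝ, ℝ)} {U Q : CellPoly}, 0 < ε → ε ≤ 1 → 0 ≤ ϖ →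
    IsLayerMesh α σ ε ϖ Cm n X → IsCoeff L A A' b → IsData k r T α ε D S E →
    0 ≤ l → l < t₀ → t₀ ≤ T → (∀ j, (U j).natDegree ≤ k) → (∀ j, (Q j).natDegree ≤ k) →
    FluxEq ε k n X U Q → ∀ t ∈ Icc l t₀, ∀ v s : CellPoly,
      v = projR k X (timeComp r l t₀ (S 0) t + timeComp r l t₀ (E 0) t) - U →
      s = projL k X (ε • (timeComp r l t₀ (S 1) t + timeComp r l t₀ (E 1) t)) - Q →
      |cip (n + 1) X (emb (projR k X (timeCompDeriv r l t₀ (S 0) t + timeCompDeriv r l t₀ (E 0) t)))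
          (emb v)
        - (timeDefect r l t₀).derivative.eval t *
            cip (n + 1) X (cst (S 0 (r + 1) t₀ + E 0 (r + 1) t₀)) (emb v)
        + ldgFun ε lam A (b - A') n X
            (emb (projR k X (timeComp r l t₀ (S 0) t + timeComp r l t₀ (E 0) t)))
            (emb (projL k X (ε • (timeComp r l t₀ (S 1) t + timeComp r l t₀ (E 1) t)))) v s
        - cip (n + 1) X (cst (rhs ε A b S E t)) (emb v)| ≤
      C * ((t₀ - l) ^ (r + 1) + ϖ ^ (k + 1)) *
        (testNorm ε n X v s + ((t₀ - l) ^ (r + 1) + ϖ ^ (k + 1))) := by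
  obtain ⟨C₁, hC₁, hcmp⟩ := exists_comparison k r T hT
  obtain ⟨CR, hCR, hR⟩ := exists_projR_l2 k Cm
  obtain ⟨CL, hCL, hL⟩ := exists_projL_l2 k α σ Cm hα hσ
  obtain ⟨CF, hCF, hF⟩ := exists_projection_functional_bound k α σ Cm L hα hσ
  obtain ⟨CO, hCO, hO⟩ := exists_operator_bound k α σ L hα hσ
  set G := C₁ * D with hG
  have hG0 : 0 ≤ G := by positivity
  refine ⟨CR * G + G + CF * G + 2 * (CO * G) + 2 * (CO * G * CL * G), by positivity, ?_⟩
  intro ε lam ϖ l t₀ n X A A' b S E U Q hε hε1 hϖ hX hco hSE hl hlt ht₀ hU hQ hUQ t ht v s hv hs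
  have hgr := hX.isGrid
  have hc := hcmp hα hε hSE hl hlt ht₀ t ht
  set z₀ := timeComp r l t₀ (S 0) t + timeComp r l t₀ (E 0) t with hz₀
  set z₁ := timeComp r l t₀ (S 1) t + timeComp r l t₀ (E 1) t with hz₁
  set z₂ := timeComp r l t₀ (S 2) t + timeComp r l t₀ (E 2) t with hz₂
  set d₀ := timeCompDeriv r l t₀ (S 0) t + timeCompDeriv r l t₀ (E 0) t with hd₀
  set a := S 0 (r + 1) t₀ + E 0 (r + 1) t₀ with ha
  set χ' := (timeDefect r l t₀).derivative.eval t with hχ'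
  set δ := (t₀ - l) ^ (r + 1) with hδ
  set o := ϖ ^ (k + 1) with ho
  have hδ0 : 0 ≤ δ := by have := sub_pos.2 hlt; positivity
  have ho0 : 0 ≤ o := by positivity
  have ht₀T : t₀ ∈ Icc 0 T := ⟨hl.trans hlt.le, ht₀⟩
  have hvd : ∀ j, (v j).natDegree ≤ k := fun j => by
    rw [hv]
    exact (Polynomial.natDegree_sub_le_of_le (projR_natDegree k X z₀ j) (hU j)).trans (by simp)
  have hsd : ∀ j, (s j).natDegree ≤ k := fun j => by
    rw [hs]
    exact (Polynomial.natDegree_sub_le_of_le (projL_natDegree k X _ j) (hQ j)).trans (by simp)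
  have hz01 : ∀ x ∈ Ioo (0 : ℝ) 1, HasDerivAt z₀ (z₁ x) x := fun x hx =>
    (hc.comp.dS 0 x hx).add (hc.comp.dE 0 x hx)
  have hz12 : ∀ x ∈ Ioo (0 : ℝ) 1, HasDerivAt z₁ (z₂ x) x := fun x hx =>
    (hc.comp.dS 1 x hx).add (hc.comp.dE 1 x hx)
  have hb0 : ∀ y, (∀ i, S 0 i t₀ y + E 0 i t₀ y = 0) → z₀ y = 0 := fun y hy => by
    rw [hz₀, ContinuousMap.add_apply, timeComp_apply, timeComp_apply, ← Finset.sum_add_distrib]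
    refine Finset.sum_eq_zero fun i _ => ?_
    rw [← mul_add, hy, mul_zero]
  have hzl : z₀ 0 = 0 := hb0 0 fun i => hSE.left i t₀ ht₀T
  have hzr : z₀ 1 = 0 := hb0 1 fun i => hSE.right i t₀ ht₀T
  have hcons := ldgFun_consistency (lam := lam) (b := b) hgr hε.ne' hco.dA hz01 hz12 hzl hzr v s
  have T1 := (hR hα hσ hε hϖ hX hc.compDeriv).1
  have T3 := hF (lam := lam) hε hε1 hϖ hX hco hc.comp v s hvd hsd
  have T4 := hO (A := A) (A' := A') (b := b) (w := z₀) (w₁ := z₁) hε hε1 hX hco hz01 hzl hzr hU hUQ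
    (hc.error.dE 0) (hc.error.dE 1) (hc.error.bS 0 (by omega)) (hc.error.bS 1 (by omega))
    (hc.error.bS 2 (by omega)) (fun x hx => by simpa using hc.error.bE 0 (by omega) x hx)
    (fun x hx => by simpa using hc.error.bE 1 (by omega) x hx)
  rw [← hv] at T4
  have hp : cst (ε • z₁) - emb Q = -(emb (projL k X (ε • z₁)) - cst (ε • z₁)) + emb s := by
    rw [hs, map_sub]; abel
  have hL1 : ε⁻¹ * cip (n + 1) X (-(emb (projL k X (ε • z₁)) - cst (ε • z₁)))
      (-(emb (projL k X (ε • z₁)) - cst (ε • z₁))) ≤ (CL * (G * o)) ^ 2 := by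
    have h1 := (hL hε hε1 hϖ hX hc.comp).1
    simp only [map_neg, LinearMap.neg_apply, neg_neg]
    exact h1
  have hp2 := sqrt_cip_add_le hgr hε (by positivity) _ (emb s) hL1
  rw [← hp] at hp2
  set ρ : C(ℝ, ℝ) := d₀ - (S 0 1 t + E 0 1 t) - χ' • a with hρ
  have T2 : cip (n + 1) X (cst ρ) (cst ρ) ≤ (G * δ) ^ 2 := by
    refine cip_self_le_of_abs_le hgr fun j hj x hx => ?_
    have h1 := hc.remDeriv x (hgr.Icc_subset hj hx)
    rw [← abs_neg] at h1
    refine le_trans (le_of_eq ?_) (h1.trans (le_of_eq (by rw [hG]; ring)))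
    rw [cst_apply, hρ, hd₀, ha]
    simp only [ContinuousMap.sub_apply, ContinuousMap.add_apply, ContinuousMap.smul_apply,
      smul_eq_mul]
    congr 1
    ring
  set Y := Real.sqrt (cip (n + 1) X (emb v) (emb v)) with hY
  have hYY : cip (n + 1) X (emb v) (emb v) ≤ Y ^ 2 := (Real.sq_sqrt (cip_self_nonneg hgr _)).ge
  have hY0 : 0 ≤ Y := Real.sqrt_nonneg _
  have B1 := abs_cip_le_of_sq_le hgr T1 hYY (by positivity) hY0
  have B2 := abs_cip_le_of_sq_le hgr T2 hYY (by positivity) hY0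
  set τ := testNorm ε n X v s with hτ
  have hτ' : τ = Y + Real.sqrt (ε⁻¹ * cip (n + 1) X (emb s) (emb s)) + |(v n).eval (X (n + 1))| := rfl
  have hs0 := Real.sqrt_nonneg (ε⁻¹ * cip (n + 1) X (emb s) (emb s))
  have hv0 := abs_nonneg ((v n).eval (X (n + 1)))
  have hτ0 : 0 ≤ τ := testNorm_nonneg _ _ _ _ _
  -- By consistency the form at z is the spatial operator applied to z and tested with v; the
  -- right-hand side is the time derivative of the solution plus the same operator applied to the
  -- solution.
  have hid : cip (n + 1) X (emb (projR k X d₀)) (emb v) - χ' * cip (n + 1) X (cst a) (emb v)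
        + ldgFun ε lam A (b - A') n X (emb (projR k X z₀)) (emb (projL k X (ε • z₁))) v s
        - cip (n + 1) X (cst (rhs ε A b S E t)) (emb v) =
      cip (n + 1) X (emb (projR k X d₀) - cst d₀) (emb v) + cip (n + 1) X (cst ρ) (emb v)
      + (ldgFun ε lam A (b - A') n X (emb (projR k X z₀)) (emb (projL k X (ε • z₁))) v s -
          ldgFun ε lam A (b - A') n X (cst z₀) (cst (ε • z₁)) v s)
      - cip (n + 1) X (cst (-(ε • ((S 2 0 t - timeComp r l t₀ (S 2) t) +
          (E 2 0 t - timeComp r l t₀ (E 2) t))) +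
          A * ((S 1 0 t - timeComp r l t₀ (S 1) t) + (E 1 0 t - timeComp r l t₀ (E 1) t)) +
          b * ((S 0 0 t - timeComp r l t₀ (S 0) t) + (E 0 0 t - timeComp r l t₀ (E 0) t))))
          (emb v) := by
    rw [hcons]
    have e1 : -(ε • ((S 2 0 t - timeComp r l t₀ (S 2) t) + (E 2 0 t - timeComp r l t₀ (E 2) t))) +
          A * ((S 1 0 t - timeComp r l t₀ (S 1) t) + (E 1 0 t - timeComp r l t₀ (E 1) t)) +
          b * ((S 0 0 t - timeComp r l t₀ (S 0) t) + (E 0 0 t - timeComp r l t₀ (E 0) t)) =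
        rhs ε A b S E t - (S 0 1 t + E 0 1 t) - (-(ε • z₂) + A * z₁ + b * z₀) := by
      ext x
      rw [hz₀, hz₁, hz₂, rhs]
      simp only [ContinuousMap.sub_apply, ContinuousMap.add_apply, ContinuousMap.smul_apply,
        ContinuousMap.neg_apply, ContinuousMap.mul_apply, smul_eq_mul]
      ring
    rw [e1, hρ]
    simp only [map_sub, map_smul, LinearMap.sub_apply, LinearMap.smul_apply, smul_eq_mul]
    ring
  rw [hid]
  set t1 := cip (n + 1) X (emb (projR k X d₀) - cst d₀) (emb v)
  set t2 := cip (n + 1) X (cst ρ) (emb v)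
  have B1' : |t1| ≤ CR * G * ((δ + o) * τ) := by
    calc |t1| ≤ CR * (G * o) * Y := B1
      _ = CR * G * (o * Y) := by ring
      _ ≤ _ := by gcongr <;> linarith
  have B2' : |t2| ≤ G * ((δ + o) * τ) := by
    calc |t2| ≤ G * δ * Y := B2
      _ = G * (δ * Y) := by ring
      _ ≤ _ := by gcongr <;> linarith
  have B3' : CF * (G * o) * τ ≤ CF * G * ((δ + o) * τ) := by
    calc _ = CF * G * (o * τ) := by ring
      _ ≤ _ := by gcongr; linarith
  have B4' : CO * (C₁ * δ * D) * (Y + Real.sqrt (ε⁻¹ * cip (n + 1) X (cst (ε • z₁) - emb Q)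
      (cst (ε • z₁) - emb Q)) + |(v n).eval (X (n + 1))|) ≤
      CO * G * ((δ + o) * (2 * τ + 2 * (CL * G * (δ + o)))) := by
    calc _ ≤ CO * (C₁ * δ * D) * (2 * τ + 2 * (CL * G * (δ + o))) := by
          refine mul_le_mul_of_nonneg_left ?_ (by positivity)
          have : CL * (G * o) ≤ CL * G * (δ + o) := by
            rw [← mul_assoc]; gcongr; linarith
          linarith
      _ = CO * G * (δ * (2 * τ + 2 * (CL * G * (δ + o)))) := by rw [hG]; ring
      _ ≤ _ := by gcongr; linarith
  refine (abs_sub _ _).trans ?_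
  refine (add_le_add ((abs_add_le _ _).trans (add_le_add ((abs_add_le _ _).trans
    (add_le_add B1' B2')) (T3.trans B3'))) (T4.trans B4')).trans ?_
  have e : 0 ≤ (CR * G + G + CF * G + 2 * (CO * G)) * (δ + o) * (δ + o) := by positivity
  have e' : 0 ≤ 2 * (CO * G * CL * G) * (δ + o) * τ := by positivity
  linarith

/-! ### The jump at the beginning of a time interval -/

/-- Pairing with a fixed ψ gives a scalar polynomial in time, so the one-dimensional inverse
inequality applies at the cost of one power of the step. -/
lemma exists_time_inverse (r : ℕ) : ∃ C, 0 < C ∧ ∀ {n : ℕ} {X : ℕ → ℝ} {l t₀ P : ℝ} {ψ : CellFn}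
    {e : ℕ → CellPoly}, IsGrid n X → l < t₀ → 0 ≤ P → cip (n + 1) X ψ ψ ≤ P ^ 2 →
      (t₀ - l) * cip (n + 1) X ψ (emb (tev r e l)) ^ 2 ≤
        C * P ^ 2 * ∫ t in l..t₀, cip (n + 1) X (emb (tev r e t)) (emb (tev r e t)) := by
  obtain ⟨C, hC, h⟩ := exists_inverse r
  refine ⟨C, hC, ?_⟩
  intro n X l t₀ P ψ e hX hl hP hψ
  obtain ⟨p, hp, hpe⟩ := exists_poly_tev r fun i => cip (n + 1) X ψ (emb (e i))
  have h1 : ∀ t, cip (n + 1) X ψ (emb (tev r e t)) = p.eval t := fun t => by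
    rw [hpe, map_tev emb, map_tev]
  have h2 := (h p hp l t₀ hl l (left_mem_Icc.2 hl.le)).1
  rw [h1]
  refine h2.trans ?_
  rw [mul_assoc]
  refine mul_le_mul_of_nonneg_left ?_ hC.le
  rw [← intervalIntegral.integral_const_mul]
  refine intervalIntegral.integral_mono_on hl.le
    (Continuous.intervalIntegrable (by fun_prop) _ _)
    (Continuous.intervalIntegrable ?_ _ _) fun t _ => ?_
  · have := continuous_bilin_tev (cip (n + 1) X) r (fun i => emb (e i)) (fun i => emb (e i))
    simp only [← map_tev emb] at this
    exact continuous_const.mul this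
  · rw [← h1]
    exact (cip_sq_le hX _ _).trans (mul_le_mul_of_nonneg_right hψ (cip_self_nonneg hX _))

/-- At l the comparison function misses the solution by χ(l)a up to order Δ^{r+2}, and the
projection error of the time error is of size Δ^{r+1}ϖ^{k+1}. The remainder ψ is therefore smaller
by a factor Δ than the target accuracy. After Δ⁻¹ is spent in the inverse inequality, one power of Δ
survives in the square, and the contributions sum to a multiple of T. -/
lemma exists_jump_bound (k r : ℕ) (T α σ Cm D : ℝ) (hT : 0 < T) (hα : 0 < α)
    (hσ : (k : ℝ) + 2 ≤ σ) (hD : 0 ≤ D) : ∃ C, 0 ≤ C ∧ ∀ {ε ϖ l t₀ : ℝ} {n : ℕ} {X : ℕ → ℝ}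
    {S E : ℕ → ℕ → ℝ → C(ℝ, ℝ)} {e : ℕ → CellPoly}, 0 < ε → 0 ≤ ϖ →
    IsLayerMesh α σ ε ϖ Cm n X → IsData k r T α ε D S E → 0 ≤ l → l < t₀ → t₀ ≤ T →
      (cip (n + 1) X (emb (projR k X (timeComp r l t₀ (S 0) l + timeComp r l t₀ (E 0) l)) -
          emb (projR k X (S 0 0 l + E 0 0 l))) (emb (tev r e l)) -
        (timeDefect r l t₀).eval l *
          cip (n + 1) X (cst (S 0 (r + 1) t₀ + E 0 (r + 1) t₀)) (emb (tev r e l))) ^ 2 ≤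
      C * (t₀ - l) * ((t₀ - l) ^ (r + 1) + ϖ ^ (k + 1)) ^ 2 *
        ∫ t in l..t₀, cip (n + 1) X (emb (tev r e t)) (emb (tev r e t)) := by
  obtain ⟨C₁, hC₁, hcmp⟩ := exists_comparison k r T hT
  obtain ⟨CR, hCR, hR⟩ := exists_projR_l2 k Cm
  obtain ⟨CI, hCI, hI⟩ := exists_time_inverse r
  set G := C₁ * D with hG
  have hG0 : 0 ≤ G := by positivity
  set H := 2 * CR * G * (1 + T) ^ r + 2 * G with hH
  have hH0 : 0 ≤ H := by positivity
  refine ⟨CI * H ^ 2, by positivity, ?_⟩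
  intro ε ϖ l t₀ n X S E e hε hϖ hX hSE hl hlt ht₀
  have hgr := hX.isGrid
  have hc := hcmp hα hε hSE hl hlt ht₀ l (left_mem_Icc.2 hlt.le)
  set z₀ := timeComp r l t₀ (S 0) l + timeComp r l t₀ (E 0) l with hz₀
  set a := S 0 (r + 1) t₀ + E 0 (r + 1) t₀ with ha
  set χ := (timeDefect r l t₀).eval l with hχ
  set Δ := t₀ - l with hΔ
  have hΔ0 : 0 < Δ := sub_pos.2 hlt
  have hΔT : Δ ≤ 1 + T := by linarith
  set o := ϖ ^ (k + 1) with ho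
  have ho0 : 0 ≤ o := by positivity
  set ζ : C(ℝ, ℝ) := (S 0 0 l - timeComp r l t₀ (S 0) l) + (E 0 0 l - timeComp r l t₀ (E 0) l)
    with hζ
  set ρ : C(ℝ, ℝ) := -ζ - χ • a with hρ
  have h1 := (hR hα hσ hε hϖ hX hc.error).1
  have h2 : cip (n + 1) X (cst ρ) (cst ρ) ≤ (G * Δ ^ (r + 2)) ^ 2 := by
    refine cip_self_le_of_abs_le hgr fun j hj x hx => ?_
    have h1 := hc.rem x (hgr.Icc_subset hj hx)
    rw [← abs_neg] at h1
    refine le_trans (le_of_eq ?_) (h1.trans (le_of_eq (by rw [hG]; ring)))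
    rw [cst_apply, hρ, hζ, ha]
    simp only [ContinuousMap.sub_apply, ContinuousMap.add_apply, ContinuousMap.smul_apply,
      ContinuousMap.neg_apply, smul_eq_mul]
    congr 1
    ring
  set ψ : CellFn := -(emb (projR k X ζ) - cst ζ) + cst ρ with hψ
  -- The projected mismatch, less the defect term, is the time remainder ρ minus the projection
  -- error of the time error ζ.
  have hψ' : emb (projR k X z₀) - emb (projR k X (S 0 0 l + E 0 0 l)) - χ • cst a = ψ := by
    have : z₀ = (S 0 0 l + E 0 0 l) - ζ := by rw [hz₀, hζ]; abel
    rw [this, hψ, hρ]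
    simp only [map_sub, map_neg, map_smul]
    abel
  have hψ2 : cip (n + 1) X ψ ψ ≤ (H * (Δ * (Δ ^ (r + 1) + o))) ^ 2 := by
    refine (cip_add_self_le hgr _ _).trans ?_
    simp only [map_neg, LinearMap.neg_apply, neg_neg]
    have e1 : CR * (C₁ * Δ ^ (r + 1) * D * o) ≤ CR * G * (1 + T) ^ r * (Δ * (Δ ^ (r + 1) + o)) := by
      have : Δ ^ r ≤ (1 + T) ^ r := by gcongr
      calc CR * (C₁ * Δ ^ (r + 1) * D * o) = CR * G * Δ ^ r * (Δ * o) := by rw [hG]; ring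
        _ ≤ CR * G * (1 + T) ^ r * (Δ * (Δ ^ (r + 1) + o)) := by
          gcongr
          have : 0 ≤ Δ ^ (r + 1) := by positivity
          linarith
    have e2 : G * Δ ^ (r + 2) ≤ G * (Δ * (Δ ^ (r + 1) + o)) := by
      have : Δ ^ (r + 2) = Δ * Δ ^ (r + 1) := by ring
      rw [this]
      gcongr
      linarith
    set w := Δ * (Δ ^ (r + 1) + o) with hw
    have hw0 : 0 ≤ w := by positivity
    have q1 := h1.trans (pow_le_pow_left₀ (by positivity) e1 2)
    have q2 := h2.trans (pow_le_pow_left₀ (by positivity) e2 2)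
    have p1 : 0 ≤ CR * G * (1 + T) ^ r * w := by positivity
    have p2 : 0 ≤ G * w := by positivity
    rw [hH]
    nlinarith [mul_nonneg p1 p2]
  have h3 := hI (e := e) hgr hlt (by positivity) hψ2
  have h4 : cip (n + 1) X (emb (projR k X z₀) - emb (projR k X (S 0 0 l + E 0 0 l)))
      (emb (tev r e l)) - χ * cip (n + 1) X (cst a) (emb (tev r e l)) =
      cip (n + 1) X ψ (emb (tev r e l)) := by
    rw [← hψ']
    simp only [map_sub, map_smul, LinearMap.sub_apply, LinearMap.smul_apply, smul_eq_mul]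
  rw [h4]
  refine le_of_mul_le_mul_left (h3.trans (le_of_eq ?_)) hΔ0
  ring

end LDG

end

/-! ### The energy argument in time. -/

noncomputable section

namespace LDG

open scoped Polynomial

/-! ### The discrete error on one time interval -/

/-- The outflow jump contributes the last term, which absorbs the flux projection error at x = 1. Of
the penalty only the sign is used. -/
lemma le_ldgEnergy {ε lam α β : ℝ} {A ρ : C(ℝ, ℝ)} {n : ℕ} {X : ℕ → ℝ} (h : IsGrid n X)
    (hα : 0 ≤ α) (hlam : 0 ≤ lam) (hA : ∀ x ∈ Icc (0 : ℝ) 1, α ≤ A x)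
    (hρ : ∀ x ∈ Icc (0 : ℝ) 1, β ≤ ρ x) (f g : CellFn) :
    β * cip (n + 1) X f f + ε⁻¹ * cip (n + 1) X g g + α / 2 * f n (X (n + 1)) ^ 2 ≤
      ldgEnergy ε lam A ρ n X f g := by
  have h1 : β * cip (n + 1) X f f ≤ cip (n + 1) X (cst ρ * f) f := by
    rw [← smul_eq_mul, ← LinearMap.smul_apply, ← map_smul]
    refine cip_mono h fun j hj x hx => ?_
    have := hρ x (h.Icc_subset hj hx)
    simp only [Pi.smul_apply, ContinuousMap.smul_apply, Pi.mul_apply,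
      ContinuousMap.mul_apply, cst_apply, smul_eq_mul]
    nlinarith [mul_le_mul_of_nonneg_right this (mul_self_nonneg (f j x))]
  have h2 : 0 ≤ A (X 0) * f 0 (X 0) ^ 2 :=
    mul_nonneg (hα.trans (hA _ (h.mem (Nat.zero_le _)))) (sq_nonneg _)
  have h3 : 0 ≤ ∑ j ∈ Finset.range n, A (X (j + 1)) * (f (j + 1) (X (j + 1)) - f j (X (j + 1))) ^ 2 :=
    Finset.sum_nonneg fun j hj => mul_nonneg
      (hα.trans (hA _ (h.mem (by have := Finset.mem_range.1 hj; omega)))) (sq_nonneg _)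
  have h4 : α * f n (X (n + 1)) ^ 2 ≤ A (X (n + 1)) * f n (X (n + 1)) ^ 2 :=
    mul_le_mul_of_nonneg_right (hA _ (h.mem le_rfl)) (sq_nonneg _)
  have h5 : 0 ≤ lam * f n (X (n + 1)) ^ 2 := mul_nonneg hlam (sq_nonneg _)
  unfold ldgEnergy
  linarith

/-- The coefficients in time of the projection of the comparison function. -/
def compU (k r : ℕ) (X : ℕ → ℝ) (l t₀ : ℝ) (S E : ℕ → ℕ → ℝ → C(ℝ, ℝ)) (i : ℕ) : CellPoly :=
  ∑ m ∈ Finset.range (r + 2), (timeCoeff r l t₀ m).coeff i • projR k X (S 0 m t₀ + E 0 m t₀)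

/-- The coefficients in time of the projection of the flux of the comparison function. -/
def compQ (ε : ℝ) (k r : ℕ) (X : ℕ → ℝ) (l t₀ : ℝ) (S E : ℕ → ℕ → ℝ → C(ℝ, ℝ)) (i : ℕ) :
    CellPoly :=
  ∑ m ∈ Finset.range (r + 2), (timeCoeff r l t₀ m).coeff i •
    projL k X (ε • (S 1 m t₀ + E 1 m t₀))

section Comp

variable (ε : ℝ) (k r : ℕ) (X : ℕ → ℝ) (l t₀ : ℝ) (S E : ℕ → ℕ → ℝ → C(ℝ, ℝ))

lemma tev_compU (t : ℝ) : tev r (compU k r X l t₀ S E) t =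
    projR k X (timeComp r l t₀ (S 0) t + timeComp r l t₀ (E 0) t) := by
  unfold compU
  rw [← sum_eval_smul_eq_tev fun i _ => timeCoeff_natDegree r l t₀ i, timeComp, timeComp,
    ← Finset.sum_add_distrib, map_sum]
  exact Finset.sum_congr rfl fun i _ => by rw [← smul_add, map_smul]

lemma tdv_compU (t : ℝ) : tdv r (compU k r X l t₀ S E) t =
    projR k X (timeCompDeriv r l t₀ (S 0) t + timeCompDeriv r l t₀ (E 0) t) := by
  unfold compU
  rw [← sum_derivative_eval_smul_eq_tdv fun i _ => timeCoeff_natDegree r l t₀ i, timeCompDeriv,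
    timeCompDeriv, ← Finset.sum_add_distrib, map_sum]
  exact Finset.sum_congr rfl fun i _ => by rw [← smul_add, map_smul]

lemma tev_compQ (t : ℝ) : tev r (compQ ε k r X l t₀ S E) t =
    projL k X (ε • (timeComp r l t₀ (S 1) t + timeComp r l t₀ (E 1) t)) := by
  unfold compQ
  rw [← sum_eval_smul_eq_tev fun i _ => timeCoeff_natDegree r l t₀ i, timeComp, timeComp,
    ← Finset.sum_add_distrib, Finset.smul_sum, map_sum]
  exact Finset.sum_congr rfl fun i _ => by
    rw [← smul_add, smul_comm, map_smul (projL k X) ((timeCoeff r l t₀ i).eval t)]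

lemma compU_natDegree (i j : ℕ) : (compU k r X l t₀ S E i j).natDegree ≤ k := by
  rw [compU, Finset.sum_apply]
  exact Polynomial.natDegree_sum_le_of_forall_le _ _ fun i _ =>
    (Polynomial.natDegree_smul_le _ _).trans (projR_natDegree k X _ j)

lemma compQ_natDegree (i j : ℕ) : (compQ ε k r X l t₀ S E i j).natDegree ≤ k := by
  rw [compQ, Finset.sum_apply]
  exact Polynomial.natDegree_sum_le_of_forall_le _ _ fun i _ =>
    (Polynomial.natDegree_smul_le _ _).trans (projL_natDegree k X _ j)

end Comp

lemma continuous_cip_tev (N : ℕ) (X : ℕ → ℝ) (r : ℕ) (e e' : ℕ → CellPoly) :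
    Continuous fun t => cip N X (emb (tev r e t)) (emb (tev r e' t)) := by
  simp_rw [map_tev emb]
  exact continuous_bilin_tev _ _ _ _

lemma continuous_cip_tdv (N : ℕ) (X : ℕ → ℝ) (r : ℕ) (e e' : ℕ → CellPoly) :
    Continuous fun t => cip N X (emb (tdv r e t)) (emb (tev r e' t)) := by
  simp_rw [map_tev emb, map_tdv emb]
  exact continuous_bilin_tdv _ _ _ _

lemma continuous_form_tev (form : (CellFn × CellFn) →ₗ[ℝ] (CellPoly × CellPoly) →ₗ[ℝ] ℝ) (r : ℕ)
    (e₁ e₂ e₃ e₄ : ℕ → CellPoly) : Continuous fun t =>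
      form (emb (tev r e₁ t), emb (tev r e₂ t)) (tev r e₃ t, tev r e₄ t) := by
  simp_rw [map_tev emb, ← tev_prod]
  exact continuous_bilin_tev _ _ _ _

lemma integral_cip_tdv_self (N : ℕ) (X : ℕ → ℝ) (r : ℕ) (e : ℕ → CellPoly) (l t₀ : ℝ) :
    ∫ t in l..t₀, cip N X (emb (tdv r e t)) (emb (tev r e t)) =
      1 / 2 * cip N X (emb (tev r e t₀)) (emb (tev r e t₀)) -
        1 / 2 * cip N X (emb (tev r e l)) (emb (tev r e l)) := by
  have h1 : ∀ t, HasDerivAt (fun t => 1 / 2 * cip N X (emb (tev r e t)) (emb (tev r e t)))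
      (cip N X (emb (tdv r e t)) (emb (tev r e t))) t := by
    intro t
    have h2 := (hasDerivAt_bilin_tev (cip N X) r (fun i => emb (e i)) (fun i => emb (e i)) t).const_mul
      (1 / 2 : ℝ)
    simp only [← map_tev emb, ← map_tdv emb] at h2
    refine h2.congr_deriv ?_
    rw [cip_comm N X (emb (tev r e t)) (emb (tdv r e t))]
    ring
  exact intervalIntegral.integral_eq_sub_of_hasDerivAt (fun t _ => h1 t)
    ((continuous_cip_tdv N X r e e).intervalIntegrable _ _)

lemma integral_add_sub {f₁ f₂ f₃ f₄ f₅ : ℝ → ℝ} (h₁ : Continuous f₁) (h₂ : Continuous f₂)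
    (h₃ : Continuous f₃) (h₄ : Continuous f₄) (h₅ : Continuous f₅) (l r : ℝ) :
    ∫ t in l..r, (f₁ t + f₂ t + f₃ t - f₄ t - f₅ t) =
      (∫ t in l..r, f₁ t) + (∫ t in l..r, f₂ t) + (∫ t in l..r, f₃ t) - (∫ t in l..r, f₄ t) -
        ∫ t in l..r, f₅ t := by
  rw [intervalIntegral.integral_sub, intervalIntegral.integral_sub, intervalIntegral.integral_add,
    intervalIntegral.integral_add]
  all_goals exact Continuous.intervalIntegrable (by fun_prop) _ _

lemma two_mul_le_add_of_sq_le {J p q : ℝ} (hp : 0 ≤ p) (hq : 0 ≤ q) (h : J ^ 2 ≤ p * q) :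
    2 * J ≤ p + q := by
  have : |2 * J| ≤ p + q := abs_le_of_sq_le_sq (by nlinarith [sq_nonneg (p - q)]) (by linarith)
  exact (le_abs_self _).trans this

/-- Young's inequality, with weights chosen so that the quadratic terms amount to a quarter of the
lower bound in `le_ldgEnergy`. -/
lemma young_bound {α β C e x y w : ℝ} (hα : 0 < α) (hβ : 0 < β) :
    C * e * (x + y + w + e) ≤
      1 / 4 * (β * x ^ 2 + y ^ 2 + α / 2 * w ^ 2) + (C ^ 2 * (1 / β + 1 + 2 / α) + C) * e ^ 2 := by
  have q1 : C * e * x ≤ β / 4 * x ^ 2 + C ^ 2 * (1 / β) * e ^ 2 := by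
    have h1 : β / 4 * x ^ 2 + C ^ 2 * (1 / β) * e ^ 2 - C * e * x =
        1 / β * (β / 2 * x - C * e) ^ 2 := by field_simp; ring
    have : 0 ≤ 1 / β * (β / 2 * x - C * e) ^ 2 := by positivity
    linarith
  have q2 : C * e * y ≤ 1 / 4 * y ^ 2 + C ^ 2 * e ^ 2 := by
    nlinarith [sq_nonneg (1 / 2 * y - C * e)]
  have q3 : C * e * w ≤ α / 8 * w ^ 2 + C ^ 2 * (2 / α) * e ^ 2 := by
    have h1 : α / 8 * w ^ 2 + C ^ 2 * (2 / α) * e ^ 2 - C * e * w =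
        2 / α * (α / 4 * w - C * e) ^ 2 := by field_simp; ring
    have : 0 ≤ 2 / α * (α / 4 * w - C * e) ^ 2 := by positivity
    linarith
  linarith

set_option maxHeartbeats 1000000 in
/-- The change of the discrete error over one time interval. -/
lemma exists_energy_step (k r : ℕ) (T α β σ Cm L D : ℝ) (hT : 0 < T) (hα : 0 < α) (hβ : 0 < β)
    (hσ : (k : ℝ) + 2 ≤ σ) (hD : 0 ≤ D) : ∃ C, 0 ≤ C ∧ ∀ {ε lam ϖ : ℝ} {n M : ℕ} {X : ℕ → ℝ}
    {A A' b w₀ : C(ℝ, ℝ)} {S E : ℕ → ℕ → ℝ → C(ℝ, ℝ)} {p₀ : CellPoly} {cu cq : ℕ → ℕ → CellPoly},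
    0 < ε → ε ≤ 1 → 0 ≤ lam → 0 ≤ ϖ → IsLayerMesh α σ ε ϖ Cm n X → IsCoeff L A A' b →
    (∀ x ∈ Icc (0 : ℝ) 1, α ≤ A x) → (∀ x ∈ Icc (0 : ℝ) 1, β ≤ (b - (1 / 2 : ℝ) • A') x) →
    IsData k r T α ε D S E →
    IsCellDG k r n X T M (ldgForm ε lam A (b - A') n X) (rhs ε A b S E) w₀ p₀ cu cq →
    ∀ m < M, ∀ l t₀ : ℝ, l = timePt T M m → t₀ = timePt T M (m + 1) → ∀ xu xq : ℕ → CellPoly,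
      (xu = fun i => compU k r X l t₀ S E i - cu m i) →
      (xq = fun i => compQ ε k r X l t₀ S E i - cq m i) →
      cip (n + 1) X (emb (tev r xu t₀)) (emb (tev r xu t₀)) +
        (∫ t in l..t₀, ldgEnergy ε lam A (b - (1 / 2 : ℝ) • A') n X (emb (tev r xu t))
          (emb (tev r xq t))) ≤
      cip (n + 1) X (emb (projR k X (S 0 0 l + E 0 0 l) - prevPoly r T M p₀ cu m))
          (emb (projR k X (S 0 0 l + E 0 0 l) - prevPoly r T M p₀ cu m)) +
        C * (t₀ - l) * ((t₀ - l) ^ (r + 1) + ϖ ^ (k + 1)) ^ 2 := by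
  obtain ⟨C₁, hC₁, hres⟩ := exists_residual_bound k r T α σ Cm L D hT hα hσ hD
  obtain ⟨C₃, hC₃, hjump⟩ := exists_jump_bound k r T α σ Cm D hT hα hσ hD
  set C₂ := C₁ ^ 2 * (1 / β + 1 + 2 / α) + C₁ with hC₂
  have hC₂0 : 0 ≤ C₂ := by positivity
  refine ⟨2 * C₂ + 2 * C₃ / β, by positivity, ?_⟩
  intro ε lam ϖ n M X A A' b w₀ S E p₀ cu cq hε hε1 hlam hϖ hX hco hA hρ hSE hDG m hm l t₀ hl ht₀
    xu xq hxu hxq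
  have hgr := hX.isGrid
  have hlt : l < t₀ := by rw [hl, ht₀]; exact timePt_lt hT hm
  have hl0 : 0 ≤ l := by rw [hl]; exact (timePt_mem hT hm.le).1
  have ht₀T : t₀ ≤ T := by rw [ht₀]; exact (timePt_mem hT hm).2
  set 𝓔 := (t₀ - l) ^ (r + 1) + ϖ ^ (k + 1) with h𝓔
  have hΔ : 0 < t₀ - l := sub_pos.2 hlt
  have h𝓔0 : 0 ≤ 𝓔 := by positivity
  have hξ : ∀ t, tev r xu t = projR k X (timeComp r l t₀ (S 0) t + timeComp r l t₀ (E 0) t) -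
      tev r (cu m) t := fun t => by rw [hxu, tev_sub, tev_compU]
  have hξd : ∀ t, tdv r xu t = projR k X (timeCompDeriv r l t₀ (S 0) t + timeCompDeriv r l t₀ (E 0) t)
      - tdv r (cu m) t := fun t => by rw [hxu, tdv_sub, tdv_compU]
  have hξq : ∀ t, tev r xq t = projL k X (ε • (timeComp r l t₀ (S 1) t + timeComp r l t₀ (E 1) t)) -
      tev r (cq m) t := fun t => by rw [hxq, tev_sub, tev_compQ]
  set form := ldgForm ε lam A (b - A') n X with hform
  have hxud : ∀ i j, (xu i j).natDegree ≤ k := fun i j => by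
    rw [hxu]
    exact (Polynomial.natDegree_sub_le_of_le (compU_natDegree k r X l t₀ S E i j)
      (hDG.degU m i j)).trans (by simp)
  have hxqd : ∀ i j, (xq i j).natDegree ≤ k := fun i j => by
    rw [hxq]
    exact (Polynomial.natDegree_sub_le_of_le (compQ_natDegree ε k r X l t₀ S E i j)
      (hDG.degQ m i j)).trans (by simp)
  set a := S 0 (r + 1) t₀ + E 0 (r + 1) t₀ with ha
  have hEn : ∀ t, ldgEnergy ε lam A (b - (1 / 2 : ℝ) • A') n X (emb (tev r xu t)) (emb (tev r xq t)) =
      form (emb (tev r xu t), emb (tev r xq t)) (tev r xu t, tev r xq t) := fun t => by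
    rw [hform, ldgForm_apply, ldgFun_self hgr hco.dA]
  -- Tested with the discrete error, the derivative of order r + 1 gives a polynomial of degree at
  -- most r in time, as `timeDefect_consistency` requires.
  obtain ⟨p, hp, hpe⟩ := exists_poly_tev r fun i => cip (n + 1) X (cst a) (emb (xu i))
  have hp' : ∀ t, cip (n + 1) X (cst a) (emb (tev r xu t)) = p.eval t := fun t => by
    rw [hpe, map_tev emb, map_tev]
  -- The residual of the comparison function, written through the discrete error and the discrete
  -- solution. It is bounded pointwise in time, while its integral is evaluated by the scheme.
  set Res : ℝ → ℝ := fun t => cip (n + 1) X (emb (tdv r xu t)) (emb (tev r xu t)) +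
    form (emb (tev r xu t), emb (tev r xq t)) (tev r xu t, tev r xq t) +
    (cip (n + 1) X (emb (tdv r (cu m) t)) (emb (tev r xu t)) +
      form (emb (tev r (cu m) t), emb (tev r (cq m) t)) (tev r xu t, tev r xq t)) -
    (timeDefect r l t₀).derivative.eval t * p.eval t -
    cip (n + 1) X (cst (rhs ε A b S E t)) (emb (tev r xu t)) with hRes
  have c1 := continuous_cip_tdv (n + 1) X r xu xu
  have c2 := continuous_form_tev form r xu xq xu xq
  have c3 := (continuous_cip_tdv (n + 1) X r (cu m) xu).add
    (continuous_form_tev form r (cu m) (cq m) xu xq)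
  have c4 : Continuous fun t => (timeDefect r l t₀).derivative.eval t * p.eval t := by fun_prop
  have c5 := continuous_cip_cst (continuous_rhs (ε := ε) (A := A) (b := b) hSE.sS hSE.sE) (n + 1) X r xu
  have cR : Continuous Res := (((c1.add c2).add c3).sub c4).sub c5
  have hbound : ∀ t ∈ Icc l t₀, |Res t| ≤ C₁ * 𝓔 * (testNorm ε n X (tev r xu t) (tev r xq t) + 𝓔) := by
    intro t ht
    have hfl := hDG.fluxEq hT hm (t := t) (by rw [← hl, ← ht₀]; exact ht)
    have := hres (lam := lam) hε hε1 hϖ hX hco hSE hl0 hlt ht₀T (tev_natDegree (hDG.degU m) t)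
      (tev_natDegree (hDG.degQ m) t) hfl t ht _ _ (hξ t) (hξq t)
    refine le_trans (le_of_eq ?_) this
    have e1 : cip (n + 1) X (emb (tdv r xu t)) (emb (tev r xu t)) =
        cip (n + 1) X (emb (projR k X (timeCompDeriv r l t₀ (S 0) t + timeCompDeriv r l t₀ (E 0) t)))
          (emb (tev r xu t)) - cip (n + 1) X (emb (tdv r (cu m) t)) (emb (tev r xu t)) := by
      rw [hξd, map_sub emb, map_sub, LinearMap.sub_apply]
    have e2 : form (emb (tev r xu t), emb (tev r xq t)) (tev r xu t, tev r xq t) =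
        ldgFun ε lam A (b - A') n X
            (emb (projR k X (timeComp r l t₀ (S 0) t + timeComp r l t₀ (E 0) t)))
            (emb (projL k X (ε • (timeComp r l t₀ (S 1) t + timeComp r l t₀ (E 1) t))))
            (tev r xu t) (tev r xq t) -
          form (emb (tev r (cu m) t), emb (tev r (cq m) t)) (tev r xu t, tev r xq t) := by
      have : (emb (tev r xu t), emb (tev r xq t)) =
          (emb (projR k X (timeComp r l t₀ (S 0) t + timeComp r l t₀ (E 0) t)),
            emb (projL k X (ε • (timeComp r l t₀ (S 1) t + timeComp r l t₀ (E 1) t)))) -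
          (emb (tev r (cu m) t), emb (tev r (cq m) t)) := by
        rw [hξ, hξq, map_sub, map_sub, Prod.mk_sub_mk]
      rw [this, map_sub, LinearMap.sub_apply, hform, ldgForm_apply]
    simp only [hRes]
    rw [e1, e2, hp']
    congr 1
    ring
  have hint : (∫ t in l..t₀, Res t) =
      (1 / 2 * cip (n + 1) X (emb (tev r xu t₀)) (emb (tev r xu t₀)) -
        1 / 2 * cip (n + 1) X (emb (tev r xu l)) (emb (tev r xu l))) +
      (∫ t in l..t₀, form (emb (tev r xu t), emb (tev r xq t)) (tev r xu t, tev r xq t)) +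
      (∫ t in l..t₀, (cip (n + 1) X (emb (tdv r (cu m) t)) (emb (tev r xu t)) +
        form (emb (tev r (cu m) t), emb (tev r (cq m) t)) (tev r xu t, tev r xq t))) -
      (∫ t in l..t₀, (timeDefect r l t₀).derivative.eval t * p.eval t) -
      ∫ t in l..t₀, cip (n + 1) X (cst (rhs ε A b S E t)) (emb (tev r xu t)) := by
    rw [← integral_cip_tdv_self]
    exact integral_add_sub c1 c2 c3 c4 c5 l t₀
  have hsch := hDG.scheme m hm xu xq hxud hxqd
  rw [← hl, ← ht₀] at hsch
  -- Over the whole interval the defect term reduces to its value at l, where it is joined to the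
  -- mismatch of the comparison function in J.
  have hcns := timeDefect_consistency hlt hp
  rw [← hp' l] at hcns
  have hJ := hjump (e := xu) hε hϖ hX hSE hl0 hlt ht₀T
  set pl := projR k X (S 0 0 l + E 0 0 l) with hpl
  set J := cip (n + 1) X (emb (projR k X (timeComp r l t₀ (S 0) l + timeComp r l t₀ (E 0) l)) -
    emb pl) (emb (tev r xu l)) - (timeDefect r l t₀).eval l * cip (n + 1) X (cst a) (emb (tev r xu l))
    with hJd
  set g := pl - prevPoly r T M p₀ cu m with hg
  have hprev : cip (n + 1) X (emb (tev r (cu m) l) - emb (prevPoly r T M p₀ cu m)) (emb (tev r xu l)) -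
      (timeDefect r l t₀).eval l * cip (n + 1) X (cst a) (emb (tev r xu l)) =
      J + cip (n + 1) X (emb g) (emb (tev r xu l)) -
        cip (n + 1) X (emb (tev r xu l)) (emb (tev r xu l)) := by
    have h1 : emb (tev r (cu m) l) - emb (prevPoly r T M p₀ cu m) =
        (emb (projR k X (timeComp r l t₀ (S 0) l + timeComp r l t₀ (E 0) l)) - emb pl) +
          emb g - emb (tev r xu l) := by
      rw [hg]
      nth_rewrite 1 [hξ l]
      simp only [map_sub]
      abel
    rw [h1, hJd]
    simp only [map_add, map_sub, LinearMap.add_apply, LinearMap.sub_apply]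
    ring
  -- The squared norm at l appearing here is supplied by the upwind jump in time; only the incoming
  -- error g is left.
  have hg2 : 2 * cip (n + 1) X (emb g) (emb (tev r xu l)) ≤
      cip (n + 1) X (emb g) (emb g) + cip (n + 1) X (emb (tev r xu l)) (emb (tev r xu l)) :=
    two_mul_le_add_of_sq_le (cip_self_nonneg hgr _) (cip_self_nonneg hgr _) (cip_sq_le hgr _ _)
  set En : ℝ → ℝ := fun t => form (emb (tev r xu t), emb (tev r xq t)) (tev r xu t, tev r xq t)
    with hEnd
  have hEnle : ∀ t, β * cip (n + 1) X (emb (tev r xu t)) (emb (tev r xu t)) +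
      ε⁻¹ * cip (n + 1) X (emb (tev r xq t)) (emb (tev r xq t)) +
      α / 2 * ((tev r xu t) n).eval (X (n + 1)) ^ 2 ≤ En t := fun t => by
    rw [hEnd]
    simp only [← hEn]
    exact le_ldgEnergy hgr hα.le hlam hA hρ _ _
  have hε' : 0 < ε⁻¹ := inv_pos.2 hε
  -- The identity is used multiplied by two and then contains the energy integral twice. The
  -- residual consumes half of one copy and the term J the other half, so one full copy remains.
  have hI1 : (∫ t in l..t₀, Res t) ≤ 1 / 4 * (∫ t in l..t₀, En t) + C₂ * (t₀ - l) * 𝓔 ^ 2 := by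
    have h1 : (∫ t in l..t₀, Res t) ≤ ∫ t in l..t₀, (1 / 4 * En t + C₂ * 𝓔 ^ 2) := by
      refine intervalIntegral.integral_mono_on hlt.le (cR.intervalIntegrable _ _)
        (((c2.const_mul _).add continuous_const).intervalIntegrable _ _) fun t ht => ?_
      refine (le_abs_self _).trans ((hbound t ht).trans ?_)
      have h2 := hEnle t
      unfold testNorm
      set x := Real.sqrt (cip (n + 1) X (emb (tev r xu t)) (emb (tev r xu t))) with hx
      set y := Real.sqrt (ε⁻¹ * cip (n + 1) X (emb (tev r xq t)) (emb (tev r xq t))) with hy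
      have hx2 : x ^ 2 = cip (n + 1) X (emb (tev r xu t)) (emb (tev r xu t)) :=
        Real.sq_sqrt (cip_self_nonneg hgr _)
      have hy2 : y ^ 2 = ε⁻¹ * cip (n + 1) X (emb (tev r xq t)) (emb (tev r xq t)) :=
        Real.sq_sqrt (mul_nonneg hε'.le (cip_self_nonneg hgr _))
      rw [← hx2, ← hy2, ← sq_abs (((tev r xu t) n).eval (X (n + 1)))] at h2
      set w := |((tev r xu t) n).eval (X (n + 1))|
      exact (young_bound hα hβ).trans (by rw [hC₂]; linarith)
    refine h1.trans (le_of_eq ?_)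
    rw [intervalIntegral.integral_add ((c2.const_mul _).intervalIntegrable _ _)
      (continuous_const.intervalIntegrable _ _), intervalIntegral.integral_const_mul,
      intervalIntegral.integral_const, smul_eq_mul]
    ring
  have hI2 : β * (∫ t in l..t₀, cip (n + 1) X (emb (tev r xu t)) (emb (tev r xu t))) ≤
      ∫ t in l..t₀, En t := by
    rw [← intervalIntegral.integral_const_mul]
    refine intervalIntegral.integral_mono_on hlt.le
      (((continuous_cip_tev (n + 1) X r xu xu).const_mul _).intervalIntegrable _ _)
      (c2.intervalIntegrable _ _) fun t _ => ?_
    have h2 := hEnle t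
    have h3 := mul_nonneg hε'.le (cip_self_nonneg hgr (emb (tev r xq t)))
    have h4 : 0 ≤ α / 2 * ((tev r xu t) n).eval (X (n + 1)) ^ 2 := by positivity
    linarith
  have hI0 : 0 ≤ ∫ t in l..t₀, cip (n + 1) X (emb (tev r xu t)) (emb (tev r xu t)) :=
    intervalIntegral.integral_nonneg hlt.le fun t _ => cip_self_nonneg hgr _
  set I := ∫ t in l..t₀, En t with hI
  have hJ2 : 2 * J ≤ 2 * C₃ / β * (t₀ - l) * 𝓔 ^ 2 + 1 / 2 * I := by
    refine two_mul_le_add_of_sq_le (by positivity) (by nlinarith) (hJ.trans ?_)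
    have h1 : (∫ t in l..t₀, cip (n + 1) X (emb (tev r xu t)) (emb (tev r xu t))) ≤ I / β := by
      rw [le_div_iff₀ hβ]; linarith
    calc C₃ * (t₀ - l) * 𝓔 ^ 2 * (∫ t in l..t₀, cip (n + 1) X (emb (tev r xu t)) (emb (tev r xu t)))
        ≤ C₃ * (t₀ - l) * 𝓔 ^ 2 * (I / β) := mul_le_mul_of_nonneg_left h1 (by positivity)
      _ = _ := by ring
  simp_rw [hEn]
  change _ + I ≤ _
  have e3 : (2 * C₂ + 2 * C₃ / β) * (t₀ - l) * 𝓔 ^ 2 =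
      2 * (C₂ * (t₀ - l) * 𝓔 ^ 2) + 2 * C₃ / β * (t₀ - l) * 𝓔 ^ 2 := by ring
  rw [e3]
  linarith

/-- The discrete error over the whole time interval. -/
lemma exists_discrete_error (k r : ℕ) (T α β σ Cm L D : ℝ) (hT : 0 < T) (hα : 0 < α) (hβ : 0 < β)
    (hσ : (k : ℝ) + 2 ≤ σ) (hD : 0 ≤ D) : ∃ C, 0 ≤ C ∧ ∀ {ε lam ϖ : ℝ} {n M : ℕ} {X : ℕ → ℝ}
    {A A' b : C(ℝ, ℝ)} {S E : ℕ → ℕ → ℝ → C(ℝ, ℝ)} {p₀ : CellPoly} {cu cq : ℕ → ℕ → CellPoly},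
    0 < ε → ε ≤ 1 → 0 ≤ lam → 0 ≤ ϖ → 1 ≤ M → IsLayerMesh α σ ε ϖ Cm n X → IsCoeff L A A' b →
    (∀ x ∈ Icc (0 : ℝ) 1, α ≤ A x) → (∀ x ∈ Icc (0 : ℝ) 1, β ≤ (b - (1 / 2 : ℝ) • A') x) →
    IsData k r T α ε D S E →
    IsCellDG k r n X T M (ldgForm ε lam A (b - A') n X) (rhs ε A b S E) (S 0 0 0 + E 0 0 0) p₀ cu cq →
      cip (n + 1) X (emb (projR k X (S 0 0 T + E 0 0 T) - prevPoly r T M p₀ cu M))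
          (emb (projR k X (S 0 0 T + E 0 0 T) - prevPoly r T M p₀ cu M)) +
        ∑ m ∈ Finset.range M, (∫ t in (timePt T M m)..(timePt T M (m + 1)),
          ldgEnergy ε lam A (b - (1 / 2 : ℝ) • A') n X
            (emb (projR k X (timeComp r (timePt T M m) (timePt T M (m + 1)) (S 0) t +
              timeComp r (timePt T M m) (timePt T M (m + 1)) (E 0) t) - tev r (cu m) t))
            (emb (projL k X (ε • (timeComp r (timePt T M m) (timePt T M (m + 1)) (S 1) t +
              timeComp r (timePt T M m) (timePt T M (m + 1)) (E 1) t)) - tev r (cq m) t))) ≤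
      C * ((T / M) ^ (r + 1) + ϖ ^ (k + 1)) ^ 2 := by
  obtain ⟨C₁, hC₁, hstep⟩ := exists_energy_step k r T α β σ Cm L D hT hα hβ hσ hD
  obtain ⟨CR, hCR, hR⟩ := exists_projR_l2 k Cm
  refine ⟨C₁ * T + (CR * D) ^ 2, by positivity, ?_⟩
  intro ε lam ϖ n M X A A' b S E p₀ cu cq hε hε1 hlam hϖ hM hX hco hA hρ hSE hDG
  have hgr := hX.isGrid
  set 𝓔 := (T / M) ^ (r + 1) + ϖ ^ (k + 1) with h𝓔
  have h𝓔0 : 0 ≤ 𝓔 := by positivity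
  set e : ℕ → ℝ := fun m => cip (n + 1) X
    (emb (projR k X (S 0 0 (timePt T M m) + E 0 0 (timePt T M m)) - prevPoly r T M p₀ cu m))
    (emb (projR k X (S 0 0 (timePt T M m) + E 0 0 (timePt T M m)) - prevPoly r T M p₀ cu m)) with he
  set I : ℕ → ℝ := fun m => ∫ t in (timePt T M m)..(timePt T M (m + 1)),
          ldgEnergy ε lam A (b - (1 / 2 : ℝ) • A') n X
            (emb (projR k X (timeComp r (timePt T M m) (timePt T M (m + 1)) (S 0) t +
              timeComp r (timePt T M m) (timePt T M (m + 1)) (E 0) t) - tev r (cu m) t))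
            (emb (projL k X (ε • (timeComp r (timePt T M m) (timePt T M (m + 1)) (S 1) t +
              timeComp r (timePt T M m) (timePt T M (m + 1)) (E 1) t)) - tev r (cq m) t)) with hI
  -- The incoming error carries the factor one, so the steps add up without a Gronwall argument, and
  -- the M local terms of size Δt sum to T.
  have h1 : ∀ m < M, e (m + 1) + I m ≤ e m + C₁ * (T / M) * 𝓔 ^ 2 := by
    intro m hm
    have h2 := hstep hε hε1 hlam hϖ hX hco hA hρ hSE hDG m hm _ _ rfl rfl _ _ rfl rfl
    simp only [tev_sub, tev_compU, tev_compQ, timeComp_right (timePt_lt hT hm)] at h2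
    rw [timePt_sub] at h2
    exact h2
  have h2 : ∀ m ≤ M, e m + ∑ i ∈ Finset.range m, I i ≤ e 0 + m * (C₁ * (T / M) * 𝓔 ^ 2) := by
    intro m
    induction m with
    | zero => simp
    | succ m ih =>
      intro hm
      have h3 := h1 m hm
      have h4 := ih (by omega)
      rw [Finset.sum_range_succ]
      push_cast
      linarith
  have h3 : e 0 ≤ (CR * (D * ϖ ^ (k + 1))) ^ 2 := by
    have h00 : timePt T M 0 = 0 := by simp [timePt]
    have h4 := (hR hα hσ hε hϖ hX (hSE.isLayered (t := 0) ⟨le_rfl, hT.le⟩)).1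
    simp only [he, h00, prevPoly]
    set w := S 0 0 0 + E 0 0 0 with hw
    set v := projR k X w - p₀ with hv
    have hvd : ∀ j, (v j).natDegree ≤ k := fun j =>
      (Polynomial.natDegree_sub_le_of_le (projR_natDegree k X w j) (hDG.deg₀ j)).trans (by simp)
    -- The initial value is an L² projection and v is discrete. The initial discrete error is thus
    -- dominated by the Radau projection error.
    have h5 : cip (n + 1) X (emb v) (emb v) = cip (n + 1) X (emb (projR k X w) - cst w) (emb v) := by
      nth_rewrite 1 [hv]
      have hi := hDG.initial v hvd
      simp only [map_sub, LinearMap.sub_apply]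
      linarith
    have h6 := cip_sq_le hgr (emb (projR k X w) - cst w) (emb v)
    rw [← h5, sq] at h6
    rcases (cip_self_nonneg hgr (emb v)).eq_or_lt with h7 | h7
    · rw [← h7]; positivity
    · exact (le_of_mul_le_mul_right h6 h7).trans h4
  have h4 := h2 M le_rfl
  have hM0 : (M : ℝ) ≠ 0 := by positivity
  have h5 : (M : ℝ) * (C₁ * (T / M) * 𝓔 ^ 2) = C₁ * T * 𝓔 ^ 2 := by field_simp
  have h6 : (CR * (D * ϖ ^ (k + 1))) ^ 2 ≤ (CR * D) ^ 2 * 𝓔 ^ 2 := by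
    rw [← mul_assoc, mul_pow]
    have h7 : ϖ ^ (k + 1) ≤ 𝓔 := by
      have : 0 ≤ (T / M) ^ (r + 1) := by positivity
      linarith
    gcongr
  have h7 : e M = cip (n + 1) X (emb (projR k X (S 0 0 T + E 0 0 T) - prevPoly r T M p₀ cu M))
          (emb (projR k X (S 0 0 T + E 0 0 T) - prevPoly r T M p₀ cu M)) := by
    simp only [he, timePt_self T hM]
  rw [← h7]
  rw [h5] at h4
  linarith

end LDG

end

noncomputable section

namespace LDG

open scoped Polynomial

/-! ### The energy norm of the remaining parts of the error -/

section Energy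

variable {ε lam : ℝ} {A ρ : C(ℝ, ℝ)} {n : ℕ} {X : ℕ → ℝ}

lemma ldgEnergy_parallelogram (f g f' g' : CellFn) :
    ldgEnergy ε lam A ρ n X (f + f') (g + g') + ldgEnergy ε lam A ρ n X (f - f') (g - g') =
      2 * ldgEnergy ε lam A ρ n X f g + 2 * ldgEnergy ε lam A ρ n X f' g' := by
  have e1 : ∑ j ∈ Finset.range n, A (X (j + 1)) *
        ((f + f') (j + 1) (X (j + 1)) - (f + f') j (X (j + 1))) ^ 2 =
      2 * ∑ j ∈ Finset.range n, A (X (j + 1)) * (f (j + 1) (X (j + 1)) - f j (X (j + 1))) ^ 2 +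
      2 * ∑ j ∈ Finset.range n, A (X (j + 1)) * (f' (j + 1) (X (j + 1)) - f' j (X (j + 1))) ^ 2 -
      ∑ j ∈ Finset.range n, A (X (j + 1)) *
        ((f - f') (j + 1) (X (j + 1)) - (f - f') j (X (j + 1))) ^ 2 := by
    rw [Finset.mul_sum, Finset.mul_sum, ← Finset.sum_add_distrib, ← Finset.sum_sub_distrib]
    refine Finset.sum_congr rfl fun j _ => ?_
    simp only [Pi.add_apply, Pi.sub_apply, ContinuousMap.add_apply, ContinuousMap.sub_apply]
    ring
  unfold ldgEnergy
  rw [e1]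
  simp only [mul_add, mul_sub, map_add, map_sub, LinearMap.add_apply, LinearMap.sub_apply,
    Pi.add_apply, Pi.sub_apply, ContinuousMap.add_apply, ContinuousMap.sub_apply]
  ring

lemma ldgEnergy_nonneg {α : ℝ} (h : IsGrid n X) (hε : 0 < ε) (hα : 0 ≤ α) (hlam : 0 ≤ lam)
    (hA : ∀ x ∈ Icc (0 : ℝ) 1, α ≤ A x) (hρ : ∀ x ∈ Icc (0 : ℝ) 1, 0 ≤ ρ x) (f g : CellFn) :
    0 ≤ ldgEnergy ε lam A ρ n X f g := by
  have h1 := le_ldgEnergy (ε := ε) h hα hlam hA hρ f g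
  have h2 : 0 ≤ ε⁻¹ * cip (n + 1) X g g := mul_nonneg (inv_pos.2 hε).le (cip_self_nonneg h g)
  have h3 : 0 ≤ α / 2 * f n (X (n + 1)) ^ 2 := by positivity
  linarith

lemma ldgEnergy_add_le {α : ℝ} (h : IsGrid n X) (hε : 0 < ε) (hα : 0 ≤ α) (hlam : 0 ≤ lam)
    (hA : ∀ x ∈ Icc (0 : ℝ) 1, α ≤ A x) (hρ : ∀ x ∈ Icc (0 : ℝ) 1, 0 ≤ ρ x) (f g f' g' : CellFn) :
    ldgEnergy ε lam A ρ n X (f + f') (g + g') ≤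
      2 * ldgEnergy ε lam A ρ n X f g + 2 * ldgEnergy ε lam A ρ n X f' g' := by
  have h1 := ldgEnergy_nonneg (lam := lam) h hε hα hlam hA hρ (f - f') (g - g')
  rw [← ldgEnergy_parallelogram]
  linarith

lemma cip_cst_mul_le {B : ℝ} (h : IsGrid n X) (hρ : ∀ x ∈ Icc (0 : ℝ) 1, ρ x ≤ B) (f : CellFn) :
    cip (n + 1) X (cst ρ * f) f ≤ B * cip (n + 1) X f f := by
  have h1 : B * cip (n + 1) X f f = cip (n + 1) X (B • f) f := by simp
  rw [h1]
  refine cip_mono h fun j hj x hx => ?_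
  have := hρ x (h.Icc_subset hj hx)
  simp only [Pi.smul_apply, ContinuousMap.smul_apply, Pi.mul_apply, ContinuousMap.mul_apply,
    cst_apply, smul_eq_mul]
  nlinarith [mul_le_mul_of_nonneg_right this (mul_self_nonneg (f j x))]

end Energy

/-- The energy norm of the projection error. -/
lemma exists_projection_energy (k : ℕ) (α σ Cm L : ℝ) (hα : 0 < α) (hσ : (k : ℝ) + 2 ≤ σ)
    (hL : 0 ≤ L) : ∃ C, 0 ≤ C ∧ ∀ {ε lam D ϖ : ℝ} {n : ℕ} {X : ℕ → ℝ} {S E : ℕ → C(ℝ, ℝ)}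
    {A ρ : C(ℝ, ℝ)}, 0 < ε → ε ≤ 1 → 0 ≤ ϖ → ϖ ≤ 1 → IsLayerMesh α σ ε ϖ Cm n X →
    IsLayered α ε D k S E → (∀ x ∈ Icc (0 : ℝ) 1, A x ≤ L) → (∀ x ∈ Icc (0 : ℝ) 1, ρ x ≤ L) →
      ldgEnergy ε lam A ρ n X (emb (projR k X (S 0 + E 0)) - cst (S 0 + E 0))
        (emb (projL k X (ε • (S 1 + E 1))) - cst (ε • (S 1 + E 1))) ≤
      C * D ^ 2 * ϖ ^ (2 * k + 1) := by
  obtain ⟨CR, hCR, hR⟩ := exists_projR_l2 k Cm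
  obtain ⟨CL, hCL, hP⟩ := exists_projL_l2 k α σ Cm hα hσ
  refine ⟨CL ^ 2 + L * CR ^ 2 + 1 / 2 * L * CR ^ 2, by positivity, ?_⟩
  intro ε lam D ϖ n X S E A ρ hε hε1 hϖ hϖ1 hX hSE hA hρ
  have hgr := hX.isGrid
  obtain ⟨r1, r2⟩ := hR hα hσ hε hϖ hX hSE
  have l1 := (hP hε hε1 hϖ hX hSE).1
  set w := S 0 + E 0 with hw
  set q := ε • (S 1 + E 1) with hq
  set P := D ^ 2 * ϖ ^ (2 * k + 1) with hPdef
  -- This is where ϖ ≤ 1 is used: the L² contributions have the full order and are absorbed into the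
  -- half-order jump contribution.
  have hpow : (D * ϖ ^ (k + 1)) ^ 2 ≤ P := by
    have : ϖ ^ (2 * (k + 1)) ≤ ϖ ^ (2 * k + 1) := pow_le_pow_of_le_one hϖ hϖ1 (by omega)
    calc (D * ϖ ^ (k + 1)) ^ 2 = D ^ 2 * ϖ ^ (2 * (k + 1)) := by ring
      _ ≤ _ := by rw [hPdef]; gcongr
  have b1 : ε⁻¹ * cip (n + 1) X (emb (projL k X q) - cst q) (emb (projL k X q) - cst q) ≤
      CL ^ 2 * P := by
    refine l1.trans ?_
    rw [mul_pow]; gcongr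
  have b2 : cip (n + 1) X (cst ρ * (emb (projR k X w) - cst w)) (emb (projR k X w) - cst w) ≤
      L * CR ^ 2 * P := by
    refine (cip_cst_mul_le hgr hρ _).trans ?_
    rw [mul_assoc]
    refine mul_le_mul_of_nonneg_left (r1.trans ?_) hL
    rw [mul_pow]; gcongr
  -- The left traces of the projection error vanish. Its jumps are therefore the right traces
  -- bounded by `exists_projR_l2`, and the outflow and penalty terms disappear.
  have hzero : ∀ j ≤ n, (emb (projR k X w) - cst w) j (X (j + 1)) = 0 := fun j hj => by
    rw [Pi.sub_apply, ContinuousMap.sub_apply, emb_apply, cst_apply, projR_eval hgr hj, sub_self]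
  have b3 : A (X 0) * (emb (projR k X w) - cst w) 0 (X 0) ^ 2 +
      ∑ j ∈ Finset.range n, A (X (j + 1)) * ((emb (projR k X w) - cst w) (j + 1) (X (j + 1)) -
        (emb (projR k X w) - cst w) j (X (j + 1))) ^ 2 ≤ L * (CR ^ 2 * P) := by
    have e1 : ∑ j ∈ Finset.range (n + 1), A (X j) * ((projR k X w j).eval (X j) - w (X j)) ^ 2 =
        A (X 0) * (emb (projR k X w) - cst w) 0 (X 0) ^ 2 +
        ∑ j ∈ Finset.range n, A (X (j + 1)) * ((emb (projR k X w) - cst w) (j + 1) (X (j + 1)) -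
          (emb (projR k X w) - cst w) j (X (j + 1))) ^ 2 := by
      rw [Finset.sum_range_succ', add_comm]
      congr 1
      refine Finset.sum_congr rfl fun j hj => ?_
      rw [hzero j (Finset.mem_range.1 hj).le, sub_zero]
      rfl
    rw [← e1]
    calc _ ≤ ∑ j ∈ Finset.range (n + 1), L * ((projR k X w j).eval (X j) - w (X j)) ^ 2 :=
          Finset.sum_le_sum fun j hj => mul_le_mul_of_nonneg_right
            (hA _ (hgr.mem (Finset.mem_range.1 hj).le)) (sq_nonneg _)
      _ = L * ∑ j ∈ Finset.range (n + 1), ((projR k X w j).eval (X j) - w (X j)) ^ 2 := by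
          rw [Finset.mul_sum]
      _ ≤ _ := by
          refine mul_le_mul_of_nonneg_left (r2.trans (le_of_eq ?_)) hL
          rw [hPdef]; ring
  unfold ldgEnergy
  rw [hzero n le_rfl]
  have e2 : (CL ^ 2 + L * CR ^ 2 + 1 / 2 * L * CR ^ 2) * D ^ 2 * ϖ ^ (2 * k + 1) =
      CL ^ 2 * P + L * CR ^ 2 * P + 1 / 2 * (L * (CR ^ 2 * P)) := by rw [hPdef]; ring
  rw [e2]
  linarith

/-- The energy norm of a function with a layer that vanishes on the boundary. -/
lemma exists_smooth_energy (k : ℕ) (α σ L : ℝ) (hα : 0 < α) (hσ : (k : ℝ) + 2 ≤ σ) (hL : 0 ≤ L) :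
    ∃ C, 0 ≤ C ∧ ∀ {ε lam Z : ℝ} {n : ℕ} {X : ℕ → ℝ} {S E : ℕ → C(ℝ, ℝ)} {A ρ : C(ℝ, ℝ)},
    0 < ε → ε ≤ 1 → IsGrid n X → IsLayered α ε Z k S E → (∀ x ∈ Icc (0 : ℝ) 1, ρ x ≤ L) →
    (S 0 + E 0) 0 = 0 → (S 0 + E 0) 1 = 0 →
      ldgEnergy ε lam A ρ n X (cst (S 0 + E 0)) (cst (ε • (S 1 + E 1))) ≤ C * Z ^ 2 := by
  have hσ0 : 0 < σ := by linarith [(Nat.cast_nonneg k : (0 : ℝ) ≤ k)]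
  refine ⟨2 + 2 * (σ / α) + L * 4, by positivity, ?_⟩
  intro ε lam Z n X S E A ρ hε hε1 hgr hSE hρ h0 h1
  have hZ := hSE.nonneg
  have hε' : 0 < ε⁻¹ := inv_pos.2 hε
  have hexp : ∀ x ∈ Icc (0 : ℝ) 1, Real.exp (-α * (1 - x) / ε) ≤ 1 := fun x hx => by
    rw [Real.exp_le_one_iff]
    apply div_nonpos_of_nonpos_of_nonneg _ hε.le
    nlinarith [hx.2]
  have b1 : cip (n + 1) X (cst (S 0 + E 0)) (cst (S 0 + E 0)) ≤ (2 * Z) ^ 2 := by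
    refine cip_self_le_of_abs_le hgr fun j hj x hx => ?_
    have hx' := hgr.Icc_subset hj hx
    have h2 := hSE.bS 0 (by omega) x hx'
    have h3 := hSE.bE 0 (by omega) x hx'
    rw [pow_zero, inv_one, mul_one] at h3
    have h4 := h3.trans (mul_le_of_le_one_right hZ (hexp x hx'))
    rw [cst_apply, ContinuousMap.add_apply]
    refine (abs_add_le _ _).trans ?_
    linarith
  have b2 : cip (n + 1) X (cst (ε • S 1)) (cst (ε • S 1)) ≤ (ε * Z) ^ 2 := by
    refine cip_self_le_of_abs_le hgr fun j hj x hx => ?_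
    rw [cst_apply, ContinuousMap.smul_apply, smul_eq_mul, abs_mul, abs_of_pos hε]
    exact mul_le_mul_of_nonneg_left (hSE.bS 1 (by omega) x (hgr.Icc_subset hj hx)) hε.le
  -- The layer flux is pointwise only O(Z); its small L² norm comes from the width of the layer.
  have b3 : cip (n + 1) X (cst (ε • E 1)) (cst (ε • E 1)) ≤ Z ^ 2 * (σ / α * ε) := by
    have h2 : cip (n + 1) X (cst (ε • E 1)) (cst (ε • E 1)) ≤
        cip (n + 1) X (Z • cst (layerFn α σ ε)) (Z • cst (layerFn α σ ε)) := by
      refine cip_mono hgr fun j hj x hx => ?_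
      have hx' := hgr.Icc_subset hj hx
      have h3 := hSE.bE 1 (by omega) x hx'
      have h4 : |ε * E 1 x| ≤ Z * layerFn α σ ε x := by
        rw [abs_mul, abs_of_pos hε]
        have h5 := exp_le_layerFn_pow hα hσ hε hx'.2
        have h6 : layerFn α σ ε x ^ (k + 2) ≤ layerFn α σ ε x :=
          pow_le_of_le_one (layerFn_pos _ _ _ _).le (layerFn_le_one hα hσ0 hε hx'.2) (by omega)
        calc ε * |E 1 x| ≤ ε * (Z * (ε ^ 1)⁻¹ * Real.exp (-α * (1 - x) / ε)) := by gcongr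
          _ = Z * Real.exp (-α * (1 - x) / ε) := by field_simp
          _ ≤ _ := mul_le_mul_of_nonneg_left (h5.trans h6) hZ
      simp only [Pi.smul_apply, ContinuousMap.smul_apply, cst_apply, smul_eq_mul]
      rw [← sq, ← sq]
      exact sq_le_sq' (abs_le.1 h4).1 (abs_le.1 h4).2
    refine h2.trans ?_
    rw [map_smul, map_smul, LinearMap.smul_apply, smul_eq_mul, smul_eq_mul, ← mul_assoc, ← sq]
    refine mul_le_mul_of_nonneg_left ?_ (sq_nonneg Z)
    refine le_trans (le_of_eq ?_) (integral_layerFn_sq_le hα hσ0 hε)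
    have h7 := integral_eq_sum_cells hgr (layerFn α σ ε ^ 2)
    simp only [ContinuousMap.pow_apply] at h7
    rw [← h7, cip_apply]
    simp only [cst_apply, sq]
  have b4 : ε⁻¹ * cip (n + 1) X (cst (ε • (S 1 + E 1))) (cst (ε • (S 1 + E 1))) ≤
      (2 + 2 * (σ / α)) * Z ^ 2 := by
    have h2 := cip_add_self_le hgr (cst (ε • S 1)) (cst (ε • E 1))
    rw [smul_add, map_add]
    calc _ ≤ ε⁻¹ * (2 * (ε * Z) ^ 2 + 2 * (Z ^ 2 * (σ / α * ε))) := by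
          refine mul_le_mul_of_nonneg_left (h2.trans ?_) hε'.le
          linarith
      _ = (2 * ε + 2 * (σ / α)) * Z ^ 2 := by field_simp
      _ ≤ _ := by gcongr; linarith
  have b5 := (cip_cst_mul_le hgr hρ (cst (S 0 + E 0))).trans (mul_le_mul_of_nonneg_left b1 hL)
  unfold ldgEnergy
  simp only [cst_apply, sub_self, hgr.zero, hgr.one, h0, h1]
  simp only [ne_eq, OfNat.ofNat_ne_zero, not_false_eq_true, zero_pow, mul_zero,
    Finset.sum_const_zero, add_zero]
  linarith

/-- The energy norm of the error at one time in terms of the discrete error. -/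
lemma exists_energy_bound (k r : ℕ) (T α σ Cm L D : ℝ) (hT : 0 < T) (hα : 0 < α)
    (hσ : (k : ℝ) + 2 ≤ σ) (hL : 0 ≤ L) : ∃ C, 0 ≤ C ∧ ∀ {ε lam ϖ l t₀ : ℝ} {n : ℕ} {X : ℕ → ℝ}
    {A ρ : C(ℝ, ℝ)} {S E : ℕ → ℕ → ℝ → C(ℝ, ℝ)}, 0 < ε → ε ≤ 1 → 0 ≤ lam → 0 ≤ ϖ → ϖ ≤ 1 →
    IsLayerMesh α σ ε ϖ Cm n X → (∀ x ∈ Icc (0 : ℝ) 1, α ≤ A x) → (∀ x ∈ Icc (0 : ℝ) 1, A x ≤ L) →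
    (∀ x ∈ Icc (0 : ℝ) 1, 0 ≤ ρ x) → (∀ x ∈ Icc (0 : ℝ) 1, ρ x ≤ L) → IsData k r T α ε D S E →
    0 ≤ l → l < t₀ → t₀ ≤ T → ∀ t ∈ Icc l t₀, ∀ U Q : CellPoly,
      ldgEnergy ε lam A ρ n X (cst (S 0 0 t + E 0 0 t) - emb U)
        (cst (ε • (S 1 0 t + E 1 0 t)) - emb Q) ≤
      2 * ldgEnergy ε lam A ρ n X
        (emb (projR k X (timeComp r l t₀ (S 0) t + timeComp r l t₀ (E 0) t) - U))
        (emb (projL k X (ε • (timeComp r l t₀ (S 1) t + timeComp r l t₀ (E 1) t)) - Q)) +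
      C * (((t₀ - l) ^ (r + 1)) ^ 2 + ϖ ^ (2 * k + 1)) := by
  obtain ⟨C₁, hC₁, hcmp⟩ := exists_comparison k r T hT
  obtain ⟨C₂, hC₂, hη⟩ := exists_projection_energy k α σ Cm L hα hσ hL
  obtain ⟨C₃, hC₃, hζ⟩ := exists_smooth_energy k α σ L hα hσ hL
  refine ⟨4 * (C₂ * (C₁ * D) ^ 2) + 4 * (C₃ * (C₁ * D) ^ 2), by positivity, ?_⟩
  intro ε lam ϖ l t₀ n X A ρ S E hε hε1 hlam hϖ hϖ1 hX hA hAL hρ hρL hSE hl hlt ht₀ t ht U Q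
  have hgr := hX.isGrid
  have hc := hcmp hα hε hSE hl hlt ht₀ t ht
  have htT : t ∈ Icc 0 T := ⟨hl.trans ht.1, ht.2.trans ht₀⟩
  have ht₀T : t₀ ∈ Icc 0 T := ⟨hl.trans hlt.le, ht₀⟩
  set z₀ := timeComp r l t₀ (S 0) t + timeComp r l t₀ (E 0) t with hz₀
  set z₁ := timeComp r l t₀ (S 1) t + timeComp r l t₀ (E 1) t with hz₁
  have hb : ∀ y, S 0 0 t y + E 0 0 t y = 0 → (∀ i, S 0 i t₀ y + E 0 i t₀ y = 0) →
      ((S 0 0 t - timeComp r l t₀ (S 0) t) + (E 0 0 t - timeComp r l t₀ (E 0) t)) y = 0 := by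
    intro y hy hy'
    have h1 : timeComp r l t₀ (S 0) t y + timeComp r l t₀ (E 0) t y = 0 := by
      rw [timeComp_apply, timeComp_apply, ← Finset.sum_add_distrib]
      refine Finset.sum_eq_zero fun i _ => ?_
      rw [← mul_add, hy', mul_zero]
    simp only [ContinuousMap.add_apply, ContinuousMap.sub_apply]
    linarith
  have e1 := hη (lam := lam) hε hε1 hϖ hϖ1 hX hc.comp hAL hρL
  have e2 := hζ (lam := lam) (A := A) hε hε1 hgr hc.error hρL
    (hb 0 (hSE.left 0 t htT) fun i => hSE.left i t₀ ht₀T)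
    (hb 1 (hSE.right 0 t htT) fun i => hSE.right i t₀ ht₀T)
  set ζ : C(ℝ, ℝ) := (S 0 0 t - timeComp r l t₀ (S 0) t) + (E 0 0 t - timeComp r l t₀ (E 0) t)
    with hζd
  set ζ₁ : C(ℝ, ℝ) := (S 1 0 t - timeComp r l t₀ (S 1) t) + (E 1 0 t - timeComp r l t₀ (E 1) t)
    with hζ₁d
  -- The error is the discrete error plus the time error minus the projection error of the
  -- comparison function.
  have s1 : cst (S 0 0 t + E 0 0 t) - emb U = emb (projR k X z₀ - U) +
      (cst ζ - (emb (projR k X z₀) - cst z₀)) := by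
    rw [show S 0 0 t + E 0 0 t = ζ + z₀ by rw [hζd, hz₀]; abel]
    simp only [map_add, map_sub]
    abel
  have s2 : cst (ε • (S 1 0 t + E 1 0 t)) - emb Q = emb (projL k X (ε • z₁) - Q) +
      (cst (ε • ζ₁) - (emb (projL k X (ε • z₁)) - cst (ε • z₁))) := by
    rw [show S 1 0 t + E 1 0 t = ζ₁ + z₁ by rw [hζ₁d, hz₁]; abel]
    simp only [smul_add, map_add, map_sub]
    abel
  rw [s1, s2]
  have m1 := ldgEnergy_add_le (lam := lam) hgr hε hα.le hlam hA hρ (emb (projR k X z₀ - U))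
    (emb (projL k X (ε • z₁) - Q)) (cst ζ - (emb (projR k X z₀) - cst z₀))
    (cst (ε • ζ₁) - (emb (projL k X (ε • z₁)) - cst (ε • z₁)))
  have m2 := ldgEnergy_parallelogram (ε := ε) (lam := lam) (A := A) (ρ := ρ) (n := n) (X := X)
    (cst ζ) (cst (ε • ζ₁)) (emb (projR k X z₀) - cst z₀) (emb (projL k X (ε • z₁)) - cst (ε • z₁))
  have m3 := ldgEnergy_nonneg (lam := lam) hgr hε hα.le hlam hA hρ
    (cst ζ + (emb (projR k X z₀) - cst z₀))
    (cst (ε • ζ₁) + (emb (projL k X (ε • z₁)) - cst (ε • z₁)))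
  have e3 : C₃ * (C₁ * (t₀ - l) ^ (r + 1) * D) ^ 2 = C₃ * (C₁ * D) ^ 2 * ((t₀ - l) ^ (r + 1)) ^ 2 := by
    ring
  rw [e3] at e2
  have p1 : 0 ≤ C₂ * (C₁ * D) ^ 2 * ((t₀ - l) ^ (r + 1)) ^ 2 := by positivity
  have p2 : 0 ≤ C₃ * (C₁ * D) ^ 2 * ϖ ^ (2 * k + 1) := by positivity
  linarith

end LDG

end

noncomputable section

namespace LDG

open scoped Polynomial

/-! ### The data of the problem -/

lemma exists_continuousMap_eqOn {g : ℝ → ℝ} (hg : ContinuousOn g (Icc 0 1)) :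
    ∃ G : C(ℝ, ℝ), ∀ x ∈ Icc (0 : ℝ) 1, g x = G x := by
  refine ⟨⟨IccExtend zero_le_one ((Icc 0 1).domRestrict g), hg.domRestrict.Icc_extend'⟩,
    fun x hx => ?_⟩
  exact (IccExtend_of_mem zero_le_one ((Icc 0 1).domRestrict g) hx).symm

lemma exists_isCoeff {a b : ℝ → ℝ} (ha : ContDiffOn ℝ ∞ a (Icc 0 1))
    (hb : ContDiffOn ℝ ∞ b (Icc 0 1)) : ∃ (A A' B : C(ℝ, ℝ)) (L : ℝ), IsCoeff L A A' B ∧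
      (∀ x ∈ Icc (0 : ℝ) 1, a x = A x) ∧ (∀ x ∈ Icc (0 : ℝ) 1, coefDeriv a x = A' x) ∧
      ∀ x ∈ Icc (0 : ℝ) 1, b x = B x := by
  have hu := uniqueDiffOn_Icc (zero_lt_one (α := ℝ))
  have ha' : ContinuousOn (coefDeriv a) (Icc 0 1) :=
    ha.continuousOn_derivWithin hu (by norm_cast)
  obtain ⟨A, hA⟩ := exists_continuousMap_eqOn ha.continuousOn
  obtain ⟨A', hA'⟩ := exists_continuousMap_eqOn ha'
  obtain ⟨B, hB⟩ := exists_continuousMap_eqOn hb.continuousOn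
  obtain ⟨L₁, h₁⟩ := isCompact_Icc.exists_bound_of_continuousOn (s := Icc (0 : ℝ) 1) A.continuous.continuousOn
  obtain ⟨L₂, h₂⟩ := isCompact_Icc.exists_bound_of_continuousOn (s := Icc (0 : ℝ) 1) A'.continuous.continuousOn
  obtain ⟨L₃, h₃⟩ := isCompact_Icc.exists_bound_of_continuousOn (s := Icc (0 : ℝ) 1) B.continuous.continuousOn
  refine ⟨A, A', B, max L₁ (max L₂ L₃), ⟨fun x hx => ?_, fun x hx => ?_, fun x hx => ?_,
    fun x hx => ?_⟩, hA, hA', hB⟩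
  · have hx' := Ioo_subset_Icc_self hx
    have h := ((ha.differentiableOn (by simp)) x hx').hasDerivWithinAt.hasDerivAt
      (Icc_mem_nhds hx.1 hx.2)
    rw [← hA' x hx']
    refine h.congr_of_eventuallyEq ?_
    filter_upwards [Ioo_mem_nhds hx.1 hx.2] with y hy
    exact (hA y (Ioo_subset_Icc_self hy)).symm
  · exact (h₁ x hx).trans (le_max_left _ _)
  · exact (h₂ x hx).trans ((le_max_left _ _).trans (le_max_right _ _))
  · exact (h₃ x hx).trans ((le_max_right _ _).trans (le_max_right _ _))

/-- Boundary values that vanish for all times have vanishing time derivatives. -/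
lemma IsSmoothFamily.add_eq_zero {T : ℝ} (hT : 0 < T) {S E : ℕ → ℕ → ℝ → C(ℝ, ℝ)}
    (hS : IsSmoothFamily T S) (hE : IsSmoothFamily T E) {x : ℝ} (hx : x ∈ Icc (0 : ℝ) 1)
    (h : ∀ t ∈ Ioo 0 T, S 0 0 t x + E 0 0 t x = 0) (i : ℕ) :
    ∀ t ∈ Icc 0 T, S 0 i t x + E 0 i t x = 0 := by
  have h1 : ∀ t ∈ Ioo 0 T, S 0 i t x + E 0 i t x = 0 := by
    induction i with
    | zero => exact h
    | succ i ih =>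
      intro t ht
      have h2 := (hS.dt 0 i x hx t ht).add (hE.dt 0 i x hx t ht)
      have h3 : HasDerivAt (fun _ : ℝ => (0 : ℝ)) (S 0 (i + 1) t x + E 0 (i + 1) t x) t := by
        refine h2.congr_of_eventuallyEq ?_
        filter_upwards [Ioo_mem_nhds ht.1 ht.2] with s hs
        exact (ih s hs).symm
      exact h3.unique (hasDerivAt_const t 0)
  have h2 : EqOn (fun t => S 0 i t x + E 0 i t x) (fun _ => 0) (closure (Ioo 0 T)) :=
    EqOn.closure h1 ((hS.continuous_time 0 i x).add (hE.continuous_time 0 i x)) continuous_const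
  rw [closure_Ioo hT.ne] at h2
  exact h2

/-- The data of the convergence proof for a solution with a layer. -/
lemma exists_isData (k r : ℕ) {T ε α D : ℝ} (hT : 0 < T) (hε : 0 < ε) {a b u₀ : ℝ → ℝ}
    {f u : ℝ → ℝ → ℝ} {K : ℕ → ℕ → ℝ} {A B : C(ℝ, ℝ)} (hA : ∀ x ∈ Icc (0 : ℝ) 1, a x = A x)
    (hB : ∀ x ∈ Icc (0 : ℝ) 1, b x = B x) (hK : ∀ j ≤ k + 2, ∀ i ≤ r + 2, K j i ≤ D)
    (hu : IsClassicalSolution T ε a b f u₀ u) (hSE : HasLayerDecomposition T ε α K u) :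
    ∃ S E : ℕ → ℕ → ℝ → C(ℝ, ℝ), IsData k r T α ε D S E ∧
      (∀ x ∈ Icc (0 : ℝ) 1, ∀ t ∈ Icc 0 T, u x t = (S 0 0 t + E 0 0 t) x) ∧
      (∀ x ∈ Icc (0 : ℝ) 1, ∀ t ∈ Icc 0 T, flux ε u t x = (ε • (S 1 0 t + E 1 0 t)) x) ∧
      ∀ x ∈ Ioo (0 : ℝ) 1, ∀ t ∈ Ioc 0 T, f x t = rhs ε A B S E t x := by
  obtain ⟨S, E, hS, hE, bS, bE, hm, hd⟩ := hSE.exists_families hT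
  have hu0 : ∀ x ∈ Icc (0 : ℝ) 1, ∀ t ∈ Icc 0 T, u x t = S 0 0 t x + E 0 0 t x :=
    fun x hx t ht => by
      rw [← hm 0 0 x hx t ht]
      simp [mixedDeriv]
  refine ⟨S, E, ⟨hS, hE, ?_, ?_, ?_, ?_⟩, hu0, ?_, ?_⟩
  · exact fun j hj i hi x hx t ht => (bS j i x hx t ht).trans (hK j hj i hi)
  · intro j hj i hi x hx t ht
    refine (bE j i x hx t ht).trans ?_
    have := hK j hj i hi
    gcongr
  · refine hS.add_eq_zero hT hE (by simp) fun t ht => ?_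
    rw [← hu0 0 (by simp) t (Ioo_subset_Icc_self ht)]
    exact hu.left_bdry t ⟨ht.1, ht.2.le⟩
  · refine hS.add_eq_zero hT hE (by simp) fun t ht => ?_
    rw [← hu0 1 (by simp) t (Ioo_subset_Icc_self ht)]
    exact hu.right_bdry t ⟨ht.1, ht.2.le⟩
  · intro x hx t ht
    rw [flux, hd x hx t ht]
    rfl
  · intro x hx t ht
    have hx' := Ioo_subset_Icc_self hx
    have ht' : t ∈ Icc 0 T := ⟨ht.1.le, ht.2⟩
    rw [← hu.pde x hx t ht, hm 0 1 x hx' t ht', hm 2 0 x hx' t ht', hm 1 0 x hx' t ht',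
      hu0 x hx' t ht', hA x hx', hB x hx', rhs]
    simp only [ContinuousMap.add_apply, ContinuousMap.neg_apply, ContinuousMap.smul_apply,
      ContinuousMap.mul_apply, smul_eq_mul]
    ring

lemma l2norm_le_of_isRep {n : ℕ} {X : ℕ → ℝ} {w : ℝ → ℝ} {f : CellFn} {c : ℝ} (h : IsGrid n X)
    (hw : IsRep n X w f) (hc : 0 ≤ c) (hf : cip (n + 1) X f f ≤ c ^ 2) : l2norm w ≤ c := by
  rw [l2norm, hw.l2 h hw]
  exact Real.sqrt_le_iff.2 ⟨hc, hf⟩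

/-- For a nonnegative lower integrand only the majorant has to be integrable. No measurability in
time of the energy of the error has to be proved. -/
lemma intervalIntegral_mono_of_nonneg {l t₀ : ℝ} (h : l ≤ t₀) {f g : ℝ → ℝ} (hg : Continuous g)
    (hf : ∀ t ∈ Ioc l t₀, 0 ≤ f t) (hfg : ∀ t ∈ Ioc l t₀, f t ≤ g t) :
    ∫ t in l..t₀, f t ≤ ∫ t in l..t₀, g t := by
  rw [intervalIntegral.integral_of_le h, intervalIntegral.integral_of_le h]
  refine integral_mono_of_nonneg ?_ ?_ ?_
  · exact (ae_restrict_iff' measurableSet_Ioc).2 (Eventually.of_forall hf)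
  · exact (hg.intervalIntegrable l t₀).1
  · exact (ae_restrict_iff' measurableSet_Ioc).2 (Eventually.of_forall hfg)

/-- The errors of the space-time scheme on a layer-adapted mesh. -/
lemma exists_error_bound (k r : ℕ) (T α β σ Cm L D : ℝ) (hT : 0 < T) (hα : 0 < α) (hβ : 0 < β)
    (hσ : (k : ℝ) + 2 ≤ σ) (hL : 0 ≤ L) (hD : 0 ≤ D) : ∃ C, 0 < C ∧
    ∀ {ε ϖ : ℝ} {n M : ℕ} {X : ℕ → ℝ} {a b u₀ : ℝ → ℝ} {f u U Q : ℝ → ℝ → ℝ}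
    {A A' B : C(ℝ, ℝ)} {K : ℕ → ℕ → ℝ}, 0 < ε → ε ≤ 1 → 0 ≤ ϖ → ϖ ≤ 1 → 1 ≤ M →
    IsLayerMesh α σ ε ϖ Cm n X → IsCoeff L A A' B →
    (∀ x ∈ Icc (0 : ℝ) 1, a x = A x) → (∀ x ∈ Icc (0 : ℝ) 1, coefDeriv a x = A' x) →
    (∀ x ∈ Icc (0 : ℝ) 1, b x = B x) → (∀ x ∈ Icc (0 : ℝ) 1, α ≤ a x) →
    (∀ x ∈ Icc (0 : ℝ) 1, β ≤ b x - coefDeriv a x / 2) →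
    (∀ j ≤ k + 2, ∀ i ≤ r + 2, K j i ≤ D) → IsClassicalSolution T ε a b f u₀ u →
    HasLayerDecomposition T ε α K u → IsDGSolution k r ε a b (n + 1) X T M f u₀ U Q →
      l2norm (fun x => u x T - U T x) ≤ C * ((T / M) ^ (r + 1) + ϖ ^ (k + 1)) ∧
      ∑ m ∈ Finset.range M, ∫ t in (timePt T M m)..(timePt T M (m + 1)),
        energySq ε a b (n + 1) X (fun x => u x t - U t x) (fun x => flux ε u t x - Q t x) ≤
          C ^ 2 * (((T / M) ^ (r + 1) + ϖ ^ (k + 1)) ^ 2 +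
            ((T / M) ^ (r + 1)) ^ 2 + ϖ ^ (2 * k + 1)) := by
  obtain ⟨C₁, hC₁, hdisc⟩ := exists_discrete_error k r T α β σ Cm L D hT hα hβ hσ hD
  -- The bound 2L serves both a and b - a_x/2.
  obtain ⟨C₂, hC₂, hen⟩ := exists_energy_bound k r T α σ Cm (2 * L) D hT hα hσ (by positivity)
  obtain ⟨C₃, hC₃, hR⟩ := exists_projR_l2 k Cm
  refine ⟨1 + 2 * C₁ + 2 * (C₃ * D) + C₂ * T, by positivity, ?_⟩
  intro ε ϖ n M X a b u₀ f u U Q A A' B K hε hε1 hϖ hϖ1 hM hX hco hA hA' hB haα hbβ hK hu hSE hDG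
  have hgr := hX.isGrid
  set C := 1 + 2 * C₁ + 2 * (C₃ * D) + C₂ * T with hC
  have hC1 : 1 ≤ C := by
    have : 0 ≤ 2 * C₁ + 2 * (C₃ * D) + C₂ * T := by positivity
    linarith
  have hCC : C ≤ C ^ 2 := by nlinarith
  set lam := penalty ε (n + 1) X with hlamd
  have hlam : 0 ≤ lam := by
    rw [hlamd, penalty, Nat.add_sub_cancel]
    exact div_nonneg hε.le (sub_pos.2 (hgr.lt n le_rfl)).le
  have hAα : ∀ x ∈ Icc (0 : ℝ) 1, α ≤ A x := fun x hx => by rw [← hA x hx]; exact haα x hx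
  have hAL : ∀ x ∈ Icc (0 : ℝ) 1, A x ≤ 2 * L := fun x hx => by
    have := (abs_le.1 (hco.bA x hx)).2; linarith
  have hρ : ∀ x ∈ Icc (0 : ℝ) 1, β ≤ (B - (1 / 2 : ℝ) • A') x := fun x hx => by
    have := hbβ x hx
    rw [hB x hx, hA' x hx] at this
    simp only [ContinuousMap.sub_apply, ContinuousMap.smul_apply, smul_eq_mul]
    linarith
  have hρL : ∀ x ∈ Icc (0 : ℝ) 1, (B - (1 / 2 : ℝ) • A') x ≤ 2 * L := fun x hx => by
    have h1 := (abs_le.1 (hco.bb x hx)).2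
    have h2 := (abs_le.1 (hco.bA' x hx)).1
    simp only [ContinuousMap.sub_apply, ContinuousMap.smul_apply, smul_eq_mul]
    linarith
  obtain ⟨S, E, hdat, hu0, hq0, hf⟩ := exists_isData k r hT hε hA hB hK hu hSE
  have hu₀ : ∀ x ∈ Icc (0 : ℝ) 1, u₀ x = (S 0 0 0 + E 0 0 0) x := fun x hx => by
    rw [← hu.initial x hx, hu0 x hx 0 ⟨le_rfl, hT.le⟩]
  obtain ⟨p₀, cu, cq, hcu, hcq, hcell⟩ := hDG.exists_isCellDG hT hgr hA hA' hB hu₀ hf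
  have hmain := hdisc hε hε1 hlam hϖ hM hX hco hAα hρ hdat hcell
  set 𝓔 := (T / M) ^ (r + 1) + ϖ ^ (k + 1) with h𝓔
  have hδ0 : 0 ≤ (T / M) ^ (r + 1) := by positivity
  have h𝓔0 : 0 ≤ 𝓔 := by positivity
  have hRepU : ∀ m < M, ∀ t ∈ Ioc (timePt T M m) (timePt T M (m + 1)),
      IsRep n X (fun x => u x t - U t x) (cst (S 0 0 t + E 0 0 t) - emb (tev r (cu m) t)) := by
    intro m hm t ht
    have htT : t ∈ Icc 0 T := ⟨(timePt_mem hT hm.le).1.trans ht.1.le,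
      ht.2.trans (timePt_mem hT hm).2⟩
    exact (isRep_cst hgr fun x hx => hu0 x (Ioo_subset_Icc_self hx) t htT).sub (hcu m hm t ht)
  have hRepQ : ∀ m < M, ∀ t ∈ Ioc (timePt T M m) (timePt T M (m + 1)),
      IsRep n X (fun x => flux ε u t x - Q t x)
        (cst (ε • (S 1 0 t + E 1 0 t)) - emb (tev r (cq m) t)) := by
    intro m hm t ht
    have htT : t ∈ Icc 0 T := ⟨(timePt_mem hT hm.le).1.trans ht.1.le,
      ht.2.trans (timePt_mem hT hm).2⟩
    exact (isRep_cst hgr fun x hx => hq0 x (Ioo_subset_Icc_self hx) t htT).sub (hcq m hm t ht)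
  have hEn0 : ∀ f g : CellFn, 0 ≤ ldgEnergy ε lam A (B - (1 / 2 : ℝ) • A') n X f g :=
    ldgEnergy_nonneg hgr hε hα.le hlam hAα fun x hx => hβ.le.trans (hρ x hx)
  set En : ℕ → ℝ → ℝ := fun m t => ldgEnergy ε lam A (B - (1 / 2 : ℝ) • A') n X
            (emb (projR k X (timeComp r (timePt T M m) (timePt T M (m + 1)) (S 0) t +
              timeComp r (timePt T M m) (timePt T M (m + 1)) (E 0) t) - tev r (cu m) t))
            (emb (projL k X (ε • (timeComp r (timePt T M m) (timePt T M (m + 1)) (S 1) t +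
              timeComp r (timePt T M m) (timePt T M (m + 1)) (E 1) t)) - tev r (cq m) t)) with hEn
  have hEnc : ∀ m, Continuous (En m) := by
    intro m
    have := continuous_form_tev (ldgForm ε lam A (B - A') n X) r
      (fun i => compU k r X (timePt T M m) (timePt T M (m + 1)) S E i - cu m i)
      (fun i => compQ ε k r X (timePt T M m) (timePt T M (m + 1)) S E i - cq m i)
      (fun i => compU k r X (timePt T M m) (timePt T M (m + 1)) S E i - cu m i)
      (fun i => compQ ε k r X (timePt T M m) (timePt T M (m + 1)) S E i - cq m i)
    simp only [ldgForm_apply, ldgFun_self hgr hco.dA, tev_sub, tev_compU, tev_compQ] at this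
    exact this
  have hsum0 : 0 ≤ ∑ m ∈ Finset.range M, ∫ t in (timePt T M m)..(timePt T M (m + 1)), En m t :=
    Finset.sum_nonneg fun m hm => intervalIntegral.integral_nonneg
      (timePt_lt hT (Finset.mem_range.1 hm)).le fun t _ => hEn0 _ _
  constructor
  -- The final time lies in the last interval, which is closed on the right, so U at T coincides
  -- with the limit from the left estimated by the discrete error.
  · obtain ⟨M', rfl⟩ : ∃ M', M = M' + 1 := ⟨M - 1, by omega⟩
    have hTM : timePt T (M' + 1) (M' + 1) = T := timePt_self T hM
    have htT : T ∈ Ioc (timePt T (M' + 1) M') (timePt T (M' + 1) (M' + 1)) := by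
      rw [hTM]
      refine ⟨?_, le_rfl⟩
      nth_rewrite 2 [← hTM]
      exact timePt_lt hT (Nat.lt_succ_self M')
    refine l2norm_le_of_isRep hgr (hRepU M' (Nat.lt_succ_self M') T htT) (by positivity) ?_
    simp only [prevPoly, hTM] at hmain
    set w := S 0 0 T + E 0 0 T with hw
    have h1 := (hR hα hσ hε hϖ hX (hdat.isLayered (t := T) ⟨hT.le, le_rfl⟩)).1
    have h2 : cst w - emb (tev r (cu M') T) = -(emb (projR k X w) - cst w) +
        emb (projR k X w - tev r (cu M') T) := by
      rw [map_sub]; abel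
    have h3 := cip_add_self_le hgr (-(emb (projR k X w) - cst w)) (emb (projR k X w - tev r (cu M') T))
    rw [← h2] at h3
    have h4 : cip (n + 1) X (-(emb (projR k X w) - cst w)) (-(emb (projR k X w) - cst w)) ≤
        (C₃ * D) ^ 2 * 𝓔 ^ 2 := by
      simp only [map_neg, LinearMap.neg_apply, neg_neg]
      refine h1.trans ?_
      rw [← mul_assoc, mul_pow]
      have : ϖ ^ (k + 1) ≤ 𝓔 := by linarith
      gcongr
    have h5 : cip (n + 1) X (emb (projR k X w - tev r (cu M') T))
        (emb (projR k X w - tev r (cu M') T)) ≤ C₁ * 𝓔 ^ 2 := by linarith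
    have h6 : 2 * (C₃ * D) ^ 2 + 2 * C₁ ≤ C ^ 2 := by
      have p1 : 0 ≤ C₃ * D := by positivity
      have p2 : 0 ≤ C₂ * T := by positivity
      have p3 : 1 + 2 * C₁ + 2 * (C₃ * D) ≤ C := by linarith
      have p4 : (1 + 2 * C₁ + 2 * (C₃ * D)) ^ 2 ≤ C ^ 2 := by gcongr
      nlinarith [mul_nonneg hC₁ p1]
    calc _ ≤ 2 * ((C₃ * D) ^ 2 * 𝓔 ^ 2) + 2 * (C₁ * 𝓔 ^ 2) := by linarith
      _ = (2 * (C₃ * D) ^ 2 + 2 * C₁) * 𝓔 ^ 2 := by ring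
      _ ≤ C ^ 2 * 𝓔 ^ 2 := by gcongr
      _ = _ := by ring
  · set G := ((T / M) ^ (r + 1)) ^ 2 + ϖ ^ (2 * k + 1) with hG
    have hG0 : 0 ≤ G := by positivity
    have h1 : ∀ m ∈ Finset.range M, (∫ t in (timePt T M m)..(timePt T M (m + 1)),
        energySq ε a b (n + 1) X (fun x => u x t - U t x) (fun x => flux ε u t x - Q t x)) ≤
        2 * (∫ t in (timePt T M m)..(timePt T M (m + 1)), En m t) + C₂ * G * (T / M) := by
      intro m hm
      have hm := Finset.mem_range.1 hm
      have hlt := timePt_lt hT hm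
      have h2 : ∀ t ∈ Ioc (timePt T M m) (timePt T M (m + 1)),
          energySq ε a b (n + 1) X (fun x => u x t - U t x) (fun x => flux ε u t x - Q t x) =
          ldgEnergy ε lam A (B - (1 / 2 : ℝ) • A') n X
            (cst (S 0 0 t + E 0 0 t) - emb (tev r (cu m) t))
            (cst (ε • (S 1 0 t + E 1 0 t)) - emb (tev r (cq m) t)) := fun t ht =>
        energySq_eq_ldgEnergy hgr hA hA' hB (hRepU m hm t ht) (hRepQ m hm t ht)
      have h3 := intervalIntegral_mono_of_nonneg hlt.le
        (f := fun t => energySq ε a b (n + 1) X (fun x => u x t - U t x)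
          (fun x => flux ε u t x - Q t x)) (g := fun t => 2 * En m t + C₂ * G)
        (((hEnc m).const_mul 2).add continuous_const) (fun t ht => by rw [h2 t ht]; exact hEn0 _ _)
        (fun t ht => by
          rw [h2 t ht]
          have h4 := hen (l := timePt T M m) (t₀ := timePt T M (m + 1)) hε hε1 hlam hϖ hϖ1 hX hAα hAL
            (fun x hx => hβ.le.trans (hρ x hx)) hρL hdat (timePt_mem hT hm.le).1 hlt
            (timePt_mem hT hm).2 t (Ioc_subset_Icc_self ht) (tev r (cu m) t) (tev r (cq m) t)
          rw [timePt_sub] at h4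
          exact h4)
      refine h3.trans (le_of_eq ?_)
      rw [intervalIntegral.integral_add (((hEnc m).const_mul 2).intervalIntegrable _ _)
        (continuous_const.intervalIntegrable _ _), intervalIntegral.integral_const_mul,
        intervalIntegral.integral_const, timePt_sub, smul_eq_mul]
      ring
    have h2 := Finset.sum_le_sum h1
    rw [Finset.sum_add_distrib, ← Finset.mul_sum, Finset.sum_const, Finset.card_range,
      nsmul_eq_mul] at h2
    have hM0 : (M : ℝ) ≠ 0 := by positivity
    have h3 : (M : ℝ) * (C₂ * G * (T / M)) = C₂ * T * G := by field_simp
    rw [h3] at h2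
    -- The discrete error bound controls the norm at T and the energy together; the former is
    -- dropped.
    have h4 : ∑ m ∈ Finset.range M, ∫ t in (timePt T M m)..(timePt T M (m + 1)), En m t ≤
        C₁ * 𝓔 ^ 2 := by
      have := cip_self_nonneg hgr (emb (projR k X (S 0 0 T + E 0 0 T) - prevPoly r T M p₀ cu M))
      linarith
    have p1 : 0 ≤ C₃ * D := by positivity
    have p2 : 0 ≤ C₂ * T := by positivity
    have h5 : 2 * C₁ * 𝓔 ^ 2 ≤ C ^ 2 * 𝓔 ^ 2 := by
      gcongr; linarith
    have h6 : C₂ * T * G ≤ C ^ 2 * G := by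
      gcongr; linarith
    rw [add_assoc]
    rw [mul_add]
    linarith

end LDG

end

/-! ### Conclusion: the constants depend only on the data, and ϖ is replaced by N⁻¹ max|ψ'|. -/

theorem mainTheorem5 (k r : ℕ) (T α β σ : ℝ) (hT : 0 < T) (hα : 0 < α) (hβ : 0 < β)
    (hσ : (k : ℝ) + 2 ≤ σ) (a b : ℝ → ℝ)
    (ha : ContDiffOn ℝ ∞ a (Icc 0 1)) (hb : ContDiffOn ℝ ∞ b (Icc 0 1))
    (haα : ∀ x ∈ Icc (0 : ℝ) 1, α ≤ a x)
    (hbβ : ∀ x ∈ Icc (0 : ℝ) 1, β ≤ b x - LDG.coefDeriv a x / 2)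
    (K : ℕ → ℕ → ℝ) :
    ∃ C : ℝ, 0 < C ∧
      ∀ (ε : ℝ) (N M : ℕ) (φ : ℝ → ℝ) (f : ℝ → ℝ → ℝ) (u₀ : ℝ → ℝ) (u U Q : ℝ → ℝ → ℝ),
        0 < ε → 2 ≤ N → Even N → ε ≤ 1 / (N : ℝ) → 1 ≤ M →
        LDG.IsMeshFunction ε N φ →
        σ * ε / α * φ (1 / 2) ≤ 1 / 2 →
        LDG.IsClassicalSolution T ε a b f u₀ u →
        LDG.HasLayerDecomposition T ε α K u →
        LDG.IsDGSolution k r ε a b N (LDG.meshPt σ α ε φ N) T M f u₀ U Q →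
        LDG.l2norm (fun x => u x T - U T x)
            ≤ C * ((T / M) ^ (r + 1) + ((N : ℝ)⁻¹ * LDG.maxPsi' φ) ^ (k + 1)) ∧
        Real.sqrt (∑ m ∈ Finset.range M,
            ∫ t in (LDG.timePt T M m)..(LDG.timePt T M (m + 1)),
              LDG.energySq ε a b N (LDG.meshPt σ α ε φ N)
                (fun x => u x t - U t x) (fun x => LDG.flux ε u t x - Q t x))
            ≤ C * ((T / M) ^ (r + 1)
                + ((N : ℝ)⁻¹ * LDG.maxPsi' φ) ^ ((k : ℝ) + 1 / 2)) := by
  have hσ0 : 0 < σ := by linarith [(Nat.cast_nonneg k : (0 : ℝ) ≤ k)]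
  obtain ⟨A, A', B, L, hco, hA, hA', hB⟩ := LDG.exists_isCoeff ha hb
  -- Only spatial derivatives up to order k + 2 and time derivatives up to order r + 2 are used, so
  -- a finite sum of absolute values bounds all the constants needed.
  set D := ∑ j ∈ Finset.range (k + 3), ∑ i ∈ Finset.range (r + 3), |K j i| with hD
  have hD0 : 0 ≤ D := Finset.sum_nonneg fun _ _ => Finset.sum_nonneg fun _ _ => abs_nonneg _
  have hKD : ∀ j ≤ k + 2, ∀ i ≤ r + 2, K j i ≤ D := by
    intro j hj i hi
    calc K j i ≤ |K j i| := le_abs_self _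
      _ ≤ ∑ i ∈ Finset.range (r + 3), |K j i| :=
          Finset.single_le_sum (f := fun i => |K j i|) (fun _ _ => abs_nonneg _)
            (Finset.mem_range.2 (by omega))
      _ ≤ D := Finset.single_le_sum (f := fun j => ∑ i ∈ Finset.range (r + 3), |K j i|)
            (fun _ _ => Finset.sum_nonneg fun _ _ => abs_nonneg _) (Finset.mem_range.2 (by omega))
  obtain ⟨C, hC, h⟩ := LDG.exists_error_bound k r T α β σ (2 * max 1 (σ / α) + 1) L D hT hα hβ hσ
    hco.nonneg hD0
  refine ⟨2 * C, by positivity, ?_⟩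
  intro ε N M φ f u₀ u U Q hε hN hNe hεN hM hφ hτ hu hSE hDG
  obtain ⟨n, rfl⟩ : ∃ n, N = n + 1 := ⟨N - 1, by omega⟩
  have hψ := hφ.one_le_maxPsi' hε hN hεN
  set ω₀ := ((n + 1 : ℕ) : ℝ)⁻¹ * LDG.maxPsi' φ with hω₀
  have hω₀0 : 0 ≤ ω₀ := by positivity
  -- N⁻¹ max|ψ'| may exceed 1; estimating with the capped quantity is harmless because both bounds
  -- increase with it.
  set ϖ := min 1 ω₀ with hϖ
  have hϖ0 : 0 ≤ ϖ := le_min zero_le_one hω₀0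
  have hϖ1 : ϖ ≤ 1 := min_le_left _ _
  have hϖω : ϖ ≤ ω₀ := min_le_right _ _
  have hε1 : ε ≤ 1 := hεN.trans (by
    rw [div_le_one (by positivity)]
    exact_mod_cast Nat.le_add_left 1 n)
  have hX := LDG.isLayerMesh_meshPt hα hσ0 hε hN hNe hεN hφ hτ
  obtain ⟨h1, h2⟩ := h hε hε1 hϖ0 hϖ1 hM hX hco hA hA' hB haα hbβ hKD hu hSE hDG
  set δ := (T / M) ^ (r + 1) with hδ
  have hδ0 : 0 ≤ δ := by positivity
  constructor
  · refine h1.trans ?_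
    have h3 : ϖ ^ (k + 1) ≤ ω₀ ^ (k + 1) := by gcongr
    have h4 : 0 ≤ δ + ω₀ ^ (k + 1) := by positivity
    calc C * (δ + ϖ ^ (k + 1)) ≤ C * (δ + ω₀ ^ (k + 1)) := by gcongr
      _ ≤ 2 * C * (δ + ω₀ ^ (k + 1)) := by gcongr; linarith
  · have hk : (0 : ℝ) ≤ (k : ℝ) + 1 / 2 := by positivity
    set s := ϖ ^ ((k : ℝ) + 1 / 2) with hs
    have hs0 : 0 ≤ s := Real.rpow_nonneg hϖ0 _
    have hs2 : s ^ 2 = ϖ ^ (2 * k + 1) := by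
      rw [hs, ← Real.rpow_natCast, ← Real.rpow_mul hϖ0, ← Real.rpow_natCast]
      congr 1
      push_cast
      ring
    -- Thanks to ϖ ≤ 1 the full-order term is absorbed into the half-order one.
    have hks : ϖ ^ (k + 1) ≤ s := by
      refine le_of_sq_le_sq ?_ hs0
      rw [hs2, ← pow_mul]
      exact pow_le_pow_of_le_one hϖ0 hϖ1 (by omega)
    have hsω : s ≤ ω₀ ^ ((k : ℝ) + 1 / 2) := Real.rpow_le_rpow hϖ0 hϖω hk
    rw [Real.sqrt_le_iff]
    refine ⟨by positivity, h2.trans ?_⟩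
    rw [← hs2]
    have h3 : (δ + ϖ ^ (k + 1)) ^ 2 ≤ (δ + s) ^ 2 := by gcongr
    calc C ^ 2 * ((δ + ϖ ^ (k + 1)) ^ 2 + δ ^ 2 + s ^ 2) ≤ C ^ 2 * (4 * (δ + s) ^ 2) := by
          gcongr
          nlinarith [mul_nonneg hδ0 hs0, sq_nonneg (δ + s)]
      _ = (2 * C * (δ + s)) ^ 2 := by ring
      _ ≤ _ := by gcongr
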